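/- Let $d\ge 1$, let $G=\mathbb Z^d$ or $G=\mathbb R^d$ with its Haar measure (counting or Lebesgue measure), and let $h_1\ge 1$ be an integer. For a sequence of positive integers $q_n$ put $h_{n+1}=q_nh_n$, $\Gamma_n=h_n\mathbb Z^d$, $U_n=[0,h_n)^d\cap G$ and $M_n=G/\Gamma_n$, and let $\mu_n$ be the normalized translation-invariant measure on $M_n$. Given $\alpha_{n,\gamma}\in M_n$ for $n\ge1$ and $\gamma\in\Gamma_n/\Gamma_{n+1}$, define $\phi_n\colon M_{n+1}\to M_n$ by $$\phi_n(\gamma+u)=u+\alpha_{n,\gamma},\qquad \gamma\in\Gamma_n/\Gamma_{n+1},\ u\in U_n,$$ and let $X=\{x=(x_1,x_2,\dots): x_n\in M_n,\ \phi_n(x_{n+1})=x_n\}$, with the $\sigma$-algebra generated by the cylinder sets and with the probability measure $\mu$ whose image under $x\mapsto x_n$ is $\mu_n$ for every $n$. For $t\in G$ let $T^tx$ be the point of $X$ with $(T^tx)_n=t+x_n$ for all large $n$; it is defined for those $x$ for which, for all large $n$, the points $x_{n+1}$ and $t+x_{n+1}$ lie in the same block $\gamma+U_n$ of $M_{n+1}$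 (put $T^tx=x$ for the other $x$). A function $f$ on $X$ is cylindric if $f(x)=F(x_n)$ for some $n$ and some $F$ on $M_n$. The spectral measure $\sigma_f$ of $f\in L^2(X,\mu)$ is the finite Borel measure on the dual group $\widehat G$ ($\mathbb T^d$ or $\mathbb R^d$) with $$\widehat\sigma_f(t)=\int_{\widehat G}e^{-2\pi i\langle t,\xi\rangle}\,d\sigma_f(\xi)=\langle f\circ T^{-t},f\rangle_{L^2(X,\mu)}\qquad(t\in G).$$ **Theorem.** For each such $G$ and $h_1$ there are a sequence $q_n\to\infty$ with $q_{n+1}>2q_n$ for all $n$, and a set $S$ of pairs $(n,F)$ with $F\in L^2(M_n,\mu_n)$, $\int F\,d\mu_n=0$, such that the following holds. Let $\alpha_{n,\gamma}$ ($n\ge1$, $\gamma\in\Gamma_n/\Gamma_{n+1}$) be independent random variables, with $\alpha_{n,\gamma}$ uniformly distributed on $M_n$. Then almost surely: the measure $\mu$ exists; each $T^t$ is defined by the above rule $\mu$-almost everywhere and preserves $\mu$, and $T^0=\mathrm{id}$, $T^{s+t}=T^sT^t$ $\mu$-almost everywhere; the cylindric functions $f(x)=F(x_n)$, $(n,F)\in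 S$, are dense in $\{g\in L^2(X,\mu):\int g\,d\mu=0\}$; and for each of these functions $f$ the spectral measure $\sigma_f$ exists and satisfies $$\widehat\sigma_f(t)=O\bigl(|t|^{-1/2+\varepsilon}\bigr)\quad(|t|\to\infty)\quad\text{for every }\varepsilon>0,$$ and moreover $\widehat\sigma_f\notin L^2(G)$ and $\widehat\sigma_f\in L^p(G)$ for every $p>2$. -/

import Mathlib

open MeasureTheory ProbabilityTheory Filter Topology
open scoped ENNReal

set_option linter.unusedSectionVars false

noncomputable section

namespace Iceberg

/-! ### The lattices and the finite (or compact) quotients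

The acting group is `G = Fin d → K`, where `K` is `ℤ` or `ℝ`. -/

/-- The side lengths `h n` of the fundamental cubes: `h (n + 1) = q n * h n`, starting at `h₁`. -/
def side (h₁ : ℕ+) (q : ℕ → ℕ+) : ℕ → ℕ+
  | 0 => h₁
  | n + 1 => q n * side h₁ q n

section Group

variable (K : Type*) [CommRing K] [LinearOrder K] [IsStrictOrderedRing K] [Archimedean K]
variable (d : ℕ) (h₁ : ℕ+) (q : ℕ → ℕ+)

/-- The side length `h n` as an element of `K`. -/
def len (n : ℕ) : K := ((side h₁ q n : ℕ) : K)

theorem len_pos (n : ℕ) : 0 < len K h₁ q n := by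
  unfold len
  exact_mod_cast (side h₁ q n).pos

theorem len_succ (n : ℕ) : len K h₁ q (n + 1) = ((q n : ℕ) : ℤ) • len K h₁ q n := by
  simp [len, side]

/-- The lattice `Γ n = h n • ℤ ^ d` in `G`. -/
def lattice (n : ℕ) : AddSubgroup (Fin d → K) :=
  AddSubgroup.pi Set.univ (fun _ => AddSubgroup.zmultiples (len K h₁ q n))

theorem mem_lattice {n : ℕ} {a : Fin d → K} :
    a ∈ lattice K d h₁ q n ↔ ∀ i, ∃ k : ℤ, k • len K h₁ q n = a i := by
  simp [lattice, AddSubgroup.mem_pi, AddSubgroup.mem_zmultiples_iff]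

theorem lattice_succ_le (n : ℕ) : lattice K d h₁ q (n + 1) ≤ lattice K d h₁ q n := by
  intro a ha
  rw [mem_lattice] at ha ⊢
  intro i
  obtain ⟨k, hk⟩ := ha i
  exact ⟨k * ((q n : ℕ) : ℤ), by rw [← hk, len_succ, mul_smul]⟩

/-- The cube `U n = [0, h n) ^ d`, a fundamental domain of the lattice `Γ n`. -/
def cube (n : ℕ) : Set (Fin d → K) := {u | ∀ i, u i ∈ Set.Ico 0 (len K h₁ q n)}

/-- The homogeneous space `M n = G / Γ n`. -/
abbrev Space (n : ℕ) : Type _ := (Fin d → K) ⧸ lattice K d h₁ q n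

/-- The index set `Γ n / Γ (n + 1)` of the translates of `U n` that tile `M (n + 1)`. -/
abbrev Block (n : ℕ) : Type _ :=
  lattice K d h₁ q n ⧸ (lattice K d h₁ q (n + 1)).addSubgroupOf (lattice K d h₁ q n)

/-- The natural projection `M (n + 1) → M n`. -/
def proj (n : ℕ) : Space K d h₁ q (n + 1) →+ Space K d h₁ q n :=
  QuotientAddGroup.map _ _ (AddMonoidHom.id _) (lattice_succ_le K d h₁ q n)

/-- The element `γ` of `Γ n` with `a ∈ γ + U n`. -/
def corner (n : ℕ) (a : Fin d → K) : lattice K d h₁ q n :=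
  ⟨fun i => toIcoDiv (len_pos K h₁ q n) 0 (a i) • len K h₁ q n, by
    rw [mem_lattice]; exact fun i => ⟨_, rfl⟩⟩

theorem sub_corner_mem_cube (n : ℕ) (a : Fin d → K) :
    a - (corner K d h₁ q n a : Fin d → K) ∈ cube K d h₁ q n := by
  intro i
  have := sub_toIcoDiv_zsmul_mem_Ico (len_pos K h₁ q n) 0 (a i)
  rwa [zero_add] at this

theorem corner_add {n : ℕ} (γ : lattice K d h₁ q n) {u : Fin d → K}
    (hu : u ∈ cube K d h₁ q n) : corner K d h₁ q n ((γ : Fin d → K) + u) = γ := by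
  ext i
  obtain ⟨k, hk⟩ := (mem_lattice K d h₁ q).1 γ.2 i
  have h0 : toIcoDiv (len_pos K h₁ q n) 0 (u i) = 0 :=
    toIcoDiv_eq_of_sub_zsmul_mem_Ico _ (by simpa using hu i)
  change toIcoDiv (len_pos K h₁ q n) 0 ((γ : Fin d → K) i + u i) • len K h₁ q n = _
  rw [← hk, add_comm, toIcoDiv_add_zsmul, h0, zero_add]

/-- For `a ∈ M (n + 1)`, the unique `γ ∈ Γ n / Γ (n + 1)` with `a ∈ γ + U n`. -/
def block (n : ℕ) : Space K d h₁ q (n + 1) → Block K d h₁ q n :=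
  Quotient.lift (fun a => (QuotientAddGroup.mk (corner K d h₁ q n a) : Block K d h₁ q n)) (by
    intro a b hab
    have hab' : -a + b ∈ lattice K d h₁ q (n + 1) := QuotientAddGroup.leftRel_apply.1 hab
    refine QuotientAddGroup.eq.2 ?_
    rw [AddSubgroup.mem_addSubgroupOf, mem_lattice]
    intro i
    obtain ⟨k, hk⟩ := (mem_lattice K d h₁ q).1 hab' i
    refine ⟨k, ?_⟩
    have hb : b i = a i + (k * ((q n : ℕ) : ℤ)) • len K h₁ q n := by
      rw [mul_smul, ← len_succ, hk]; simp
    change k • len K h₁ q (n + 1) =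
      -(toIcoDiv (len_pos K h₁ q n) 0 (a i) • len K h₁ q n) +
        toIcoDiv (len_pos K h₁ q n) 0 (b i) • len K h₁ q n
    rw [hb, toIcoDiv_add_zsmul, add_smul, len_succ, mul_smul]
    abel)

/-- A family of rotations `α n γ ∈ M n`, indexed by `n` and by `γ ∈ Γ n / Γ (n + 1)`. -/
abbrev Rotations : Type _ := ∀ n, Block K d h₁ q n → Space K d h₁ q n

variable {K d h₁ q}

/-- The gluing map `φ n : M (n + 1) → M n`, which sends `γ + u`, for `u ∈ U n`, to `u + α n γ`
(see `glue_add`): each block `γ + U n` is projected to `M n` and then rotated by `α n γ`. -/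
def glue (α : Rotations K d h₁ q) (n : ℕ) (x : Space K d h₁ q (n + 1)) : Space K d h₁ q n :=
  proj K d h₁ q n x + α n (block K d h₁ q n x)

theorem glue_add (α : Rotations K d h₁ q) (n : ℕ) (γ : lattice K d h₁ q n) (u : Fin d → K)
    (hu : u ∈ cube K d h₁ q n) :
    glue α n (QuotientAddGroup.mk ((γ : Fin d → K) + u)) =
      QuotientAddGroup.mk u + α n (QuotientAddGroup.mk γ) := by
  have h1 : block K d h₁ q n (QuotientAddGroup.mk ((γ : Fin d → K) + u)) =
      QuotientAddGroup.mk γ := by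
    change (QuotientAddGroup.mk (corner K d h₁ q n ((γ : Fin d → K) + u)) : Block K d h₁ q n) = _
    rw [corner_add K d h₁ q γ hu]
  have h2 : proj K d h₁ q n (QuotientAddGroup.mk ((γ : Fin d → K) + u)) =
      QuotientAddGroup.mk u := by
    change (QuotientAddGroup.mk ((γ : Fin d → K) + u) : Space K d h₁ q n) = _
    refine QuotientAddGroup.eq.2 ?_
    have : -((γ : Fin d → K) + u) + u = -(γ : Fin d → K) := by abel
    rw [this]
    exact neg_mem γ.2
  rw [glue, h1, h2]

/-! ### The phase space and the action -/

/-- The inverse limit `X` of the spaces `M n` along the gluing maps. As a subtype of the product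
it carries the `σ`-algebra generated by the cylinder sets. -/
abbrev Phase (α : Rotations K d h₁ q) : Type _ :=
  {x : ∀ n, Space K d h₁ q n // ∀ n, glue α n (x (n + 1)) = x n}

/-- The point `x` is stable under `t ∈ G` if, for all large `n`, the coordinate `x (n + 1)` and
its translate by `t` lie in the same block. -/
def Stable (α : Rotations K d h₁ q) (t : Fin d → K) (x : Phase α) : Prop :=
  ∀ᶠ n in atTop, block K d h₁ q n (x.1 (n + 1)) =
    block K d h₁ q n (QuotientAddGroup.mk t + x.1 (n + 1))

theorem glue_translate (α : Rotations K d h₁ q) (n : ℕ) (t : Fin d → K)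
    (a : Space K d h₁ q (n + 1))
    (h : block K d h₁ q n a = block K d h₁ q n (QuotientAddGroup.mk t + a)) :
    glue α n (QuotientAddGroup.mk t + a) = QuotientAddGroup.mk t + glue α n a := by
  have : proj K d h₁ q n (QuotientAddGroup.mk t) = QuotientAddGroup.mk t := rfl
  rw [glue, glue, ← h, map_add, this, add_assoc]

theorem exists_extension (α : Rotations K d h₁ q) (z : ∀ n, Space K d h₁ q n) (N : ℕ)
    (hz : ∀ n, N ≤ n → glue α n (z (n + 1)) = z n) :
    ∃ y : Phase α, ∀ n, N ≤ n → y.1 n = z n := by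
  -- lower the threshold `N` one step at a time
  induction N generalizing z with
  | zero => exact ⟨⟨z, fun n => hz n (Nat.zero_le n)⟩, fun _ _ => rfl⟩
  | succ N ih =>
    obtain ⟨y, hy⟩ := ih (Function.update z N (glue α N (z (N + 1)))) (by
      intro n hn
      rw [Function.update_of_ne (by omega)]
      rcases Nat.eq_or_lt_of_le hn with rfl | hlt
      · rw [Function.update_self]
      · rw [Function.update_of_ne (by omega)]
        exact hz n hlt)
    exact ⟨y, fun n hn => by
      rw [hy n (by omega), Function.update_of_ne (by omega)]⟩

/-- If `x` is stable under `t`, there is exactly one point of `X` whose coordinates are `t + x n`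
for all large `n`. -/
theorem Stable.existsUnique {α : Rotations K d h₁ q} {t : Fin d → K} {x : Phase α}
    (h : Stable α t x) :
    ∃! y : Phase α, ∀ᶠ n in atTop, y.1 n = QuotientAddGroup.mk t + x.1 n := by
  obtain ⟨N, hN⟩ := eventually_atTop.1 h
  obtain ⟨y, hy⟩ := exists_extension α (fun n => QuotientAddGroup.mk t + x.1 n) N
    (fun n hn => by rw [glue_translate α n t _ (hN n hn), x.2 n])
  refine ⟨y, eventually_atTop.2 ⟨N, hy⟩, fun z hz => ?_⟩
  obtain ⟨L, hL⟩ := eventually_atTop.1 hz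
  have key : ∀ k n, max N L ≤ n + k → z.1 n = y.1 n := by
    intro k
    induction k with
    | zero =>
      intro n hn
      rw [hL n (le_trans (le_max_right _ _) hn), hy n (le_trans (le_max_left _ _) hn)]
    | succ k ih =>
      intro n hn
      rw [← z.2 n, ← y.2 n, ih (n + 1) (by omega)]
  exact Subtype.ext (funext fun n => key (max N L) n (by omega))

open Classical in
/-- The transformation `T ^ t` of `X`: the point `T ^ t x` has the coordinates `t + x n` for all
large `n`, and the other ones are recovered by the gluing maps. Points that are not stable under
`t` (a null set) are left fixed. -/
def shift (α : Rotations K d h₁ q) (t : Fin d → K) (x : Phase α) : Phase α :=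
  if h : Stable α t x then h.existsUnique.choose else x

variable [MeasurableSpace K]

/-- The normalized translation invariant measure on `M n`, as the image of the uniform
distribution on the fundamental domain `U n`. Here `ν` is the Haar measure of `G` (counting measure
on `ℤ ^ d`, Lebesgue measure on `ℝ ^ d`). -/
def uniform (K : Type*) [CommRing K] [LinearOrder K] [IsStrictOrderedRing K] [Archimedean K]
    [MeasurableSpace K] (d : ℕ) (h₁ : ℕ+) (q : ℕ → ℕ+) (ν : Measure (Fin d → K)) (n : ℕ) :
    Measure (Space K d h₁ q n) :=
  (ν[|cube K d h₁ q n]).map QuotientAddGroup.mk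

/-- `μ` is the probability measure on the inverse limit `X` that extends the measures on the
spaces `M n`. The cylinder sets form a generating `π`-system, so there is at most one. -/
structure IsLimitMeasure (α : Rotations K d h₁ q) (ν : Measure (Fin d → K))
    (μ : Measure (Phase α)) : Prop where
  isProbabilityMeasure : IsProbabilityMeasure μ
  map_coord : ∀ n, μ.map (fun x => x.1 n) = uniform K d h₁ q ν n

/-- The maps `T ^ t` are defined almost everywhere by the stability rule, preserve `μ`, and form
an action of `G` up to null sets. -/
structure IsAction (α : Rotations K d h₁ q) (μ : Measure (Phase α)) : Prop where
  ae_stable : ∀ t, ∀ᵐ x ∂μ, Stable α t x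
  measurePreserving : ∀ t, MeasurePreserving (shift α t) μ μ
  shift_add : ∀ s t, ∀ᵐ x ∂μ, shift α (s + t) x = shift α s (shift α t x)
  shift_zero : ∀ᵐ x ∂μ, shift α 0 x = x

/-- The cylindric function on `X` given by a function `F` on `M n`. -/
def cyl (α : Rotations K d h₁ q) {n : ℕ} (F : Space K d h₁ q n → ℂ) (x : Phase α) : ℂ := F (x.1 n)

/-- The correlation function `R_f (t) = ⟨f ∘ T ^ t, f⟩` in `L² (X, μ)`. -/
def correlation (α : Rotations K d h₁ q) (μ : Measure (Phase α)) (f : Phase α → ℂ)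
    (t : Fin d → K) : ℂ :=
  ∫ x, f (shift α t x) * (starRingEnd ℂ) (f x) ∂μ

/-- A set of functions, given as sets `S n` of functions on `M n`, whose members are square
integrable functions with mean zero. -/
def MeanZeroSquareIntegrable (ν : Measure (Fin d → K)) (S : ∀ n, Set (Space K d h₁ q n → ℂ)) :
    Prop :=
  ∀ n, ∀ F ∈ S n, Measurable F ∧ MemLp F 2 (uniform K d h₁ q ν n) ∧
    ∫ a, F a ∂(uniform K d h₁ q ν n) = 0

/-- The cylindric functions given by the members of the sets `S n` are dense in the space of
functions with mean zero in `L² (X, μ)`. -/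
def DenseInMeanZero (α : Rotations K d h₁ q) (μ : Measure (Phase α))
    (S : ∀ n, Set (Space K d h₁ q n → ℂ)) : Prop :=
  ∀ g : Phase α → ℂ, MemLp g 2 μ → ∫ x, g x ∂μ = 0 → ∀ ε : ℝ, 0 < ε →
    ∃ n, ∃ F ∈ S n, eLpNorm (cyl α F - g) 2 μ < ENNReal.ofReal ε

/-- `α n γ` are independent random variables on `(Ω, P)`, each uniformly distributed on `M n`. -/
structure IsUniformFamily (ν : Measure (Fin d → K)) {Ω : Type*} [MeasurableSpace Ω]
    (P : Measure Ω) (α : Ω → Rotations K d h₁ q) : Prop where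
  measurable : ∀ n γ, Measurable (fun ω => α ω n γ)
  map_eq : ∀ n γ, P.map (fun ω => α ω n γ) = uniform K d h₁ q ν n
  indep : iIndepFun (fun (p : Σ n, Block K d h₁ q n) ω => α ω p.1 p.2) P

end Group

/-! ### Spectral measures -/

/-- The Fourier coefficients `∫ exp (-2 π i ⟨t, ξ⟩) dσ(ξ)` of a measure on the torus, which is the
dual group of `ℤ ^ d`. -/
def fourierTorus {d : ℕ} (σ : Measure (UnitAddTorus (Fin d))) (t : Fin d → ℤ) : ℂ :=
  ∫ ξ, UnitAddTorus.mFourier (-t) ξ ∂σ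

/-- The Fourier transform `∫ exp (-2 π i ⟨t, ξ⟩) dσ(ξ)` of a measure on `ℝ ^ d`, which is the dual
group of `ℝ ^ d`. -/
def fourierReal {d : ℕ} (σ : Measure (Fin d → ℝ)) (t : Fin d → ℝ) : ℂ :=
  ∫ ξ, Complex.exp (-(2 * Real.pi * Complex.I * ((∑ i, t i * ξ i : ℝ) : ℂ))) ∂σ

/-- The asserted size of the Fourier transform `c` of a spectral measure: it is
`O(|t| ^ (-1/2 + ε))` at infinity for every `ε > 0`, it is not in `L²(G)`, and it is in `Lᵖ(G)` for
every `p > 2`. Here `ν` is the Haar measure of `G`. -/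
structure SalemDecay {K : Type*} [NormedAddCommGroup K] [MeasurableSpace K] {d : ℕ}
    (ν : Measure (Fin d → K)) (c : (Fin d → K) → ℂ) : Prop where
  isBigO : ∀ ε : ℝ, 0 < ε →
    c =O[cocompact (Fin d → K)] fun t => ‖t‖ ^ (-(1 / 2 : ℝ) + ε)
  not_memLp_two : ¬ MemLp c 2 ν
  memLp : ∀ p : ℝ≥0∞, 2 < p → MemLp c p ν

end Iceberg

end

/-! Let `r k` be the correlation function of the lift of a cylindric function to `M (n + k)`; it
converges to the correlation function `R` of the dynamical system. Everything rests on one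
recursion. If `x` and `z + x` lie in the same block, both are rotated by the same element and, on
average over the block rotation, such pairs reproduce the old correlation. If they lie in different
blocks, they are rotated independently, and since `F` has mean zero the contribution has mean zero.
Hence `r (k + 1) z = stay z * r k (proj z) + fluct z`, where `stay z` is the probability of
remaining in one's block and `fluct` is a centred quadratic form in `q ^ d` independent rotations,
each of which touches a mass of order `q ^ (-d)`. Its typical size is therefore `q ^ (-d / 2)`, and
all three assertions about `R` are read off from this.

Upper bound for `fluct`. Revealing the blocks one at a time gives martingale increments of size at
most `4 * B ^ 2 / q ^ d`, hence exponential tails (`IncrementFamily.measure_lt_norm_le`). A union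
bound over a fine grid, Borel–Cantelli and a Lipschitz estimate give `‖fluct‖ ≤ err`, with `err = 3
* h ^ 3 * q ^ (-d / 2)`, at all points of all large levels (`IsStandard.ae_eventually_fluct_le`).
The choice `q n = (4 * h n) ^ (n + 2)` serves two opposite needs: `q` outgrows every power of `h`,
so that `err` is essentially `q ^ (-d / 2)`, while `log q ≤ 12 * h ^ 2` keeps the union bound
summable.

Decay and integrability. For `t` comparable with some side length, errors of higher levels sum to
the claimed bound. The main term survives two consecutive levels only if `t` is close to a nonzero
lattice vector, and then `stay` is of order `1 / q` (`IsCorrLimit.exists_norm_le_rpow`). For `p >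
2`, the main term does not increase the `L ^ p` norm over a fundamental cube, because `stay ^ p ≤
stay` and the translates of `stay` by lattice vectors sum to one; the error adds `err * (h (m + 1))
^ (d / p)`, which is summable exactly because `p > 2` (`IsCorrLimit.memLp`).

Failure of square integrability. On an annulus of translations that move every point to another
block, `stay` vanishes and `fluct` is the whole correlation. Its second moment is at least a
constant over the volume of the annulus, and a fourth moment bound turns this into a lower bound for
a truncated mean. So, given the past, the `L ^ 2` mass on the annulus exceeds a fixed constant with
probability bounded below; this happens infinitely often, and later levels at most roughly halve the
values. The annuli escape to infinity, so `R` is not in `L ^ 2`.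

The spectral measures come from Herglotz's and Bochner's theorems, since `R` is a limit of positive
definite functions. The set `S` is a countable dense set of regular functions with positive second
moment, fixed before the rotations are drawn, so that the exceptional null sets can be united. -/

noncomputable section

namespace Iceberg

/-! ### Resampling coordinates of a product measure -/

section Resampling

variable {ι : Type*} {X : ι → Type*} [∀ i, MeasurableSpace (X i)] (μ : ∀ i, Measure (X i))
  [∀ i, IsProbabilityMeasure (μ i)]

/-- The mass of a finite box splits into the factor over the indices in `S` and the factor over the
others, so merging two independent samples gives a sample again. Resampling of one coordinate and
independence of disjoint sets of coordinates both follow from this map. -/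
theorem measurePreserving_piecewise (S : Set ι) [DecidablePred (· ∈ S)] :
    MeasurePreserving (fun p : (∀ i, X i) × (∀ i, X i) => S.piecewise p.1 p.2)
      ((Measure.infinitePi μ).prod (Measure.infinitePi μ)) (Measure.infinitePi μ) := by
  classical
  have hmeas : Measurable (fun p : (∀ i, X i) × (∀ i, X i) => S.piecewise p.1 p.2) := by
    refine measurable_pi_iff.2 fun i => ?_
    by_cases hi : i ∈ S
    · simp only [Set.piecewise, hi, if_true]; fun_prop
    · simp only [Set.piecewise, hi, if_false]; fun_prop
  refine ⟨hmeas, Measure.eq_infinitePi μ fun s t ht => ?_⟩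
  rw [Measure.map_apply hmeas (MeasurableSet.pi s.countable_toSet fun i _ => ht i)]
  have : (fun p : (∀ i, X i) × (∀ i, X i) => S.piecewise p.1 p.2) ⁻¹' (Set.pi s t) =
      (Set.pi (s.filter (· ∈ S) : Finset ι) t) ×ˢ (Set.pi (s.filter (¬ · ∈ S) : Finset ι) t) := by
    ext p
    simp only [Set.mem_preimage, Set.mem_pi, Set.mem_prod, Finset.coe_filter, Set.mem_ofPred_eq,
      Finset.mem_coe]
    constructor
    · intro h
      refine ⟨fun i hi => ?_, fun i hi => ?_⟩
      · have := h i hi.1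
        rwa [Set.piecewise_eq_of_mem _ _ _ hi.2] at this
      · have := h i hi.1
        rwa [Set.piecewise_eq_of_notMem _ _ _ hi.2] at this
    · rintro ⟨h1, h2⟩ i hi
      by_cases hS : i ∈ S
      · rw [Set.piecewise_eq_of_mem _ _ _ hS]; exact h1 i ⟨hi, hS⟩
      · rw [Set.piecewise_eq_of_notMem _ _ _ hS]; exact h2 i ⟨hi, hS⟩
  rw [this, Measure.prod_prod, Measure.infinitePi_pi _ fun i _ => ht i,
    Measure.infinitePi_pi _ fun i _ => ht i, Finset.prod_filter_mul_prod_filter_not]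

/-- Merging along `S = {b}` reads one coordinate of the second sample only, so that sample can be
replaced by its `b`-th coordinate. -/
theorem measurePreserving_update [DecidableEq ι] (b : ι) :
    MeasurePreserving (fun p : (∀ i, X i) × X b => Function.update p.1 b p.2)
      ((Measure.infinitePi μ).prod (μ b)) (Measure.infinitePi μ) := by
  classical
  have hg : MeasurePreserving (fun p : (∀ i, X i) × (∀ i, X i) => (p.1, p.2 b))
      ((Measure.infinitePi μ).prod (Measure.infinitePi μ)) ((Measure.infinitePi μ).prod (μ b)) :=
    (MeasurePreserving.id _).prod (measurePreserving_eval_infinitePi μ b)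
  have hmeas : Measurable (fun p : (∀ i, X i) × X b => Function.update p.1 b p.2) := by
    refine measurable_pi_iff.2 fun i => ?_
    by_cases hi : i = b
    · subst hi; simpa using measurable_snd
    · simp only [Function.update_of_ne hi]; fun_prop
  refine ⟨hmeas, ?_⟩
  rw [← hg.map_eq, Measure.map_map hmeas hg.measurable]
  have h := ((measurePreserving_piecewise μ ({b} : Set ι)).comp
    (Measure.measurePreserving_swap (μ := Measure.infinitePi μ) (ν := Measure.infinitePi μ)))
  convert h.map_eq using 2
  ext p i
  by_cases hi : i = b
  · subst hi; simp
  · simp [hi]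

variable {E : Type*} [NormedAddCommGroup E] [NormedSpace ℝ E]

/-- Conditioning on all coordinates but `b`, in Fubini form. The moment bounds and, through the
`lintegral` version, the Borel–Cantelli arguments condition in this way, without filtrations. -/
theorem integral_update [DecidableEq ι] (b : ι) {f : (∀ i, X i) → E}
    (hf : Integrable f (Measure.infinitePi μ)) :
    ∫ a, f a ∂(Measure.infinitePi μ) =
      ∫ a, ∫ s, f (Function.update a b s) ∂(μ b) ∂(Measure.infinitePi μ) := by
  have h := measurePreserving_update μ b
  have hi : Integrable (fun p : (∀ i, X i) × X b => f (Function.update p.1 b p.2))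
    ((Measure.infinitePi μ).prod (μ b)) := h.integrable_comp_of_integrable hf
  rw [← integral_prod _ hi]
  have e := integral_map (f := f) h.measurable.aemeasurable
    (by rw [h.map_eq]; exact hf.aestronglyMeasurable)
  rwa [h.map_eq] at e

theorem lintegral_update [DecidableEq ι] (b : ι) {f : (∀ i, X i) → ℝ≥0∞} (hf : Measurable f) :
    ∫⁻ a, f a ∂(Measure.infinitePi μ) =
      ∫⁻ a, ∫⁻ s, f (Function.update a b s) ∂(μ b) ∂(Measure.infinitePi μ) := by
  have h := measurePreserving_update μ b
  rw [← lintegral_prod (fun p : (∀ i, X i) × X b => f (Function.update p.1 b p.2))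
    (hf.comp h.measurable).aemeasurable]
  exact (h.lintegral_comp hf).symm

/-- Functions that depend on disjoint sets of coordinates are uncorrelated. -/
theorem integral_mul_of_depends (S : Set ι) {f g : (∀ i, X i) → ℝ}
    (hf : ∀ a a', (∀ i ∈ S, a i = a' i) → f a = f a')
    (hg : ∀ a a', (∀ i ∉ S, a i = a' i) → g a = g a')
    (hfg : Integrable (fun a => f a * g a) (Measure.infinitePi μ)) :
    ∫ a, f a * g a ∂(Measure.infinitePi μ) =
      (∫ a, f a ∂(Measure.infinitePi μ)) * ∫ a, g a ∂(Measure.infinitePi μ) := by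
  classical
  have h := measurePreserving_piecewise μ S
  have e : ∀ p : (∀ i, X i) × (∀ i, X i),
      f (S.piecewise p.1 p.2) * g (S.piecewise p.1 p.2) = f p.1 * g p.2 := fun p => by
    rw [hf (S.piecewise p.1 p.2) p.1 fun i hi => Set.piecewise_eq_of_mem _ _ _ hi,
      hg (S.piecewise p.1 p.2) p.2 fun i hi => Set.piecewise_eq_of_notMem _ _ _ hi]
  rw [← integral_prod_mul]
  simp_rw [← e]
  rw [← h.map_eq] at hfg ⊢
  rw [integral_map h.measurable.aemeasurable hfg.aestronglyMeasurable, h.map_eq]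

end Resampling

/-! ### Families with martingale increments -/

/-- A family of functions `X A` of independent variables `a γ`, `γ ∈ I`, where `X A` depends on
the variables in `A`, such that adding an index to `A` adds an increment which is bounded by `κ`,
has mean zero in the new variable, and depends only on the new variable and its neighbours. -/
structure IncrementFamily {I M : Type*} [DecidableEq I] [MeasurableSpace M] (μ : Measure M)
    (X : Finset I → (I → M) → ℂ) (κ : ℝ) (N : I → Finset I) : Prop where
  measurable : ∀ A, Measurable (X A)
  empty : ∀ a, X ∅ a = 0
  congr : ∀ A a a', (∀ γ ∈ A, a γ = a' γ) → X A a = X A a'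
  mean : ∀ A b, b ∉ A → ∀ a, ∫ s, X (insert b A) (Function.update a b s) ∂μ = X A a
  bound : ∀ A b, b ∉ A → ∀ a, ‖X (insert b A) a - X A a‖ ≤ κ
  locality : ∀ A b, b ∉ A → ∀ a a', (∀ γ ∈ insert b (N b), a γ = a' γ) →
    X (insert b A) a - X A a = X (insert b A) a' - X A a'

namespace IncrementFamily

variable {I M : Type*} [DecidableEq I] [MeasurableSpace M] {μ : Measure M}
  [IsProbabilityMeasure μ] {X : Finset I → (I → M) → ℂ} {κ : ℝ} {N : I → Finset I}

theorem norm_sub_le (h : IncrementFamily μ X κ N) (A B : Finset I) (a : I → M) :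
    ‖X (A ∪ B) a - X A a‖ ≤ B.card * κ := by
  induction B using Finset.induction_on with
  | empty => simp
  | insert b B hb ih =>
    have hκ : 0 ≤ κ := (norm_nonneg _).trans (h.bound ∅ b (Finset.notMem_empty b) a)
    rw [Finset.union_insert, Finset.card_insert_of_notMem hb]
    push_cast
    by_cases hA : b ∈ A ∪ B
    · rw [Finset.insert_eq_of_mem hA]; linarith
    · calc ‖X (insert b (A ∪ B)) a - X A a‖
          = ‖(X (insert b (A ∪ B)) a - X (A ∪ B) a) + (X (A ∪ B) a - X A a)‖ := by ring_nf
        _ ≤ _ := (norm_add_le _ _).trans (by linarith [h.bound _ _ hA a])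

theorem norm_le (h : IncrementFamily μ X κ N) (A : Finset I) (a : I → M) :
    ‖X A a‖ ≤ A.card * κ := by
  simpa [h.empty] using h.norm_sub_le ∅ A a

theorem update_eq (h : IncrementFamily μ X κ N) {A : Finset I} {b : I} (hb : b ∉ A) (a : I → M)
    (s : M) : X A (Function.update a b s) = X A a :=
  h.congr _ _ _ fun γ hγ => Function.update_of_ne (fun e => hb (by rwa [← e])) _ _

theorem integrable_slice (h : IncrementFamily μ X κ N) (A : Finset I) (b : I) (a : I → M) :
    Integrable (fun s => X A (Function.update a b s)) μ :=
  Integrable.of_bound ((h.measurable A).comp (measurable_update a)).aestronglyMeasurable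
    (A.card * κ) (Eventually.of_forall fun _ => h.norm_le _ _)

theorem integral_increment (h : IncrementFamily μ X κ N) {A : Finset I} {b : I} (hb : b ∉ A)
    (a : I → M) :
    ∫ s, (X (insert b A) (Function.update a b s) - X A a) ∂μ = 0 := by
  rw [integral_sub (h.integrable_slice _ _ _) (integrable_const _), h.mean A b hb]
  simp

/-- Exponential moments as in Azuma's inequality. In the resampled variable `b` the increment `D`
has mean zero and `|D| ≤ c ≤ 1`, so `exp D ≤ 1 + D + c ^ 2` integrates to at most `1 + c ^ 2 ≤ exp
(c ^ 2)`. The hypotheses hold for every set `A`, so the blocks may be revealed in any order, and the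
induction over `A` needs none. -/
theorem integral_exp_le (h : IncrementFamily μ X κ N) {ζ : ℂ} {c : ℝ} (hc : ‖ζ‖ * κ ≤ c)
    (hc1 : c ≤ 1) (A : Finset I) :
    ∫ a, Real.exp (ζ * X A a).re ∂(Measure.infinitePi fun _ : I => μ) ≤
      Real.exp (A.card * c ^ 2) := by
  have hbd : ∀ (A : Finset I) a, |(ζ * X A a).re| ≤ ‖ζ‖ * (A.card * κ) := fun A a =>
    (Complex.abs_re_le_norm _).trans (by
      rw [norm_mul]; exact mul_le_mul_of_nonneg_left (h.norm_le A a) (norm_nonneg _))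
  have hm : ∀ A : Finset I, Measurable fun a => Real.exp (ζ * X A a).re := fun A =>
    Real.measurable_exp.comp (Complex.measurable_re.comp ((h.measurable A).const_mul ζ))
  have hint : ∀ A : Finset I, Integrable (fun a => Real.exp (ζ * X A a).re)
      (Measure.infinitePi fun _ : I => μ) := fun A =>
    Integrable.of_bound (hm A).aestronglyMeasurable (Real.exp (‖ζ‖ * (A.card * κ)))
      (Eventually.of_forall fun a => by
        rw [Real.norm_eq_abs, Real.abs_exp]
        exact Real.exp_le_exp.2 ((le_abs_self _).trans (hbd A a)))
  induction A using Finset.induction_on with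
  | empty => simp [h.empty]
  | insert b A hb ih =>
    rw [integral_update _ b (hint _)]
    have key : ∀ a, ∫ s, Real.exp (ζ * X (insert b A) (Function.update a b s)).re ∂μ ≤
        Real.exp (ζ * X A a).re * Real.exp (c ^ 2) := by
      intro a
      set D : M → ℝ := fun s => (ζ * (X (insert b A) (Function.update a b s) - X A a)).re with hD
      have hDb : ∀ s, |D s| ≤ c := fun s => (Complex.abs_re_le_norm _).trans (by
        rw [norm_mul]
        refine le_trans (mul_le_mul_of_nonneg_left ?_ (norm_nonneg _)) hc
        have := h.bound A b hb (Function.update a b s)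
        rwa [h.update_eq hb] at this)
      have hDi : Integrable (fun s => X (insert b A) (Function.update a b s) - X A a) μ :=
        (h.integrable_slice _ _ _).sub (integrable_const _)
      have hD0 : ∫ s, D s ∂μ = 0 := by
        have e1 : ∫ s, D s ∂μ =
          (∫ s, ζ * (X (insert b A) (Function.update a b s) - X A a) ∂μ).re :=
          integral_re (hDi.const_mul ζ)
        rw [e1, integral_const_mul, h.integral_increment hb, mul_zero, Complex.zero_re]
      have hDi' : Integrable D μ := (hDi.const_mul ζ).re
      have e : ∀ s, Real.exp (ζ * X (insert b A) (Function.update a b s)).re =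
          Real.exp (ζ * X A a).re * Real.exp (D s) := fun s => by
        rw [← Real.exp_add, hD]; congr 1
        rw [← Complex.add_re]; congr 1; ring
      simp_rw [e]
      rw [integral_const_mul]
      refine mul_le_mul_of_nonneg_left ?_ (Real.exp_pos _).le
      have hle : ∀ s, Real.exp (D s) ≤ 1 + D s + c ^ 2 := fun s => by
        have h1 := Real.abs_exp_sub_one_sub_id_le ((hDb s).trans hc1)
        have h2 : D s ^ 2 ≤ c ^ 2 := sq_le_sq' (by linarith [neg_abs_le (D s), hDb s])
          ((le_abs_self _).trans (hDb s))
        linarith [le_abs_self (Real.exp (D s) - 1 - D s)]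
      have hDm : AEStronglyMeasurable (fun s => Real.exp (D s)) μ :=
        Real.continuous_exp.comp_aestronglyMeasurable hDi'.aestronglyMeasurable
      calc ∫ s, Real.exp (D s) ∂μ ≤ ∫ s, (1 + D s + c ^ 2) ∂μ := by
            refine integral_mono (Integrable.of_bound hDm (Real.exp c)
              (Eventually.of_forall fun s => ?_)) (by fun_prop) hle
            rw [Real.norm_eq_abs, Real.abs_exp]
            exact Real.exp_le_exp.2 ((le_abs_self _).trans (hDb s))
        _ = 1 + c ^ 2 := by
            rw [integral_add (by fun_prop) (by fun_prop), integral_add (by fun_prop) hDi', hD0]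
            simp
        _ ≤ Real.exp (c ^ 2) := by linarith [Real.add_one_le_exp (c ^ 2)]
    calc _ ≤ ∫ a, Real.exp (ζ * X A a).re * Real.exp (c ^ 2)
            ∂(Measure.infinitePi fun _ : I => μ) := by
          refine integral_mono_of_nonneg (Eventually.of_forall fun a => ?_)
            ((hint A).mul_const _) (Eventually.of_forall key)
          exact integral_nonneg fun s => (Real.exp_pos _).le
      _ ≤ Real.exp (A.card * c ^ 2) * Real.exp (c ^ 2) := by
          rw [integral_mul_const]
          exact mul_le_mul_of_nonneg_right ih (Real.exp_pos _).le
      _ = _ := by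
          rw [← Real.exp_add, Finset.card_insert_of_notMem hb]; push_cast; ring_nf

/-- The increment of the family at the index `b`. -/
def inc (X : Finset I → (I → M) → ℂ) (A : Finset I) (b : I) (a : I → M) : ℂ :=
  X (insert b A) a - X A a

theorem measurable_inc (h : IncrementFamily μ X κ N) (A : Finset I) (b : I) :
    Measurable (inc X A b) := (h.measurable _).sub (h.measurable _)

theorem integrable_of_norm_le {Ω : Type*} [MeasurableSpace Ω] {P : Measure Ω} [IsFiniteMeasure P]
    {E : Type*} [NormedAddCommGroup E] [MeasurableSpace E] [BorelSpace E]
    [SecondCountableTopology E] {f : Ω → E} (hf : Measurable f) {C : ℝ} (hC : ∀ ω, ‖f ω‖ ≤ C) :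
    Integrable f P :=
  Integrable.of_bound hf.aestronglyMeasurable C (Eventually.of_forall hC)

/-- Orthogonality of martingale increments: integrated over the variable `b` first, `g` is a
constant and the increment averages to zero. Only the real part enters the expansions of the second
and fourth powers. -/
theorem integral_mul_inc (h : IncrementFamily μ X κ N) {A : Finset I} {b : I} (hb : b ∉ A)
    {g : (I → M) → ℂ} (hg : Measurable g) {C : ℝ} (hC : ∀ a, ‖g a‖ ≤ C)
    (hgb : ∀ a s, g (Function.update a b s) = g a) :
    ∫ a, (g a * inc X A b a).re ∂(Measure.infinitePi fun _ : I => μ) = 0 := by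
  have hint : Integrable (fun a => (g a * inc X A b a)) (Measure.infinitePi fun _ : I => μ) :=
    integrable_of_norm_le (hg.mul (h.measurable_inc A b)) (C := C * κ) fun a => by
      rw [norm_mul]
      exact mul_le_mul (hC a) (h.bound A b hb a) (norm_nonneg _) ((norm_nonneg _).trans (hC a))
  have e1 : ∫ a, (g a * inc X A b a).re ∂(Measure.infinitePi fun _ : I => μ) =
      (∫ a, (g a * inc X A b a) ∂(Measure.infinitePi fun _ : I => μ)).re := integral_re hint
  rw [e1, integral_update _ b hint]
  have e2 : ∀ a, ∫ s, g (Function.update a b s) * inc X A b (Function.update a b s) ∂μ = 0 := by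
    intro a
    simp_rw [hgb, inc, h.update_eq hb]
    rw [integral_const_mul, h.integral_increment hb, mul_zero]
  simp [e2]

theorem norm_add_sq (x d : ℂ) :
    ‖x + d‖ ^ 2 = ‖x‖ ^ 2 + 2 * ((starRingEnd ℂ) x * d).re + ‖d‖ ^ 2 := by
  simp only [← Complex.normSq_eq_norm_sq, Complex.normSq_apply, Complex.add_re, Complex.add_im,
    Complex.mul_re, Complex.conj_re, Complex.conj_im]
  ring

/-- With `r` the real part of `conj x * d`, the left side is the square of `‖x‖ ^ 2 + 2 * r + ‖d‖ ^
2`. The term linear in `d` is kept exactly, since it will integrate to zero. The other mixed terms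
are absorbed by `4 * r * ‖d‖ ^ 2 ≤ 2 * r ^ 2 + 2 * ‖d‖ ^ 4` and `r ^ 2 ≤ ‖x‖ ^ 2 * ‖d‖ ^ 2`, whence
the constants `8 = 2 + 6` and `3 = 1 + 2`. -/
theorem norm_add_pow_four_le (x d : ℂ) :
    ‖x + d‖ ^ 4 ≤ ‖x‖ ^ 4 + 4 * ((((‖x‖ ^ 2 : ℝ) : ℂ) * (starRingEnd ℂ) x) * d).re +
      8 * (‖x‖ ^ 2 * ‖d‖ ^ 2) + 3 * ‖d‖ ^ 4 := by
  have e := norm_add_sq x d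
  have e2 : ((((‖x‖ ^ 2 : ℝ) : ℂ) * (starRingEnd ℂ) x) * d).re =
      ‖x‖ ^ 2 * ((starRingEnd ℂ) x * d).re := by rw [mul_assoc, Complex.re_ofReal_mul]
  rw [e2]
  set r := ((starRingEnd ℂ) x * d).re
  have hr : |r| ≤ ‖x‖ * ‖d‖ := (Complex.abs_re_le_norm _).trans (by simp)
  have hr2 : r ^ 2 ≤ ‖x‖ ^ 2 * ‖d‖ ^ 2 := by
    rw [← mul_pow]; exact sq_le_sq' (by linarith [neg_abs_le r]) ((le_abs_self r).trans hr)
  have : ‖x + d‖ ^ 4 = (‖x‖ ^ 2 + 2 * r + ‖d‖ ^ 2) ^ 2 := by rw [← e]; ring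
  rw [this]
  nlinarith [sq_nonneg (r - ‖d‖ ^ 2)]

/-- The second moment of `X A`. -/
def secondMoment (μ : Measure M) (X : Finset I → (I → M) → ℂ) (A : Finset I) : ℝ :=
  ∫ a, ‖X A a‖ ^ 2 ∂(Measure.infinitePi fun _ : I => μ)

theorem integrable_norm_pow (h : IncrementFamily μ X κ N) (A : Finset I) (j : ℕ) :
    Integrable (fun a => ‖X A a‖ ^ j) (Measure.infinitePi fun _ : I => μ) :=
  integrable_of_norm_le ((h.measurable A).norm.pow_const j) (C := (A.card * κ) ^ j) fun a => by
    rw [norm_pow, norm_norm]; exact pow_le_pow_left₀ (norm_nonneg _) (h.norm_le A a) j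

theorem integrable_inc_pow (h : IncrementFamily μ X κ N) {A : Finset I} {b : I} (hb : b ∉ A)
    (j : ℕ) : Integrable (fun a => ‖inc X A b a‖ ^ j) (Measure.infinitePi fun _ : I => μ) :=
  integrable_of_norm_le ((h.measurable_inc A b).norm.pow_const j) (C := κ ^ j) fun a => by
    rw [norm_pow, norm_norm]; exact pow_le_pow_left₀ (norm_nonneg _) (h.bound A b hb a) j

theorem integrable_re_mul_inc (h : IncrementFamily μ X κ N) {A : Finset I} {b : I} (hb : b ∉ A)
    {g : (I → M) → ℂ} (hg : Measurable g) {C : ℝ} (hC : ∀ a, ‖g a‖ ≤ C) :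
    Integrable (fun a => (g a * inc X A b a).re) (Measure.infinitePi fun _ : I => μ) :=
  (integrable_of_norm_le (f := fun a => g a * inc X A b a) (hg.mul (h.measurable_inc A b))
    (C := C * κ) fun a => by
      rw [norm_mul]
      exact mul_le_mul (hC a) (h.bound A b hb a) (norm_nonneg _)
        ((norm_nonneg _).trans (hC a))).re

theorem secondMoment_insert (h : IncrementFamily μ X κ N) {A : Finset I} {b : I} (hb : b ∉ A) :
    secondMoment μ X (insert b A) = secondMoment μ X A +
      ∫ a, ‖inc X A b a‖ ^ 2 ∂(Measure.infinitePi fun _ : I => μ) := by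
  have hg : Measurable fun a => (starRingEnd ℂ) (X A a) :=
    Complex.continuous_conj.measurable.comp (h.measurable A)
  have hgC : ∀ a, ‖(starRingEnd ℂ) (X A a)‖ ≤ A.card * κ := fun a => by
    simpa using h.norm_le A a
  have e : ∀ a, ‖X (insert b A) a‖ ^ 2 = ‖X A a‖ ^ 2 +
      2 * ((starRingEnd ℂ) (X A a) * inc X A b a).re + ‖inc X A b a‖ ^ 2 := fun a => by
    rw [← norm_add_sq]; simp [inc]
  have h1 := h.integral_mul_inc hb hg hgC (fun a s => by rw [h.update_eq hb])
  have i1 := h.integrable_re_mul_inc hb hg hgC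
  have i2 := h.integrable_norm_pow A 2
  have i3 := h.integrable_inc_pow hb 2
  have i12 : Integrable (fun a => ‖X A a‖ ^ 2 + 2 * ((starRingEnd ℂ) (X A a) * inc X A b a).re)
    (Measure.infinitePi fun _ : I => μ) := i2.add (i1.const_mul 2)
  simp only [secondMoment, e]
  rw [integral_add i12 i3, integral_add i2 (i1.const_mul 2),
    integral_const_mul, h1]
  ring

theorem secondMoment_nonneg (A : Finset I) : 0 ≤ secondMoment μ X A :=
  integral_nonneg fun _ => by positivity

theorem secondMoment_mono (h : IncrementFamily μ X κ N) {A B : Finset I} (hAB : A ⊆ B) :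
    secondMoment μ X A ≤ secondMoment μ X B := by
  have : ∀ C : Finset I, secondMoment μ X A ≤ secondMoment μ X (A ∪ C) := fun C => by
    induction C using Finset.induction_on with
    | empty => simp
    | insert b C hb ih =>
      rw [Finset.union_insert]
      by_cases hA : b ∈ A ∪ C
      · rwa [Finset.insert_eq_of_mem hA]
      · rw [h.secondMoment_insert hA]
        have : 0 ≤ ∫ a, ‖inc X (A ∪ C) b a‖ ^ 2 ∂(Measure.infinitePi fun _ : I => μ) :=
          integral_nonneg fun _ => by positivity
        linarith
  simpa [Finset.union_eq_right.2 hAB] using this B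

/-- `X A` and the increment at `b` are not independent, but removing the at most `k` neighbours of
`b` from `A` changes `X A` by at most `k * κ`. What remains shares no variable with the increment,
so that the integral factors. -/
theorem integral_norm_sq_mul_inc_le (h : IncrementFamily μ X κ N) {A : Finset I} {b : I}
    (hb : b ∉ A) {k : ℝ} (hk : ((N b).card : ℝ) ≤ k) :
    ∫ a, ‖X A a‖ ^ 2 * ‖inc X A b a‖ ^ 2 ∂(Measure.infinitePi fun _ : I => μ) ≤
      2 * (secondMoment μ X A + (k * κ) ^ 2) *
        ∫ a, ‖inc X A b a‖ ^ 2 ∂(Measure.infinitePi fun _ : I => μ) := by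
  have hκ : 0 ≤ κ := (norm_nonneg _).trans (h.bound A b hb (fun _ => (nonempty_of_isProbabilityMeasure μ).some))
  set Pr := Measure.infinitePi fun _ : I => μ
  set B := A \ N b with hB
  have hBA : B ∪ (A ∩ N b) = A := Finset.sdiff_union_inter A (N b)
  have hdiff : ∀ a, ‖X A a‖ ^ 2 ≤ 2 * ‖X B a‖ ^ 2 + 2 * (k * κ) ^ 2 := fun a => by
    have h1 := h.norm_sub_le B (A ∩ N b) a
    rw [hBA] at h1
    have h2 : ‖X A a - X B a‖ ≤ k * κ := h1.trans (mul_le_mul_of_nonneg_right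
      (le_trans (by exact_mod_cast Finset.card_le_card Finset.inter_subset_right) hk) hκ)
    have h3 : ‖X A a‖ ≤ ‖X B a‖ + k * κ := by
      linarith [norm_sub_norm_le (X A a) (X B a)]
    nlinarith [norm_nonneg (X A a), norm_nonneg (X B a), sq_nonneg (‖X B a‖ - k * κ)]
  have i3 := h.integrable_inc_pow hb 2
  have i4 : Integrable (fun a => ‖X B a‖ ^ 2 * ‖inc X A b a‖ ^ 2) Pr :=
    integrable_of_norm_le (((h.measurable B).norm.pow_const 2).mul
      ((h.measurable_inc A b).norm.pow_const 2)) (C := (B.card * κ) ^ 2 * κ ^ 2) fun a => by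
        rw [norm_mul, norm_pow, norm_pow, norm_norm, norm_norm]
        have := h.norm_le B a
        have := h.bound A b hb a
        gcongr
        exact this
  have hind : ∫ a, ‖X B a‖ ^ 2 * ‖inc X A b a‖ ^ 2 ∂Pr =
      (∫ a, ‖X B a‖ ^ 2 ∂Pr) * ∫ a, ‖inc X A b a‖ ^ 2 ∂Pr := by
    refine integral_mul_of_depends (fun _ : I => μ) (B : Set I) (fun a a' haa => ?_)
      (fun a a' haa => ?_) i4
    · rw [h.congr B a a' haa]
    · have : inc X A b a = inc X A b a' := h.locality A b hb a a' fun γ hγ => haa γ (by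
        rcases Finset.mem_insert.1 hγ with rfl | hγ
        · simp [hB, hb]
        · simp [hB, hγ])
      rw [this]
  calc ∫ a, ‖X A a‖ ^ 2 * ‖inc X A b a‖ ^ 2 ∂Pr
      ≤ ∫ a, (2 * (‖X B a‖ ^ 2 * ‖inc X A b a‖ ^ 2) + 2 * (k * κ) ^ 2 * ‖inc X A b a‖ ^ 2) ∂Pr := by
        refine integral_mono_of_nonneg (Eventually.of_forall fun a => by positivity)
          ((i4.const_mul 2).add (i3.const_mul _)) (Eventually.of_forall fun a => ?_)
        have := mul_le_mul_of_nonneg_right (hdiff a) (sq_nonneg ‖inc X A b a‖)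
        simp only
        linarith
    _ = 2 * (secondMoment μ X B + (k * κ) ^ 2) * ∫ a, ‖inc X A b a‖ ^ 2 ∂Pr := by
        rw [integral_add (i4.const_mul 2) (i3.const_mul _), integral_const_mul,
          integral_const_mul, hind, secondMoment]
        ring
    _ ≤ _ := by
        have := h.secondMoment_mono (Finset.sdiff_subset : B ⊆ A)
        have h0 : 0 ≤ ∫ a, ‖inc X A b a‖ ^ 2 ∂Pr := integral_nonneg fun _ => by positivity
        gcongr

/-- The right side is built to absorb one induction step. If the second moment `m` grows by `e`,
then `8 * m ^ 2` grows by at least `16 * m * e` and the linear term by `(16 * k ^ 2 + 3) * κ ^ 2 *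
e`. These pay for the mixed term, which is at most `16 * (m + (k * κ) ^ 2) * e`, and for the fourth
power of the increment, at most `3 * κ ^ 2 * e`; the cubic term vanishes by orthogonality. -/
theorem fourthMoment_le (h : IncrementFamily μ X κ N) {k : ℝ} (hk : ∀ b, ((N b).card : ℝ) ≤ k)
    (A : Finset I) :
    ∫ a, ‖X A a‖ ^ 4 ∂(Measure.infinitePi fun _ : I => μ) ≤
      8 * secondMoment μ X A ^ 2 + (16 * k ^ 2 + 3) * κ ^ 2 * secondMoment μ X A := by
  induction A using Finset.induction_on with
  | empty => simp [h.empty, secondMoment]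
  | insert b A hb ih =>
    rw [h.secondMoment_insert hb]
    set Pr := Measure.infinitePi fun _ : I => μ
    set e := ∫ a, ‖inc X A b a‖ ^ 2 ∂Pr
    set m := secondMoment μ X A
    have he : 0 ≤ e := integral_nonneg fun _ => by positivity
    have hm : 0 ≤ m := secondMoment_nonneg A
    have hg : Measurable fun a => ((‖X A a‖ ^ 2 : ℝ) : ℂ) * (starRingEnd ℂ) (X A a) :=
      (Complex.measurable_ofReal.comp ((h.measurable A).norm.pow_const 2)).mul
        (Complex.continuous_conj.measurable.comp (h.measurable A))
    have hgC : ∀ a, ‖((‖X A a‖ ^ 2 : ℝ) : ℂ) * (starRingEnd ℂ) (X A a)‖ ≤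
        (A.card * κ) ^ 2 * (A.card * κ) := fun a => by
      rw [norm_mul, Complex.norm_real, norm_pow, norm_norm, RCLike.norm_conj]
      have := h.norm_le A a
      have := norm_nonneg (X A a)
      gcongr
    have h1 := h.integral_mul_inc hb hg hgC (fun a s => by rw [h.update_eq hb])
    have i1 := h.integrable_re_mul_inc hb hg hgC
    have i2 := h.integrable_norm_pow A 4
    have i3 := h.integrable_inc_pow hb 4
    have i5 : Integrable (fun a => ‖X A a‖ ^ 2 * ‖inc X A b a‖ ^ 2) Pr :=
      integrable_of_norm_le (((h.measurable A).norm.pow_const 2).mul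
        ((h.measurable_inc A b).norm.pow_const 2)) (C := (A.card * κ) ^ 2 * κ ^ 2) fun a => by
          rw [norm_mul, norm_pow, norm_pow, norm_norm, norm_norm]
          have := h.norm_le A a
          have := h.bound A b hb a
          gcongr
          exact this
    have h4 : ∫ a, ‖inc X A b a‖ ^ 4 ∂Pr ≤ κ ^ 2 * e := by
      rw [← integral_const_mul]
      refine integral_mono i3 ((h.integrable_inc_pow hb 2).const_mul _) fun a => ?_
      have : ‖inc X A b a‖ ^ 2 ≤ κ ^ 2 := pow_le_pow_left₀ (norm_nonneg _) (h.bound A b hb a) 2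
      calc ‖inc X A b a‖ ^ 4 = ‖inc X A b a‖ ^ 2 * ‖inc X A b a‖ ^ 2 := by ring
        _ ≤ _ := mul_le_mul_of_nonneg_right this (by positivity)
    have i12 : Integrable (fun a => ‖X A a‖ ^ 4 + 4 * ((((‖X A a‖ ^ 2 : ℝ) : ℂ) *
        (starRingEnd ℂ) (X A a)) * inc X A b a).re) Pr := i2.add (i1.const_mul 4)
    have i123 : Integrable (fun a => ‖X A a‖ ^ 4 + 4 * ((((‖X A a‖ ^ 2 : ℝ) : ℂ) *
        (starRingEnd ℂ) (X A a)) * inc X A b a).re + 8 * (‖X A a‖ ^ 2 * ‖inc X A b a‖ ^ 2)) Pr :=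
      i12.add (i5.const_mul 8)
    have h5 := h.integral_norm_sq_mul_inc_le hb (hk b)
    calc ∫ a, ‖X (insert b A) a‖ ^ 4 ∂Pr
        ≤ ∫ a, (‖X A a‖ ^ 4 + 4 * ((((‖X A a‖ ^ 2 : ℝ) : ℂ) * (starRingEnd ℂ) (X A a)) *
            inc X A b a).re + 8 * (‖X A a‖ ^ 2 * ‖inc X A b a‖ ^ 2) +
            3 * ‖inc X A b a‖ ^ 4) ∂Pr := by
          refine integral_mono (h.integrable_norm_pow _ 4)
            (i123.add (i3.const_mul 3)) fun a => ?_
          have := norm_add_pow_four_le (X A a) (inc X A b a)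
          simpa [inc] using this
      _ = ∫ a, ‖X A a‖ ^ 4 ∂Pr + 8 * ∫ a, ‖X A a‖ ^ 2 * ‖inc X A b a‖ ^ 2 ∂Pr +
            3 * ∫ a, ‖inc X A b a‖ ^ 4 ∂Pr := by
          rw [integral_add i123 (i3.const_mul 3), integral_add i12 (i5.const_mul 8),
            integral_add i2 (i1.const_mul 4), integral_const_mul, integral_const_mul,
            integral_const_mul, h1]
          ring
      _ ≤ _ := by nlinarith

theorem measure_le_re_le (h : IncrementFamily μ X κ N) {ζ : ℂ} {c : ℝ} (hc : ‖ζ‖ * κ ≤ c)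
    (hc1 : c ≤ 1) (A : Finset I) (l : ℝ) :
    (Measure.infinitePi fun _ : I => μ) {a | l ≤ (ζ * X A a).re} ≤
      ENNReal.ofReal (Real.exp (A.card * c ^ 2 - l)) := by
  set Pr := Measure.infinitePi fun _ : I => μ
  have hm : Measurable fun a => (ζ * X A a).re :=
    Complex.measurable_re.comp ((h.measurable A).const_mul ζ)
  have hint : Integrable (fun a => Real.exp (ζ * X A a).re) Pr :=
    integrable_of_norm_le (Real.measurable_exp.comp hm)
      (C := Real.exp (‖ζ‖ * (A.card * κ))) fun a => by
        rw [Real.norm_eq_abs, Real.abs_exp]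
        refine Real.exp_le_exp.2 ((le_abs_self _).trans ((Complex.abs_re_le_norm _).trans ?_))
        rw [norm_mul]
        exact mul_le_mul_of_nonneg_left (h.norm_le A a) (norm_nonneg _)
  have h1 := mul_meas_ge_le_integral_of_nonneg (μ := Pr)
    (Eventually.of_forall fun a => (Real.exp_pos (ζ * X A a).re).le) hint (Real.exp l)
  have h2 := h1.trans (h.integral_exp_le hc hc1 A)
  have h3 : Pr.real {a | Real.exp l ≤ Real.exp (ζ * X A a).re} ≤
      Real.exp (A.card * c ^ 2 - l) := by
    rw [Real.exp_sub, le_div_iff₀ (Real.exp_pos l), mul_comm]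
    exact h2
  simp only [Real.exp_le_exp] at h3
  rw [← ofReal_measureReal]
  exact ENNReal.ofReal_le_ofReal h3

theorem measure_lt_norm_le (h : IncrementFamily μ X κ N) {r c : ℝ} (hr : 0 < r) (hc : r * κ ≤ c)
    (hc1 : c ≤ 1) (A : Finset I) (l : ℝ) :
    (Measure.infinitePi fun _ : I => μ) {a | 2 * l / r < ‖X A a‖} ≤
      4 * ENNReal.ofReal (Real.exp (A.card * c ^ 2 - l)) := by
  set Pr := Measure.infinitePi fun _ : I => μ
  have hn : ∀ u : ℂ, ‖u‖ = 1 → ‖(r : ℂ) * u‖ * κ ≤ c := fun u hu => by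
    rw [norm_mul, hu, mul_one, Complex.norm_real, Real.norm_of_nonneg hr.le]; exact hc
  -- A complex number of norm above `2 * l / r` has a real or imaginary part of modulus at least `l
  -- / r`. This gives four one-sided events, one for each of the unit multipliers `1, -1, I, -I`,
  -- hence the factor `4`.
  have hsub : {a | 2 * l / r < ‖X A a‖} ⊆
      ({a | l ≤ ((r : ℂ) * 1 * X A a).re} ∪ {a | l ≤ ((r : ℂ) * (-1) * X A a).re}) ∪
      ({a | l ≤ ((r : ℂ) * Complex.I * X A a).re} ∪
        {a | l ≤ ((r : ℂ) * (-Complex.I) * X A a).re}) := by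
    intro a ha
    by_contra hcon
    simp only [Set.mem_union, Set.mem_ofPred_eq, not_or, not_le] at hcon ha
    obtain ⟨⟨h1, h2⟩, h3, h4⟩ := hcon
    simp only [mul_assoc, Complex.re_ofReal_mul, one_mul, neg_mul, Complex.neg_re,
      Complex.I_mul_re] at h1 h2 h3 h4
    rw [div_lt_iff₀ hr] at ha
    have h5 := Complex.norm_le_abs_re_add_abs_im (X A a)
    have h6 : |(X A a).re| * r < l := by
      rw [← abs_of_pos hr, ← abs_mul, abs_lt]; constructor <;> linarith
    have h7 : |(X A a).im| * r < l := by
      rw [← abs_of_pos hr, ← abs_mul, abs_lt]; constructor <;> linarith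
    nlinarith
  refine (measure_mono hsub).trans ?_
  refine (measure_union_le _ _).trans ((add_le_add (measure_union_le _ _)
    (measure_union_le _ _)).trans ?_)
  have b1 := h.measure_le_re_le (hn 1 (by simp)) hc1 A l
  have b2 := h.measure_le_re_le (hn (-1) (by simp)) hc1 A l
  have b3 := h.measure_le_re_le (hn Complex.I (by simp)) hc1 A l
  have b4 := h.measure_le_re_le (hn (-Complex.I) (by simp)) hc1 A l
  refine (add_le_add (add_le_add b1 b2) (add_le_add b3 b4)).trans (le_of_eq ?_)
  ring

/-- A substitute for the Paley–Zygmund inequality. The parabola `θ * y - θ ^ 2 / 4 * y ^ 2` has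
maximum `1` and lies below `y` for `0 ≤ θ ≤ 1`, so it minorizes `min 1 y`. For `y = V * ‖X A‖ ^ 2`,
with mean `w` and second moment at most `8 * w ^ 2 + w`, the choice `θ = 1 / (4 * w + 1)` leaves `θ
* w / 2 = w / (8 * w + 2)`, which increases with `w`. The truncation at `1` is what later turns the
mean into a probability. -/
theorem le_integral_min_one (h : IncrementFamily μ X κ N) {k : ℝ}
    (hk : ∀ b, ((N b).card : ℝ) ≤ k) (A : Finset I) {V c : ℝ} (hV : 0 ≤ V) (hc : 0 < c)
    (hm : c ≤ V * secondMoment μ X A) (hV1 : (16 * k ^ 2 + 3) * κ ^ 2 * V ≤ 1) :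
    c / (8 * c + 2) ≤
      ∫ a, min 1 (V * ‖X A a‖ ^ 2) ∂(Measure.infinitePi fun _ : I => μ) := by
  set Pr := Measure.infinitePi fun _ : I => μ
  set w := V * secondMoment μ X A
  have hw : 0 < w := hc.trans_le hm
  set θ := 1 / (4 * w + 1)
  have hθ0 : 0 < θ := by positivity
  have hθ : θ * (4 * w + 1) = 1 := by simp only [θ]; field_simp
  have hθ1 : θ ≤ 1 := by nlinarith
  have i2 := h.integrable_norm_pow A 2
  have i4 := h.integrable_norm_pow A 4
  have hpt : ∀ y : ℝ, 0 ≤ y → θ * y - θ ^ 2 / 4 * y ^ 2 ≤ min 1 y := fun y hy => by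
    refine le_min ?_ ?_
    · nlinarith [sq_nonneg (θ * y / 2 - 1)]
    · nlinarith [mul_nonneg (sub_nonneg.2 hθ1) hy, sq_nonneg (θ * y)]
  have h4 := h.fourthMoment_le hk A
  have h4' : V ^ 2 * ∫ a, ‖X A a‖ ^ 4 ∂Pr ≤ 8 * w ^ 2 + w := by
    have h5 := mul_le_mul_of_nonneg_left h4 (sq_nonneg V)
    have h6 := mul_le_mul_of_nonneg_right hV1 hw.le
    have e : V ^ 2 * (8 * secondMoment μ X A ^ 2 +
      (16 * k ^ 2 + 3) * κ ^ 2 * secondMoment μ X A) =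
        8 * w ^ 2 + (16 * k ^ 2 + 3) * κ ^ 2 * V * w := by simp only [w]; ring
    linarith
  have hint : Integrable (fun a => min 1 (V * ‖X A a‖ ^ 2)) Pr :=
    integrable_of_norm_le (measurable_const.min (((h.measurable A).norm.pow_const 2).const_mul V))
      (C := 1) fun a => by
        rw [Real.norm_of_nonneg (le_min zero_le_one (by positivity))]; exact min_le_left _ _
  calc c / (8 * c + 2) ≤ w / (8 * w + 2) := by
        rw [div_le_div_iff₀ (by positivity) (by positivity)]; nlinarith
    _ = θ * w / 2 := by simp only [θ]; field_simp; ring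
    _ ≤ θ * w - θ ^ 2 / 4 * (V ^ 2 * ∫ a, ‖X A a‖ ^ 4 ∂Pr) := by
        have h7 := mul_le_mul_of_nonneg_left h4' (show 0 ≤ θ ^ 2 / 4 by positivity)
        have h8 : θ ^ 2 / 4 * (8 * w ^ 2 + w) ≤ θ * w / 2 := by
          have : θ * w / 2 = θ ^ 2 * (4 * w + 1) * w / 2 := by
            calc θ * w / 2 = θ * (θ * (4 * w + 1)) * w / 2 := by rw [hθ, mul_one]
              _ = _ := by ring
          rw [this]
          have : 0 ≤ θ ^ 2 * w := by positivity
          nlinarith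
        linarith
    _ = ∫ a, (θ * (V * ‖X A a‖ ^ 2) - θ ^ 2 / 4 * (V ^ 2 * ‖X A a‖ ^ 4)) ∂Pr := by
        rw [integral_sub ((i2.const_mul V).const_mul θ) ((i4.const_mul _).const_mul _)]
        simp only [integral_const_mul]
        rfl
    _ ≤ _ := by
        refine integral_mono (((i2.const_mul V).const_mul θ).sub ((i4.const_mul _).const_mul _))
          hint fun a => ?_
        have := hpt (V * ‖X A a‖ ^ 2) (by positivity)
        calc _ = θ * (V * ‖X A a‖ ^ 2) - θ ^ 2 / 4 * (V * ‖X A a‖ ^ 2) ^ 2 := by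
              ring
          _ ≤ _ := this

end IncrementFamily

end Iceberg

namespace Iceberg

/-! ### Correlations of functions glued from independently rotated pieces -/

section Glued

variable {M : Type*} [MeasurableSpace M] [AddCommGroup M] [MeasurableAdd₂ M] [MeasurableNeg M] {μ : Measure M}
  [IsProbabilityMeasure μ] [μ.IsAddLeftInvariant] {F : M → ℂ} {B : ℝ}

/-- The correlation function of a function on a group with an invariant measure. -/
def corr (μ : Measure M) (F : M → ℂ) (z : M) : ℂ := ∫ x, F (z + x) * (starRingEnd ℂ) (F x) ∂μ

theorem measurable_conj {Ω : Type*} [MeasurableSpace Ω] {f : Ω → ℂ} (hf : Measurable f) :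
    Measurable fun x => (starRingEnd ℂ) (f x) :=
  Complex.continuous_conj.measurable.comp hf

theorem measurable_corr (hF : Measurable F) : Measurable (corr μ F) := by
  have : Measurable fun q : M × M => F (q.1 + q.2) * (starRingEnd ℂ) (F q.2) :=
    (hF.comp (measurable_fst.add measurable_snd)).mul (measurable_conj (hF.comp measurable_snd))
  exact (this.stronglyMeasurable.integral_prod_right').measurable

theorem norm_mul_conj_le {x y : ℂ} (hx : ‖x‖ ≤ B) (hy : ‖y‖ ≤ B) :
    ‖x * (starRingEnd ℂ) y‖ ≤ B ^ 2 := by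
  rw [norm_mul, RCLike.norm_conj, sq]
  exact mul_le_mul hx hy (norm_nonneg _) ((norm_nonneg _).trans hx)

theorem norm_integral_le_of_norm_le' {Ω : Type*} [MeasurableSpace Ω] {P : Measure Ω}
    [IsProbabilityMeasure P] {f : Ω → ℂ} {C : ℝ} (h : ∀ x, ‖f x‖ ≤ C) : ‖∫ x, f x ∂P‖ ≤ C := by
  simpa using norm_integral_le_of_norm_le_const (μ := P) (Eventually.of_forall h)

theorem norm_corr_le (hB : ∀ x, ‖F x‖ ≤ B) (z : M) : ‖corr μ F z‖ ≤ B ^ 2 :=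
  norm_integral_le_of_norm_le' fun _ => norm_mul_conj_le (hB _) (hB _)

/-- Two points rotated by the same uniform element: the average depends on their difference only.
This is the source of the term `stay * corr` in the recursion. -/
theorem corr_shift (u v : M) :
    ∫ s, F (u + s) * (starRingEnd ℂ) (F (v + s)) ∂μ = corr μ F (u - v) := by
  rw [corr, ← integral_add_left_eq_self (fun x => F (u - v + x) * (starRingEnd ℂ) (F x)) v]
  simp only [← add_assoc, sub_add_cancel]

variable {I E : Type*} [Fintype I] [DecidableEq I] [MeasurableSpace E] {m : Measure E}
  [IsProbabilityMeasure m] {b b' : E → I} {p p' : E → M} {κ : ℝ} {N : I → Finset I}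

/-- A measurable decomposition of the pairs `(p x, p' x)` into blocks labelled by `(b x, b' x)`. -/
structure Pairing (m : Measure E) (b b' : E → I) (p p' : E → M) (κ : ℝ) (N : I → Finset I) :
    Prop where
  measurable_left : ∀ γ, MeasurableSet (b ⁻¹' {γ})
  measurable_right : ∀ γ, MeasurableSet (b' ⁻¹' {γ})
  measurable_p : Measurable p
  measurable_p' : Measurable p'
  left_le : ∀ γ, m.real (b ⁻¹' {γ}) ≤ κ
  right_le : ∀ γ, m.real (b' ⁻¹' {γ}) ≤ κ
  right_mem : ∀ x, b' x ∈ N (b x)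
  left_mem : ∀ x, b x ∈ N (b' x)

/-- The centred integrand of the correlation of a glued function. -/
def kern (μ : Measure M) (F : M → ℂ) (b b' : E → I) (p p' : E → M) (a : I → M) (x : E) : ℂ :=
  F (p' x + a (b' x)) * (starRingEnd ℂ) (F (p x + a (b x))) -
    if b x = b' x then corr μ F (p' x - p x) else 0

/-- The part of the centred correlation that involves only the blocks in `A`. -/
def quad (μ : Measure M) (m : Measure E) (F : M → ℂ) (b b' : E → I) (p p' : E → M)
    (A : Finset I) (a : I → M) : ℂ :=
  ∫ x, if b x ∈ A ∧ b' x ∈ A then kern μ F b b' p p' a x else 0 ∂m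

theorem norm_kern_le (hB : ∀ x, ‖F x‖ ≤ B) (a : I → M) (x : E) :
    ‖kern μ F b b' p p' a x‖ ≤ 2 * B ^ 2 := by
  refine (norm_sub_le _ _).trans ?_
  have h1 := norm_mul_conj_le (hB (p' x + a (b' x))) (hB (p x + a (b x)))
  have h2 : ‖if b x = b' x then corr μ F (p' x - p x) else 0‖ ≤ B ^ 2 := by
    split_ifs
    · exact norm_corr_le hB _
    · simpa using sq_nonneg B
  linarith

theorem measurable_apply_label {b : E → I} (hb : ∀ γ, MeasurableSet (b ⁻¹' {γ})) :
    Measurable fun q : (I → M) × E => q.1 (b q.2) := by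
  intro s hs
  have : (fun q : (I → M) × E => q.1 (b q.2)) ⁻¹' s =
      ⋃ γ, ((fun q : (I → M) × E => q.1 γ) ⁻¹' s) ∩ (Prod.snd ⁻¹' (b ⁻¹' {γ})) := by
    ext q; simp
  rw [this]
  exact MeasurableSet.iUnion fun γ =>
    (((measurable_pi_apply γ).comp measurable_fst) hs).inter (measurable_snd (hb γ))

namespace Pairing

theorem measurableSet_pred (h : Pairing m b b' p p' κ N) (r : I → I → Prop) :
    MeasurableSet {x | r (b x) (b' x)} := by
  classical
  have : {x | r (b x) (b' x)} =
      ⋃ γ, ⋃ γ', if r γ γ' then (b ⁻¹' {γ}) ∩ (b' ⁻¹' {γ'}) else ∅ := by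
    ext x
    simp only [Set.mem_ofPred_eq, Set.mem_iUnion]
    constructor
    · intro hx; exact ⟨b x, b' x, by simp [hx]⟩
    · rintro ⟨γ, γ', hx⟩
      split_ifs at hx with hr
      · obtain ⟨rfl, rfl⟩ := hx; exact hr
      · exact absurd hx (Set.notMem_empty x)
  rw [this]
  refine MeasurableSet.iUnion fun γ => MeasurableSet.iUnion fun γ' => ?_
  split_ifs
  · exact (h.measurable_left γ).inter (h.measurable_right γ')
  · exact MeasurableSet.empty

theorem measurable_kern (h : Pairing m b b' p p' κ N) (hF : Measurable F) :
    Measurable fun q : (I → M) × E => kern μ F b b' p p' q.1 q.2 := by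
  classical
  have h1 : Measurable fun q : (I → M) × E => p' q.2 + q.1 (b' q.2) :=
    (h.measurable_p'.comp measurable_snd).add (measurable_apply_label h.measurable_right)
  have h2 : Measurable fun q : (I → M) × E => p q.2 + q.1 (b q.2) :=
    (h.measurable_p.comp measurable_snd).add (measurable_apply_label h.measurable_left)
  have h3 : Measurable fun x : E => (p' x - p x) := by
    simp_rw [sub_eq_add_neg]
    exact h.measurable_p'.add h.measurable_p.neg
  refine ((hF.comp h1).mul (measurable_conj (hF.comp h2))).sub ?_
  exact Measurable.ite (measurable_snd (h.measurableSet_pred fun γ γ' => γ = γ'))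
    (((measurable_corr hF).comp h3).comp measurable_snd) measurable_const

theorem measurable_indicator_kern (h : Pairing m b b' p p' κ N) (hF : Measurable F)
    (r : I → I → Prop) [∀ γ γ', Decidable (r γ γ')] :
    Measurable fun q : (I → M) × E => if r (b q.2) (b' q.2) then kern μ F b b' p p' q.1 q.2
      else 0 :=
  Measurable.ite (measurable_snd (h.measurableSet_pred r)) (h.measurable_kern hF)
    measurable_const

theorem norm_indicator_kern_le (hB : ∀ x, ‖F x‖ ≤ B) (r : I → I → Prop) [∀ γ γ', Decidable (r γ γ')]
    (a : I → M) (x : E) :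
    ‖if r (b x) (b' x) then kern μ F b b' p p' a x else 0‖ ≤ 2 * B ^ 2 := by
  split_ifs
  · exact norm_kern_le hB a x
  · rw [norm_zero]; positivity

theorem integrable_indicator_kern (h : Pairing m b b' p p' κ N) (hF : Measurable F)
    (hB : ∀ x, ‖F x‖ ≤ B) (r : I → I → Prop) [∀ γ γ', Decidable (r γ γ')]
    (a : I → M) :
    Integrable (fun x => if r (b x) (b' x) then kern μ F b b' p p' a x else 0) m :=
  IncrementFamily.integrable_of_norm_le
    ((h.measurable_indicator_kern hF r).comp (measurable_prodMk_left (x := a)))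
    (norm_indicator_kern_le hB r a)

theorem quad_insert_sub (h : Pairing m b b' p p' κ N) (hF : Measurable F)
    (hB : ∀ x, ‖F x‖ ≤ B) {A : Finset I} {c : I} (hc : c ∉ A) (a : I → M) :
    quad μ m F b b' p p' (insert c A) a - quad μ m F b b' p p' A a =
      ∫ x, if ((b x ∈ insert c A ∧ b' x ∈ insert c A) ∧ (b x = c ∨ b' x = c)) then
        kern μ F b b' p p' a x else 0 ∂m := by
  rw [quad, quad, ← integral_sub
    (h.integrable_indicator_kern hF hB (fun γ γ' => γ ∈ insert c A ∧ γ' ∈ insert c A) a)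
    (h.integrable_indicator_kern hF hB (fun γ γ' => γ ∈ A ∧ γ' ∈ A) a)]
  congr 1
  funext x
  by_cases h1 : b x = c <;> by_cases h2 : b' x = c <;> simp [h1, h2, hc]

/-- If both points carry the label `c`, the average over the common rotation is exactly the
correlation that `kern` subtracts. If only one does, the other factor is constant and the mean zero
of `F` annihilates the average. -/
theorem integral_kern_update (hF : Measurable F) (hB : ∀ x, ‖F x‖ ≤ B)
    (hF0 : ∫ x, F x ∂μ = 0) (a : I → M) {c : I} {x : E} (hx : b x = c ∨ b' x = c) :
    ∫ s, kern μ F b b' p p' (Function.update a c s) x ∂μ = 0 := by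
  have ht : ∀ z, ∫ s, F (z + s) ∂μ = 0 := fun z => by
    rw [integral_add_left_eq_self F z, hF0]
  by_cases h1 : b x = c <;> by_cases h2 : b' x = c
  · simp only [kern, h1, h2, Function.update_self, if_true]
    rw [integral_sub _ (integrable_const _), corr_shift]
    · simp
    · exact IncrementFamily.integrable_of_norm_le ((hF.comp (measurable_const_add _)).mul
        (measurable_conj (hF.comp (measurable_const_add _)))) fun s =>
          norm_mul_conj_le (hB _) (hB _)
  · have h3 : c ≠ b' x := fun e => h2 e.symm
    simp only [kern, h1, Function.update_self, Function.update_of_ne h2, if_neg h3, sub_zero]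
    rw [integral_const_mul]
    have : ∫ s, (starRingEnd ℂ) (F (p x + s)) ∂μ = 0 := by rw [integral_conj, ht, map_zero]
    rw [this, mul_zero]
  · have h3 : b x ≠ c := h1
    simp only [kern, h2, Function.update_self, Function.update_of_ne h1, if_neg h3, sub_zero]
    rw [integral_mul_const, ht, zero_mul]
  · exact absurd hx (by simp [h1, h2])

theorem kern_congr {a a' : I → M} {x : E} (h1 : a (b x) = a' (b x)) (h2 : a (b' x) = a' (b' x)) :
    kern μ F b b' p p' a x = kern μ F b b' p p' a' x := by
  rw [kern, kern, h1, h2]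

/-- Adding the block `c` brings in only points with a label equal to `c`. They have mass at most `2
* κ`, and the kernel is at most `2 * B ^ 2`, hence the bound `4 * B ^ 2 * κ`. The other label of
such a point is a neighbour of `c`, which gives the locality. -/
theorem incrementFamily (h : Pairing m b b' p p' κ N) (hF : Measurable F)
    (hB : ∀ x, ‖F x‖ ≤ B) (hF0 : ∫ x, F x ∂μ = 0) :
    IncrementFamily μ (quad μ m F b b' p p') (4 * B ^ 2 * κ) N where
  measurable A := ((h.measurable_indicator_kern hF
    fun γ γ' => γ ∈ A ∧ γ' ∈ A).stronglyMeasurable.integral_prod_right').measurable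
  empty a := by simp [quad]
  congr A a a' haa := by
    rw [quad, quad]
    congr 1
    funext x
    split_ifs with hx
    · exact kern_congr (haa _ hx.1) (haa _ hx.2)
    · rfl
  mean A c hc a := by
    have hmeas : Measurable fun q : M × E => if b q.2 ∈ insert c A ∧ b' q.2 ∈ insert c A then
        kern μ F b b' p p' (Function.update a c q.1) q.2 else 0 :=
      (h.measurable_indicator_kern hF fun γ γ' => γ ∈ insert c A ∧ γ' ∈ insert c A).comp
        (((measurable_update a).comp measurable_fst).prodMk measurable_snd)
    simp only [quad]
    rw [integral_integral_swap]
    · congr 1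
      funext x
      by_cases hx : b x ∈ insert c A ∧ b' x ∈ insert c A
      · simp only [hx, and_self, if_true]
        by_cases hbc : b x = c ∨ b' x = c
        · rw [integral_kern_update hF hB hF0 a hbc, if_neg]
          rintro ⟨h1, h2⟩
          rcases hbc with e | e
          · exact hc (e ▸ h1)
          · exact hc (e ▸ h2)
        · push Not at hbc
          have h1 := (Finset.mem_insert.1 hx.1).resolve_left hbc.1
          have h2 := (Finset.mem_insert.1 hx.2).resolve_left hbc.2
          rw [if_pos ⟨h1, h2⟩]
          have : ∀ s, kern μ F b b' p p' (Function.update a c s) x = kern μ F b b' p p' a x :=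
            fun s => kern_congr (Function.update_of_ne hbc.1 _ _)
              (Function.update_of_ne hbc.2 _ _)
          simp [this]
      · have hx' : ¬ (b x ∈ A ∧ b' x ∈ A) := fun h' =>
          hx ⟨Finset.mem_insert_of_mem h'.1, Finset.mem_insert_of_mem h'.2⟩
        simp only [if_neg hx, if_neg hx', integral_zero]
    · exact IncrementFamily.integrable_of_norm_le hmeas fun q =>
        norm_indicator_kern_le hB (fun γ γ' => γ ∈ insert c A ∧ γ' ∈ insert c A) _ q.2
  bound A c hc a := by
    rw [h.quad_insert_sub hF hB hc]
    have hle : ∀ x, ‖if ((b x ∈ insert c A ∧ b' x ∈ insert c A) ∧ (b x = c ∨ b' x = c)) then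
        kern μ F b b' p p' a x else 0‖ ≤ (b ⁻¹' {c}).indicator (fun _ => 2 * B ^ 2) x +
          (b' ⁻¹' {c}).indicator (fun _ => 2 * B ^ 2) x := fun x => by
      have h0 : 0 ≤ 2 * B ^ 2 := by positivity
      have hk := norm_kern_le (μ := μ) (b := b) (b' := b') (p := p) (p' := p') hB a x
      by_cases h1 : b x = c <;> by_cases h2 : b' x = c <;>
        simp only [Set.indicator, Set.mem_preimage, Set.mem_singleton_iff, h1, h2, if_true,
          if_false, or_self, or_false, or_true, and_true, and_false, norm_zero, add_zero,
          le_refl] <;> split_ifs <;> (try simp only [norm_zero]) <;> linarith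
    refine (norm_integral_le_of_norm_le (g := fun x => (b ⁻¹' {c}).indicator
      (fun _ => 2 * B ^ 2) x + (b' ⁻¹' {c}).indicator (fun _ => 2 * B ^ 2) x) ?_
      (Eventually.of_forall hle)).trans ?_
    · exact ((integrable_const _).indicator (h.measurable_left c)).add
        ((integrable_const _).indicator (h.measurable_right c))
    · rw [integral_add ((integrable_const _).indicator (h.measurable_left c))
        ((integrable_const _).indicator (h.measurable_right c)),
        integral_indicator_const _ (h.measurable_left c),
        integral_indicator_const _ (h.measurable_right c), smul_eq_mul, smul_eq_mul]
      have := h.left_le c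
      have := h.right_le c
      have : 0 ≤ B ^ 2 := sq_nonneg B
      nlinarith
  locality A c hc a a' haa := by
    rw [h.quad_insert_sub hF hB hc, h.quad_insert_sub hF hB hc]
    congr 1
    funext x
    split_ifs with hx
    · obtain ⟨-, e | e⟩ := hx
      · have := h.right_mem x
        rw [e] at this
        exact kern_congr (haa _ (by simp [e])) (haa _ (Finset.mem_insert_of_mem this))
      · have := h.left_mem x
        rw [e] at this
        exact kern_congr (haa _ (Finset.mem_insert_of_mem this)) (haa _ (by simp [e]))
    · rfl

theorem quad_univ (h : Pairing m b b' p p' κ N) (hF : Measurable F) (hB : ∀ x, ‖F x‖ ≤ B)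
    {z : M} (hz : ∀ x, p' x = z + p x) (a : I → M) :
    quad μ m F b b' p p' Finset.univ a =
      ∫ x, F (p' x + a (b' x)) * (starRingEnd ℂ) (F (p x + a (b x))) ∂m -
        m.real {x | b x = b' x} * corr μ F z := by
  classical
  have hs := h.measurableSet_pred fun γ γ' => γ = γ'
  have e : ∀ x, kern μ F b b' p p' a x =
      F (p' x + a (b' x)) * (starRingEnd ℂ) (F (p x + a (b x))) -
        {x | b x = b' x}.indicator (fun _ => corr μ F z) x := fun x => by
    simp only [kern, Set.indicator, Set.mem_ofPred_eq, hz, add_sub_cancel_right]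
  have hi : Integrable (fun x => F (p' x + a (b' x)) * (starRingEnd ℂ) (F (p x + a (b x)))) m := by
    refine IncrementFamily.integrable_of_norm_le ?_ fun x => norm_mul_conj_le (hB _) (hB _)
    have h1 : Measurable fun x => p' x + a (b' x) := h.measurable_p'.add
      ((measurable_apply_label h.measurable_right).comp (measurable_prodMk_left (x := a)))
    have h2 : Measurable fun x => p x + a (b x) := h.measurable_p.add
      ((measurable_apply_label h.measurable_left).comp (measurable_prodMk_left (x := a)))
    exact (hF.comp h1).mul (measurable_conj (hF.comp h2))
  simp only [quad, Finset.mem_univ, and_self, if_true, e]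
  rw [integral_sub hi ((integrable_const _).indicator hs), integral_indicator_const _ hs]
  simp

/-- Covariances of the kernel at two points. For equal pairs of labels, averaging over the second
rotation and then over the first gives a correlation times its conjugate. For different pairs some
label of `x` is not a label of `x'`, and averaging over its rotation gives zero. Swapped pairs would
leave another nonzero covariance, which is why `hswap` is imposed. -/
theorem integral_kern_mul_conj (hF : Measurable F) (hB : ∀ x, ‖F x‖ ≤ B)
    (hF0 : ∫ x, F x ∂μ = 0) (h : Pairing m b b' p p' κ N)
    {z : M} (hz : ∀ x, p' x = z + p x) (hdiag : ∀ x, b x ≠ b' x)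
    (hswap : ∀ x x', ¬ (b x = b' x' ∧ b' x = b x')) (x x' : E) :
    ∫ a, kern μ F b b' p p' a x * (starRingEnd ℂ) (kern μ F b b' p p' a x')
      ∂(Measure.infinitePi fun _ : I => μ) =
    if b x = b x' ∧ b' x = b' x' then ((‖corr μ F (p x - p x')‖ ^ 2 : ℝ) : ℂ) else 0 := by
  set Pr := Measure.infinitePi fun _ : I => μ
  have hk : ∀ y, Measurable fun a : I → M => kern μ F b b' p p' a y := fun y =>
    (h.measurable_kern hF).comp (measurable_prodMk_right (y := y))
  have hint : Integrable (fun a => kern μ F b b' p p' a x *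
      (starRingEnd ℂ) (kern μ F b b' p p' a x')) Pr :=
    IncrementFamily.integrable_of_norm_le ((hk x).mul (measurable_conj (hk x'))) fun a =>
      norm_mul_conj_le (norm_kern_le hB a x) (norm_kern_le hB a x')
  split_ifs with hs
  · obtain ⟨e1, e2⟩ := hs
    have hdx : b' x' ≠ b x' := (hdiag x').symm
    rw [integral_update _ (b' x') hint]
    have inner : ∀ a : I → M, ∫ s, kern μ F b b' p p' (Function.update a (b' x') s) x *
        (starRingEnd ℂ) (kern μ F b b' p p' (Function.update a (b' x') s) x') ∂μ =
        corr μ F (p x - p x') * (starRingEnd ℂ) (F (p x + a (b x')) *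
          (starRingEnd ℂ) (F (p x' + a (b x')))) := fun a => by
      simp only [kern, e1, e2, if_neg (hdiag x'), Function.update_self,
        Function.update_of_ne (hdiag x'), sub_zero, hz, map_mul, Complex.conj_conj]
      rw [show p x - p x' = (z + p x) - (z + p x') by abel, ← corr_shift,
        ← integral_mul_const]
      congr 1
      funext s
      ring
    simp_rw [inner]
    rw [integral_const_mul, integral_conj]
    have hev := measurePreserving_eval_infinitePi (fun _ : I => μ) (b x')
    have e3 : ∫ a, F (p x + a (b x')) * (starRingEnd ℂ) (F (p x' + a (b x'))) ∂Pr =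
        corr μ F (p x - p x') := by
      rw [← corr_shift]
      have hm : Measurable fun s => F (p x + s) * (starRingEnd ℂ) (F (p x' + s)) :=
        (hF.comp (measurable_const_add _)).mul
          (measurable_conj (hF.comp (measurable_const_add _)))
      have := integral_map (μ := Pr) hev.measurable.aemeasurable
        (f := fun s => F (p x + s) * (starRingEnd ℂ) (F (p x' + s))) hm.aestronglyMeasurable
      rw [hev.map_eq] at this
      exact this.symm
    rw [e3, Complex.mul_conj, Complex.normSq_eq_norm_sq]
  -- If every label of `x` were a label of `x'`, then, the two labels of each point being distinct,
  -- the pairs would be equal or swapped; both cases are excluded.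
  · have hv : ∃ c, (b x = c ∨ b' x = c) ∧ b x' ≠ c ∧ b' x' ≠ c := by
      by_contra hcon
      push Not at hcon
      have h1 := hcon (b x) (Or.inl rfl)
      have h2 := hcon (b' x) (Or.inr rfl)
      by_cases h3 : b x' = b x
      · by_cases h4 : b x' = b' x
        · exact hdiag x (h3.symm.trans h4)
        · exact hs ⟨h3.symm, (h2 h4).symm⟩
      · by_cases h4 : b x' = b' x
        · exact hswap x x' ⟨(h1 h3).symm, h4.symm⟩
        · exact hdiag x ((h1 h3).symm.trans (h2 h4))
    obtain ⟨c, hc, h1, h2⟩ := hv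
    rw [integral_update _ c hint]
    have inner : ∀ a : I → M, ∫ s, kern μ F b b' p p' (Function.update a c s) x *
        (starRingEnd ℂ) (kern μ F b b' p p' (Function.update a c s) x') ∂μ = 0 := fun a => by
      have : ∀ s, kern μ F b b' p p' (Function.update a c s) x' = kern μ F b b' p p' a x' :=
        fun s => kern_congr (Function.update_of_ne h1 _ _) (Function.update_of_ne h2 _ _)
      simp_rw [this]
      rw [integral_mul_const, integral_kern_update hF hB hF0 a hc, zero_mul]
    simp_rw [inner]
    simp

/-- The second moment is the double integral of the covariance `K`, which is nonnegative. On pairs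
of points with a common label `l` it is at least `σ ^ 2`, and by the Cauchy–Schwarz inequality a
partition into `J` classes has a sum of squared masses of at least `1 / card J`. -/
theorem le_secondMoment_quad (hF : Measurable F) (hB : ∀ x, ‖F x‖ ≤ B)
    (hF0 : ∫ x, F x ∂μ = 0) (h : Pairing m b b' p p' κ N)
    {z : M} (hz : ∀ x, p' x = z + p x) (hdiag : ∀ x, b x ≠ b' x)
    (hswap : ∀ x x', ¬ (b x = b' x' ∧ b' x = b x')) {J : Type*} [Fintype J] {l : E → J}
    (hl : ∀ j, MeasurableSet (l ⁻¹' {j})) {σ : ℝ} (hσ : 0 ≤ σ)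
    (hls : ∀ x x', l x = l x' → b x = b x' ∧ b' x = b' x' ∧ σ ≤ ‖corr μ F (p x - p x')‖) :
    σ ^ 2 / Fintype.card J ≤
      IncrementFamily.secondMoment μ (quad μ m F b b' p p') Finset.univ := by
  set Pr := Measure.infinitePi fun _ : I => μ
  have hkm := h.measurable_kern (μ := μ) hF
  have hG : Measurable fun q : (I → M) × (E × E) => kern μ F b b' p p' q.1 q.2.1 *
      (starRingEnd ℂ) (kern μ F b b' p p' q.1 q.2.2) :=
    (hkm.comp (measurable_fst.prodMk (measurable_fst.comp measurable_snd))).mul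
      (measurable_conj (hkm.comp (measurable_fst.prodMk (measurable_snd.comp measurable_snd))))
  have hGi : Integrable (fun q : (I → M) × (E × E) => kern μ F b b' p p' q.1 q.2.1 *
      (starRingEnd ℂ) (kern μ F b b' p p' q.1 q.2.2)) (Pr.prod (m.prod m)) :=
    IncrementFamily.integrable_of_norm_le hG fun q =>
      norm_mul_conj_le (norm_kern_le hB q.1 q.2.1) (norm_kern_le hB q.1 q.2.2)
  set K : E × E → ℝ := fun q => if b q.1 = b q.2 ∧ b' q.1 = b' q.2 then
    ‖corr μ F (p q.1 - p q.2)‖ ^ 2 else 0 with hK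
  have hKe : ∀ q : E × E, ∫ a, kern μ F b b' p p' a q.1 *
      (starRingEnd ℂ) (kern μ F b b' p p' a q.2) ∂Pr = ((K q : ℝ) : ℂ) := fun q => by
    rw [integral_kern_mul_conj hF hB hF0 h hz hdiag hswap]
    simp only [hK]
    split_ifs <;> simp
  have e1 : ((IncrementFamily.secondMoment μ (quad μ m F b b' p p') Finset.univ : ℝ) : ℂ) =
      ((∫ q, K q ∂(m.prod m) : ℝ) : ℂ) := by
    calc _ = ∫ a, quad μ m F b b' p p' Finset.univ a *
          (starRingEnd ℂ) (quad μ m F b b' p p' Finset.univ a) ∂Pr := by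
          rw [IncrementFamily.secondMoment, ← integral_complex_ofReal]
          simp_rw [Complex.mul_conj, Complex.normSq_eq_norm_sq]
          rfl
      _ = ∫ a, ∫ q : E × E, kern μ F b b' p p' a q.1 *
          (starRingEnd ℂ) (kern μ F b b' p p' a q.2) ∂(m.prod m) ∂Pr := by
          congr 1
          funext a
          rw [integral_prod_mul (fun x => kern μ F b b' p p' a x)
            (fun x => (starRingEnd ℂ) (kern μ F b b' p p' a x)), integral_conj]
          simp [quad]
      _ = ∫ q : E × E, ∫ a, kern μ F b b' p p' a q.1 *
          (starRingEnd ℂ) (kern μ F b b' p p' a q.2) ∂Pr ∂(m.prod m) :=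
          integral_integral_swap hGi
      _ = _ := by
          simp_rw [hKe]
          exact integral_complex_ofReal
  have e2 : IncrementFamily.secondMoment μ (quad μ m F b b' p p') Finset.univ =
      ∫ q, K q ∂(m.prod m) := by exact_mod_cast e1
  have hKi : Integrable K (m.prod m) := by
    have h1 : Integrable (fun q => ((K q : ℝ) : ℂ)) (m.prod m) := by
      simp_rw [← hKe]
      exact hGi.integral_prod_right
    exact h1.re
  have hind : ∀ j, Integrable (fun q : E × E => (l ⁻¹' {j}).indicator (fun _ => (1 : ℝ)) q.1 *
      (l ⁻¹' {j}).indicator (fun _ => (1 : ℝ)) q.2) (m.prod m) := fun j =>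
    Integrable.mul_prod ((integrable_const _).indicator (hl j))
      ((integrable_const _).indicator (hl j))
  have hpt : ∀ q : E × E, σ ^ 2 * ∑ j, (l ⁻¹' {j}).indicator (fun _ => (1 : ℝ)) q.1 *
      (l ⁻¹' {j}).indicator (fun _ => (1 : ℝ)) q.2 ≤ K q := fun q => by
    rw [Finset.sum_eq_single (l q.1)]
    · by_cases hq : l q.1 = l q.2
      · obtain ⟨h1, h2, h3⟩ := hls q.1 q.2 hq
        simp only [hK, h1, h2, and_self, if_true]
        rw [Set.indicator_of_mem (by simp), Set.indicator_of_mem (by simp [hq])]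
        simpa using pow_le_pow_left₀ hσ h3 2
      · rw [Set.indicator_of_notMem (s := l ⁻¹' {l q.1}) (a := q.2)
          (fun e => hq (Set.mem_singleton_iff.1 e).symm)]
        simp only [mul_zero, hK]
        split_ifs <;> positivity
    · intro j _ hj
      rw [Set.indicator_of_notMem (s := l ⁻¹' {j}) (a := q.1)
        (fun e => hj (Set.mem_singleton_iff.1 e).symm), zero_mul]
    · simp
  have hsum : ∑ j, m.real (l ⁻¹' {j}) = 1 := by
    have h1 : (⋃ j ∈ (Finset.univ : Finset J), l ⁻¹' {j}) = Set.univ := by ext; simp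
    rw [← measureReal_biUnion_finset (fun i _ j _ hij => ?_) (fun j _ => hl j), h1]
    · simp
    · exact Set.disjoint_left.2 fun x hx hx' => hij (hx.symm.trans hx')
  have hcs := sq_sum_le_card_mul_sum_sq (s := (Finset.univ : Finset J))
    (f := fun j => m.real (l ⁻¹' {j}))
  rw [hsum, one_pow, Finset.card_univ] at hcs
  have hJ : (0 : ℝ) < Fintype.card J := by
    rcases Nat.eq_zero_or_pos (Fintype.card J) with h0 | h0
    · rw [h0] at hcs; norm_num at hcs
    · exact_mod_cast h0
  calc σ ^ 2 / Fintype.card J ≤ σ ^ 2 * ∑ j, m.real (l ⁻¹' {j}) ^ 2 := by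
        rw [div_le_iff₀ hJ, mul_assoc]
        refine le_mul_of_one_le_right (sq_nonneg σ) ?_
        rw [mul_comm]; exact hcs
    _ = ∫ q : E × E, σ ^ 2 * ∑ j, (l ⁻¹' {j}).indicator (fun _ => (1 : ℝ)) q.1 *
      (l ⁻¹' {j}).indicator (fun _ => (1 : ℝ)) q.2 ∂(m.prod m) := by
        rw [integral_const_mul, integral_finsetSum _ fun j _ => hind j]
        congr 1
        refine Finset.sum_congr rfl fun j _ => ?_
        rw [integral_prod_mul (fun x => (l ⁻¹' {j}).indicator (fun _ => (1 : ℝ)) x)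
          (fun x => (l ⁻¹' {j}).indicator (fun _ => (1 : ℝ)) x),
          integral_indicator_const _ (hl j)]
        simp [sq]
    _ ≤ ∫ q, K q ∂(m.prod m) :=
        integral_mono ((integrable_finsetSum _ fun j _ => hind j).const_mul _) hKi hpt
    _ = _ := e2.symm

end Pairing
end Glued

end Iceberg

namespace Iceberg

/-! ### Geometry of the quotients -/

/-- The side length `h n` as a real number. -/
def lenR (h₁ : ℕ+) (q : ℕ → ℕ+) (n : ℕ) : ℝ := ((side h₁ q n : ℕ) : ℝ)

theorem lenR_pos (h₁ : ℕ+) (q : ℕ → ℕ+) (n : ℕ) : 0 < lenR h₁ q n := by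
  unfold lenR; exact_mod_cast (side h₁ q n).pos

theorem one_le_lenR (h₁ : ℕ+) (q : ℕ → ℕ+) (n : ℕ) : 1 ≤ lenR h₁ q n := by
  unfold lenR; exact_mod_cast (side h₁ q n).pos

theorem lenR_succ (h₁ : ℕ+) (q : ℕ → ℕ+) (n : ℕ) :
    lenR h₁ q (n + 1) = (q n : ℕ) * lenR h₁ q n := by
  simp [lenR, side]

section Geometry

variable {K : Type*} [CommRing K] [LinearOrder K] [IsStrictOrderedRing K] [Archimedean K]
  {d : ℕ} {h₁ : ℕ+} {q : ℕ → ℕ+}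

theorem map_len (e : K →+* ℝ) (n : ℕ) : e (len K h₁ q n) = lenR h₁ q n := by
  simp [len, lenR]

theorem corner_lattice_add {n : ℕ} (γ : lattice K d h₁ q n) (v : Fin d → K) :
    corner K d h₁ q n ((γ : Fin d → K) + v) = γ + corner K d h₁ q n v := by
  have h := corner_add K d h₁ q (γ + corner K d h₁ q n v) (sub_corner_mem_cube K d h₁ q n v)
  rw [← h]
  congr 1
  push_cast
  abel

theorem corner_of_mem_cube {n : ℕ} {u : Fin d → K} (hu : u ∈ cube K d h₁ q n) :
    corner K d h₁ q n u = 0 := by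
  simpa using corner_add K d h₁ q (0 : lattice K d h₁ q n) hu

/-- The representative of a point of `M n` in the fundamental cube. -/
def rep (n : ℕ) : Space K d h₁ q n → (Fin d → K) :=
  Quotient.lift (fun a => a - (corner K d h₁ q n a : Fin d → K)) (by
    intro a b hab
    have hab' : -a + b ∈ lattice K d h₁ q n := QuotientAddGroup.leftRel_apply.1 hab
    have hb : b = ((⟨-a + b, hab'⟩ : lattice K d h₁ q n) : Fin d → K) + a := by simp
    rw [hb, corner_lattice_add]
    push_cast
    abel)

theorem rep_mk (n : ℕ) (a : Fin d → K) :
    rep n (QuotientAddGroup.mk a : Space K d h₁ q n) = a - (corner K d h₁ q n a : Fin d → K) := rfl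

theorem rep_mk_of_mem {n : ℕ} {u : Fin d → K} (hu : u ∈ cube K d h₁ q n) :
    rep n (QuotientAddGroup.mk u : Space K d h₁ q n) = u := by
  rw [rep_mk, corner_of_mem_cube hu]; simp

theorem mk_rep {n : ℕ} (x : Space K d h₁ q n) : QuotientAddGroup.mk (rep n x) = x := by
  induction x using QuotientAddGroup.induction_on with
  | H a =>
    rw [rep_mk]
    refine QuotientAddGroup.eq.2 ?_
    have : -(a - (corner K d h₁ q n a : Fin d → K)) + a = corner K d h₁ q n a := by abel
    rw [this]; exact (corner K d h₁ q n a).2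

theorem rep_mem {n : ℕ} (x : Space K d h₁ q n) : rep n x ∈ cube K d h₁ q n := by
  induction x using QuotientAddGroup.induction_on with
  | H a => exact sub_corner_mem_cube K d h₁ q n a

theorem block_mk (n : ℕ) (a : Fin d → K) :
    block K d h₁ q n (QuotientAddGroup.mk a) = QuotientAddGroup.mk (corner K d h₁ q n a) := rfl

theorem proj_mk (n : ℕ) (a : Fin d → K) :
    proj K d h₁ q n (QuotientAddGroup.mk a) = QuotientAddGroup.mk a := rfl

theorem mk_lattice {n : ℕ} (γ : lattice K d h₁ q n) :
    (QuotientAddGroup.mk (γ : Fin d → K) : Space K d h₁ q n) = 0 :=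
  (QuotientAddGroup.eq_zero_iff _).2 γ.2

theorem block_lattice_add {n : ℕ} (γ : lattice K d h₁ q n) (x : Space K d h₁ q (n + 1)) :
    block K d h₁ q n (QuotientAddGroup.mk (γ : Fin d → K) + x) =
      QuotientAddGroup.mk γ + block K d h₁ q n x := by
  induction x using QuotientAddGroup.induction_on with
  | H a =>
    rw [← QuotientAddGroup.mk_add, block_mk, block_mk, corner_lattice_add, QuotientAddGroup.mk_add]

theorem rep_proj (n : ℕ) (x : Space K d h₁ q (n + 1)) :
    rep n (proj K d h₁ q n x) = rep (n + 1) x - corner K d h₁ q n (rep (n + 1) x) := by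
  conv_lhs => rw [← mk_rep x, proj_mk, rep_mk]

/-- The displacement of the block of a point `x` of `M (n + 1)` under the translation by `t` depends
only on the projection of `x`. -/
theorem block_translate (n : ℕ) (t : Fin d → K) (x : Space K d h₁ q (n + 1)) :
    block K d h₁ q n (QuotientAddGroup.mk t + x) =
      QuotientAddGroup.mk (corner K d h₁ q n (t + rep n (proj K d h₁ q n x))) +
        block K d h₁ q n x := by
  rw [rep_proj]
  have hx := mk_rep x
  generalize rep (n + 1) x = r at hx ⊢
  rw [← hx, ← QuotientAddGroup.mk_add, block_mk, block_mk, ← QuotientAddGroup.mk_add]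
  congr 1
  have h := corner_lattice_add (corner K d h₁ q n r) (t + (r - (corner K d h₁ q n r : Fin d → K)))
  rw [add_comm (corner K d h₁ q n (t + _)), ← h]
  congr 1
  abel

theorem cube_subset_cube (n : ℕ) : cube K d h₁ q n ⊆ cube K d h₁ q (n + 1) := by
  intro u hu i
  refine ⟨(hu i).1, (hu i).2.trans_le ?_⟩
  rw [len_succ, zsmul_eq_mul]
  have h0 := len_pos K h₁ q n
  have : (1 : K) ≤ (((q n : ℕ) : ℤ) : K) := by exact_mod_cast (q n).pos
  nlinarith

theorem block_eq_zero_iff {n : ℕ} {u : Fin d → K} (hu : u ∈ cube K d h₁ q (n + 1)) :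
    block K d h₁ q n (QuotientAddGroup.mk u) = 0 ↔ u ∈ cube K d h₁ q n := by
  constructor
  · intro h
    rw [block_mk, QuotientAddGroup.eq_zero_iff, AddSubgroup.mem_addSubgroupOf] at h
    have hc : u - (corner K d h₁ q n u : Fin d → K) ∈ cube K d h₁ q n :=
      sub_corner_mem_cube K d h₁ q n u
    have h2 := corner_add K d h₁ q (⟨_, h⟩ : lattice K d h₁ q (n + 1)) (cube_subset_cube n hc)
    simp only [add_sub_cancel, corner_of_mem_cube hu] at h2
    have h3 : (corner K d h₁ q n u : Fin d → K) = 0 := by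
      have := congrArg Subtype.val h2
      simpa using this.symm
    rwa [h3, sub_zero] at hc
  · intro h
    rw [block_mk, corner_of_mem_cube h]; rfl

instance (n : ℕ) : Finite (Block K d h₁ q n) := by
  let f : (Fin d → Fin (q n)) → Block K d h₁ q n := fun k =>
    QuotientAddGroup.mk ⟨fun i => (((k i : ℕ) : ℤ)) • len K h₁ q n, by
      rw [mem_lattice]; exact fun i => ⟨_, rfl⟩⟩
  refine Finite.of_surjective f fun c => ?_
  induction c using QuotientAddGroup.induction_on with
  | H γ =>
    choose k hk using (mem_lattice K d h₁ q).1 γ.2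
    have hq : (0 : ℤ) < ((q n : ℕ) : ℤ) := by exact_mod_cast (q n).pos
    refine ⟨fun i => ⟨(k i % ((q n : ℕ) : ℤ)).toNat, ?_⟩, ?_⟩
    · have := Int.emod_lt_of_pos (k i) hq
      have := Int.emod_nonneg (k i) hq.ne'
      omega
    · refine QuotientAddGroup.eq.2 ?_
      rw [AddSubgroup.mem_addSubgroupOf, mem_lattice]
      intro i
      refine ⟨k i / ((q n : ℕ) : ℤ), ?_⟩
      have h1 := Int.emod_nonneg (k i) hq.ne'
      change _ = -((((k i % ((q n : ℕ) : ℤ)).toNat : ℕ) : ℤ) • len K h₁ q n) +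
        (γ : Fin d → K) i
      rw [Int.toNat_of_nonneg h1, ← hk i, len_succ, ← mul_smul, ← neg_smul, ← add_smul]
      congr 1
      have := Int.emod_add_mul_ediv (k i) ((q n : ℕ) : ℤ)
      linarith

instance (n : ℕ) : Fintype (Block K d h₁ q n) := Fintype.ofFinite _

instance (n : ℕ) : DecidableEq (Block K d h₁ q n) := Classical.decEq _

instance (n : ℕ) : Countable (lattice K d h₁ q n) := by
  refine Function.Surjective.countable (α := Fin d → ℤ)
    (f := fun k => ⟨fun i => k i • len K h₁ q n, by
      rw [mem_lattice]; exact fun i => ⟨_, rfl⟩⟩) fun γ => ?_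
  choose k hk using (mem_lattice K d h₁ q).1 γ.2
  exact ⟨k, Subtype.ext (funext hk)⟩

/-! ### Measurability -/

variable [MeasurableSpace K] [MeasurableAdd₂ K] [MeasurableNeg K]

theorem measurable_mk (n : ℕ) :
    Measurable (QuotientAddGroup.mk : (Fin d → K) → Space K d h₁ q n) :=
  measurable_quotient_mk''

/-- The properties of the groups `ℤ ^ d` and `ℝ ^ d` with their Haar measures that matter for
the geometry of the quotients. -/
structure IsStandard (e : K →+* ℝ) (ν : Measure (Fin d → K)) : Prop where
  strictMono : StrictMono e
  measurable : Measurable e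
  box : ∀ a b : Fin d → K, (∀ i, a i ≤ b i) →
    ν (Set.univ.pi fun i => Set.Ico (a i) (b i)) = ∏ i, ENNReal.ofReal (e (b i) - e (a i))

/-- Transports the block index to the real floor function, so that measurability and estimates for
`ℤ` and `ℝ` are obtained together through `e`. -/
theorem toIcoDiv_eq_floor {e : K →+* ℝ} (he : StrictMono e) {p : K} (hp : 0 < p) (x : K) :
    toIcoDiv hp 0 x = ⌊e x / e p⌋ := by
  have hp' : 0 < e p := by simpa using he hp
  refine toIcoDiv_eq_of_sub_zsmul_mem_Ico _ ⟨?_, ?_⟩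
  · rw [← he.le_iff_le, map_zero, map_sub, map_zsmul, zsmul_eq_mul, sub_nonneg]
    exact (le_div_iff₀ hp').1 (Int.floor_le _)
  · rw [zero_add, ← he.lt_iff_lt, map_sub, map_zsmul, zsmul_eq_mul, sub_lt_iff_lt_add]
    have := (div_lt_iff₀ hp').1 (Int.lt_floor_add_one (e x / e p))
    linarith

namespace IsStandard

variable {e : K →+* ℝ} {ν : Measure (Fin d → K)} (hS : IsStandard e ν)
include hS

theorem measurable_corner (n : ℕ) :
    Measurable fun a : Fin d → K => (corner K d h₁ q n a : Fin d → K) := by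
  refine measurable_pi_iff.2 fun i => ?_
  have : (fun a : Fin d → K => (corner K d h₁ q n a : Fin d → K) i) =
      (fun k : ℤ => k • len K h₁ q n) ∘ (fun x : ℝ => ⌊x / e (len K h₁ q n)⌋) ∘ e ∘
        (fun a : Fin d → K => a i) := by
    ext a
    simp only [Function.comp_apply, ← toIcoDiv_eq_floor hS.strictMono (len_pos K h₁ q n)]
    rfl
  rw [this]
  exact (Measurable.of_discrete).comp (((measurable_id.div_const _).floor).comp
    (hS.measurable.comp (measurable_pi_apply i)))

theorem measurable_rep (n : ℕ) : Measurable (rep n : Space K d h₁ q n → (Fin d → K)) := by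
  refine measurable_from_quotient.2 ?_
  change Measurable fun a : Fin d → K => a - (corner K d h₁ q n a : Fin d → K)
  simp_rw [sub_eq_add_neg]
  exact measurable_id.add (hS.measurable_corner n).neg

theorem measurableAdd₂ (n : ℕ) : MeasurableAdd₂ (Space K d h₁ q n) := by
  refine ⟨?_⟩
  have : (fun p : Space K d h₁ q n × Space K d h₁ q n => p.1 + p.2) =
      fun p => QuotientAddGroup.mk (rep n p.1 + rep n p.2) := by
    ext p
    rw [QuotientAddGroup.mk_add, mk_rep, mk_rep]
  rw [this]
  exact (measurable_mk n).comp (((hS.measurable_rep n).comp measurable_fst).add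
    ((hS.measurable_rep n).comp measurable_snd))

theorem measurableNeg (n : ℕ) : MeasurableNeg (Space K d h₁ q n) := by
  refine ⟨measurable_from_quotient.2 ?_⟩
  exact (measurable_mk n).comp measurable_neg

theorem measurable_proj (n : ℕ) : Measurable (proj K d h₁ q n) :=
  measurable_from_quotient.2 (measurable_mk n)

/-- No measurability of `f` or `s` is needed: the corner factors through the vector of floors, which
takes values in the countable discrete space `Fin d → ℤ`. -/
theorem measurableSet_corner (n : ℕ) {X : Type*} (f : lattice K d h₁ q n → X) (s : Set X) :
    MeasurableSet {a : Fin d → K | f (corner K d h₁ q n a) ∈ s} := by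
  have hm : Measurable fun a : Fin d → K => fun i => ⌊e (a i) / e (len K h₁ q n)⌋ :=
    measurable_pi_iff.2 fun i => ((measurable_id.div_const _).floor).comp
      (hS.measurable.comp (measurable_pi_apply i))
  have e1 : ∀ a : Fin d → K, corner K d h₁ q n a =
      (fun k : Fin d → ℤ => (⟨fun i => k i • len K h₁ q n, by
        rw [mem_lattice]; exact fun i => ⟨_, rfl⟩⟩ : lattice K d h₁ q n))
        (fun i => ⌊e (a i) / e (len K h₁ q n)⌋) := fun a => by
    ext i
    simp only [← toIcoDiv_eq_floor hS.strictMono (len_pos K h₁ q n)]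
    rfl
  simp_rw [e1]
  exact hm (MeasurableSet.of_discrete (s := {k : Fin d → ℤ | f ⟨fun i => k i • len K h₁ q n, by
    rw [mem_lattice]; exact fun i => ⟨_, rfl⟩⟩ ∈ s}))

theorem measurableSet_block (n : ℕ) (c : Block K d h₁ q n) :
    MeasurableSet (block K d h₁ q n ⁻¹' {c}) :=
  measurableSet_quotient.2 (hS.measurableSet_corner n (fun γ => (QuotientAddGroup.mk γ :
    Block K d h₁ q n)) {c})

/-- The measure of a set of labels under a measurable labelling. -/
theorem measurable_block_comp (n : ℕ) {X : Type*} [MeasurableSpace X]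
    (f : Block K d h₁ q n → X) : Measurable fun x => f (block K d h₁ q n x) := by
  intro s _
  have : (fun x => f (block K d h₁ q n x)) ⁻¹' s = ⋃ c ∈ f ⁻¹' s, block K d h₁ q n ⁻¹' {c} := by
    ext x; simp
  rw [this]
  exact MeasurableSet.biUnion (Set.to_countable _) fun c _ => hS.measurableSet_block n c

theorem measurable_glue (α : Rotations K d h₁ q) (n : ℕ) : Measurable (glue α n) := by
  have := hS.measurableAdd₂ (h₁ := h₁) (q := q) n
  exact (hS.measurable_proj n).add (hS.measurable_block_comp n (α n))

/-! ### The invariant measures -/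

theorem cube_eq_pi (n : ℕ) : cube K d h₁ q n = Set.univ.pi fun _ => Set.Ico 0 (len K h₁ q n) := by
  ext u; simp [cube]

theorem measurableSet_Ico (a b : K) : MeasurableSet (Set.Ico a b) := by
  have : Set.Ico a b = e ⁻¹' Set.Ico (e a) (e b) := by
    ext x; simp [hS.strictMono.le_iff_le, hS.strictMono.lt_iff_lt]
  rw [this]
  exact hS.measurable _root_.measurableSet_Ico

theorem measurableSet_cube (n : ℕ) : MeasurableSet (cube K d h₁ q n) := by
  rw [hS.cube_eq_pi]
  exact MeasurableSet.univ_pi fun _ => hS.measurableSet_Ico _ _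

theorem measure_cube (n : ℕ) : ν (cube K d h₁ q n) = ENNReal.ofReal (lenR h₁ q n ^ d) := by
  rw [hS.cube_eq_pi, hS.box _ _ fun _ => (len_pos K h₁ q n).le]
  simp [map_len, ENNReal.ofReal_pow (lenR_pos h₁ q n).le]

theorem measure_cube_ne_zero (n : ℕ) : ν (cube K d h₁ q n) ≠ 0 := by
  rw [hS.measure_cube]
  simpa using pow_pos (lenR_pos h₁ q n) d

theorem measure_cube_ne_top (n : ℕ) : ν (cube K d h₁ q n) ≠ ⊤ := by
  rw [hS.measure_cube]; exact ENNReal.ofReal_ne_top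

theorem isProbabilityMeasure_uniform (n : ℕ) : IsProbabilityMeasure (uniform K d h₁ q ν n) := by
  have := cond_isProbabilityMeasure_of_finite (μ := ν) 
    (hS.measure_cube_ne_zero (h₁ := h₁) (q := q) n)
    (hS.measure_cube_ne_top (h₁ := h₁) (q := q) n)
  exact Measure.isProbabilityMeasure_map (measurable_mk n).aemeasurable

theorem lintegral_uniform (n : ℕ) {f : Space K d h₁ q n → ℝ≥0∞} (hf : Measurable f) :
    ∫⁻ x, f x ∂(uniform K d h₁ q ν n) =
      (ν (cube K d h₁ q n))⁻¹ * ∫⁻ u in cube K d h₁ q n, f (QuotientAddGroup.mk u) ∂ν := by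
  rw [uniform, lintegral_map hf (measurable_mk n), ProbabilityTheory.cond, lintegral_smul_measure,
    smul_eq_mul]

variable [ν.IsAddLeftInvariant]

/-- Stated for all translates of the cube: invariance of `uniform` compares the cube with its
translates, and the `L ^ p` bound needs cubes that exhaust the whole group. -/
theorem isAddFundamentalDomain_cube (n : ℕ) (t : Fin d → K) :
    IsAddFundamentalDomain (lattice K d h₁ q n) {u | t + u ∈ cube K d h₁ q n} ν := by
  refine IsAddFundamentalDomain.mk' ?_ fun x => ?_
  · exact (measurable_const_add t
      (hS.measurableSet_cube (h₁ := h₁) (q := q) n)).nullMeasurableSet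
  · refine ⟨-corner K d h₁ q n (t + x), ?_, fun γ hγ => ?_⟩
    · have := sub_corner_mem_cube K d h₁ q n (t + x)
      change t + ((-corner K d h₁ q n (t + x) : lattice K d h₁ q n) + x) ∈ cube K d h₁ q n
      convert this using 1
      push_cast
      abel
    · have h1 : t + ((γ : Fin d → K) + x) ∈ cube K d h₁ q n := hγ
      have h2 := corner_of_mem_cube h1
      rw [show t + ((γ : Fin d → K) + x) = γ + (t + x) by abel, corner_lattice_add] at h2
      exact eq_neg_of_add_eq_zero_left h2

theorem setLIntegral_cube_translate (n : ℕ) (t : Fin d → K) (f : Space K d h₁ q n → ℝ≥0∞) :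
    ∫⁻ u in {u | t + u ∈ cube K d h₁ q n}, f (QuotientAddGroup.mk u) ∂ν =
      ∫⁻ u in cube K d h₁ q n, f (QuotientAddGroup.mk u) ∂ν := by
  have h1 := hS.isAddFundamentalDomain_cube (h₁ := h₁) (q := q) n t
  have h2 := hS.isAddFundamentalDomain_cube (h₁ := h₁) (q := q) n 0
  simp only [zero_add] at h2
  refine h1.setLIntegral_eq h2 _ fun γ x => ?_
  change f (QuotientAddGroup.mk ((γ : Fin d → K) + x)) = _
  rw [QuotientAddGroup.mk_add, mk_lattice, zero_add]

theorem isAddLeftInvariant_uniform (n : ℕ) :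
    (uniform K d h₁ q ν n).IsAddLeftInvariant := by
  have := hS.measurableAdd₂ (h₁ := h₁) (q := q) n
  refine ⟨fun g => ?_⟩
  ext A hA
  obtain ⟨t, rfl⟩ := QuotientAddGroup.mk_surjective g
  have hA' := measurable_const_add (QuotientAddGroup.mk t : Space K d h₁ q n) hA
  rw [Measure.map_apply (measurable_const_add _) hA, ← lintegral_indicator_one hA,
    ← lintegral_indicator_one hA', hS.lintegral_uniform n (measurable_one.indicator hA),
    hS.lintegral_uniform n (measurable_one.indicator hA')]
  congr 1
  have hc : MeasurableSet {u | t + u ∈ cube K d h₁ q n} :=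
    measurable_const_add t (hS.measurableSet_cube n)
  rw [← hS.setLIntegral_cube_translate n t, ← lintegral_indicator (hS.measurableSet_cube n),
    ← lintegral_indicator hc, ← lintegral_add_left_eq_self
      ((cube K d h₁ q n).indicator fun u => A.indicator 1 (QuotientAddGroup.mk u)) t]
  rfl

end IsStandard

end Geometry

end Iceberg

namespace Iceberg

/-! ### Integration over blocks, gluing, and the probability of staying in a block. -/

section Blocks

variable {K : Type*} [CommRing K] [LinearOrder K] [IsStrictOrderedRing K] [Archimedean K]
  {d : ℕ} {h₁ : ℕ+} {q : ℕ → ℕ+}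

/-- The gluing map given by the rotations `a` of the blocks. -/
def glueWith (n : ℕ) (a : Block K d h₁ q n → Space K d h₁ q n) (x : Space K d h₁ q (n + 1)) :
    Space K d h₁ q n :=
  proj K d h₁ q n x + a (block K d h₁ q n x)

theorem glue_eq (α : Rotations K d h₁ q) (n : ℕ) : glue α n = glueWith n (α n) := rfl

variable [MeasurableSpace K] [MeasurableAdd₂ K] [MeasurableNeg K]

/-- The probability that a point of `M (n + 1)` stays in its block under the translation by `z`. -/
def stay (ν : Measure (Fin d → K)) (n : ℕ) (z : Space K d h₁ q (n + 1)) : ℝ :=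
  (uniform K d h₁ q ν (n + 1)).real {x | block K d h₁ q n (z + x) = block K d h₁ q n x}

namespace IsStandard

variable {e : K →+* ℝ} {ν : Measure (Fin d → K)} (hS : IsStandard e ν)
include hS

theorem measure_cube_succ (n : ℕ) :
    ν (cube K d h₁ q (n + 1)) = ((q n : ℕ) : ℝ≥0∞) ^ d * ν (cube K d h₁ q n) := by
  rw [hS.measure_cube, hS.measure_cube, lenR_succ, mul_pow, ENNReal.ofReal_mul (by positivity),
    ENNReal.ofReal_pow (by positivity), ENNReal.ofReal_natCast]

theorem q_pow_ne_zero (n : ℕ) : ((q n : ℕ) : ℝ≥0∞) ^ d ≠ 0 :=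
  pow_ne_zero _ (by exact_mod_cast (q n).pos.ne')

theorem q_pow_ne_top (n : ℕ) : ((q n : ℕ) : ℝ≥0∞) ^ d ≠ ⊤ :=
  ENNReal.pow_ne_top (ENNReal.natCast_ne_top _)

variable [ν.IsAddLeftInvariant]

/-- By translation invariance the block may be taken to be the zero block, whose representatives in
the large cube form the small cube; the factor is the ratio of the two volumes. -/
theorem lintegral_block (n : ℕ) (c : Block K d h₁ q n) {f : Space K d h₁ q n → ℝ≥0∞}
    (hf : Measurable f) :
    ∫⁻ x, (if block K d h₁ q n x = c then f (proj K d h₁ q n x) else 0)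
      ∂(uniform K d h₁ q ν (n + 1)) =
      (((q n : ℕ) : ℝ≥0∞) ^ d)⁻¹ * ∫⁻ z, f z ∂(uniform K d h₁ q ν n) := by
  have := hS.measurableAdd₂ (h₁ := h₁) (q := q) (n + 1)
  have := hS.isAddLeftInvariant_uniform (h₁ := h₁) (q := q) (n + 1)
  have hm : ∀ c, Measurable fun x => if block K d h₁ q n x = c then f (proj K d h₁ q n x) else 0 :=
    fun c => Measurable.ite (hS.measurableSet_block n c) (hf.comp (hS.measurable_proj n))
      measurable_const
  obtain ⟨γ, rfl⟩ := QuotientAddGroup.mk_surjective c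
  rw [← lintegral_add_left_eq_self _ (QuotientAddGroup.mk (γ : Fin d → K))]
  have e1 : ∀ x : Space K d h₁ q (n + 1),
      (if block K d h₁ q n (QuotientAddGroup.mk (γ : Fin d → K) + x) = QuotientAddGroup.mk γ then
        f (proj K d h₁ q n (QuotientAddGroup.mk (γ : Fin d → K) + x)) else 0) =
      if block K d h₁ q n x = 0 then f (proj K d h₁ q n x) else 0 := fun x => by
    simp only [block_lattice_add, add_eq_left, map_add, proj_mk, mk_lattice, zero_add]
  simp_rw [e1]
  rw [hS.lintegral_uniform _ (hm 0), hS.lintegral_uniform _ hf, hS.measure_cube_succ,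
    ENNReal.mul_inv (Or.inl (hS.q_pow_ne_zero n)) (Or.inl (hS.q_pow_ne_top n)), mul_assoc]
  congr 2
  rw [← lintegral_indicator (hS.measurableSet_cube n),
    ← lintegral_indicator (hS.measurableSet_cube (n + 1))]
  congr 1
  ext u
  by_cases hu : u ∈ cube K d h₁ q (n + 1)
  · rw [Set.indicator_of_mem hu]
    by_cases hu' : u ∈ cube K d h₁ q n
    · rw [Set.indicator_of_mem hu', if_pos ((block_eq_zero_iff hu).2 hu'), proj_mk]
    · rw [Set.indicator_of_notMem hu', if_neg (fun h => hu' ((block_eq_zero_iff hu).1 h))]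
  · rw [Set.indicator_of_notMem hu, Set.indicator_of_notMem (fun h => hu (cube_subset_cube n h))]

theorem measure_block (n : ℕ) (c : Block K d h₁ q n) :
    uniform K d h₁ q ν (n + 1) (block K d h₁ q n ⁻¹' {c}) = (((q n : ℕ) : ℝ≥0∞) ^ d)⁻¹ := by
  have := hS.isProbabilityMeasure_uniform (h₁ := h₁) (q := q) n
  have h := hS.lintegral_block n c (f := fun _ => 1) measurable_const
  rw [lintegral_one, measure_univ, mul_one] at h
  rw [← h, ← lintegral_indicator_one (hS.measurableSet_block n c)]
  rfl

theorem measureReal_block (n : ℕ) (c : Block K d h₁ q n) :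
    (uniform K d h₁ q ν (n + 1)).real (block K d h₁ q n ⁻¹' {c}) = 1 / ((q n : ℕ) : ℝ) ^ d := by
  rw [Measure.real, hS.measure_block]; simp

/-- Integration over `M (n + 1)` block by block. -/
theorem lintegral_sum_block (n : ℕ) {g : Block K d h₁ q n → Space K d h₁ q n → ℝ≥0∞}
    (hg : ∀ c, Measurable (g c)) :
    ∫⁻ x, g (block K d h₁ q n x) (proj K d h₁ q n x) ∂(uniform K d h₁ q ν (n + 1)) =
      (((q n : ℕ) : ℝ≥0∞) ^ d)⁻¹ * ∑ c, ∫⁻ z, g c z ∂(uniform K d h₁ q ν n) := by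
  have e1 : ∀ x : Space K d h₁ q (n + 1), g (block K d h₁ q n x) (proj K d h₁ q n x) =
      ∑ c, if block K d h₁ q n x = c then g c (proj K d h₁ q n x) else 0 := fun x => by simp
  simp_rw [e1]
  have hm : ∀ c ∈ Finset.univ, Measurable fun x : Space K d h₁ q (n + 1) =>
      if block K d h₁ q n x = c then g c (proj K d h₁ q n x) else 0 := fun c _ =>
    Measurable.ite (hS.measurableSet_block n c) ((hg c).comp (hS.measurable_proj n))
      measurable_const
  rw [lintegral_finsetSum _ hm, Finset.mul_sum]
  exact Finset.sum_congr rfl fun c _ => hS.lintegral_block n c (hg c)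

/-- The blocks are counted by their masses: each has mass `q ^ (-d)` and the total mass is one. -/
theorem card_block (n : ℕ) : Fintype.card (Block K d h₁ q n) = (q n : ℕ) ^ d := by
  have := hS.isProbabilityMeasure_uniform (h₁ := h₁) (q := q) n
  have := hS.isProbabilityMeasure_uniform (h₁ := h₁) (q := q) (n + 1)
  have h := hS.lintegral_sum_block (h₁ := h₁) (q := q) n (g := fun _ _ => 1)
    fun _ => measurable_const
  simp only [lintegral_one, measure_univ, Finset.sum_const, Finset.card_univ, nsmul_eq_mul,
    mul_one] at h
  have h2 : ((q n : ℕ) : ℝ≥0∞) ^ d = (Fintype.card (Block K d h₁ q n) : ℝ≥0∞) := by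
    calc _ = ((q n : ℕ) : ℝ≥0∞) ^ d * 1 := (mul_one _).symm
      _ = _ := by
        rw [h, ← mul_assoc, ENNReal.mul_inv_cancel (hS.q_pow_ne_zero n) (hS.q_pow_ne_top n),
          one_mul]
  exact_mod_cast h2.symm

theorem measurable_glueWith (n : ℕ) (a : Block K d h₁ q n → Space K d h₁ q n) :
    Measurable (glueWith n a) := by
  have := hS.measurableAdd₂ (h₁ := h₁) (q := q) n
  exact (hS.measurable_proj n).add (hS.measurable_block_comp n a)

/-- Each block is carried onto a `q ^ (-d)` share of the invariant measure below, and the rotation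
of the block preserves that share. Hence the compatibility of the measures holds for every choice of
rotations, not just almost surely. -/
theorem measurePreserving_glueWith (n : ℕ) (a : Block K d h₁ q n → Space K d h₁ q n) :
    MeasurePreserving (glueWith n a) (uniform K d h₁ q ν (n + 1)) (uniform K d h₁ q ν n) := by
  have := hS.measurableAdd₂ (h₁ := h₁) (q := q) n
  have := hS.isAddLeftInvariant_uniform (h₁ := h₁) (q := q) n
  refine ⟨hS.measurable_glueWith n a, ?_⟩
  ext A hA
  rw [Measure.map_apply (hS.measurable_glueWith n a) hA,
    ← lintegral_indicator_one (hS.measurable_glueWith n a hA)]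
  have h := hS.lintegral_sum_block n (g := fun c z => A.indicator 1 (z + a c))
    fun c => (measurable_one.indicator hA).comp (measurable_add_const (a c))
  refine Eq.trans ?_ (h.trans ?_)
  · rfl
  · have : ∀ c : Block K d h₁ q n, ∫⁻ z, A.indicator 1 (z + a c) ∂(uniform K d h₁ q ν n) =
        uniform K d h₁ q ν n A := fun c => by
      simp_rw [add_comm _ (a c)]
      rw [lintegral_add_left_eq_self (A.indicator 1) (a c), lintegral_indicator_one hA]
    simp_rw [this]
    rw [Finset.sum_const, Finset.card_univ, hS.card_block, nsmul_eq_mul]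
    push_cast
    rw [← mul_assoc, ENNReal.inv_mul_cancel (hS.q_pow_ne_zero n) (hS.q_pow_ne_top n), one_mul]

theorem measurePreserving_proj (n : ℕ) :
    MeasurePreserving (proj K d h₁ q n) (uniform K d h₁ q ν (n + 1)) (uniform K d h₁ q ν n) := by
  have h := hS.measurePreserving_glueWith (h₁ := h₁) (q := q) n (fun _ => 0)
  have e1 : glueWith n (fun _ : Block K d h₁ q n => (0 : Space K d h₁ q n)) = proj K d h₁ q n := by
    ext x; simp [glueWith]
  rwa [e1] at h

theorem measurable_block_pair (n : ℕ) : MeasurableSet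
    {p : Space K d h₁ q (n + 1) × Space K d h₁ q (n + 1) |
      block K d h₁ q n p.1 = block K d h₁ q n p.2} := by
  have : {p : Space K d h₁ q (n + 1) × Space K d h₁ q (n + 1) |
      block K d h₁ q n p.1 = block K d h₁ q n p.2} =
      ⋃ c, (block K d h₁ q n ⁻¹' {c}) ×ˢ (block K d h₁ q n ⁻¹' {c}) := by
    ext p
    simp only [Set.mem_ofPred_eq, Set.mem_iUnion, Set.mem_prod, Set.mem_preimage,
      Set.mem_singleton_iff]
    exact ⟨fun h => ⟨_, h, rfl⟩, fun ⟨c, h1, h2⟩ => h1.trans h2.symm⟩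
  rw [this]
  exact MeasurableSet.iUnion fun c => (hS.measurableSet_block n c).prod (hS.measurableSet_block n c)

theorem measurableSet_stay (n : ℕ) (z : Space K d h₁ q (n + 1)) :
    MeasurableSet {x | block K d h₁ q n (z + x) = block K d h₁ q n x} := by
  have := hS.measurableAdd₂ (h₁ := h₁) (q := q) (n + 1)
  exact ((measurable_const_add z).prodMk measurable_id) (hS.measurable_block_pair n)

theorem measurable_stay (n : ℕ) : Measurable (stay ν n : Space K d h₁ q (n + 1) → ℝ) := by
  have := hS.measurableAdd₂ (h₁ := h₁) (q := q) (n + 1)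
  have := hS.isProbabilityMeasure_uniform (h₁ := h₁) (q := q) (n + 1)
  exact (measurable_measure_prodMk_left ((measurable_fst.add measurable_snd).prodMk measurable_snd
    (hS.measurable_block_pair n))).ennreal_toReal

theorem stay_nonneg (n : ℕ) (z : Space K d h₁ q (n + 1)) : 0 ≤ stay ν n z := measureReal_nonneg

theorem stay_le_one (n : ℕ) (z : Space K d h₁ q (n + 1)) : stay ν n z ≤ 1 := by
  have := hS.isProbabilityMeasure_uniform (h₁ := h₁) (q := q) (n + 1)
  exact measureReal_le_one

/-- The translates of a point stay in the block with total probability one. -/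
theorem lintegral_stay_mul (n : ℕ) {f : Space K d h₁ q n → ℝ≥0∞} (hf : Measurable f) :
    ∫⁻ z, ENNReal.ofReal (stay ν n z) * f (proj K d h₁ q n z) ∂(uniform K d h₁ q ν (n + 1)) =
      (((q n : ℕ) : ℝ≥0∞) ^ d)⁻¹ * ∫⁻ z, f z ∂(uniform K d h₁ q ν n) := by
  have := hS.measurableAdd₂ (h₁ := h₁) (q := q) (n + 1)
  have := hS.measurableAdd₂ (h₁ := h₁) (q := q) n
  have := hS.isAddLeftInvariant_uniform (h₁ := h₁) (q := q) (n + 1)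
  have := hS.isAddLeftInvariant_uniform (h₁ := h₁) (q := q) n
  have := hS.isProbabilityMeasure_uniform (h₁ := h₁) (q := q) (n + 1)
  set P := uniform K d h₁ q ν (n + 1)
  have hm : MeasurableSet {p : Space K d h₁ q (n + 1) × Space K d h₁ q (n + 1) |
      block K d h₁ q n (p.1 + p.2) = block K d h₁ q n p.2} :=
    (measurable_fst.add measurable_snd).prodMk measurable_snd (hS.measurable_block_pair n)
  have hm' : Measurable fun p : Space K d h₁ q (n + 1) × Space K d h₁ q (n + 1) =>
      if block K d h₁ q n (p.1 + p.2) = block K d h₁ q n p.2 then f (proj K d h₁ q n p.1) else 0 :=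
    Measurable.ite hm ((hf.comp (hS.measurable_proj n)).comp measurable_fst) measurable_const
  calc _ = ∫⁻ z, ∫⁻ x, (if block K d h₁ q n (z + x) = block K d h₁ q n x then
          f (proj K d h₁ q n z) else 0) ∂P ∂P := by
        congr 1
        funext z
        rw [stay, ofReal_measureReal, mul_comm,
          ← lintegral_indicator_const (hS.measurableSet_stay n z)]
        rfl
    _ = ∫⁻ x, ∫⁻ z, (if block K d h₁ q n (z + x) = block K d h₁ q n x then
          f (proj K d h₁ q n z) else 0) ∂P ∂P := lintegral_lintegral_swap hm'.aemeasurable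
    _ = ∫⁻ x, (((q n : ℕ) : ℝ≥0∞) ^ d)⁻¹ * ∫⁻ z, f z ∂(uniform K d h₁ q ν n) ∂P := by
        congr 1
        funext x
        -- For fixed `x`, the substitution `z ↦ -x + z` turns the condition into membership of `z`
        -- in the block of `x`, and the shift of the argument of `f` by `proj x` is removed by
        -- invariance.
        have h := hS.lintegral_block n (block K d h₁ q n x)
          (f := fun z => f (-(proj K d h₁ q n x) + z)) (hf.comp (measurable_const_add _))
        rw [lintegral_add_left_eq_self] at h
        rw [← h, ← lintegral_add_left_eq_self _ (-x)]
        congr 1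
        funext z
        rw [map_add, map_neg, add_comm (-x) z, neg_add_cancel_right]
    _ = _ := by simp

/-- A point that leaves the cube does so in some coordinate `i`, and there it lies in a slab of
thickness `|e (t i)|`. -/
theorem measure_boundary_le (n : ℕ) (t : Fin d → K) :
    ν {u | u ∈ cube K d h₁ q n ∧ t + u ∉ cube K d h₁ q n} ≤
      ENNReal.ofReal (∑ i, |e (t i)| / lenR h₁ q n) * ν (cube K d h₁ q n) := by
  have hlen := lenR_pos h₁ q n
  have hsub : {u | u ∈ cube K d h₁ q n ∧ t + u ∉ cube K d h₁ q n} ⊆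
      ⋃ i, {u | u ∈ cube K d h₁ q n ∧ t i + u i ∉ Set.Ico 0 (len K h₁ q n)} := by
    rintro u ⟨hu, hu'⟩
    simp only [cube, Set.mem_ofPred_eq, not_forall] at hu'
    obtain ⟨i, hi⟩ := hu'
    exact Set.mem_iUnion.2 ⟨i, hu, hi⟩
  have hone : ∀ i, ν {u | u ∈ cube K d h₁ q n ∧ t i + u i ∉ Set.Ico 0 (len K h₁ q n)} ≤
      ENNReal.ofReal (|e (t i)| / lenR h₁ q n) * ν (cube K d h₁ q n) := by
    intro i
    -- The slab lies at the upper end of the interval if `t i ≥ 0` and at the lower end otherwise.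
    -- It may stick out of the cube when `t i` is long, which does no harm to an upper bound.
    obtain ⟨lo, hi, hlohi, h1, h2⟩ : ∃ lo hi : K, lo ≤ hi ∧ e hi - e lo ≤ |e (t i)| ∧
        ∀ x ∈ Set.Ico 0 (len K h₁ q n), t i + x ∉ Set.Ico 0 (len K h₁ q n) →
          x ∈ Set.Ico lo hi := by
      rcases le_total 0 (t i) with ht | ht
      · refine ⟨len K h₁ q n - t i, len K h₁ q n, by linarith, ?_, ?_⟩
        · rw [map_sub]; linarith [le_abs_self (e (t i))]
        · rintro x ⟨hx0, hx1⟩ hx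
          refine ⟨?_, hx1⟩
          by_contra hcon
          exact hx ⟨by linarith, by linarith⟩
      · refine ⟨0, -t i, by linarith, ?_, ?_⟩
        · rw [map_neg, map_zero]; linarith [neg_abs_le (e (t i))]
        · rintro x ⟨hx0, hx1⟩ hx
          refine ⟨hx0, ?_⟩
          by_contra hcon
          exact hx ⟨by linarith, by linarith⟩
    have hsub' : {u | u ∈ cube K d h₁ q n ∧ t i + u i ∉ Set.Ico 0 (len K h₁ q n)} ⊆
        Set.univ.pi fun j => Set.Ico ((Function.update (fun _ => (0 : K)) i lo) j)
          ((Function.update (fun _ => len K h₁ q n) i hi) j) := by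
      rintro u ⟨hu, hu'⟩ j _
      by_cases hj : j = i
      · subst hj; simpa using h2 _ (hu j) hu'
      · simpa [Function.update_of_ne hj] using hu j
    refine (measure_mono hsub').trans ?_
    rw [hS.box _ _ fun j => ?_, hS.measure_cube]
    · rw [← ENNReal.ofReal_mul (by positivity), ← Finset.mul_prod_erase _ _ (Finset.mem_univ i)]
      have h3 : ∀ j ∈ Finset.univ.erase i, ENNReal.ofReal
          (e (Function.update (fun _ => len K h₁ q n) i hi j) -
            e (Function.update (fun _ => (0 : K)) i lo j)) = ENNReal.ofReal (lenR h₁ q n) := by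
        intro j hj
        have hj' := Finset.ne_of_mem_erase hj
        simp [Function.update_of_ne hj', map_len]
      rw [Finset.prod_congr rfl h3, Finset.prod_const, Finset.card_erase_of_mem (Finset.mem_univ i),
        Finset.card_univ, Fintype.card_fin, ← ENNReal.ofReal_pow hlen.le]
      simp only [Function.update_self]
      have hd : 0 < d := i.pos
      have e1 : |e (t i)| / lenR h₁ q n * lenR h₁ q n ^ d = |e (t i)| * lenR h₁ q n ^ (d - 1) := by
        obtain ⟨k, rfl⟩ := Nat.exists_eq_add_of_lt hd
        simp only [zero_add, Nat.add_sub_cancel]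
        field_simp
        ring
      rw [e1, ENNReal.ofReal_mul (abs_nonneg _)]
      gcongr
    · by_cases hj : j = i
      · subst hj; simpa using hlohi
      · simpa [Function.update_of_ne hj] using (len_pos K h₁ q n).le
  refine (measure_mono hsub).trans ((measure_iUnion_le _).trans ?_)
  rw [tsum_fintype, ENNReal.ofReal_sum_of_nonneg fun i _ => by positivity, Finset.sum_mul]
  exact Finset.sum_le_sum fun i _ => hone i

theorem uniform_boundary_le (n : ℕ) (t : Fin d → K) :
    (uniform K d h₁ q ν n).real {z | t + rep n z ∉ cube K d h₁ q n} ≤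
      ∑ i, |e (t i)| / lenR h₁ q n := by
  have hlen := lenR_pos h₁ q n
  have hm : MeasurableSet {z : Space K d h₁ q n | t + rep n z ∉ cube K d h₁ q n} :=
    ((measurable_const_add t).comp (hS.measurable_rep n) (hS.measurableSet_cube n)).compl
  have h1 : uniform K d h₁ q ν n {z | t + rep n z ∉ cube K d h₁ q n} ≤
      ENNReal.ofReal (∑ i, |e (t i)| / lenR h₁ q n) := by
    rw [← lintegral_indicator_one hm, hS.lintegral_uniform n (measurable_one.indicator hm),
      ← lintegral_indicator (hS.measurableSet_cube n)]
    have h2 : ∀ u, (cube K d h₁ q n).indicator (fun u =>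
        {z : Space K d h₁ q n | t + rep n z ∉ cube K d h₁ q n}.indicator (1 : Space K d h₁ q n → ℝ≥0∞)
          (QuotientAddGroup.mk u)) u =
        {u | u ∈ cube K d h₁ q n ∧ t + u ∉ cube K d h₁ q n}.indicator 1 u := fun u => by
      by_cases hu : u ∈ cube K d h₁ q n
      · have hiff : ((QuotientAddGroup.mk u : Space K d h₁ q n) ∈
            {z : Space K d h₁ q n | t + rep n z ∉ cube K d h₁ q n}) ↔ t + u ∉ cube K d h₁ q n := by
          change t + rep n (QuotientAddGroup.mk u) ∉ _ ↔ _
          rw [rep_mk_of_mem hu]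
        rw [Set.indicator_of_mem hu]
        by_cases ht : t + u ∈ cube K d h₁ q n
        · rw [Set.indicator_of_notMem (fun h => hiff.1 h ht),
            Set.indicator_of_notMem (fun h => h.2 ht)]
        · rw [Set.indicator_of_mem (hiff.2 ht), Set.indicator_of_mem (show u ∈ {u |
            u ∈ cube K d h₁ q n ∧ t + u ∉ cube K d h₁ q n} from ⟨hu, ht⟩)]
          rfl
      · simp [hu]
    simp_rw [h2]
    have hm2 : MeasurableSet {u | u ∈ cube K d h₁ q n ∧ t + u ∉ cube K d h₁ q n} :=
      (hS.measurableSet_cube n).inter ((measurable_const_add t) (hS.measurableSet_cube n)).compl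
    rw [lintegral_indicator_one hm2, mul_comm,
      ← div_eq_mul_inv]
    exact ENNReal.div_le_of_le_mul (hS.measure_boundary_le n t)
  exact ENNReal.toReal_le_of_le_ofReal (Finset.sum_nonneg fun i _ => by positivity) h1

theorem measureReal_leave_le (n : ℕ) (t : Fin d → K) :
    (uniform K d h₁ q ν (n + 1)).real {x | block K d h₁ q n (QuotientAddGroup.mk t + x) ≠
      block K d h₁ q n x} ≤ ∑ i, |e (t i)| / lenR h₁ q n := by
  have := hS.isProbabilityMeasure_uniform (h₁ := h₁) (q := q) (n + 1)
  refine le_trans ?_ (hS.uniform_boundary_le n t)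
  have hm : MeasurableSet {z : Space K d h₁ q n | t + rep n z ∉ cube K d h₁ q n} :=
    ((measurable_const_add t).comp (hS.measurable_rep n) (hS.measurableSet_cube n)).compl
  have hp := hS.measurePreserving_proj (h₁ := h₁) (q := q) n
  rw [← hp.measureReal_preimage hm.nullMeasurableSet]
  refine measureReal_mono fun x hx => ?_
  intro hcon
  refine hx ?_
  rw [block_translate, corner_of_mem_cube hcon]
  simp

theorem one_sub_stay_le (n : ℕ) (t : Fin d → K) :
    1 - stay ν n (QuotientAddGroup.mk t : Space K d h₁ q (n + 1)) ≤
      ∑ i, |e (t i)| / lenR h₁ q n := by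
  have := hS.isProbabilityMeasure_uniform (h₁ := h₁) (q := q) (n + 1)
  rw [stay, ← probReal_compl_eq_one_sub (hS.measurableSet_stay n _)]
  exact hS.measureReal_leave_le n t

/-- Translations that differ by a nonzero label cannot both keep a point in its block. -/
theorem stay_add_stay_le (n : ℕ) (z : Space K d h₁ q (n + 1)) (γ : lattice K d h₁ q n)
    (hγ : (γ : Fin d → K) ∉ lattice K d h₁ q (n + 1)) :
    stay ν n z + stay ν n (QuotientAddGroup.mk (γ : Fin d → K) + z) ≤ 1 := by
  have := hS.isProbabilityMeasure_uniform (h₁ := h₁) (q := q) (n + 1)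
  rw [stay, stay, ← measureReal_union _ (hS.measurableSet_stay n _)]
  · exact measureReal_le_one
  · refine Set.disjoint_left.2 fun x hx hx' => hγ ?_
    simp only [Set.mem_ofPred_eq] at hx hx'
    rw [add_assoc, block_lattice_add, hx, add_eq_right, QuotientAddGroup.eq_zero_iff,
      AddSubgroup.mem_addSubgroupOf] at hx'
    exact hx'

/-- If some point stays in its block, the translation is short modulo the lattice. -/
theorem exists_of_stay_ne_zero (n : ℕ) (t : Fin d → K)
    (h : stay ν n (QuotientAddGroup.mk t : Space K d h₁ q (n + 1)) ≠ 0) :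
    ∃ γ : lattice K d h₁ q (n + 1), ∀ i, |e (t i) - e ((γ : Fin d → K) i)| < lenR h₁ q n := by
  obtain ⟨x, hx⟩ : {x | block K d h₁ q n (QuotientAddGroup.mk t + x) =
      block K d h₁ q n x}.Nonempty := by
    by_contra hcon
    rw [Set.not_nonempty_iff_eq_empty] at hcon
    exact h (by rw [stay, hcon, measureReal_empty])
  -- Staying in the block means that the corner of `t` plus the representative of `x` belongs to `Γ
  -- (n + 1)`. Up to this corner, `t` is the difference of two points of the small cube.
  simp only [Set.mem_ofPred_eq, block_translate, add_eq_right, QuotientAddGroup.eq_zero_iff,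
    AddSubgroup.mem_addSubgroupOf] at hx
  refine ⟨⟨_, hx⟩, fun i => ?_⟩
  have h1 := sub_corner_mem_cube K d h₁ q n (t + rep n (proj K d h₁ q n x)) i
  have h2 := rep_mem (proj K d h₁ q n x) i
  simp only [Pi.sub_apply, Pi.add_apply, Set.mem_Ico, ← hS.strictMono.le_iff_le,
    ← hS.strictMono.lt_iff_lt, map_sub, map_add, map_zero, map_len] at h1 h2
  rw [abs_lt]
  constructor <;> simp only <;> linarith

end IsStandard

end Blocks

end Iceberg

namespace Iceberg

/-! ### The limit measure and the action -/

section Limit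

variable {K : Type*} [CommRing K] [LinearOrder K] [IsStrictOrderedRing K] [Archimedean K]
  {d : ℕ} {h₁ : ℕ+} {q : ℕ → ℕ+}

/-- The point of the block `c` which the gluing map sends to `z`. -/
def lower (α : Rotations K d h₁ q) (n : ℕ) (z : Space K d h₁ q n) (c : Block K d h₁ q n) :
    Space K d h₁ q (n + 1) :=
  QuotientAddGroup.mk (((Quotient.out c : lattice K d h₁ q n) : Fin d → K) + rep n (z - α n c))

theorem glue_lower (α : Rotations K d h₁ q) (n : ℕ) (z : Space K d h₁ q n)
    (c : Block K d h₁ q n) : glue α n (lower α n z c) = z := by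
  have hc : (QuotientAddGroup.mk (Quotient.out c) : Block K d h₁ q n) = c := Quotient.out_eq c
  rw [lower, glue_add α n _ _ (rep_mem _), mk_rep, hc, sub_add_cancel]

theorem lower_glue (α : Rotations K d h₁ q) (n : ℕ) (x : Space K d h₁ q (n + 1)) :
    lower α n (glue α n x) (block K d h₁ q n x) = x := by
  rw [lower, glue, add_sub_cancel_right]
  have hx := mk_rep x
  rw [rep_proj]
  generalize rep (n + 1) x = r at hx ⊢
  subst hx
  rw [block_mk]
  set c : Block K d h₁ q n := QuotientAddGroup.mk (corner K d h₁ q n r) with hc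
  have h1 : (QuotientAddGroup.mk (Quotient.out c) : Block K d h₁ q n) = c := Quotient.out_eq c
  rw [hc] at h1
  have h2 := QuotientAddGroup.eq.1 h1
  rw [AddSubgroup.mem_addSubgroupOf] at h2
  refine QuotientAddGroup.eq.2 ?_
  convert h2 using 1
  push_cast
  abel

/-- The composed gluing map `M (n + k) → M n`. -/
def descend (α : Rotations K d h₁ q) (n : ℕ) : ∀ k, Space K d h₁ q (n + k) → Space K d h₁ q n
  | 0 => id
  | k + 1 => fun z => descend α n k (glue α (n + k) z)

theorem descend_coord (α : Rotations K d h₁ q) (n k : ℕ) (x : Phase α) :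
    descend α n k (x.1 (n + k)) = x.1 n := by
  induction k with
  | zero => rfl
  | succ k ih => rw [← ih, ← x.2 (n + k)]; rfl

theorem shift_spec {α : Rotations K d h₁ q} {t : Fin d → K} {x : Phase α} (h : Stable α t x) :
    ∀ᶠ n in atTop, (shift α t x).1 n = QuotientAddGroup.mk t + x.1 n := by
  rw [shift, dif_pos h]
  exact h.existsUnique.choose_spec.1

theorem eq_shift {α : Rotations K d h₁ q} {t : Fin d → K} {x y : Phase α} (h : Stable α t x)
    (hy : ∀ᶠ n in atTop, y.1 n = QuotientAddGroup.mk t + x.1 n) : shift α t x = y :=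
  h.existsUnique.unique (shift_spec h) hy

theorem eventually_shift_coord {α : Rotations K d h₁ q} {t : Fin d → K} {x : Phase α}
    (h : Stable α t x) (n : ℕ) :
    ∀ᶠ k in atTop, (shift α t x).1 n =
      descend α n k (QuotientAddGroup.mk t + x.1 (n + k)) := by
  have := (tendsto_add_atTop_nat n).eventually (shift_spec h)
  filter_upwards [this] with k hk
  rw [add_comm k n] at hk
  rw [← hk, descend_coord]

variable [MeasurableSpace K] [MeasurableAdd₂ K] [MeasurableNeg K]

theorem measurable_coord (α : Rotations K d h₁ q) (n : ℕ) :
    Measurable fun x : Phase α => x.1 n :=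
  (measurable_pi_apply n).comp measurable_subtype_coe

namespace IsStandard

variable {e : K →+* ℝ} {ν : Measure (Fin d → K)} (hS : IsStandard e ν)
include hS

theorem measurable_lower (α : Rotations K d h₁ q) (n : ℕ) (c : Block K d h₁ q n) :
    Measurable fun z => lower α n z c := by
  have := hS.measurableAdd₂ (h₁ := h₁) (q := q) n
  unfold lower
  simp_rw [sub_eq_add_neg]
  exact (measurable_mk _).comp ((measurable_const_add _).comp
    ((hS.measurable_rep n).comp (measurable_add_const _)))

theorem measurable_descend (α : Rotations K d h₁ q) (n k : ℕ) : Measurable (descend α n k) := by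
  induction k with
  | zero => exact measurable_id
  | succ k ih => exact ih.comp (hS.measurable_glue α (n + k))

variable [ν.IsAddLeftInvariant]

/-- One step of a Markov chain upwards: a uniform point of `M n` is lifted into a block chosen
uniformly, here as the block of an independent uniform point, and the result is uniform on `M (n +
1)`. For each block the rotation is absorbed by invariance. -/
theorem lintegral_lower (α : Rotations K d h₁ q) (n : ℕ) {f : Space K d h₁ q (n + 1) → ℝ≥0∞}
    (hf : Measurable f) :
    ∫⁻ z, ∫⁻ y, f (lower α n z (block K d h₁ q n y)) ∂(uniform K d h₁ q ν (n + 1))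
      ∂(uniform K d h₁ q ν n) = ∫⁻ x, f x ∂(uniform K d h₁ q ν (n + 1)) := by
  have := hS.measurableAdd₂ (h₁ := h₁) (q := q) n
  have := hS.isAddLeftInvariant_uniform (h₁ := h₁) (q := q) n
  have := hS.isProbabilityMeasure_uniform (h₁ := h₁) (q := q) n
  have e1 : ∀ z, ∫⁻ y, f (lower α n z (block K d h₁ q n y)) ∂(uniform K d h₁ q ν (n + 1)) =
      (((q n : ℕ) : ℝ≥0∞) ^ d)⁻¹ * ∑ c, f (lower α n z c) := fun z => by
    rw [hS.lintegral_sum_block n (g := fun c _ => f (lower α n z c)) fun c => measurable_const]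
    simp
  have e2 : ∀ x, f x = f (lower α n (proj K d h₁ q n x + α n (block K d h₁ q n x))
      (block K d h₁ q n x)) := fun x => by
    conv_lhs => rw [← lower_glue α n x]
    rfl
  have hm : ∀ c, Measurable fun z => f (lower α n z c) := fun c =>
    hf.comp (hS.measurable_lower α n c)
  simp_rw [e1]
  rw [lintegral_const_mul _ (Finset.measurable_sum _ fun c _ => hm c),
    lintegral_finsetSum _ fun c _ => hm c, lintegral_congr e2,
    hS.lintegral_sum_block n (g := fun c z => f (lower α n (z + α n c) c))
      fun c => (hm c).comp (measurable_add_const _)]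
  congr 1
  refine Finset.sum_congr rfl fun c _ => ?_
  simp_rw [add_comm _ (α n c)]
  rw [lintegral_add_left_eq_self fun z => f (lower α n z c)]

omit hS [ν.IsAddLeftInvariant] in
/-- The coordinates of a random point of `X`, built from a sequence of points `y n` of `M n`: the
block of `x (n + 1)` is the block of `y (n + 1)`. -/
def randomCoord (α : Rotations K d h₁ q) (y : ∀ n, Space K d h₁ q n) :
    ∀ n, Space K d h₁ q n
  | 0 => y 0
  | n + 1 => lower α n (randomCoord α y n) (block K d h₁ q n (y (n + 1)))

omit [ν.IsAddLeftInvariant] in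
theorem measurable_randomCoord (α : Rotations K d h₁ q) (n : ℕ) :
    Measurable fun y => randomCoord α y n := by
  induction n with
  | zero => exact measurable_pi_apply 0
  | succ n ih =>
    have : ∀ y, randomCoord α y (n + 1) =
      lower α n (randomCoord α y n) (block K d h₁ q n (y (n + 1))) := fun _ => rfl
    simp_rw [this]
    intro s hs
    have h2 : (fun y => lower α n (randomCoord α y n) (block K d h₁ q n (y (n + 1)))) ⁻¹' s =
        ⋃ c, ((fun y => lower α n (randomCoord α y n) c) ⁻¹' s) ∩
          ((fun y : ∀ n, Space K d h₁ q n => y (n + 1)) ⁻¹' (block K d h₁ q n ⁻¹' {c})) := by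
      ext y; simp
    rw [h2]
    exact MeasurableSet.iUnion fun c => (((hS.measurable_lower α n c).comp ih) hs).inter
      (measurable_pi_apply _ (hS.measurableSet_block n c))

omit hS [ν.IsAddLeftInvariant] in
theorem randomCoord_congr (α : Rotations K d h₁ q) {y y' : ∀ n, Space K d h₁ q n} {n : ℕ}
    (h : ∀ m ≤ n, y m = y' m) : randomCoord α y n = randomCoord α y' n := by
  induction n with
  | zero => exact h 0 le_rfl
  | succ n ih =>
    rw [randomCoord, randomCoord, ih fun m hm => h m (by omega), h (n + 1) le_rfl]

/-- Only the coordinate `n + 1` of `y` is resampled. The lower random coordinate ignores it and is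
uniform by induction, so that `lintegral_lower` applies. -/
theorem measurePreserving_randomCoord (α : Rotations K d h₁ q)
    [∀ n, IsProbabilityMeasure (uniform K d h₁ q ν n)] (n : ℕ) :
    MeasurePreserving (fun y => randomCoord α y n)
      (Measure.infinitePi fun n => uniform K d h₁ q ν n) (uniform K d h₁ q ν n) := by
  induction n with
  | zero => exact measurePreserving_eval_infinitePi _ 0
  | succ n ih =>
    refine ⟨hS.measurable_randomCoord α (n + 1), ?_⟩
    refine Measure.ext_of_lintegral _ fun f hf => ?_
    have hm := hS.measurable_randomCoord α (n + 1)
    rw [lintegral_map hf hm]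
    refine (lintegral_update _ (n + 1) (hf.comp hm)).trans ?_
    rw [← hS.lintegral_lower α n hf]
    have e1 : ∀ (y : ∀ n, Space K d h₁ q n) (s : Space K d h₁ q (n + 1)),
        randomCoord α (Function.update y (n + 1) s) (n + 1) =
          lower α n (randomCoord α y n) (block K d h₁ q n s) := fun y s => by
      rw [randomCoord, Function.update_self, randomCoord_congr α fun m hm =>
        Function.update_of_ne (by omega) _ _]
    simp only [Function.comp_apply, e1]
    refine ih.lintegral_comp (f := fun z => ∫⁻ y, f (lower α n z (block K d h₁ q n y))
      ∂(uniform K d h₁ q ν (n + 1))) ?_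
    have e2 : ∀ z, ∫⁻ y, f (lower α n z (block K d h₁ q n y)) ∂(uniform K d h₁ q ν (n + 1)) =
        (((q n : ℕ) : ℝ≥0∞) ^ d)⁻¹ * ∑ c, f (lower α n z c) := fun z => by
      rw [hS.lintegral_sum_block n (g := fun c _ => f (lower α n z c)) fun c => measurable_const]
      simp
    simp_rw [e2]
    exact (Finset.measurable_sum _ fun c _ => hf.comp (hS.measurable_lower α n c)).const_mul _

/-- The limit measure is the image of an infinite product measure under the chain of random lifts,
whose paths are points of the inverse limit by construction. It exists for every family of
rotations. -/
theorem exists_isLimitMeasure (α : Rotations K d h₁ q) :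
    ∃ μ : Measure (Phase α), IsLimitMeasure α ν μ := by
  have := hS.isProbabilityMeasure_uniform (h₁ := h₁) (q := q)
  set Pr := Measure.infinitePi fun n => uniform K d h₁ q ν n
  let Ψ : (∀ n, Space K d h₁ q n) → Phase α := fun y =>
    ⟨fun n => randomCoord α y n, fun n => glue_lower α n _ _⟩
  have hΨ : Measurable Ψ :=
    (measurable_pi_iff.2 fun n => hS.measurable_randomCoord α n).subtype_mk
  refine ⟨Pr.map Ψ, Measure.isProbabilityMeasure_map hΨ.aemeasurable, fun n => ?_⟩
  rw [Measure.map_map (measurable_coord α n) hΨ]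
  exact (hS.measurePreserving_randomCoord α n).map_eq

end IsStandard

/-- The cylinder sets. -/
def cylinders (α : Rotations K d h₁ q) : Set (Set (Phase α)) :=
  {s | ∃ n, ∃ A : Set (Space K d h₁ q n), MeasurableSet A ∧ s = {x | x.1 n ∈ A}}

theorem generateFrom_cylinders (α : Rotations K d h₁ q) :
    MeasurableSpace.generateFrom (cylinders α) = (inferInstance : MeasurableSpace (Phase α)) := by
  refine le_antisymm (MeasurableSpace.generateFrom_le ?_) ?_
  · rintro _ ⟨n, A, hA, rfl⟩
    exact measurable_coord α n hA
  · change MeasurableSpace.comap Subtype.val MeasurableSpace.pi ≤ _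
    rw [MeasurableSpace.pi, MeasurableSpace.comap_iSup]
    refine iSup_le fun n => ?_
    rw [MeasurableSpace.comap_comp]
    rintro s ⟨A, hA, rfl⟩
    exact MeasurableSpace.measurableSet_generateFrom ⟨n, A, hA, rfl⟩

namespace IsLimitMeasure

variable {α : Rotations K d h₁ q} {ν : Measure (Fin d → K)} {μ : Measure (Phase α)}

theorem measurePreserving_coord (hμ : IsLimitMeasure α ν μ) (n : ℕ) :
    MeasurePreserving (fun x : Phase α => x.1 n) μ (uniform K d h₁ q ν n) :=
  ⟨measurable_coord α n, hμ.map_coord n⟩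

variable {e : K →+* ℝ} (hS : IsStandard e ν)
include hS

omit μ in
theorem exists_common_level {m n : ℕ} (h : m ≤ n) {A : Set (Space K d h₁ q m)}
    (hA : MeasurableSet A) :
    ∃ B : Set (Space K d h₁ q n), MeasurableSet B ∧
      {x : Phase α | x.1 m ∈ A} = {x : Phase α | x.1 n ∈ B} := by
  obtain ⟨k, rfl⟩ := Nat.exists_eq_add_of_le h
  refine ⟨descend α m k ⁻¹' A, hS.measurable_descend α m k hA, ?_⟩
  ext x
  simp [descend_coord]

omit μ in
theorem isPiSystem_cylinders : IsPiSystem (cylinders α) := by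
  rintro _ ⟨m, A, hA, rfl⟩ _ ⟨n, B, hB, rfl⟩ _
  obtain ⟨A', hA', e1⟩ := exists_common_level hS (α := α) (le_max_left m n) hA
  obtain ⟨B', hB', e2⟩ := exists_common_level hS (α := α) (le_max_right m n) hB
  exact ⟨max m n, A' ∩ B', hA'.inter hB', by rw [e1, e2]; rfl⟩

theorem ext_of_coord {μ' : Measure (Phase α)} [IsFiniteMeasure μ]
    (h : ∀ n (A : Set (Space K d h₁ q n)), MeasurableSet A →
      μ {x | x.1 n ∈ A} = μ' {x | x.1 n ∈ A}) : μ = μ' := by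
  refine ext_of_generate_finite _ (generateFrom_cylinders α).symm (isPiSystem_cylinders hS) ?_ ?_
  · rintro _ ⟨n, A, hA, rfl⟩
    exact h n A hA
  · simpa using h 0 Set.univ MeasurableSet.univ

variable [ν.IsAddLeftInvariant]

omit μ in
theorem measurableSet_change (t : Fin d → K) (n : ℕ) :
    MeasurableSet {x : Phase α | block K d h₁ q n (x.1 (n + 1)) =
      block K d h₁ q n (QuotientAddGroup.mk t + x.1 (n + 1))} := by
  have := hS.measurableAdd₂ (h₁ := h₁) (q := q) (n + 1)
  exact ((measurable_coord α (n + 1)).prodMk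
    ((measurable_const_add _).comp (measurable_coord α (n + 1)))) (hS.measurable_block_pair n)

omit hS μ in
theorem measurableSet_eventually {X : Type*} [MeasurableSpace X] {p : ℕ → X → Prop}
    (hp : ∀ n, MeasurableSet {x | p n x}) : MeasurableSet {x | ∀ᶠ n in atTop, p n x} := by
  simp only [eventually_atTop]
  have : {x | ∃ N, ∀ n, N ≤ n → p n x} = ⋃ N, ⋂ n, ⋂ (_ : N ≤ n), {x | p n x} := by ext; simp
  rw [this]
  exact MeasurableSet.iUnion fun N => MeasurableSet.iInter fun n => MeasurableSet.iInter fun _ =>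
    hp n

omit μ in
theorem measurableSet_stable (t : Fin d → K) : MeasurableSet {x : Phase α | Stable α t x} :=
  measurableSet_eventually fun n => measurableSet_change hS t n

omit μ in
theorem measurable_shift (t : Fin d → K) : Measurable (shift α t) := by
  refine Measurable.subtype_mk (f := fun x : Phase α => (shift α t x).1) ?_
  refine measurable_pi_iff.2 fun n A hA => ?_
  have := fun n => hS.measurableAdd₂ (h₁ := h₁) (q := q) n
  -- On stable points the coordinate of the image eventually equals the descent of a translated high
  -- coordinate. Membership in `A` is then an eventual condition on measurable functions of `x`.
  have e1 : (fun x : Phase α => (shift α t x).1 n) ⁻¹' A =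
      ({x | Stable α t x} ∩ {x | ∀ᶠ k in atTop,
        descend α n k (QuotientAddGroup.mk t + x.1 (n + k)) ∈ A}) ∪
      ({x | Stable α t x}ᶜ ∩ {x | x.1 n ∈ A}) := by
    ext x
    simp only [Set.mem_preimage, Set.mem_union, Set.mem_inter_iff, Set.mem_ofPred_eq,
      Set.mem_compl_iff]
    by_cases hx : Stable α t x
    · simp only [hx, true_and, not_true_eq_false, false_and, or_false]
      constructor
      · intro h
        filter_upwards [eventually_shift_coord hx n] with k hk
        rwa [← hk]
      · intro h
        obtain ⟨k, hk, hk'⟩ := (h.and (eventually_shift_coord hx n)).exists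
        rwa [hk']
    · simp [hx, shift]
  rw [e1]
  refine ((measurableSet_stable hS t).inter (measurableSet_eventually fun k => ?_)).union
    ((measurableSet_stable hS t).compl.inter (measurable_coord α n hA))
  exact ((hS.measurable_descend α n k).comp ((measurable_const_add _).comp
    (measurable_coord α (n + k)))) hA

/-- Borel–Cantelli: at level `n` the translation by `t` changes the block with probability at most
`(∑ i, |e (t i)|) / h n`, which is summable. -/
theorem ae_stable (hμ : IsLimitMeasure α ν μ) (hsum : Summable fun n => 1 / lenR h₁ q n)
    (t : Fin d → K) : ∀ᵐ x ∂μ, Stable α t x := by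
  have := hS.isProbabilityMeasure_uniform (h₁ := h₁) (q := q)
  have hle : ∀ n, μ {x | block K d h₁ q n (QuotientAddGroup.mk t + x.1 (n + 1)) ≠
      block K d h₁ q n (x.1 (n + 1))} ≤ ENNReal.ofReal ((∑ i, |e (t i)|) * (1 / lenR h₁ q n)) := by
    intro n
    have h1 := hS.measureReal_leave_le (h₁ := h₁) (q := q) n t
    have h2 := (hμ.measurePreserving_coord (n + 1)).measure_preimage
      (hS.measurableSet_stay n (QuotientAddGroup.mk t)).compl.nullMeasurableSet
    refine le_trans (le_of_eq h2) ?_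
    rw [← ofReal_measureReal]
    refine ENNReal.ofReal_le_ofReal (h1.trans (le_of_eq ?_))
    rw [Finset.sum_mul]
    simp [div_eq_mul_inv]
  have h3 : ∑' n, μ {x | block K d h₁ q n (QuotientAddGroup.mk t + x.1 (n + 1)) ≠
      block K d h₁ q n (x.1 (n + 1))} ≠ ∞ := by
    refine ne_top_of_le_ne_top ?_ (ENNReal.tsum_le_tsum hle)
    rw [← ENNReal.ofReal_tsum_of_nonneg (fun n => ?_) (hsum.mul_left _)]
    · exact ENNReal.ofReal_ne_top
    · have := lenR_pos h₁ q n
      exact mul_nonneg (Finset.sum_nonneg fun i _ => abs_nonneg _) (by positivity)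
  filter_upwards [ae_eventually_notMem h3] with x hx
  filter_upwards [hx] with n hn
  simpa [eq_comm] using hn

/-- For each finite `k`, translating the coordinate `n + k` and descending has exactly the law of
the coordinate `n`. Almost surely this coordinate is eventually that of the image, and dominated
convergence passes to the limit. -/
theorem measurePreserving_shift (hμ : IsLimitMeasure α ν μ)
    (hsum : Summable fun n => 1 / lenR h₁ q n) (t : Fin d → K) :
    MeasurePreserving (shift α t) μ μ := by
  have := hμ.isProbabilityMeasure
  have := fun n => hS.measurableAdd₂ (h₁ := h₁) (q := q) n
  have := fun n => hS.isAddLeftInvariant_uniform (h₁ := h₁) (q := q) n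
  have hm := measurable_shift (α := α) hS t
  refine ⟨hm, (ext_of_coord hS (μ := μ) fun n A hA => ?_).symm⟩
  rw [Measure.map_apply (s := {x : Phase α | x.1 n ∈ A}) hm (measurable_coord α n hA)]
  have hk : ∀ k, ∫⁻ x, A.indicator 1 (descend α n k (QuotientAddGroup.mk t + x.1 (n + k))) ∂μ =
      μ {x | x.1 n ∈ A} := fun k => by
    have hmk : Measurable fun z : Space K d h₁ q (n + k) =>
        (A.indicator 1 (descend α n k z) : ℝ≥0∞) :=
      (measurable_one.indicator hA).comp (hS.measurable_descend α n k)
    rw [(hμ.measurePreserving_coord (n + k)).lintegral_comp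
      (f := fun z => A.indicator 1 (descend α n k (QuotientAddGroup.mk t + z)))
      (hmk.comp (measurable_const_add _)),
      lintegral_add_left_eq_self (fun z => (A.indicator 1 (descend α n k z) : ℝ≥0∞)),
      ← (hμ.measurePreserving_coord (n + k)).lintegral_comp hmk]
    simp only [descend_coord]
    exact lintegral_indicator_one (s := {x : Phase α | x.1 n ∈ A}) (measurable_coord α n hA)
  have hlim : Tendsto (fun k => ∫⁻ x, A.indicator 1
      (descend α n k (QuotientAddGroup.mk t + x.1 (n + k))) ∂μ) atTop
      (𝓝 (∫⁻ x, A.indicator 1 ((shift α t x).1 n) ∂μ)) := by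
    refine tendsto_lintegral_of_dominated_convergence (fun _ => 1) (fun k => ?_) (fun k => ?_) ?_ ?_
    · exact (measurable_one.indicator hA).comp ((hS.measurable_descend α n k).comp
        ((measurable_const_add _).comp (measurable_coord α (n + k))))
    · exact Eventually.of_forall fun x => Set.indicator_le_self' (by simp) _
    · simp
    · filter_upwards [hμ.ae_stable hS hsum t] with x hx
      refine tendsto_const_nhds.congr' ?_
      filter_upwards [eventually_shift_coord hx n] with k hk
      rw [hk]
  simp_rw [hk] at hlim
  rw [tendsto_nhds_unique tendsto_const_nhds hlim]
  exact lintegral_indicator_one (s := shift α t ⁻¹' {x : Phase α | x.1 n ∈ A})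
    (hm (measurable_coord α n hA))

theorem isAction (hμ : IsLimitMeasure α ν μ) (hsum : Summable fun n => 1 / lenR h₁ q n) :
    IsAction α μ where
  ae_stable := hμ.ae_stable hS hsum
  measurePreserving := hμ.measurePreserving_shift hS hsum
  shift_add s t := by
    filter_upwards [hμ.ae_stable hS hsum (s + t), hμ.ae_stable hS hsum t,
      (hμ.measurePreserving_shift hS hsum t).quasiMeasurePreserving.ae
        (hμ.ae_stable hS hsum s)] with x h1 h2 h3
    refine eq_shift h1 ?_
    filter_upwards [shift_spec h3, shift_spec h2] with n h4 h5
    rw [h4, h5, QuotientAddGroup.mk_add, add_assoc]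
  shift_zero := by
    filter_upwards [hμ.ae_stable hS hsum 0] with x h1
    refine eq_shift h1 (Eventually.of_forall fun n => ?_)
    simp

/-- The correlation function of a cylindric function is the limit of those of its lifts. -/
theorem tendsto_correlation (hμ : IsLimitMeasure α ν μ)
    (hsum : Summable fun n => 1 / lenR h₁ q n) {n : ℕ} {F : Space K d h₁ q n → ℂ}
    (hF : Measurable F) {B : ℝ} (hB : ∀ x, ‖F x‖ ≤ B) (t : Fin d → K) :
    Tendsto (fun k => corr (uniform K d h₁ q ν (n + k)) (F ∘ descend α n k)
      (QuotientAddGroup.mk t)) atTop (𝓝 (correlation α μ (cyl α F) t)) := by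
  have := hμ.isProbabilityMeasure
  have := fun n => hS.measurableAdd₂ (h₁ := h₁) (q := q) n
  have hm : ∀ k, Measurable fun z : Space K d h₁ q (n + k) =>
      F (descend α n k (QuotientAddGroup.mk t + z)) * (starRingEnd ℂ) (F (descend α n k z)) :=
    fun k => (hF.comp ((hS.measurable_descend α n k).comp (measurable_const_add _))).mul
      (measurable_conj (hF.comp (hS.measurable_descend α n k)))
  have e1 : ∀ k, corr (uniform K d h₁ q ν (n + k)) (F ∘ descend α n k) (QuotientAddGroup.mk t) =
      ∫ x, F (descend α n k (QuotientAddGroup.mk t + x.1 (n + k))) *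
        (starRingEnd ℂ) (F (x.1 n)) ∂μ := fun k => by
    rw [corr, ← (hμ.measurePreserving_coord (n + k)).map_eq]
    refine (integral_map (measurable_coord α (n + k)).aemeasurable
      (hm k).aestronglyMeasurable).trans ?_
    simp only [descend_coord]
  simp_rw [e1]
  refine tendsto_integral_of_dominated_convergence (fun _ => B ^ 2) (fun k => ?_)
    (integrable_const _) (fun k => Eventually.of_forall fun x => norm_mul_conj_le (hB _) (hB _)) ?_
  · have := (hm k).comp (measurable_coord α (n + k))
    simp only [Function.comp_def, descend_coord] at this
    exact this.aestronglyMeasurable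
  · filter_upwards [hμ.ae_stable hS hsum t] with x hx
    refine tendsto_const_nhds.congr' ?_
    filter_upwards [eventually_shift_coord hx n] with k hk
    rw [cyl, cyl, hk]

end IsLimitMeasure
end Limit

end Iceberg

namespace Iceberg

/-! ### A rapidly growing sequence -/

section Growth

/-- The side lengths for the sequence `sparse h₁`. -/
def sparseSide (h₁ : ℕ+) : ℕ → ℕ+
  | 0 => h₁
  | n + 1 => (4 * sparseSide h₁ n) ^ (n + 2) * sparseSide h₁ n

/-- A sequence `q` with `q n = (4 * h n) ^ (n + 2)`. -/
def sparse (h₁ : ℕ+) (n : ℕ) : ℕ+ := (4 * sparseSide h₁ n) ^ (n + 2)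

theorem side_sparse (h₁ : ℕ+) (n : ℕ) : side h₁ (sparse h₁) n = sparseSide h₁ n := by
  induction n with
  | zero => rfl
  | succ n ih => rw [side, ih]; rfl

theorem sparse_eq (h₁ : ℕ+) (n : ℕ) :
    ((sparse h₁ n : ℕ) : ℝ) = (4 * lenR h₁ (sparse h₁) n) ^ (n + 2) := by
  rw [lenR, side_sparse, sparse]
  push_cast
  rfl

variable {h₁ : ℕ+} {q : ℕ → ℕ+} (hq : ∀ n, ((q n : ℕ) : ℝ) = (4 * lenR h₁ q n) ^ (n + 2))
include hq

theorem sixteen_mul_le (n : ℕ) : 16 * lenR h₁ q n ^ 2 ≤ ((q n : ℕ) : ℝ) := by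
  have h := one_le_lenR h₁ q n
  rw [hq]
  calc 16 * lenR h₁ q n ^ 2 = (4 * lenR h₁ q n) ^ 2 := by ring
    _ ≤ _ := pow_le_pow_right₀ (by linarith) (by omega)

theorem four_mul_lenR_le (n : ℕ) : 4 * lenR h₁ q n ≤ ((q n : ℕ) : ℝ) := by
  have h := one_le_lenR h₁ q n
  have := sixteen_mul_le hq n
  nlinarith

theorem four_le_q (n : ℕ) : (4 : ℝ) ≤ ((q n : ℕ) : ℝ) := by
  have h := one_le_lenR h₁ q n
  have := four_mul_lenR_le hq n
  linarith

theorem four_mul_lenR_le_succ (n : ℕ) : 4 * lenR h₁ q n ≤ lenR h₁ q (n + 1) := by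
  have h := lenR_pos h₁ q n
  rw [lenR_succ]
  exact mul_le_mul_of_nonneg_right (four_le_q hq n) h.le

theorem four_pow_mul_lenR_le (n k : ℕ) : 4 ^ k * lenR h₁ q n ≤ lenR h₁ q (n + k) := by
  induction k with
  | zero => simp
  | succ k ih =>
    have := four_mul_lenR_le_succ hq (n + k)
    rw [pow_succ]
    change _ ≤ lenR h₁ q (n + k + 1)
    linarith

theorem four_pow_le_lenR (n : ℕ) : 4 ^ n ≤ lenR h₁ q n := by
  have h1 := one_le_lenR h₁ q 0
  have h2 := four_pow_mul_lenR_le hq 0 n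
  rw [zero_add] at h2
  nlinarith [pow_pos (by norm_num : (0 : ℝ) < 4) n]

theorem natCast_le_lenR (n : ℕ) : (n : ℝ) ≤ lenR h₁ q n := by
  refine le_trans ?_ (four_pow_le_lenR hq n)
  exact_mod_cast (Nat.lt_pow_self (by norm_num : 1 < 4)).le

theorem tendsto_lenR : Tendsto (lenR h₁ q) atTop atTop :=
  tendsto_atTop_mono (natCast_le_lenR hq) tendsto_natCast_atTop_atTop

theorem lenR_le_q (n : ℕ) : lenR h₁ q n ≤ ((q n : ℕ) : ℝ) := by
  have := four_mul_lenR_le hq n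
  have := lenR_pos h₁ q n
  linarith

theorem tendsto_q_real : Tendsto (fun n => ((q n : ℕ) : ℝ)) atTop atTop :=
  tendsto_atTop_mono (lenR_le_q hq) (tendsto_lenR hq)

theorem tendsto_q : Tendsto (fun n => (q n : ℕ)) atTop atTop :=
  tendsto_natCast_atTop_iff.1 (tendsto_q_real hq)

theorem two_mul_q_lt (n : ℕ) : 2 * (q n : ℕ) < q (n + 1) := by
  have h := one_le_lenR h₁ q n
  have h1 := four_mul_lenR_le hq (n + 1)
  have h2 := four_le_q hq n
  rw [lenR_succ] at h1
  have : (2 : ℝ) * (q n : ℕ) < ((q (n + 1) : ℕ) : ℝ) := by nlinarith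
  exact_mod_cast this

theorem summable_inv_lenR : Summable fun n => 1 / lenR h₁ q n := by
  refine Summable.of_nonneg_of_le (fun n => ?_) (fun n => ?_)
    (summable_geometric_of_lt_one (by norm_num : (0 : ℝ) ≤ 1 / 4) (by norm_num))
  · have := lenR_pos h₁ q n
    positivity
  · rw [one_div_pow]
    exact one_div_le_one_div_of_le (by positivity) (four_pow_le_lenR hq n)

/-- The sequence `q` grows faster than any power of `h`. -/
theorem eventually_rpow_le (A : ℝ) {θ : ℝ} (hθ : 0 < θ) :
    ∀ᶠ n in atTop, lenR h₁ q n ^ A ≤ ((q n : ℕ) : ℝ) ^ θ := by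
  obtain ⟨N, hN⟩ := exists_nat_ge (A / θ)
  filter_upwards [eventually_ge_atTop N] with n hn
  have h := one_le_lenR h₁ q n
  have hn' : A ≤ (n + 2 : ℕ) * θ := by
    have : (N : ℝ) ≤ n := by exact_mod_cast hn
    rw [div_le_iff₀ hθ] at hN
    push_cast
    nlinarith
  rw [hq, ← Real.rpow_natCast, ← Real.rpow_mul (by positivity)]
  calc lenR h₁ q n ^ A ≤ lenR h₁ q n ^ ((n + 2 : ℕ) * θ) := Real.rpow_le_rpow_of_exponent_le h hn'
    _ ≤ _ := Real.rpow_le_rpow (by positivity) (by linarith) (by positivity)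

/-- From `4 * h ≤ exp (4 * h)` and `n + 2 ≤ 3 * h`. This bounds `log q` polynomially in `h`, which
the union bound over the grid requires. -/
theorem q_le_exp (n : ℕ) : ((q n : ℕ) : ℝ) ≤ Real.exp (12 * lenR h₁ q n ^ 2) := by
  have h := one_le_lenR h₁ q n
  have h1 := natCast_le_lenR hq n
  have h2 : 4 * lenR h₁ q n ≤ Real.exp (4 * lenR h₁ q n) := by
    linarith [Real.add_one_le_exp (4 * lenR h₁ q n)]
  rw [hq]
  refine (pow_le_pow_left₀ (by positivity) h2 _).trans ?_
  rw [← Real.exp_nat_mul]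
  refine Real.exp_le_exp.2 ?_
  push_cast
  nlinarith

theorem lenR_succ_le_exp (n : ℕ) : lenR h₁ q (n + 1) ≤ Real.exp (13 * lenR h₁ q n ^ 2) := by
  have h := one_le_lenR h₁ q n
  have h2 : lenR h₁ q n ≤ Real.exp (lenR h₁ q n ^ 2) := by
    nlinarith [Real.add_one_le_exp (lenR h₁ q n ^ 2)]
  rw [lenR_succ]
  calc _ ≤ Real.exp (12 * lenR h₁ q n ^ 2) * Real.exp (lenR h₁ q n ^ 2) :=
        mul_le_mul (q_le_exp hq n) h2 (by positivity) (by positivity)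
    _ = _ := by rw [← Real.exp_add]; ring_nf

/-- The union bound over the points of a fine grid is summable. -/
theorem summable_grid (d : ℕ) (C : ℝ) : Summable fun n =>
    (lenR h₁ q (n + 1) * ((q n : ℕ) : ℝ) ^ d) ^ d * (4 * Real.exp (C - lenR h₁ q n ^ 3)) := by
  have hdom : Summable fun n : ℕ => 4 * Real.exp (-(n : ℝ)) :=
    Real.summable_exp_neg_nat.mul_left 4
  refine hdom.of_norm_bounded_eventually_nat ?_
  -- The grid has at most `exp (D * h ^ 2)` points, by `h (n + 1) ≤ exp (13 * h ^ 2)` and `q ≤ exp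
  -- (12 * h ^ 2)`; the cubic exponent of the tail bound wins.
  set D : ℝ := (13 + d * 12) * d with hD
  filter_upwards [(tendsto_lenR hq).eventually_ge_atTop (D + |C| + 1)] with n hn
  have h := one_le_lenR h₁ q n
  have h0 := lenR_pos h₁ q (n + 1)
  have hC := abs_nonneg C
  have hD0 : 0 ≤ D := by positivity
  rw [Real.norm_of_nonneg (by positivity)]
  have h1 : (lenR h₁ q (n + 1) * ((q n : ℕ) : ℝ) ^ d) ^ d ≤ Real.exp (D * lenR h₁ q n ^ 2) := by
    calc _ ≤ (Real.exp (13 * lenR h₁ q n ^ 2) * Real.exp (12 * lenR h₁ q n ^ 2) ^ d) ^ d := by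
          gcongr
          · exact lenR_succ_le_exp hq n
          · exact q_le_exp hq n
      _ = _ := by
          rw [← Real.exp_nat_mul, ← Real.exp_add, ← Real.exp_nat_mul]
          congr 1
          rw [hD]
          ring
  have h3 := natCast_le_lenR hq n
  calc _ ≤ Real.exp (D * lenR h₁ q n ^ 2) * (4 * Real.exp (C - lenR h₁ q n ^ 3)) := by gcongr
    _ = 4 * Real.exp (D * lenR h₁ q n ^ 2 + (C - lenR h₁ q n ^ 3)) := by
        rw [Real.exp_add]; ring
    _ ≤ _ := by
        gcongr
        have h4 : C ≤ |C| := le_abs_self C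
        have h5 : lenR h₁ q n ^ 3 ≥ (D + |C| + 1) * lenR h₁ q n ^ 2 := by
          nlinarith [sq_nonneg (lenR h₁ q n)]
        nlinarith [mul_nonneg hC (by nlinarith : (0 : ℝ) ≤ lenR h₁ q n ^ 2 - 1)]

end Growth

end Iceberg

namespace Iceberg

/-! ### One step of the construction with random rotations -/

section Step

variable {K : Type*} [CommRing K] [LinearOrder K] [IsStrictOrderedRing K] [Archimedean K]
  {d : ℕ} {h₁ : ℕ+} {q : ℕ → ℕ+}

/-- The displacements of the blocks of `M (n + 1)` that the translation by `t` produces: in each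
coordinate there may be a carry. -/
def displacement (h₁ : ℕ+) (q : ℕ → ℕ+) (e : K →+* ℝ) (n : ℕ) (t : Fin d → K)
    (ε : Fin d → Bool) : lattice K d h₁ q n :=
  ⟨fun i => (⌊e (t i) / lenR h₁ q n⌋ + if ε i then 1 else 0) • len K h₁ q n, by
    rw [mem_lattice]; exact fun i => ⟨_, rfl⟩⟩

/-- The coordinates in which adding `u` to `t` produces a carry. -/
def carry (h₁ : ℕ+) (q : ℕ → ℕ+) (e : K →+* ℝ) (n : ℕ) (t u : Fin d → K) (i : Fin d) : Bool :=
  decide (⌊e (t i + u i) / lenR h₁ q n⌋ = ⌊e (t i) / lenR h₁ q n⌋ + 1)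

/-- The blocks from which or to which points of the block `γ` move under the translation by `t`. -/
def neighbours (e : K →+* ℝ) (n : ℕ) (t : Fin d → K) (γ : Block K d h₁ q n) :
    Finset (Block K d h₁ q n) :=
  (Finset.univ.image fun ε => QuotientAddGroup.mk (displacement h₁ q e n t ε) + γ) ∪
    Finset.univ.image fun ε => γ - QuotientAddGroup.mk (displacement h₁ q e n t ε)

theorem card_neighbours_le (e : K →+* ℝ) (n : ℕ) (t : Fin d → K) (γ : Block K d h₁ q n) :
    ((neighbours e n t γ).card : ℝ) ≤ 2 * 2 ^ d := by
  have h1 : (neighbours e n t γ).card ≤ 2 ^ d + 2 ^ d := by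
    refine (Finset.card_union_le _ _).trans (add_le_add ?_ ?_) <;>
    · refine Finset.card_image_le.trans ?_
      simp
  calc ((neighbours e n t γ).card : ℝ) ≤ ((2 ^ d + 2 ^ d : ℕ) : ℝ) := by exact_mod_cast h1
    _ = _ := by push_cast; ring

variable [MeasurableSpace K] [MeasurableAdd₂ K] [MeasurableNeg K]

/-- The random part of the correlation function after one gluing step. -/
def fluct (ν : Measure (Fin d → K)) (n : ℕ) (F : Space K d h₁ q n → ℂ)
    (a : Block K d h₁ q n → Space K d h₁ q n) (z : Space K d h₁ q (n + 1)) : ℂ :=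
  corr (uniform K d h₁ q ν (n + 1)) (F ∘ glueWith n a) z -
    stay ν n z * corr (uniform K d h₁ q ν n) F (proj K d h₁ q n z)

namespace IsStandard

variable {e : K →+* ℝ} {ν : Measure (Fin d → K)} (hS : IsStandard e ν)
include hS

theorem corner_apply (n : ℕ) (a : Fin d → K) (i : Fin d) :
    (corner K d h₁ q n a : Fin d → K) i = ⌊e (a i) / lenR h₁ q n⌋ • len K h₁ q n := by
  rw [← map_len e n, ← toIcoDiv_eq_floor hS.strictMono (len_pos K h₁ q n)]
  rfl

theorem floor_add_mem (n : ℕ) (t : K) {u : K} (hu : u ∈ Set.Ico 0 (len K h₁ q n)) :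
    ⌊e (t + u) / lenR h₁ q n⌋ = ⌊e t / lenR h₁ q n⌋ ∨
      ⌊e (t + u) / lenR h₁ q n⌋ = ⌊e t / lenR h₁ q n⌋ + 1 := by
  have hl := lenR_pos h₁ q n
  have h0 : 0 ≤ e u := by simpa using hS.strictMono.monotone hu.1
  have h1 : e u < lenR h₁ q n := by rw [← map_len e n]; exact hS.strictMono hu.2
  have h2 : e (t + u) / lenR h₁ q n = e t / lenR h₁ q n + e u / lenR h₁ q n := by
    rw [map_add, add_div]
  have h3 : 0 ≤ e u / lenR h₁ q n := by positivity
  have h4 : e u / lenR h₁ q n < 1 := by rwa [div_lt_one hl]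
  have h5 : ⌊e t / lenR h₁ q n⌋ ≤ ⌊e (t + u) / lenR h₁ q n⌋ := by
    rw [h2]; exact Int.floor_mono (by linarith)
  have h6 : ⌊e (t + u) / lenR h₁ q n⌋ < ⌊e t / lenR h₁ q n⌋ + 2 := by
    rw [h2, Int.floor_lt]
    push_cast
    linarith [Int.lt_floor_add_one (e t / lenR h₁ q n)]
  omega

/-- Adding a point of the cube raises each floor by `0` or `1`. A translation therefore realizes at
most `2 ^ d` displacements, and the number of neighbours of a block is bounded independently of `q`.
-/
theorem corner_add_eq (n : ℕ) (t : Fin d → K) {u : Fin d → K} (hu : u ∈ cube K d h₁ q n) :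
    corner K d h₁ q n (t + u) = displacement h₁ q e n t (carry h₁ q e n t u) := by
  ext i
  rw [hS.corner_apply]
  change _ = (_ + if carry h₁ q e n t u i = true then (1 : ℤ) else 0) • _
  rw [Pi.add_apply]
  rcases hS.floor_add_mem n (t i) (hu i) with h | h
  · have hc : carry h₁ q e n t u i = false := by simp only [carry, h, decide_eq_false_iff_not]; omega
    rw [hc, h]; simp
  · have hc : carry h₁ q e n t u i = true := by simp only [carry, h, decide_true]
    rw [hc, h]; simp

theorem block_mk_add (n : ℕ) (t : Fin d → K) (x : Space K d h₁ q (n + 1)) :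
    block K d h₁ q n (QuotientAddGroup.mk t + x) =
      QuotientAddGroup.mk (displacement h₁ q e n t
        (carry h₁ q e n t (rep n (proj K d h₁ q n x)))) + block K d h₁ q n x := by
  rw [block_translate, hS.corner_add_eq n t (rep_mem _)]

variable [ν.IsAddLeftInvariant]

theorem pairing (n : ℕ) (t : Fin d → K) :
    Pairing (uniform K d h₁ q ν (n + 1)) (block K d h₁ q n)
      (fun x => block K d h₁ q n (QuotientAddGroup.mk t + x)) (proj K d h₁ q n)
      (fun x => QuotientAddGroup.mk t + proj K d h₁ q n x) (1 / ((q n : ℕ) : ℝ) ^ d)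
      (neighbours e n t) := by
  have := hS.measurableAdd₂ (h₁ := h₁) (q := q) (n + 1)
  have := hS.measurableAdd₂ (h₁ := h₁) (q := q) n
  have := hS.isAddLeftInvariant_uniform (h₁ := h₁) (q := q) (n + 1)
  refine ⟨hS.measurableSet_block n, fun γ => ?_, hS.measurable_proj n,
    (measurable_const_add _).comp (hS.measurable_proj n), fun γ => (hS.measureReal_block n γ).le,
    fun γ => ?_, fun x => ?_, fun x => ?_⟩
  · exact (measurable_const_add _) (hS.measurableSet_block n γ)
  · have h := (measurePreserving_add_left (uniform K d h₁ q ν (n + 1))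
      (QuotientAddGroup.mk t)).measureReal_preimage
      (hS.measurableSet_block n γ).nullMeasurableSet
    exact (h.trans (hS.measureReal_block n γ)).le
  · rw [hS.block_mk_add]
    exact Finset.mem_union_left _ (Finset.mem_image_of_mem _ (Finset.mem_univ _))
  · refine Finset.mem_union_right _ (Finset.mem_image.2 ⟨carry h₁ q e n t (rep n (proj K d h₁ q n x)),
      Finset.mem_univ _, ?_⟩)
    rw [hS.block_mk_add, add_sub_cancel_left]

theorem fluct_mk {n : ℕ} {F : Space K d h₁ q n → ℂ} (hF : Measurable F) {B : ℝ}
    (hB : ∀ x, ‖F x‖ ≤ B) (a : Block K d h₁ q n → Space K d h₁ q n) (t : Fin d → K) :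
    fluct ν n F a (QuotientAddGroup.mk t) =
      quad (uniform K d h₁ q ν n) (uniform K d h₁ q ν (n + 1)) F (block K d h₁ q n)
        (fun x => block K d h₁ q n (QuotientAddGroup.mk t + x)) (proj K d h₁ q n)
        (fun x => QuotientAddGroup.mk t + proj K d h₁ q n x) Finset.univ a := by
  have := hS.measurableAdd₂ (h₁ := h₁) (q := q) n
  have := hS.measurableNeg (h₁ := h₁) (q := q) n
  have := hS.isAddLeftInvariant_uniform (h₁ := h₁) (q := q) n
  have := hS.isProbabilityMeasure_uniform (h₁ := h₁) (q := q) n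
  have := hS.isProbabilityMeasure_uniform (h₁ := h₁) (q := q) (n + 1)
  rw [(hS.pairing n t).quad_univ hF hB (fun x => rfl) a, fluct]
  have hst : stay ν n (QuotientAddGroup.mk t : Space K d h₁ q (n + 1)) =
      (uniform K d h₁ q ν (n + 1)).real
        {x | block K d h₁ q n x = block K d h₁ q n (QuotientAddGroup.mk t + x)} := by
    rw [stay]
    congr 1
    ext x
    exact eq_comm
  rw [hst, corr]
  simp only [Function.comp_apply, glueWith, map_add, proj_mk]

/-- The random part is small with a probability close to one. -/
theorem measure_lt_fluct_le {n : ℕ} {F : Space K d h₁ q n → ℂ} (hF : Measurable F) {B : ℝ}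
    (hB : ∀ x, ‖F x‖ ≤ B) (hF0 : ∫ x, F x ∂(uniform K d h₁ q ν n) = 0)
    (hQ : (4 * B ^ 2) ^ 2 ≤ ((q n : ℕ) : ℝ) ^ d) (l : ℝ) (z : Space K d h₁ q (n + 1)) :
    (Measure.infinitePi fun _ : Block K d h₁ q n => uniform K d h₁ q ν n)
      {a | 2 * l / √(((q n : ℕ) : ℝ) ^ d) < ‖fluct ν n F a z‖} ≤
      4 * ENNReal.ofReal (Real.exp (16 * B ^ 4 - l)) := by
  have := hS.measurableAdd₂ (h₁ := h₁) (q := q) n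
  have := hS.measurableNeg (h₁ := h₁) (q := q) n
  have := hS.isAddLeftInvariant_uniform (h₁ := h₁) (q := q) n
  have := hS.isProbabilityMeasure_uniform (h₁ := h₁) (q := q) n
  have := hS.isProbabilityMeasure_uniform (h₁ := h₁) (q := q) (n + 1)
  induction z using QuotientAddGroup.induction_on with
  | H t =>
    have hq0 : (0 : ℝ) < ((q n : ℕ) : ℝ) ^ d := pow_pos (by exact_mod_cast (q n).pos) _
    set Q : ℝ := ((q n : ℕ) : ℝ) ^ d with hQdef
    have hr : 0 < √Q := Real.sqrt_pos.2 hq0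
    have hrr : √Q * √Q = Q := Real.mul_self_sqrt hq0.le
    have hfam := (hS.pairing n t).incrementFamily (μ := uniform K d h₁ q ν n) hF hB hF0
    -- The increments are at most `4 * B ^ 2 / Q`, so `r = √Q` gives `c = 4 * B ^ 2 / √Q`, which is
    -- at most one by `hQ`. With `Q` blocks, `card * c ^ 2 = 16 * B ^ 4` does not depend on the
    -- level.
    have h1 := hfam.measure_lt_norm_le (r := √Q) (c := 4 * B ^ 2 / √Q) hr (le_of_eq (by
      field_simp
      rw [sq, hrr, mul_comm])) (by
      rw [div_le_one hr]
      exact Real.le_sqrt_of_sq_le hQ) Finset.univ l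
    have h2 : ((Finset.univ : Finset (Block K d h₁ q n)).card : ℝ) * (4 * B ^ 2 / √Q) ^ 2 =
        16 * B ^ 4 := by
      rw [Finset.card_univ, hS.card_block n]
      push_cast
      rw [div_pow, sq (√Q), hrr]
      change Q * _ = _
      field_simp
      ring
    rw [h2] at h1
    simp_rw [hS.fluct_mk hF hB]
    exact h1

omit [ν.IsAddLeftInvariant] in
/-- A translation by less than half of the side of the torus does not fix a block. -/
theorem displacement_floor (n : ℕ) {t : Fin d → K} {m : ℕ} {i : Fin d}
    (ht : lenR h₁ q n ≤ e (t i) ∧ e (t i) < m * lenR h₁ q n) (ε : Fin d → Bool) :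
    ∃ k : ℤ, 1 ≤ k ∧ k ≤ m ∧ (displacement h₁ q e n t ε : Fin d → K) i = k • len K h₁ q n := by
  have hl := lenR_pos h₁ q n
  refine ⟨_, ?_, ?_, rfl⟩
  · have : 1 ≤ ⌊e (t i) / lenR h₁ q n⌋ := by
      rw [Int.le_floor, Int.cast_one, le_div_iff₀ hl]
      linarith [ht.1]
    split_ifs <;> omega
  · have : ⌊e (t i) / lenR h₁ q n⌋ < m := by
      rw [Int.floor_lt, div_lt_iff₀ hl]
      exact_mod_cast ht.2
    split_ifs <;> omega

omit hS [ν.IsAddLeftInvariant] in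
theorem ne_zero_of_coord {n : ℕ} {γ : lattice K d h₁ q n} {i : Fin d} {k : ℤ} (hk : 0 < k)
    (hkq : k < (q n : ℕ)) (h : (γ : Fin d → K) i = k • len K h₁ q n) :
    (QuotientAddGroup.mk γ : Block K d h₁ q n) ≠ 0 := by
  intro h0
  rw [QuotientAddGroup.eq_zero_iff, AddSubgroup.mem_addSubgroupOf, mem_lattice] at h0
  obtain ⟨l, hl⟩ := h0 i
  have hlen := len_pos K h₁ q n
  rw [h, len_succ, ← mul_smul] at hl
  have h2 : l * ((q n : ℕ) : ℤ) = k := by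
    have := sub_eq_zero.2 hl
    rw [← sub_smul, smul_eq_zero] at this
    rcases this with h | h
    · omega
    · exact absurd h hlen.ne'
  have hl0 : 0 < l := by
    by_contra hcon
    have : l * ((q n : ℕ) : ℤ) ≤ 0 := mul_nonpos_of_nonpos_of_nonneg (by omega) (by omega)
    omega
  nlinarith

omit [ν.IsAddLeftInvariant] in
theorem block_ne (n : ℕ) {t : Fin d → K} {m : ℕ} (hm : 2 * m < (q n : ℕ)) (i : Fin d)
    (ht : lenR h₁ q n ≤ e (t i) ∧ e (t i) < m * lenR h₁ q n) (x : Space K d h₁ q (n + 1)) :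
    block K d h₁ q n x ≠ block K d h₁ q n (QuotientAddGroup.mk t + x) := by
  rw [hS.block_mk_add]
  obtain ⟨k, h1, h2, h3⟩ := hS.displacement_floor n ht
    (carry h₁ q e n t (rep n (proj K d h₁ q n x)))
  intro h
  exact ne_zero_of_coord (by omega) (by omega) h3 (right_eq_add.1 h)

omit [ν.IsAddLeftInvariant] in
-- A swap would make the sum of two displacements trivial. In the coordinate `i` this sum is between
-- `2` and `2 * m` steps of length `h n`, which is less than a full period `q` of the torus.
theorem block_no_swap (n : ℕ) {t : Fin d → K} {m : ℕ} (hm : 2 * m < (q n : ℕ)) (i : Fin d)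
    (ht : lenR h₁ q n ≤ e (t i) ∧ e (t i) < m * lenR h₁ q n) (x x' : Space K d h₁ q (n + 1)) :
    ¬ (block K d h₁ q n x = block K d h₁ q n (QuotientAddGroup.mk t + x') ∧
      block K d h₁ q n (QuotientAddGroup.mk t + x) = block K d h₁ q n x') := by
  rw [hS.block_mk_add, hS.block_mk_add]
  obtain ⟨k, h1, h2, h3⟩ := hS.displacement_floor n ht
    (carry h₁ q e n t (rep n (proj K d h₁ q n x)))
  obtain ⟨k', h1', h2', h3'⟩ := hS.displacement_floor n ht
    (carry h₁ q e n t (rep n (proj K d h₁ q n x')))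
  generalize displacement h₁ q e n t (carry h₁ q e n t (rep n (proj K d h₁ q n x))) = D at h3 ⊢
  generalize displacement h₁ q e n t (carry h₁ q e n t (rep n (proj K d h₁ q n x'))) = D' at h3' ⊢
  rintro ⟨ha, hb⟩
  rw [← hb, ← add_assoc, ← QuotientAddGroup.mk_add] at ha
  have h4 : ((D' + D : lattice K d h₁ q n) : Fin d → K) i = (k' + k) • len K h₁ q n := by
    rw [AddSubgroup.coe_add, Pi.add_apply, h3, h3', add_smul]
  exact ne_zero_of_coord (by omega) (by omega) h4 (right_eq_add.1 ha)

theorem stay_eq_zero (n : ℕ) {t : Fin d → K} {m : ℕ} (hm : 2 * m < (q n : ℕ)) (i : Fin d)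
    (ht : lenR h₁ q n ≤ e (t i) ∧ e (t i) < m * lenR h₁ q n) :
    stay ν n (QuotientAddGroup.mk t : Space K d h₁ q (n + 1)) = 0 := by
  have : {x | block K d h₁ q n (QuotientAddGroup.mk t + x) = block K d h₁ q n x} = ∅ :=
    Set.eq_empty_of_forall_notMem fun x hx => hS.block_ne n hm i ht x hx.symm
  rw [stay, this, measureReal_empty]

end IsStandard
end Step

end Iceberg

namespace Iceberg

/-! ### Regular functions -/

section Regularity

variable {K : Type*} [CommRing K] [LinearOrder K] [IsStrictOrderedRing K] [Archimedean K]
  {d : ℕ} {h₁ : ℕ+} {q : ℕ → ℕ+} [MeasurableSpace K] [MeasurableAdd₂ K] [MeasurableNeg K]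

/-- Bounded functions with mean zero and given second moment which are Lipschitz continuous in
the mean. -/
structure Regular (e : K →+* ℝ) (ν : Measure (Fin d → K)) {n : ℕ} (F : Space K d h₁ q n → ℂ)
    (B L s : ℝ) : Prop where
  measurable : Measurable F
  norm_le : ∀ x, ‖F x‖ ≤ B
  integral_eq_zero : ∫ x, F x ∂(uniform K d h₁ q ν n) = 0
  lipschitz : ∀ t : Fin d → K, ∫ x, ‖F (QuotientAddGroup.mk t + x) - F x‖ ∂(uniform K d h₁ q ν n) ≤
    L * ∑ i, |e (t i)|
  integral_sq : ∫ x, ‖F x‖ ^ 2 ∂(uniform K d h₁ q ν n) = s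

namespace Regular

variable {e : K →+* ℝ} {ν : Measure (Fin d → K)} {n : ℕ} {F : Space K d h₁ q n → ℂ} {B L s : ℝ}

theorem mono {L' : ℝ} (hF : Regular e ν F B L s) (h : L ≤ L') : Regular e ν F B L' s where
  measurable := hF.measurable
  norm_le := hF.norm_le
  integral_eq_zero := hF.integral_eq_zero
  lipschitz t := (hF.lipschitz t).trans
    (mul_le_mul_of_nonneg_right h (Finset.sum_nonneg fun i _ => abs_nonneg _))
  integral_sq := hF.integral_sq

theorem bound_nonneg (hF : Regular e ν F B L s) : 0 ≤ B := (norm_nonneg _).trans (hF.norm_le 0)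

variable (hS : IsStandard e ν) [ν.IsAddLeftInvariant]
include hS

omit hS [ν.IsAddLeftInvariant] in
theorem norm_sub_le (hF : Regular e ν F B L s) (x y : Space K d h₁ q n) : ‖F x - F y‖ ≤ 2 * B := by
  have h1 := hF.norm_le x
  have h2 := hF.norm_le y
  have h3 := _root_.norm_sub_le (F x) (F y)
  linarith

theorem integrable_diff (hF : Regular e ν F B L s) (t : Fin d → K) :
    Integrable (fun x => ‖F (QuotientAddGroup.mk t + x) - F x‖) (uniform K d h₁ q ν n) := by
  have := hS.isProbabilityMeasure_uniform (h₁ := h₁) (q := q) n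
  have := hS.measurableAdd₂ (h₁ := h₁) (q := q) n
  exact (IncrementFamily.integrable_of_norm_le
    ((hF.measurable.comp (measurable_const_add _)).sub hF.measurable)
    fun x => hF.norm_sub_le _ _).norm

/-- Continuity in the mean suffices, because the second factor of the correlation is bounded. Glued
functions jump at the walls between blocks and satisfy no better bound uniformly. -/
theorem norm_corr_sub_le (hF : Regular e ν F B L s) (t : Fin d → K) (z : Space K d h₁ q n) :
    ‖corr (uniform K d h₁ q ν n) F (QuotientAddGroup.mk t + z) -
      corr (uniform K d h₁ q ν n) F z‖ ≤ B * L * ∑ i, |e (t i)| := by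
  have := hS.isProbabilityMeasure_uniform (h₁ := h₁) (q := q) n
  have := hS.measurableAdd₂ (h₁ := h₁) (q := q) n
  have := hS.isAddLeftInvariant_uniform (h₁ := h₁) (q := q) n
  have hB := hF.bound_nonneg
  have hi : ∀ w : Space K d h₁ q n, Integrable (fun x => F (w + x) * (starRingEnd ℂ) (F x))
      (uniform K d h₁ q ν n) := fun w => IncrementFamily.integrable_of_norm_le
    ((hF.measurable.comp (measurable_const_add w)).mul (measurable_conj hF.measurable))
    fun x => norm_mul_conj_le (hF.norm_le _) (hF.norm_le _)
  rw [corr, corr, ← integral_sub (hi _) (hi _)]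
  calc _ ≤ ∫ x, B * ‖F (QuotientAddGroup.mk t + (z + x)) - F (z + x)‖
        ∂(uniform K d h₁ q ν n) := by
        refine norm_integral_le_of_norm_le ((((measurePreserving_add_left _ z).integrable_comp
          (hF.integrable_diff hS t).aestronglyMeasurable).2 (hF.integrable_diff hS t)).const_mul B) (Eventually.of_forall fun x => ?_)
        rw [← sub_mul, norm_mul, RCLike.norm_conj, mul_comm, add_assoc]
        exact mul_le_mul_of_nonneg_right (hF.norm_le x) (norm_nonneg _)
    _ = B * ∫ x, ‖F (QuotientAddGroup.mk t + x) - F x‖ ∂(uniform K d h₁ q ν n) := by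
        rw [integral_const_mul,
          integral_add_left_eq_self (fun x => ‖F (QuotientAddGroup.mk t + x) - F x‖) z]
    _ ≤ _ := by
        rw [mul_assoc]
        exact mul_le_mul_of_nonneg_left (hF.lipschitz t) hB

omit hS [ν.IsAddLeftInvariant] in
theorem corr_zero (hF : Regular e ν F B L s) : corr (uniform K d h₁ q ν n) F 0 = (s : ℂ) := by
  rw [corr, ← hF.integral_sq, ← integral_complex_ofReal]
  congr 1
  funext x
  rw [zero_add, Complex.mul_conj, Complex.normSq_eq_norm_sq]

theorem le_norm_corr (hF : Regular e ν F B L s) (t : Fin d → K) :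
    s - B * L * ∑ i, |e (t i)| ≤ ‖corr (uniform K d h₁ q ν n) F (QuotientAddGroup.mk t)‖ := by
  have h := hF.norm_corr_sub_le hS t 0
  rw [add_zero, hF.corr_zero] at h
  have h2 := norm_sub_norm_le (s : ℂ) (corr (uniform K d h₁ q ν n) F (QuotientAddGroup.mk t))
  rw [norm_sub_rev] at h2
  have h3 : s ≤ ‖(s : ℂ)‖ := by
    rw [Complex.norm_real]; exact le_abs_self s
  linarith

/-- Away from points that change their block, the glued function varies like `F` at the image point.
The exceptional set has mass at most `(∑ i, |e (t i)|) / h n` and costs `2 * B` there. -/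
theorem glueWith (hF : Regular e ν F B L s) (a : Block K d h₁ q n → Space K d h₁ q n) :
    Regular e ν (F ∘ glueWith n a) B (L + 2 * B * (1 / lenR h₁ q n)) s where
  measurable := hF.measurable.comp (hS.measurable_glueWith n a)
  norm_le x := hF.norm_le _
  integral_eq_zero := by
    rw [← hF.integral_eq_zero, ← (hS.measurePreserving_glueWith n a).map_eq,
      integral_map (hS.measurable_glueWith n a).aemeasurable hF.measurable.aestronglyMeasurable]
    rfl
  integral_sq := by
    rw [← hF.integral_sq, ← (hS.measurePreserving_glueWith n a).map_eq,
      integral_map (hS.measurable_glueWith n a).aemeasurable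
        (hF.measurable.norm.pow_const 2).aestronglyMeasurable]
    rfl
  lipschitz t := by
    have := hS.isProbabilityMeasure_uniform (h₁ := h₁) (q := q) (n + 1)
    have := hS.measurableAdd₂ (h₁ := h₁) (q := q) (n + 1)
    have hB := hF.bound_nonneg
    have hg := hS.measurePreserving_glueWith (h₁ := h₁) (q := q) n a
    set D := {x : Space K d h₁ q (n + 1) |
      block K d h₁ q n (QuotientAddGroup.mk t + x) ≠ block K d h₁ q n x}
    have hD : MeasurableSet D := (hS.measurableSet_stay n (QuotientAddGroup.mk t)).compl
    have hle : ∀ x, ‖(F ∘ Iceberg.glueWith n a) (QuotientAddGroup.mk t + x) -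
        (F ∘ Iceberg.glueWith n a) x‖ ≤
        ‖F (QuotientAddGroup.mk t + Iceberg.glueWith n a x) - F (Iceberg.glueWith n a x)‖ +
          D.indicator (fun _ => 2 * B) x := fun x => by
      by_cases hx : x ∈ D
      · rw [Set.indicator_of_mem hx]
        have h1 := hF.norm_sub_le (Iceberg.glueWith n a (QuotientAddGroup.mk t + x))
          (Iceberg.glueWith n a x)
        simp only [Function.comp_apply]
        linarith [norm_nonneg (F (QuotientAddGroup.mk t + Iceberg.glueWith n a x) -
          F (Iceberg.glueWith n a x))]
      · rw [Set.indicator_of_notMem hx, add_zero]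
        have hx' : block K d h₁ q n (QuotientAddGroup.mk t + x) = block K d h₁ q n x :=
          not_not.1 hx
        simp only [Function.comp_apply, Iceberg.glueWith, hx', map_add, proj_mk, add_assoc]
        exact le_rfl
    have hi1 : Integrable (fun x => ‖F (QuotientAddGroup.mk t + Iceberg.glueWith n a x) -
        F (Iceberg.glueWith n a x)‖) (uniform K d h₁ q ν (n + 1)) :=
      (hg.integrable_comp (hF.integrable_diff hS t).aestronglyMeasurable).2
        (hF.integrable_diff hS t)
    have hi2 : Integrable (D.indicator fun _ => 2 * B) (uniform K d h₁ q ν (n + 1)) :=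
      (integrable_const _).indicator hD
    have hfm : Measurable (F ∘ Iceberg.glueWith n a) :=
      hF.measurable.comp (hS.measurable_glueWith n a)
    calc _ ≤ ∫ x, (‖F (QuotientAddGroup.mk t + Iceberg.glueWith n a x) -
          F (Iceberg.glueWith n a x)‖ + D.indicator (fun _ => 2 * B) x)
            ∂(uniform K d h₁ q ν (n + 1)) := by
          refine integral_mono (IncrementFamily.integrable_of_norm_le (C := 2 * B)
            (f := fun x => (F ∘ Iceberg.glueWith n a) (QuotientAddGroup.mk t + x) -
              (F ∘ Iceberg.glueWith n a) x)
            ((hfm.comp (measurable_const_add _)).sub hfm)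
            fun x => hF.norm_sub_le _ _).norm (hi1.add hi2) hle
      _ = ∫ x, ‖F (QuotientAddGroup.mk t + x) - F x‖ ∂(uniform K d h₁ q ν n) +
          (uniform K d h₁ q ν (n + 1)).real D * (2 * B) := by
          rw [integral_add hi1 hi2, integral_indicator hD, setIntegral_const, smul_eq_mul]
          congr 1
          rw [← hg.map_eq, integral_map hg.measurable.aemeasurable]
          rw [hg.map_eq]
          exact (hF.integrable_diff hS t).aestronglyMeasurable
      _ ≤ L * ∑ i, |e (t i)| + (∑ i, |e (t i)| / lenR h₁ q n) * (2 * B) := by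
          have := hS.measureReal_leave_le (h₁ := h₁) (q := q) n t
          exact add_le_add (hF.lipschitz t) (mul_le_mul_of_nonneg_right this (by positivity))
      _ = _ := by
          rw [← Finset.sum_div]
          ring

theorem descend (hF : Regular e ν F B L s) (α : Rotations K d h₁ q) (k : ℕ) :
    Regular e ν (F ∘ descend α n k) B
      (L + 2 * B * ∑ j ∈ Finset.range k, 1 / lenR h₁ q (n + j)) s := by
  induction k with
  | zero =>
    have h : L ≤ L + 2 * B * ∑ j ∈ Finset.range 0, 1 / lenR h₁ q (n + j) := by simp
    exact hF.mono h
  | succ k ih =>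
    refine (ih.glueWith hS (α (n + k))).mono (le_of_eq ?_)
    rw [Finset.sum_range_succ]
    ring

/-- The Lipschitz constants of all lifts are bounded independently of `k` and of the rotations.
Hence the probabilistic estimates hold uniformly when the lower levels are conditioned upon. -/
theorem descend_of_summable (hF : Regular e ν F B L s)
    (hsum : Summable fun n => 1 / lenR h₁ q n) (α : Rotations K d h₁ q) (k : ℕ) :
    Regular e ν (F ∘ Iceberg.descend α n k) B (L + 2 * B * ∑' j, 1 / lenR h₁ q j) s := by
  refine (hF.descend hS α k).mono ?_
  have hB := hF.bound_nonneg
  have hpos : ∀ j, 0 ≤ 1 / lenR h₁ q j := fun j => by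
    have := lenR_pos h₁ q j
    positivity
  gcongr
  refine le_trans (le_of_eq ?_)
    (hsum.sum_le_tsum (Finset.image (n + ·) (Finset.range k)) fun j _ => hpos j)
  rw [Finset.sum_image fun a _ b _ h => by simpa using h]

end Regular

/-! ### Regularity and nondegeneracy of the random part. -/

namespace IsStandard

variable {e : K →+* ℝ} {ν : Measure (Fin d → K)} (hS : IsStandard e ν) [ν.IsAddLeftInvariant]
include hS

theorem abs_stay_sub_le (n : ℕ) (t : Fin d → K) (z : Space K d h₁ q (n + 1)) :
    |stay ν n (QuotientAddGroup.mk t + z) - stay ν n z| ≤ ∑ i, |e (t i)| / lenR h₁ q n := by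
  have := hS.isProbabilityMeasure_uniform (h₁ := h₁) (q := q) (n + 1)
  have := hS.measurableAdd₂ (h₁ := h₁) (q := q) (n + 1)
  have := hS.isAddLeftInvariant_uniform (h₁ := h₁) (q := q) (n + 1)
  set D := {x : Space K d h₁ q (n + 1) |
    block K d h₁ q n (QuotientAddGroup.mk t + x) ≠ block K d h₁ q n x}
  have hD : MeasurableSet D := (hS.measurableSet_stay n (QuotientAddGroup.mk t)).compl
  have hDz : (uniform K d h₁ q ν (n + 1)).real ((z + ·) ⁻¹' D) ≤ ∑ i, |e (t i)| / lenR h₁ q n := by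
    rw [(measurePreserving_add_left _ z).measureReal_preimage hD.nullMeasurableSet]
    exact hS.measureReal_leave_le n t
  rw [abs_sub_le_iff, stay, stay]
  constructor
  · rw [sub_le_iff_le_add]
    refine (measureReal_mono fun x hx => ?_).trans ((measureReal_union_le _ _).trans
      (add_le_add_left hDz _))
    by_cases h : x ∈ (z + ·) ⁻¹' D
    · exact Or.inl h
    · refine Or.inr ?_
      have h' := not_not.1 h
      have hx' : block K d h₁ q n (QuotientAddGroup.mk t + z + x) = block K d h₁ q n x := hx
      rw [add_assoc, h'] at hx'
      exact hx'
  · rw [sub_le_iff_le_add]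
    refine (measureReal_mono fun x hx => ?_).trans ((measureReal_union_le _ _).trans
      (add_le_add_left hDz _))
    by_cases h : x ∈ (z + ·) ⁻¹' D
    · exact Or.inl h
    · refine Or.inr ?_
      have h' := not_not.1 h
      change block K d h₁ q n (QuotientAddGroup.mk t + z + x) = block K d h₁ q n x
      rw [add_assoc, h']
      exact hx

/-- Used to pass from a grid to all points. The correlation of the glued function contributes `B * L
+ 2 * B ^ 2`, the old correlation `B * L`, and the variation of `stay` contributes `B ^ 2`. -/
theorem norm_fluct_sub_le {n : ℕ} {F : Space K d h₁ q n → ℂ} {B L s : ℝ}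
    (hF : Regular e ν F B L s) (a : Block K d h₁ q n → Space K d h₁ q n) (t : Fin d → K)
    (z : Space K d h₁ q (n + 1)) :
    ‖fluct ν n F a (QuotientAddGroup.mk t + z) - fluct ν n F a z‖ ≤
      (2 * B * L + 3 * B ^ 2) * ∑ i, |e (t i)| := by
  have hl := one_le_lenR h₁ q n
  have hB := hF.bound_nonneg
  have h1 := (hF.glueWith hS a).norm_corr_sub_le hS t z
  have h2 := hF.norm_corr_sub_le hS t (proj K d h₁ q n z)
  have h3 := hS.abs_stay_sub_le n t z
  have hp := hS.isProbabilityMeasure_uniform (h₁ := h₁) (q := q) n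
  have := hS.measurableAdd₂ (h₁ := h₁) (q := q) n
  have := hS.measurableNeg (h₁ := h₁) (q := q) n
  have := hS.isAddLeftInvariant_uniform (h₁ := h₁) (q := q) n
  have h4 := norm_corr_le (μ := uniform K d h₁ q ν n) hF.norm_le (proj K d h₁ q n z)
  have h5 := hS.stay_le_one n (QuotientAddGroup.mk t + z)
  have h6 := hS.stay_nonneg n (QuotientAddGroup.mk t + z)
  set T := ∑ i, |e (t i)|
  have hT : 0 ≤ T := Finset.sum_nonneg fun i _ => abs_nonneg _
  rw [← Finset.sum_div] at h3
  have h3' : T / lenR h₁ q n ≤ T := div_le_self hT hl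
  have h1' : B * (L + 2 * B * (1 / lenR h₁ q n)) * T ≤ (B * L + 2 * B ^ 2) * T := by
    have : 1 / lenR h₁ q n ≤ 1 := by rw [div_le_one (by linarith)]; exact hl
    refine mul_le_mul_of_nonneg_right ?_ hT
    have h7 : B * (2 * B * (1 / lenR h₁ q n)) ≤ B * (2 * B * 1) := by gcongr
    linarith
  unfold fluct
  rw [map_add, proj_mk]
  set c' := corr (uniform K d h₁ q ν n) F (QuotientAddGroup.mk t + proj K d h₁ q n z)
  set c := corr (uniform K d h₁ q ν n) F (proj K d h₁ q n z)
  set r' := corr (uniform K d h₁ q ν (n + 1)) (F ∘ glueWith n a) (QuotientAddGroup.mk t + z)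
  set r := corr (uniform K d h₁ q ν (n + 1)) (F ∘ glueWith n a) z
  set s' := stay ν n (QuotientAddGroup.mk t + z)
  set s := stay ν n z
  have e1 : r' - (s' : ℂ) * c' - (r - (s : ℂ) * c) =
      (r' - r) - ((s' : ℂ) * (c' - c) + ((s' - s : ℝ) : ℂ) * c) := by push_cast; ring
  rw [e1]
  refine (norm_sub_le _ _).trans ?_
  have h8 : ‖(s' : ℂ) * (c' - c) + ((s' - s : ℝ) : ℂ) * c‖ ≤ B * L * T + T * B ^ 2 := by
    refine (norm_add_le _ _).trans (add_le_add ?_ ?_)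
    · rw [norm_mul, Complex.norm_real, Real.norm_of_nonneg h6]
      calc s' * ‖c' - c‖ ≤ 1 * ‖c' - c‖ := mul_le_mul_of_nonneg_right h5 (norm_nonneg _)
        _ ≤ _ := by rw [one_mul]; exact h2
    · rw [norm_mul, Complex.norm_real, Real.norm_eq_abs]
      exact mul_le_mul (h3.trans h3') h4 (norm_nonneg _) hT
  linarith

/-- The random part is not too small with a positive probability, on average. -/
theorem le_integral_min_corr {n : ℕ} {F : Space K d h₁ q n → ℂ} {B L s : ℝ}
    (hF : Regular e ν F B L s) {σ : ℝ} (hσ : 0 ≤ σ) {k : ℕ} (hk : 0 < k)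
    (hcell : ∀ v : Fin d → K, (∀ i, |e (v i)| ≤ 1 / k) →
      σ ≤ ‖corr (uniform K d h₁ q ν n) F (QuotientAddGroup.mk v)‖)
    {m : ℕ} (hm : 2 * m < (q n : ℕ)) (hd : 0 < d) {t : Fin d → K}
    (ht : ∀ i, lenR h₁ q n ≤ e (t i) ∧ e (t i) < m * lenR h₁ q n) {V c : ℝ} (hV : 0 ≤ V)
    (hc : 0 < c)
    (hVc : c * (((q n : ℕ) : ℝ) ^ d * (2 ^ d * (k * lenR h₁ q n) ^ d)) ≤ V * σ ^ 2)
    (hV1 : (16 * (2 * 2 ^ d) ^ 2 + 3) * (4 * B ^ 2 * (1 / ((q n : ℕ) : ℝ) ^ d)) ^ 2 * V ≤ 1) :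
    c / (8 * c + 2) ≤ ∫ a, min 1 (V * ‖corr (uniform K d h₁ q ν (n + 1)) (F ∘ glueWith n a)
      (QuotientAddGroup.mk t)‖ ^ 2)
        ∂(Measure.infinitePi fun _ : Block K d h₁ q n => uniform K d h₁ q ν n) := by
  have := hS.measurableAdd₂ (h₁ := h₁) (q := q) n
  have := hS.measurableNeg (h₁ := h₁) (q := q) n
  have := hS.isAddLeftInvariant_uniform (h₁ := h₁) (q := q) n
  have := hS.isProbabilityMeasure_uniform (h₁ := h₁) (q := q) n
  have := hS.isProbabilityMeasure_uniform (h₁ := h₁) (q := q) (n + 1)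
  have hl := lenR_pos h₁ q n
  have hP := hS.pairing (h₁ := h₁) (q := q) n t
  have h0 := hS.stay_eq_zero n hm ⟨0, hd⟩ (ht _)
  have e1 : ∀ a : Block K d h₁ q n → Space K d h₁ q n,
      corr (uniform K d h₁ q ν (n + 1)) (F ∘ Iceberg.glueWith n a) (QuotientAddGroup.mk t) =
      fluct ν n F a (QuotientAddGroup.mk t) := fun a => by
    rw [fluct, h0]; simp
  simp_rw [e1, hS.fluct_mk hF.measurable hF.norm_le]
  refine (hP.incrementFamily hF.measurable hF.norm_le hF.integral_eq_zero).le_integral_min_one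
    (card_neighbours_le e n t) Finset.univ hV hc ?_ hV1
  -- the label of a point records its block, the carries, and a small cell of the fundamental domain
  have hN : 0 < k * (side h₁ q n : ℕ) := Nat.mul_pos hk (side h₁ q n).pos
  set N := k * (side h₁ q n : ℕ) with hNdef
  have hk' : (0 : ℝ) < k := by exact_mod_cast hk
  -- The minimum only makes the cell index total; for points of the fundamental domain the floor is
  -- below `N = k * h`, so it has no effect.
  let cell : K → Fin N := fun u => ⟨min ⌊k * e u⌋₊ (N - 1), by omega⟩
  have hcellm : Measurable cell :=
    (Measurable.of_discrete (f := fun j : ℕ => (⟨min j (N - 1), by omega⟩ : Fin N))).comp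
      (Nat.measurable_floor.comp (hS.measurable.const_mul (k : ℝ)))
  have hcarry : Measurable (carry h₁ q e n t) := by
    refine measurable_pi_iff.2 fun i => ?_
    exact (Measurable.of_discrete
      (f := fun j : ℤ => decide (j = ⌊e (t i) / lenR h₁ q n⌋ + 1))).comp
      (Int.measurable_floor.comp ((hS.measurable.comp
        ((measurable_const_add (t i)).comp (measurable_pi_apply i))).div_const _))
  let r : Space K d h₁ q (n + 1) → Fin d → K := fun x => rep n (proj K d h₁ q n x)
  have hr : Measurable r := (hS.measurable_rep n).comp (hS.measurable_proj n)
  let g : Space K d h₁ q (n + 1) → (Fin d → Bool) × (Fin d → Fin N) := fun x =>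
    (carry h₁ q e n t (r x), fun i => cell (r x i))
  have hg : Measurable g := (hcarry.comp hr).prodMk
    (measurable_pi_iff.2 fun i => hcellm.comp ((measurable_pi_apply i).comp hr))
  have hclose : ∀ u u' : K, u ∈ Set.Ico 0 (len K h₁ q n) → u' ∈ Set.Ico 0 (len K h₁ q n) →
      cell u = cell u' → |e (u - u')| ≤ 1 / k := by
    intro u u' hu hu' h
    have hb : ∀ v : K, v ∈ Set.Ico 0 (len K h₁ q n) → 0 ≤ k * e v ∧ ⌊k * e v⌋₊ < N := by
      intro v hv
      have h1 : 0 ≤ e v := by simpa using hS.strictMono.monotone hv.1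
      have h2 : e v < lenR h₁ q n := by rw [← map_len e n]; exact hS.strictMono hv.2
      refine ⟨by positivity, ?_⟩
      rw [Nat.floor_lt (by positivity), hNdef]
      push_cast
      exact mul_lt_mul_of_pos_left h2 hk'
    obtain ⟨h1, h2⟩ := hb u hu
    obtain ⟨h1', h2'⟩ := hb u' hu'
    have h3 : ⌊k * e u⌋₊ = ⌊k * e u'⌋₊ := by
      have := congrArg Fin.val h
      simp only [cell] at this
      omega
    have a1 := Nat.floor_le h1
    have a2 := Nat.lt_floor_add_one (k * e u)
    have a3 := Nat.floor_le h1'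
    have a4 := Nat.lt_floor_add_one (k * e u')
    rw [h3] at a1 a2
    have hx : |(e u - e u') * k| ≤ 1 := abs_le.2 ⟨by linarith, by linarith⟩
    rw [abs_mul, abs_of_pos hk'] at hx
    rwa [map_sub, le_div_iff₀ hk']
  -- Equal blocks and equal carries force equal target blocks. Equal cells put the representatives
  -- within `1 / k` of each other in every coordinate, where `hcell` bounds the correlation from
  -- below.
  have hsec := hP.le_secondMoment_quad (μ := uniform K d h₁ q ν n) (F := F)
    (l := fun x => (block K d h₁ q n x, g x)) (σ := σ) hF.measurable hF.norm_le
    hF.integral_eq_zero (fun x => rfl) (hS.block_ne n hm ⟨0, hd⟩ (ht _))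
    (hS.block_no_swap n hm ⟨0, hd⟩ (ht _)) (fun j => ?_) hσ (fun x x' hxx => ?_)
  · have hcard : (Fintype.card (Block K d h₁ q n × ((Fin d → Bool) × (Fin d → Fin N))) : ℝ) =
        ((q n : ℕ) : ℝ) ^ d * (2 ^ d * (k * lenR h₁ q n) ^ d) := by
      simp only [Fintype.card_prod, hS.card_block, Fintype.card_fun, Fintype.card_bool,
        Fintype.card_fin]
      rw [hNdef, lenR]
      push_cast
      ring
    rw [hcard] at hsec
    refine le_trans ?_ (mul_le_mul_of_nonneg_left hsec hV)
    have hq0 : (0 : ℝ) < ((q n : ℕ) : ℝ) := by exact_mod_cast (q n).pos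
    rw [mul_div_assoc', le_div_iff₀ (by positivity)]
    exact hVc
  · have : (fun x => (block K d h₁ q n x, g x)) ⁻¹' {j} =
        (block K d h₁ q n ⁻¹' {j.1}) ∩ g ⁻¹' {j.2} := by
      ext x
      simp [Prod.ext_iff]
    rw [this]
    exact (hS.measurableSet_block n _).inter (hg (measurableSet_singleton _))
  · obtain ⟨hb, hg'⟩ := Prod.ext_iff.1 hxx
    obtain ⟨hc1, hc2⟩ := Prod.ext_iff.1 hg'
    refine ⟨hb, ?_, ?_⟩
    · rw [hS.block_mk_add, hS.block_mk_add]
      exact congrArg₂ (fun ε b => QuotientAddGroup.mk (displacement h₁ q e n t ε) + b) hc1 hb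
    · have hp : proj K d h₁ q n x - proj K d h₁ q n x' =
          QuotientAddGroup.mk (r x - r x') := by
        rw [QuotientAddGroup.mk_sub, mk_rep, mk_rep]
      rw [hp]
      exact hcell _ fun i => hclose _ _ (rep_mem _ i) (rep_mem _ i) (congrFun hc2 i)

end IsStandard
end Regularity

end Iceberg

namespace Iceberg

/-! ### Events determined step by step -/

section Resample

variable {X : ℕ → Type*} [∀ n, MeasurableSpace (X n)] (μ : ∀ n, Measure (X n))
  [∀ n, IsProbabilityMeasure (μ n)]

theorem infinitePi_eq_lintegral_update (b : ℕ) {A : Set (∀ n, X n)} (hA : MeasurableSet A) :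
    Measure.infinitePi μ A = ∫⁻ a, μ b {s | Function.update a b s ∈ A} ∂(Measure.infinitePi μ) := by
  rw [← lintegral_indicator_one hA, lintegral_update μ b (measurable_one.indicator hA)]
  refine lintegral_congr fun a => ?_
  exact lintegral_indicator_one (s := {s | Function.update a b s ∈ A}) (measurable_update a hA)

/-- A form of the Borel–Cantelli lemma. -/
theorem ae_eventually_notMem_of_update (m : ℕ → ℕ) {E : ℕ → Set (∀ n, X n)}
    (hE : ∀ k, MeasurableSet (E k)) {ε : ℕ → ℝ≥0∞} (hε : ∑' k, ε k ≠ ∞)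
    (h : ∀ᶠ k in atTop, ∀ a, μ (m k) {s | Function.update a (m k) s ∈ E k} ≤ ε k) :
    ∀ᵐ a ∂(Measure.infinitePi μ), ∀ᶠ k in atTop, a ∉ E k := by
  obtain ⟨N, hN⟩ := eventually_atTop.1 h
  have hle : ∀ k, Measure.infinitePi μ (E (k + N)) ≤ ε (k + N) := fun k => by
    rw [infinitePi_eq_lintegral_update μ (m (k + N)) (hE _)]
    refine (lintegral_mono fun a => hN (k + N) (by omega) a).trans ?_
    simp
  have hsum : ∑' k, Measure.infinitePi μ (E (k + N)) ≠ ∞ :=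
    ne_top_of_le_ne_top hε ((ENNReal.tsum_le_tsum hle).trans
      (ENNReal.tsum_comp_le_tsum_of_injective (add_left_injective N) ε))
  filter_upwards [ae_eventually_notMem hsum] with a ha
  obtain ⟨k, hk⟩ := eventually_atTop.1 ha
  refine eventually_atTop.2 ⟨k + N, fun j hj => ?_⟩
  have := hk (j - N) (by omega)
  rwa [Nat.sub_add_cancel (by omega)] at this

/-- Events which have a conditional probability bounded from below occur infinitely often. -/
theorem ae_frequently_mem_of_update (n : ℕ) {E : ℕ → Set (∀ n, X n)}
    (hE : ∀ k, MeasurableSet (E k))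
    (hdep : ∀ k a a', (∀ j ≤ n + k, a j = a' j) → (a ∈ E k ↔ a' ∈ E k)) {δ : ℝ≥0∞} (hδ : δ ≠ 0)
    (h : ∀ᶠ k in atTop, ∀ a, δ ≤ μ (n + k) {s | Function.update a (n + k) s ∈ E k}) :
    ∀ᵐ a ∂(Measure.infinitePi μ), ∃ᶠ k in atTop, a ∈ E k := by
  obtain ⟨N, hN⟩ := eventually_atTop.1 h
  -- The probability that none of `j` consecutive events occurs is at most `(1 - δ) ^ j`. Resampling
  -- the coordinate `n + (M + j)` leaves the earlier events unchanged by `hdep`, while the last one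
  -- fails with probability at most `1 - δ`.
  have key : ∀ M, N ≤ M → ∀ j, Measure.infinitePi μ (⋂ i ∈ Finset.range j, (E (M + i))ᶜ) ≤
      (1 - δ) ^ j := by
    intro M hM j
    induction j with
    | zero => simpa using prob_le_one
    | succ j ih =>
      have hm : ∀ j, MeasurableSet (⋂ i ∈ Finset.range j, (E (M + i))ᶜ) := fun j =>
        Finset.measurableSet_biInter _ fun i _ => (hE _).compl
      rw [infinitePi_eq_lintegral_update μ (n + (M + j)) (hm _)]
      have hle : ∀ a, μ (n + (M + j)) {s | Function.update a (n + (M + j)) s ∈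
          ⋂ i ∈ Finset.range (j + 1), (E (M + i))ᶜ} ≤
          (⋂ i ∈ Finset.range j, (E (M + i))ᶜ).indicator (fun _ => 1 - δ) a := by
        intro a
        by_cases ha : a ∈ ⋂ i ∈ Finset.range j, (E (M + i))ᶜ
        · rw [Set.indicator_of_mem ha]
          have h1 := hN (M + j) (by omega) a
          have hms := measurable_update a (hE (M + j)) (a := n + (M + j))
          calc _ ≤ μ (n + (M + j)) ({s | Function.update a (n + (M + j)) s ∈ E (M + j)}ᶜ) := by
                refine measure_mono fun s hs => ?_
                simp only [Set.mem_ofPred_eq, Set.mem_iInter] at hs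
                exact hs j (Finset.self_mem_range_succ j)
            _ = 1 - μ (n + (M + j)) {s | Function.update a (n + (M + j)) s ∈ E (M + j)} :=
                prob_compl_eq_one_sub hms
            _ ≤ 1 - δ := tsub_le_tsub_left h1 1
        · rw [Set.indicator_of_notMem ha, nonpos_iff_eq_zero]
          convert measure_empty (μ := μ (n + (M + j)))
          refine Set.eq_empty_of_forall_notMem fun s hs => ha ?_
          simp only [Set.mem_ofPred_eq, Set.mem_iInter] at hs ⊢
          intro i hi
          have hi' := Finset.mem_range.1 hi
          have h2 := hs i (Finset.mem_range.2 (by omega))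
          intro h3
          refine h2 ((hdep (M + i) a _ fun l hl => ?_).1 h3)
          rw [Function.update_of_ne (by omega)]
      refine (lintegral_mono hle).trans ?_
      rw [lintegral_indicator (hm j), setLIntegral_const, pow_succ, mul_comm]
      exact mul_le_mul_left ih _
  have hzero : ∀ M, N ≤ M → Measure.infinitePi μ {a | ∀ k, M ≤ k → a ∉ E k} = 0 := by
    intro M hM
    have h1 : ∀ j, Measure.infinitePi μ {a | ∀ k, M ≤ k → a ∉ E k} ≤ (1 - δ) ^ j := fun j =>
      (measure_mono fun a ha => by
        simp only [Set.mem_iInter]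
        exact fun i _ => ha (M + i) (by omega)).trans (key M hM j)
    have h2 : Tendsto (fun j : ℕ => (1 - δ) ^ j) atTop (𝓝 0) :=
      ENNReal.tendsto_pow_atTop_nhds_zero_of_lt_one
        (ENNReal.sub_lt_self ENNReal.one_ne_top one_ne_zero hδ)
    exact le_antisymm (ge_of_tendsto' h2 h1) zero_le
  have hall : ∀ᵐ a ∂(Measure.infinitePi μ), ∀ M, ¬ ∀ k, max N M ≤ k → a ∉ E k :=
    ae_all_iff.2 fun M => by
      rw [ae_iff]
      simp only [not_not]
      exact hzero _ (le_max_left _ _)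
  filter_upwards [hall] with a ha
  rw [frequently_atTop]
  intro M
  have := ha M
  push Not at this
  obtain ⟨k, hk, hk'⟩ := this
  exact ⟨k, (le_max_right _ _).trans hk, hk'⟩

end Resample

/-! ### The joint law of the rotations, and joint measurability in rotations and points. -/

section Law

variable {K : Type*} [CommRing K] [LinearOrder K] [IsStrictOrderedRing K] [Archimedean K]
  {d : ℕ} {h₁ : ℕ+} {q : ℕ → ℕ+} [MeasurableSpace K] [MeasurableAdd₂ K] [MeasurableNeg K]

/-- The joint law of the random rotations. -/
def rotationLaw (K : Type*) [CommRing K] [LinearOrder K] [IsStrictOrderedRing K] [Archimedean K]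
    [MeasurableSpace K] (d : ℕ) (h₁ : ℕ+) (q : ℕ → ℕ+) (ν : Measure (Fin d → K)) :
    Measure (Rotations K d h₁ q) :=
  Measure.infinitePi fun n => Measure.infinitePi fun _ : Block K d h₁ q n => uniform K d h₁ q ν n

theorem descend_congr {α α' : Rotations K d h₁ q} (n k : ℕ) (h : ∀ j < n + k, α j = α' j) :
    descend α n k = descend α' n k := by
  induction k with
  | zero => rfl
  | succ k ih =>
    funext z
    simp only [descend, glue, ih fun j hj => h j (by omega), h (n + k) (by omega)]

variable {e : K →+* ℝ} {ν : Measure (Fin d → K)} (hS : IsStandard e ν)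
include hS

/-- Independence over all pairs of a level and a block gives a product measure over pairs. Currying
it produces the product over levels of products over blocks, so almost sure statements need proof
for this canonical law only. -/
theorem IsUniformFamily.ae_of_ae_rotationLaw {Ω : Type*} [MeasurableSpace Ω] {P : Measure Ω}
    [IsProbabilityMeasure P] {α : Ω → Rotations K d h₁ q} (h : IsUniformFamily ν P α)
    {p : Rotations K d h₁ q → Prop} (hp : ∀ᵐ a ∂(rotationLaw K d h₁ q ν), p a) :
    ∀ᵐ ω ∂P, p (α ω) := by
  have := hS.isProbabilityMeasure_uniform (h₁ := h₁) (q := q)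
  have hm : Measurable fun ω (r : Σ n, Block K d h₁ q n) => α ω r.1 r.2 :=
    measurable_pi_iff.2 fun r => h.measurable r.1 r.2
  have h1 := h.indep.map_fun_eq_infinitePi_map₀ hm.aemeasurable
  simp only [h.map_eq] at h1
  have hα : Measurable α :=
    measurable_pi_iff.2 fun n => measurable_pi_iff.2 fun γ => h.measurable n γ
  have h2 : P.map α = rotationLaw K d h₁ q ν := by
    rw [rotationLaw, ← Measure.infinitePi_map_piCurry
      (fun n (_ : Block K d h₁ q n) => uniform K d h₁ q ν n), ← h1,
      Measure.map_map (MeasurableEquiv.measurable _) hm]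
    rfl
  rw [← h2] at hp
  exact ae_of_ae_map hα.aemeasurable hp

namespace IsStandard

theorem measurable_glue_joint (n : ℕ) :
    Measurable fun p : Rotations K d h₁ q × Space K d h₁ q (n + 1) => glue p.1 n p.2 := by
  have := hS.measurableAdd₂ (h₁ := h₁) (q := q) n
  refine ((hS.measurable_proj n).comp measurable_snd).add ?_
  intro s hs
  have : (fun p : Rotations K d h₁ q × Space K d h₁ q (n + 1) =>
      p.1 n (block K d h₁ q n p.2)) ⁻¹' s =
      ⋃ γ, ((fun p : Rotations K d h₁ q × Space K d h₁ q (n + 1) => p.1 n γ) ⁻¹' s) ∩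
        (Prod.snd ⁻¹' (block K d h₁ q n ⁻¹' {γ})) := by
    ext p; simp
  rw [this]
  exact MeasurableSet.iUnion fun γ =>
    ((measurable_pi_iff.1 (measurable_pi_iff.1 measurable_fst n) γ) hs).inter
      (measurable_snd (hS.measurableSet_block n γ))

theorem measurable_descend_joint (n k : ℕ) :
    Measurable fun p : Rotations K d h₁ q × Space K d h₁ q (n + k) => descend p.1 n k p.2 := by
  induction k with
  | zero => exact measurable_snd
  | succ k ih =>
    exact ih.comp (measurable_fst.prodMk (hS.measurable_glue_joint (n + k)))

theorem measurable_corr_descend (n k : ℕ) {F : Space K d h₁ q n → ℂ} (hF : Measurable F) :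
    Measurable fun p : Rotations K d h₁ q × Space K d h₁ q (n + k) =>
      corr (uniform K d h₁ q ν (n + k)) (F ∘ descend p.1 n k) p.2 := by
  have := hS.measurableAdd₂ (h₁ := h₁) (q := q) (n + k)
  have := hS.isProbabilityMeasure_uniform (h₁ := h₁) (q := q) (n + k)
  have hm : Measurable fun r : (Rotations K d h₁ q × Space K d h₁ q (n + k)) ×
      Space K d h₁ q (n + k) => F (descend r.1.1 n k (r.1.2 + r.2)) *
        (starRingEnd ℂ) (F (descend r.1.1 n k r.2)) := by
    have h1 : Measurable fun r : (Rotations K d h₁ q × Space K d h₁ q (n + k)) ×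
        Space K d h₁ q (n + k) => (r.1.1, r.1.2 + r.2) := by fun_prop
    have h2 : Measurable fun r : (Rotations K d h₁ q × Space K d h₁ q (n + k)) ×
        Space K d h₁ q (n + k) => (r.1.1, r.2) := by fun_prop
    exact (hF.comp ((hS.measurable_descend_joint n k).comp h1)).mul
      (measurable_conj (hF.comp ((hS.measurable_descend_joint n k).comp h2)))
  exact (hm.stronglyMeasurable.integral_prod_right').measurable

end IsStandard
end Law

end Iceberg

namespace Iceberg

/-! ### Almost sure bounds for the correlation functions -/

section AlmostSure

/-- The bound for the random part of the correlation function. -/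
def err (d : ℕ) (h₁ : ℕ+) (q : ℕ → ℕ+) (n : ℕ) : ℝ :=
  3 * lenR h₁ q n ^ 3 / √(((q n : ℕ) : ℝ) ^ d)

variable {K : Type*} [CommRing K] [LinearOrder K] [IsStrictOrderedRing K] [Archimedean K]
  {d : ℕ} {h₁ : ℕ+} {q : ℕ → ℕ+} [MeasurableSpace K]

/-- Intervals have nets of arbitrarily small mesh and with few points. -/
def HasNet (e : K →+* ℝ) : Prop :=
  ∀ N L : ℕ, 0 < N → ∃ s : Finset K, s.card ≤ L * N ∧
    ∀ x ∈ Set.Ico (0 : K) L, ∃ y ∈ s, |e (x - y)| ≤ 1 / N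

theorem HasNet.exists_grid {e : K →+* ℝ} (h : HasNet e) (n : ℕ) :
    ∃ s : Finset (Fin d → K), (s.card : ℝ) ≤ (lenR h₁ q (n + 1) * ((q n : ℕ) : ℝ) ^ d) ^ d ∧
      ∀ u ∈ cube K d h₁ q (n + 1), ∃ t ∈ s, ∀ i, |e ((u - t) i)| ≤ 1 / ((q n : ℕ) : ℝ) ^ d := by
  obtain ⟨s, hs, hnet⟩ := h ((q n : ℕ) ^ d) (side h₁ q (n + 1)) (pow_pos (q n).pos d)
  refine ⟨Fintype.piFinset fun _ => s, ?_, fun u hu => ?_⟩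
  · rw [Fintype.card_piFinset, Finset.prod_const, Finset.card_univ, Fintype.card_fin]
    push_cast
    refine pow_le_pow_left₀ (by positivity) ?_ d
    rw [lenR]
    exact_mod_cast hs
  · choose y hy hle using fun i => hnet (u i) (hu i)
    refine ⟨y, Fintype.mem_piFinset.2 hy, fun i => ?_⟩
    simpa using hle i

/-- The region of translations that move every point to another block, but not too far. -/
def annulus (e : K →+* ℝ) (d : ℕ) (h₁ : ℕ+) (q : ℕ → ℕ+) (n : ℕ) : Set (Fin d → K) :=
  {t | ∀ i, lenR h₁ q n ≤ e (t i) ∧ e (t i) < ((q n : ℕ) / (8 * d) : ℕ) * lenR h₁ q n}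

variable [MeasurableAdd₂ K] [MeasurableNeg K]

namespace IsStandard

variable {e : K →+* ℝ} {ν : Measure (Fin d → K)} (hS : IsStandard e ν)
include hS

theorem annulus_eq_pi (n : ℕ) : annulus e d h₁ q n = Set.univ.pi fun _ : Fin d =>
    Set.Ico (len K h₁ q n) (((q n : ℕ) / (8 * d) : ℕ) * len K h₁ q n) := by
  ext t
  simp only [annulus, Set.mem_ofPred_eq, Set.mem_univ_pi, Set.mem_Ico]
  refine forall_congr' fun i => ?_
  rw [← hS.strictMono.le_iff_le, ← hS.strictMono.lt_iff_lt (b := _ * _), map_mul, map_natCast,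
    map_len]

theorem measurableSet_annulus (n : ℕ) : MeasurableSet (annulus e d h₁ q n) := by
  rw [hS.annulus_eq_pi]
  exact MeasurableSet.univ_pi fun _ => hS.measurableSet_Ico _ _

theorem measure_annulus (n : ℕ) (h : 8 * d ≤ (q n : ℕ)) (hd : 0 < d) :
    ν (annulus e d h₁ q n) =
      ENNReal.ofReal (((((q n : ℕ) / (8 * d) : ℕ) - 1) * lenR h₁ q n) ^ d) := by
  have hM : (1 : K) ≤ (((q n : ℕ) / (8 * d) : ℕ) : K) := by
    exact_mod_cast (Nat.le_div_iff_mul_le (by omega)).2 (by omega)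
  have hM' : (1 : ℝ) ≤ (((q n : ℕ) / (8 * d) : ℕ) : ℝ) := by
    exact_mod_cast (Nat.le_div_iff_mul_le (by omega)).2 (by omega)
  have hl := len_pos K h₁ q n
  have hl' := lenR_pos h₁ q n
  rw [hS.annulus_eq_pi, hS.box _ _ fun _ => by nlinarith]
  simp only [map_mul, map_natCast, map_len, Finset.prod_const, Finset.card_univ, Fintype.card_fin]
  rw [← ENNReal.ofReal_pow (by nlinarith)]
  congr 2
  ring

/-- The size of the region, up to constants. -/
theorem measureReal_annulus_bounds {n : ℕ} (hd : 0 < d) (hn : (32 * d : ℝ) ≤ ((q n : ℕ) : ℝ)) :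
    (((q n : ℕ) : ℝ) * lenR h₁ q n / (16 * d)) ^ d ≤ ν.real (annulus e d h₁ q n) ∧
      ν.real (annulus e d h₁ q n) ≤ (((q n : ℕ) : ℝ) * lenR h₁ q n) ^ d ∧
      ν (annulus e d h₁ q n) ≠ ∞ ∧ 2 * ((q n : ℕ) / (8 * d)) < (q n : ℕ) := by
  have hl := lenR_pos h₁ q n
  have hn2 : 32 * d ≤ (q n : ℕ) := by exact_mod_cast hn
  have hν := hS.measure_annulus (h₁ := h₁) (q := q) n (by omega) hd
  -- The factor `8 * d` makes the sum of the coordinates of a point of the annulus at most `h (n +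
  -- 1) / 8`, as the later lower bound for the limit requires. The volume remains comparable with
  -- `(q * h) ^ d`: since `q ≥ 32 * d`, one has `M - 1 > q / (8 * d) - 2 ≥ q / (16 * d)`.
  set M := (q n : ℕ) / (8 * d) with hM
  have hM1 : M * (8 * d) ≤ (q n : ℕ) := Nat.div_mul_le_self _ _
  have hM2 : (q n : ℕ) < (M + 1) * (8 * d) := by
    have := Nat.lt_div_mul_add (a := (q n : ℕ)) (b := 8 * d) (by omega)
    rw [← hM] at this
    linarith
  have hM1' : (M : ℝ) * (8 * d) ≤ ((q n : ℕ) : ℝ) := by exact_mod_cast hM1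
  have hM2' : ((q n : ℕ) : ℝ) < (M + 1) * (8 * d) := by exact_mod_cast hM2
  have hd1 : (1 : ℝ) ≤ d := by exact_mod_cast hd
  have hMge : (1 : ℝ) ≤ M := by
    exact_mod_cast (Nat.le_div_iff_mul_le (by omega)).2 (by omega)
  have hreal : ν.real (annulus e d h₁ q n) = ((M - 1) * lenR h₁ q n) ^ d := by
    rw [Measure.real, hν, ENNReal.toReal_ofReal]
    exact pow_nonneg (mul_nonneg (by linarith) hl.le) _
  refine ⟨?_, ?_, ?_, ?_⟩
  · rw [hreal]
    refine pow_le_pow_left₀ (by positivity) ?_ d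
    rw [mul_div_right_comm]
    refine mul_le_mul_of_nonneg_right ?_ hl.le
    rw [div_le_iff₀ (by positivity)]
    linarith
  · rw [hreal]
    refine pow_le_pow_left₀ (mul_nonneg (by linarith) hl.le) ?_ d
    refine mul_le_mul_of_nonneg_right ?_ hl.le
    nlinarith
  · rw [hν]; exact ENNReal.ofReal_ne_top
  · have hMpos : 0 < M := by exact_mod_cast (by linarith : (0 : ℝ) < M)
    nlinarith

theorem isProbabilityMeasure_cond_annulus {n : ℕ} (hd : 0 < d)
    (hn : (32 * d : ℝ) ≤ ((q n : ℕ) : ℝ)) :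
    IsProbabilityMeasure ν[|annulus e d h₁ q n] := by
  obtain ⟨h1, -, h3, -⟩ := hS.measureReal_annulus_bounds (h₁ := h₁) hd hn
  refine cond_isProbabilityMeasure_of_finite (fun h0 => ?_) h3
  have hl := lenR_pos h₁ q n
  have hq0 : (0 : ℝ) < ((q n : ℕ) : ℝ) := by exact_mod_cast (q n).pos
  have h2 : 0 < (((q n : ℕ) : ℝ) * lenR h₁ q n / (16 * d)) ^ d := by positivity
  rw [Measure.real, h0] at h1
  simp only [ENNReal.toReal_zero] at h1
  linarith

variable [ν.IsAddLeftInvariant]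

/-- The lower bound for the mean of the truncated correlations in the region. -/
theorem le_integral_min_corr_of_mem_annulus
    (hq : ∀ n, ((q n : ℕ) : ℝ) = (4 * lenR h₁ q n) ^ (n + 2)) (hd : 0 < d) {n : ℕ}
    {F : Space K d h₁ q n → ℂ} {B L s σ : ℝ} (hF : Regular e ν F B L s) (hσ : 0 < σ) {k : ℕ}
    (hk : 0 < k) (hcell : ∀ v : Fin d → K, (∀ i, |e (v i)| ≤ 1 / k) →
      σ ≤ ‖corr (uniform K d h₁ q ν n) F (QuotientAddGroup.mk v)‖)
    (hn : (32 * d : ℝ) ≤ ((q n : ℕ) : ℝ))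
    (hn2 : (16 * (2 * 2 ^ d) ^ 2 + 3) * (16 * B ^ 4) ≤ lenR h₁ q n)
    {t : Fin d → K} (ht : t ∈ annulus e d h₁ q n) {c : ℝ} (hc : c = σ ^ 2 / (32 * d * k) ^ d) :
    c / (8 * c + 2) ≤ ∫ a, min 1 (ν.real (annulus e d h₁ q n) *
      ‖corr (uniform K d h₁ q ν (n + 1)) (F ∘ glueWith n a) (QuotientAddGroup.mk t)‖ ^ 2)
        ∂(Measure.infinitePi fun _ : Block K d h₁ q n => uniform K d h₁ q ν n) := by
  obtain ⟨hV1, hV2, -, hV4⟩ := hS.measureReal_annulus_bounds (h₁ := h₁) hd hn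
  have hl := lenR_pos h₁ q n
  have hq0 : (0 : ℝ) < ((q n : ℕ) : ℝ) := by exact_mod_cast (q n).pos
  have hk0 : (0 : ℝ) < k := by exact_mod_cast hk
  have hd0 : (0 : ℝ) < d := by exact_mod_cast hd
  refine hS.le_integral_min_corr hF hσ.le hk hcell hV4 hd ht measureReal_nonneg
    (by rw [hc]; positivity) ?_ ?_
  -- The constant `c` is fixed by equality with the lower bound for the volume: `(32 * d * k) ^ d`
  -- is the product of `(16 * d) ^ d` from the annulus and `(2 * k) ^ d` from the carries and cells.
  · refine le_trans (le_of_eq ?_) (mul_le_mul_of_nonneg_right hV1 (sq_nonneg σ))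
    rw [hc, ← mul_pow, ← mul_pow, mul_comm ((_ / _) ^ d), div_mul_eq_mul_div,
      mul_div_assoc, ← div_pow]
    congr 2
    field_simp
    norm_num
  -- The increments squared times the volume are at most `16 * B ^ 4 * (h / q) ^ d`, and `(h / q) ^
  -- d ≤ h / q ≤ 1 / h` because `q ≥ 16 * h ^ 2`.
  · have hx1 : lenR h₁ q n / ((q n : ℕ) : ℝ) ≤ 1 / lenR h₁ q n := by
      rw [div_le_div_iff₀ hq0 hl]
      have := sixteen_mul_le hq n
      nlinarith
    have hx2 : (lenR h₁ q n / ((q n : ℕ) : ℝ)) ^ d ≤ 1 / lenR h₁ q n := by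
      refine le_trans (pow_le_of_le_one (by positivity) ?_ hd.ne') hx1
      rw [div_le_one hq0]
      exact lenR_le_q hq _
    calc _ ≤ (16 * (2 * 2 ^ d) ^ 2 + 3) * (4 * B ^ 2 * (1 / ((q n : ℕ) : ℝ) ^ d)) ^ 2 *
          (((q n : ℕ) : ℝ) * lenR h₁ q n) ^ d := mul_le_mul_of_nonneg_left hV2 (by positivity)
      _ = (16 * (2 * 2 ^ d) ^ 2 + 3) * (16 * B ^ 4) *
          (lenR h₁ q n / ((q n : ℕ) : ℝ)) ^ d := by
          rw [mul_pow, div_pow]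
          field_simp
          ring
      _ ≤ lenR h₁ q n * (1 / lenR h₁ q n) :=
          mul_le_mul hn2 hx2 (by positivity) hl.le
      _ = 1 := by field_simp

theorem measurable_fluct_descend (n k : ℕ) {F : Space K d h₁ q n → ℂ} (hF : Measurable F)
    (z : Space K d h₁ q (n + k + 1)) :
    Measurable fun α : Rotations K d h₁ q =>
      fluct ν (n + k) (F ∘ descend α n k) (α (n + k)) z := by
  refine Measurable.sub ?_ (Measurable.const_mul ?_ _)
  · exact (hS.measurable_corr_descend n (k + 1) hF).comp (measurable_id.prodMk measurable_const)
  · exact (hS.measurable_corr_descend n k hF).comp (measurable_id.prodMk measurable_const)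

/-- The tail bound is applied with `l = h ^ 3` at the points of a grid of mesh `1 / q ^ d`, and
Borel–Cantelli gives `2 * h ^ 3 / √(q ^ d)` there. Passing to an arbitrary point costs at most `(2 *
B * L' + 3 * B ^ 2) * d / q ^ d`, eventually below `h ^ 3 / √(q ^ d)`; together this is `err`. -/
theorem ae_eventually_fluct_le (hq : ∀ n, ((q n : ℕ) : ℝ) = (4 * lenR h₁ q n) ^ (n + 2))
    (hd : 0 < d) (hnet : HasNet e) {n : ℕ} {F : Space K d h₁ q n → ℂ} {B L s : ℝ}
    (hF : Regular e ν F B L s) :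
    ∀ᵐ α ∂(rotationLaw K d h₁ q ν), ∀ᶠ k in atTop, ∀ z,
      ‖fluct ν (n + k) (F ∘ descend α n k) (α (n + k)) z‖ ≤ err d h₁ q (n + k) := by
  have hpr := hS.isProbabilityMeasure_uniform (h₁ := h₁) (q := q)
  set L' := L + 2 * B * ∑' j, 1 / lenR h₁ q j
  have hreg : ∀ α k, Regular e ν (F ∘ descend α n k) B L' s := fun α k =>
    hF.descend_of_summable hS (summable_inv_lenR hq) α k
  choose grid hcard hgrid using fun m => hnet.exists_grid (d := d) (h₁ := h₁) (q := q) m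
  let E : ℕ → Set (Rotations K d h₁ q) := fun k => ⋃ t ∈ grid (n + k),
    {α | 2 * lenR h₁ q (n + k) ^ 3 / √(((q (n + k) : ℕ) : ℝ) ^ d) <
      ‖fluct ν (n + k) (F ∘ descend α n k) (α (n + k)) (QuotientAddGroup.mk t)‖}
  have hE : ∀ k, MeasurableSet (E k) := fun k => Finset.measurableSet_biUnion _ fun t _ =>
    measurableSet_lt measurable_const (hS.measurable_fluct_descend n k hF.measurable _).norm
  have htend : Tendsto (fun k => n + k) atTop atTop := tendsto_atTop_mono (fun k => Nat.le_add_left k n) tendsto_id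
  have hqd : ∀ m, ((q m : ℕ) : ℝ) ≤ ((q m : ℕ) : ℝ) ^ d := fun m =>
    le_self_pow₀ (by exact_mod_cast (q m).pos) hd.ne'
  set ε : ℕ → ℝ := fun m => (lenR h₁ q (m + 1) * ((q m : ℕ) : ℝ) ^ d) ^ d *
    (4 * Real.exp (16 * B ^ 4 - lenR h₁ q m ^ 3)) with hε
  have hεs : Summable fun k => ε (n + k) :=
    (summable_grid hq d (16 * B ^ 4)).comp_injective (add_right_injective n)
  have hbound : ∀ᶠ k in atTop, ∀ α : Rotations K d h₁ q,
      (Measure.infinitePi fun _ : Block K d h₁ q (n + k) => uniform K d h₁ q ν (n + k))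
        {a | Function.update α (n + k) a ∈ E k} ≤ ENNReal.ofReal (ε (n + k)) := by
    filter_upwards [htend.eventually
      ((tendsto_q_real hq).eventually_ge_atTop ((4 * B ^ 2) ^ 2))] with k hk α
    have hsub : {a | Function.update α (n + k) a ∈ E k} ⊆ ⋃ t ∈ grid (n + k),
        {a | 2 * lenR h₁ q (n + k) ^ 3 / √(((q (n + k) : ℕ) : ℝ) ^ d) <
          ‖fluct ν (n + k) (F ∘ descend α n k) a (QuotientAddGroup.mk t)‖} := by
      intro a ha
      simp only [E, Set.mem_ofPred_eq, Set.mem_iUnion, exists_prop] at ha ⊢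
      obtain ⟨t, ht, h⟩ := ha
      refine ⟨t, ht, ?_⟩
      -- The lift to level `n + k` uses rotations of lower levels only. Given those, it is a fixed
      -- regular function, and the tail bound applies to the rotations of level `n + k`.
      rwa [Function.update_self, descend_congr (α' := α) n k fun j hj =>
        Function.update_of_ne (by omega) _ _] at h
    refine (measure_mono hsub).trans ((measure_biUnion_finset_le _ _).trans ?_)
    refine (Finset.sum_le_sum fun t _ => hS.measure_lt_fluct_le (hreg α k).measurable
      (hreg α k).norm_le (hreg α k).integral_eq_zero (hk.trans (hqd _)) _ _).trans ?_
    rw [Finset.sum_const, nsmul_eq_mul, hε]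
    have h4 : (4 : ℝ≥0∞) = ENNReal.ofReal 4 := by simp
    rw [h4, ← ENNReal.ofReal_mul (by norm_num), ← ENNReal.ofReal_natCast,
      ← ENNReal.ofReal_mul (by positivity)]
    exact ENNReal.ofReal_le_ofReal (mul_le_mul_of_nonneg_right (hcard _) (by positivity))
  filter_upwards [ae_eventually_notMem_of_update (fun m => Measure.infinitePi
    fun _ : Block K d h₁ q m => uniform K d h₁ q ν m) (fun k => n + k) hE
    hεs.tsum_ofReal_ne_top hbound] with α hα
  filter_upwards [hα, htend.eventually ((tendsto_lenR hq).eventually_ge_atTop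
    ((2 * B * L' + 3 * B ^ 2) * d)), htend.eventually ((tendsto_lenR hq).eventually_ge_atTop 1)]
    with k hk hk2 hk3 z
  obtain ⟨t, ht, htz⟩ := hgrid (n + k) _ (rep_mem z)
  have h1 : ‖fluct ν (n + k) (F ∘ descend α n k) (α (n + k)) (QuotientAddGroup.mk t)‖ ≤
      2 * lenR h₁ q (n + k) ^ 3 / √(((q (n + k) : ℕ) : ℝ) ^ d) := by
    by_contra hcon
    exact hk (Set.mem_biUnion ht (not_le.1 hcon))
  have h2 := hS.norm_fluct_sub_le (hreg α k) (α (n + k)) (rep (n + k + 1) z - t)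
    (QuotientAddGroup.mk t)
  rw [← QuotientAddGroup.mk_add, sub_add_cancel, mk_rep] at h2
  set Q : ℝ := ((q (n + k) : ℕ) : ℝ) ^ d with hQdef
  have hQ1 : 1 ≤ Q := one_le_pow₀ (by exact_mod_cast (q (n + k)).pos)
  have hQ0 : 0 < √Q := Real.sqrt_pos.2 (by linarith)
  have hQs : √Q ≤ Q := by
    have : 1 ≤ √Q := Real.one_le_sqrt.2 hQ1
    nlinarith [Real.mul_self_sqrt (by linarith : 0 ≤ Q)]
  have h3 : ∑ i, |e ((rep (n + k + 1) z - t) i)| ≤ d * (1 / Q) :=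
    (Finset.sum_le_sum fun i _ => htz i).trans (by simp)
  have hC : 0 ≤ 2 * B * L' + 3 * B ^ 2 := by
    have hL := (hreg α k).lipschitz
    have hB := hF.bound_nonneg
    have hL' : 0 ≤ L' := by
      -- The nonnegativity of the Lipschitz constant is read off from its own inequality at one
      -- translation whose length is positive.
      have h4 := hL (fun _ => 1)
      have h5 : (0 : ℝ) < ∑ _i : Fin d, |e 1| := by simp [hd]
      have h6 : 0 ≤ ∫ x, ‖(F ∘ descend α n k) (QuotientAddGroup.mk (fun _ => 1) + x) -
        (F ∘ descend α n k) x‖ ∂(uniform K d h₁ q ν (n + k)) :=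
        integral_nonneg fun _ => norm_nonneg _
      exact nonneg_of_mul_nonneg_left (h6.trans h4) h5
    positivity
  have h5 : ‖fluct ν (n + k) (F ∘ descend α n k) (α (n + k)) z -
      fluct ν (n + k) (F ∘ descend α n k) (α (n + k)) (QuotientAddGroup.mk t)‖ ≤
      lenR h₁ q (n + k) ^ 3 / √Q := by
    calc _ ≤ (2 * B * L' + 3 * B ^ 2) * (d * (1 / Q)) :=
          h2.trans (mul_le_mul_of_nonneg_left h3 hC)
      _ = ((2 * B * L' + 3 * B ^ 2) * d) / Q := by ring
      _ ≤ lenR h₁ q (n + k) ^ 3 / √Q := by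
          have h6 : lenR h₁ q (n + k) ≤ lenR h₁ q (n + k) ^ 3 := le_self_pow₀ hk3 (by norm_num)
          exact div_le_div₀ (by positivity) (hk2.trans h6) hQ0 hQs
  have h6 := norm_le_norm_add_norm_sub
    (fluct ν (n + k) (F ∘ descend α n k) (α (n + k)) (QuotientAddGroup.mk t))
    (fluct ν (n + k) (F ∘ descend α n k) (α (n + k)) z)
  rw [norm_sub_rev] at h6
  calc _ ≤ 2 * lenR h₁ q (n + k) ^ 3 / √Q + lenR h₁ q (n + k) ^ 3 / √Q := by linarith
    _ = _ := by rw [err, ← hQdef]; ring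

omit hS [ν.IsAddLeftInvariant] [MeasurableAdd₂ K] [MeasurableNeg K] [MeasurableSpace K]
  [LinearOrder K] [IsStrictOrderedRing K] [Archimedean K] [CommRing K] in
-- A reverse Markov inequality, from `f ≤ indicator {δ ≤ f} + δ`; it needs `f ≤ 1`, which explains
-- the truncated correlations.
theorem ofReal_le_measure_of_le_integral {Ω : Type*} [MeasurableSpace Ω] {P : Measure Ω}
    [IsProbabilityMeasure P] {f : Ω → ℝ} (hf : Measurable f) (h0 : ∀ x, 0 ≤ f x)
    (h1 : ∀ x, f x ≤ 1) {δ : ℝ} (hδ : 0 ≤ δ) (h : 2 * δ ≤ ∫ x, f x ∂P) :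
    ENNReal.ofReal δ ≤ P {x | δ ≤ f x} := by
  have hm : MeasurableSet {x | δ ≤ f x} := measurableSet_le measurable_const hf
  have hi : Integrable f P := Integrable.of_bound hf.aestronglyMeasurable 1
    (Eventually.of_forall fun x => by rw [Real.norm_of_nonneg (h0 x)]; exact h1 x)
  have hle : ∫ x, f x ∂P ≤ ∫ x, ({x | δ ≤ f x}.indicator (fun _ => (1 : ℝ)) x + δ) ∂P := by
    refine integral_mono hi (((integrable_const _).indicator hm).add (integrable_const _))
      fun x => ?_
    by_cases hx : δ ≤ f x
    · rw [Set.indicator_of_mem (show x ∈ {x | δ ≤ f x} from hx)]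
      linarith [h1 x]
    · rw [Set.indicator_of_notMem (show x ∉ {x | δ ≤ f x} from hx)]
      linarith
  rw [integral_add ((integrable_const _).indicator hm) (integrable_const _),
    integral_indicator hm, setIntegral_const] at hle
  simp only [smul_eq_mul, mul_one, integral_const, probReal_univ, one_mul] at hle
  refine ENNReal.ofReal_le_of_le_toReal ?_
  change δ ≤ P.real _
  linarith

/-- By Fubini, the average of the truncated correlation over the annulus has conditional mean at
least `2 * δ` given the other levels, so it exceeds `δ` with conditional probability at least `δ`,
and hence infinitely often. Without the truncation, the average of volume times squared correlation
is the integral over the annulus. The constant depends on the function only, not on the rotations.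
-/
theorem ae_frequently_le_integral (hq : ∀ n, ((q n : ℕ) : ℝ) = (4 * lenR h₁ q n) ^ (n + 2))
    (hd : 0 < d) {n : ℕ} {F : Space K d h₁ q n → ℂ} {B L s : ℝ}
    (hF : Regular e ν F B L s) (hs : 0 < s) :
    ∃ c : ℝ, 0 < c ∧ ∀ᵐ α ∂(rotationLaw K d h₁ q ν), ∃ᶠ k in atTop,
      c ≤ ∫ t in annulus e d h₁ q (n + k), ‖corr (uniform K d h₁ q ν (n + k + 1))
        (F ∘ descend α n (k + 1)) (QuotientAddGroup.mk t)‖ ^ 2 ∂ν := by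
  have hpr := hS.isProbabilityMeasure_uniform (h₁ := h₁) (q := q)
  set L' := L + 2 * B * ∑' j, 1 / lenR h₁ q j
  have hreg : ∀ α k, Regular e ν (F ∘ descend α n k) B L' s := fun α k =>
    hF.descend_of_summable hS (summable_inv_lenR hq) α k
  have hB := hF.bound_nonneg
  -- On cells of side `1 / k'` the correlation differs from its value `s` at zero by at most `s /
  -- 2`, so `σ = s / 2` is available on every lift.
  obtain ⟨k', hk'⟩ := exists_nat_gt (2 * |B * L'| * d / s)
  have hk0 : (0 : ℝ) < k' := lt_of_le_of_lt (by positivity) hk'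
  have hd0 : (0 : ℝ) < d := by exact_mod_cast hd
  set σ := s / 2 with hσ
  set c := σ ^ 2 / (32 * d * k') ^ d with hc
  have hc0 : 0 < c := by positivity
  set δ := c / (8 * c + 2) / 2 with hδ
  have hδ0 : 0 < δ := by positivity
  have hcell : ∀ α k (v : Fin d → K), (∀ i, |e (v i)| ≤ 1 / k') →
      σ ≤ ‖corr (uniform K d h₁ q ν (n + k)) (F ∘ descend α n k) (QuotientAddGroup.mk v)‖ := by
    intro α k v hv
    refine le_trans ?_ ((hreg α k).le_norm_corr hS v)
    have h1 : ∑ i, |e (v i)| ≤ d * (1 / k') := (Finset.sum_le_sum fun i _ => hv i).trans (by simp)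
    have h2 : B * L' * ∑ i, |e (v i)| ≤ |B * L'| * (d * (1 / k')) :=
      mul_le_mul (le_abs_self _) h1 (Finset.sum_nonneg fun i _ => abs_nonneg _) (abs_nonneg _)
    have h3 : |B * L'| * (d * (1 / k')) ≤ s / 2 := by
      rw [div_lt_iff₀ hs] at hk'
      rw [mul_one_div, mul_div_assoc', div_le_iff₀ hk0]
      linarith
    rw [hσ]
    linarith
  let D : ℕ → Set (Fin d → K) := fun k => annulus e d h₁ q (n + k)
  let G : ℕ → Rotations K d h₁ q → (Fin d → K) → ℂ := fun k α t =>
    corr (uniform K d h₁ q ν (n + k + 1)) (F ∘ descend α n (k + 1)) (QuotientAddGroup.mk t)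
  have hGm : ∀ k, Measurable fun p : Rotations K d h₁ q × (Fin d → K) => G k p.1 p.2 := fun k =>
    (hS.measurable_corr_descend n (k + 1) hF.measurable).comp
      (measurable_fst.prodMk ((measurable_mk _).comp measurable_snd))
  obtain ⟨W, hW⟩ : ∃ W : ℕ → Rotations K d h₁ q → (Fin d → K) → ℝ, ∀ k α t, W k α t =
    min 1 (ν.real (D k) * ‖G k α t‖ ^ 2) := ⟨_, fun _ _ _ => rfl⟩
  have hWm : ∀ k, Measurable fun p : Rotations K d h₁ q × (Fin d → K) => W k p.1 p.2 := fun k => by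
    simp_rw [hW]
    exact measurable_const.min (((hGm k).norm.pow_const 2).const_mul _)
  have hW0 : ∀ k α t, 0 ≤ W k α t := fun k α t => by
    rw [hW]; exact le_min zero_le_one (by positivity)
  have hW1 : ∀ k α t, W k α t ≤ 1 := fun k α t => by
    rw [hW]; exact min_le_left _ _
  let E : ℕ → Set (Rotations K d h₁ q) := fun k => {α | δ ≤ ∫ t, W k α t ∂ν[|D k]}
  have hIm : ∀ k, Measurable fun α => ∫ t, W k α t ∂ν[|D k] := fun k =>
    ((hWm k).stronglyMeasurable.integral_prod_right' (ν := ν[|D k])).measurable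
  have htend : Tendsto (fun k => n + k) atTop atTop := tendsto_atTop_mono (fun k => Nat.le_add_left k n) tendsto_id
  have hlarge : ∀ᶠ k in atTop, (32 * d : ℝ) ≤ ((q (n + k) : ℕ) : ℝ) ∧
      (16 * (2 * 2 ^ d) ^ 2 + 3) * (16 * B ^ 4) ≤ lenR h₁ q (n + k) :=
    (htend.eventually ((tendsto_q_real hq).eventually_ge_atTop _)).and
      (htend.eventually ((tendsto_lenR hq).eventually_ge_atTop _))
  have hDsize := fun k (hk : (32 * d : ℝ) ≤ ((q (n + k) : ℕ) : ℝ)) =>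
    hS.measureReal_annulus_bounds (h₁ := h₁) (q := q) hd hk
  have hprob := fun k (hk : (32 * d : ℝ) ≤ ((q (n + k) : ℕ) : ℝ)) =>
    hS.isProbabilityMeasure_cond_annulus (h₁ := h₁) (q := q) hd hk
  have hcond : ∀ᶠ k in atTop, ∀ α : Rotations K d h₁ q, ENNReal.ofReal δ ≤
      (Measure.infinitePi fun _ : Block K d h₁ q (n + k) => uniform K d h₁ q ν (n + k))
        {a | Function.update α (n + k) a ∈ E k} := by
    filter_upwards [hlarge] with k hk α
    obtain ⟨hk1, hk2⟩ := hk
    obtain ⟨hV1, hV2, hV3, hV4⟩ := hDsize k hk1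
    have := hprob k hk1
    set Pr := Measure.infinitePi fun _ : Block K d h₁ q (n + k) => uniform K d h₁ q ν (n + k)
    have hl := lenR_pos h₁ q (n + k)
    have hq0 : (0 : ℝ) < ((q (n + k) : ℕ) : ℝ) := by exact_mod_cast (q (n + k)).pos
    have hupd : Measurable fun a : Block K d h₁ q (n + k) → Space K d h₁ q (n + k) =>
      Function.update α (n + k) a := measurable_update α
    have hmj : Measurable fun p : (Block K d h₁ q (n + k) → Space K d h₁ q (n + k)) ×
        (Fin d → K) => W k (Function.update α (n + k) p.1) p.2 :=
      (hWm k).comp (g := fun p : Rotations K d h₁ q × (Fin d → K) => W k p.1 p.2)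
        (f := fun p : (Block K d h₁ q (n + k) → Space K d h₁ q (n + k)) × (Fin d → K) =>
          (Function.update α (n + k) p.1, p.2))
        ((hupd.comp measurable_fst).prodMk measurable_snd)
    have hij : Integrable (Function.uncurry fun (a : Block K d h₁ q (n + k) →
        Space K d h₁ q (n + k)) (t : Fin d → K) => W k (Function.update α (n + k) a) t)
        (Pr.prod ν[|D k]) := Integrable.of_bound hmj.aestronglyMeasurable 1
      (Eventually.of_forall fun p => by
        rw [Function.uncurry, Real.norm_of_nonneg (hW0 _ _ _)]; exact hW1 _ _ _)
    refine ofReal_le_measure_of_le_integral ((hIm k).comp hupd)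
      (fun a => integral_nonneg fun t => hW0 _ _ _)
      (fun a => ?_) hδ0.le ?_
    · refine (integral_mono (Integrable.of_bound ((hWm k).comp
        measurable_prodMk_left).aestronglyMeasurable 1 (Eventually.of_forall fun p => by
          rw [Function.comp_apply, Real.norm_of_nonneg (hW0 _ _ _)]; exact hW1 _ _ _))
        (integrable_const 1) fun t => hW1 _ _ _).trans ?_
      simp
    · change _ ≤ ∫ a, ∫ t, W k (Function.update α (n + k) a) t ∂ν[|D k] ∂Pr
      rw [integral_integral_swap hij]
      have hpt : ∀ t ∈ D k, 2 * δ ≤ ∫ a, W k (Function.update α (n + k) a) t ∂Pr := by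
        intro t ht
        have hmain := hS.le_integral_min_corr_of_mem_annulus hq hd (hreg α k) (σ := σ)
          (by positivity) (by exact_mod_cast hk0) (hcell α k) hk1 hk2 ht hc
        have e1 : 2 * δ = c / (8 * c + 2) := by rw [hδ]; ring
        rw [e1]
        refine hmain.trans (le_of_eq (integral_congr_ae (Eventually.of_forall fun a => ?_)))
        have e2 : F ∘ descend (Function.update α (n + k) a) n (k + 1) =
            (F ∘ descend α n k) ∘ glueWith (n + k) a := by
          funext z
          simp only [descend, glue_eq, Function.update_self, Function.comp_apply]
          rw [descend_congr (α' := α) n k fun j hj => Function.update_of_ne (by omega) _ _]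
        simp only [hW, G, e2, D]
      calc 2 * δ = ∫ _t, 2 * δ ∂ν[|D k] := by simp
        _ ≤ _ := integral_mono_ae (integrable_const _) hij.integral_prod_right
            ((ae_cond_mem (hS.measurableSet_annulus _)).mono hpt)
  refine ⟨δ, hδ0, ?_⟩
  have hfreq := ae_frequently_mem_of_update (fun m => Measure.infinitePi
    fun _ : Block K d h₁ q m => uniform K d h₁ q ν m) n (E := E)
    (fun k => measurableSet_le measurable_const (hIm k)) (fun k α α' h => ?_)
    (δ := ENNReal.ofReal δ) (by simpa using hδ0) hcond
  · filter_upwards [hfreq] with α hα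
    refine (hα.and_eventually hlarge).mono fun k hk => ?_
    obtain ⟨hk0, hk1, -⟩ := hk
    obtain ⟨-, -, hV3, -⟩ := hDsize k hk1
    have := hprob k hk1
    have := hS.measurableAdd₂ (h₁ := h₁) (q := q) (n + (k + 1))
    have := hS.measurableNeg (h₁ := h₁) (q := q) (n + (k + 1))
    have := hS.isAddLeftInvariant_uniform (h₁ := h₁) (q := q) (n + (k + 1))
    have hGb : ∀ t, ‖G k α t‖ ≤ B ^ 2 := fun t => norm_corr_le (hreg α (k + 1)).norm_le _
    have hGi : Integrable (fun t => ν.real (D k) * ‖G k α t‖ ^ 2) ν[|D k] :=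
      (Integrable.of_bound (((hGm k).comp measurable_prodMk_left).norm.pow_const
        2).aestronglyMeasurable ((B ^ 2) ^ 2) (Eventually.of_forall fun t => by
          rw [Real.norm_of_nonneg (by positivity)]
          exact pow_le_pow_left₀ (norm_nonneg _) (hGb t) 2)).const_mul _
    calc δ ≤ ∫ t, W k α t ∂ν[|D k] := hk0
      _ ≤ ∫ t, ν.real (D k) * ‖G k α t‖ ^ 2 ∂ν[|D k] := by
          refine integral_mono (Integrable.of_bound ((hWm k).comp
            measurable_prodMk_left).aestronglyMeasurable 1 (Eventually.of_forall fun p => by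
            rw [Real.norm_of_nonneg (hW0 _ _ _)]; exact hW1 _ _ _)) hGi
            fun t => by rw [hW]; exact min_le_right _ _
      _ = ∫ t in D k, ‖G k α t‖ ^ 2 ∂ν := by
          rw [integral_const_mul, ProbabilityTheory.cond, integral_smul_measure, smul_eq_mul,
            ← mul_assoc, ENNReal.toReal_inv]
          have hne : ν.real (D k) ≠ 0 := fun h0 => by
            have h1 : ν[|D k] Set.univ = 1 := measure_univ
            rw [ProbabilityTheory.cond, Measure.smul_apply, Measure.restrict_apply_univ,
              (measureReal_eq_zero_iff hV3).1 h0, smul_zero] at h1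
            exact zero_ne_one h1
          change ν.real (D k) * (ν.real (D k))⁻¹ * _ = _
          rw [mul_inv_cancel₀ hne, one_mul]
  · have e1 : descend α n (k + 1) = descend α' n (k + 1) :=
      descend_congr n (k + 1) fun j hj => h j (by omega)
    change δ ≤ _ ↔ δ ≤ _
    simp only [hW, G, e1]

end IsStandard
end AlmostSure

end Iceberg

namespace Iceberg

/-! ### Estimates for the errors -/

section Errors

variable {d : ℕ} {h₁ : ℕ+} {q : ℕ → ℕ+}
  (hq : ∀ n, ((q n : ℕ) : ℝ) = (4 * lenR h₁ q n) ^ (n + 2))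

omit hq in
theorem err_nonneg (n : ℕ) : 0 ≤ err d h₁ q n := by
  have := lenR_pos h₁ q n
  unfold err
  positivity

omit hq in
theorem sqrt_q_pow (n : ℕ) : √(((q n : ℕ) : ℝ) ^ d) = ((q n : ℕ) : ℝ) ^ ((d : ℝ) / 2) := by
  rw [Real.sqrt_eq_rpow, ← Real.rpow_natCast, ← Real.rpow_mul (by positivity)]
  ring_nf

include hq

theorem eventually_err_le : ∀ᶠ n in atTop,
    err d h₁ q n ≤ lenR h₁ q n ^ (5 : ℝ) * ((q n : ℕ) : ℝ) ^ (-((d : ℝ) / 2)) := by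
  filter_upwards [(tendsto_lenR hq).eventually_ge_atTop 2] with n hn
  have hq0 : (0 : ℝ) < ((q n : ℕ) : ℝ) := by exact_mod_cast (q n).pos
  rw [err, sqrt_q_pow, Real.rpow_neg hq0.le, ← div_eq_mul_inv]
  refine div_le_div_of_nonneg_right ?_ (by positivity)
  have : lenR h₁ q n ^ (5 : ℝ) = lenR h₁ q n ^ 2 * lenR h₁ q n ^ 3 := by
    rw [← pow_add]; exact_mod_cast Real.rpow_natCast _ 5
  rw [this]
  exact mul_le_mul_of_nonneg_right (by nlinarith) (by positivity)

/-- Powers of `h` are negligible against any positive power of `q`. Thus `err` is `q ^ (-d / 2)` up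
to `q ^ θ`, with an arbitrary negative power of `h` to spare. -/
theorem eventually_err_le_rpow (hd : 0 < d) (A : ℝ) {θ : ℝ} (hθ : 0 < θ) : ∀ᶠ n in atTop,
    err d h₁ q n ≤ lenR h₁ q n ^ (-A) * ((q n : ℕ) : ℝ) ^ (-((d : ℝ) / 2) + θ) := by
  filter_upwards [eventually_err_le (d := d) hq, eventually_rpow_le hq (A + 5) hθ] with n h1 h2
  have hl := lenR_pos h₁ q n
  have hq0 : (0 : ℝ) < ((q n : ℕ) : ℝ) := by exact_mod_cast (q n).pos
  refine h1.trans ?_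
  rw [Real.rpow_add hq0, ← mul_assoc, mul_right_comm]
  refine mul_le_mul_of_nonneg_right ?_ (by positivity)
  rw [Real.rpow_add hl] at h2
  rw [Real.rpow_neg hl.le, inv_mul_eq_div, le_div_iff₀ (by positivity), mul_comm]
  exact h2

theorem eventually_err_le_succ (hd : 0 < d) {a : ℝ} (ha : a < 1 / 2) : ∀ᶠ n in atTop,
    err d h₁ q n ≤ lenR h₁ q (n + 1) ^ (-a) := by
  -- With `θ = 1 / 2 - a` the exponent `-d / 2 + θ` is at most `-a`, as `d ≥ 1`; the factor `h ^
  -- (-a)` completes `(q * h) ^ (-a)`.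
  filter_upwards [eventually_err_le_rpow hq hd a (θ := 1 / 2 - a) (by linarith)] with n h1
  have hl := lenR_pos h₁ q n
  have hq1 : (1 : ℝ) ≤ ((q n : ℕ) : ℝ) := by exact_mod_cast (q n).pos
  have hd1 : (1 : ℝ) ≤ d := by exact_mod_cast hd
  refine h1.trans ?_
  rw [lenR_succ, Real.mul_rpow (by positivity) hl.le, mul_comm]
  refine mul_le_mul_of_nonneg_right ?_ (by positivity)
  exact Real.rpow_le_rpow_of_exponent_le hq1 (by linarith)

theorem eventually_err_le_pow (hd : 0 < d) (A : ℝ) : ∀ᶠ n in atTop,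
    err d h₁ q n ≤ lenR h₁ q n ^ (-A) := by
  filter_upwards [eventually_err_le_rpow hq hd A (θ := 1 / 2) (by norm_num)] with n h1
  have hl := lenR_pos h₁ q n
  have hq1 : (1 : ℝ) ≤ ((q n : ℕ) : ℝ) := by exact_mod_cast (q n).pos
  have hd1 : (1 : ℝ) ≤ d := by exact_mod_cast hd
  refine h1.trans (mul_le_of_le_one_right (by positivity) ?_)
  exact Real.rpow_le_one_of_one_le_of_nonpos hq1 (by linarith)

/-- The sums of negative powers of the sides are dominated by their first terms. -/
theorem sum_rpow_le {a : ℝ} (ha : 0 < a) (m j : ℕ) :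
    ∑ i ∈ Finset.range j, lenR h₁ q (m + i) ^ (-a) ≤
      (1 - (4 : ℝ) ^ (-a))⁻¹ * lenR h₁ q m ^ (-a) := by
  have hl := lenR_pos h₁ q m
  have h4 : (4 : ℝ) ^ (-a) < 1 := Real.rpow_lt_one_of_one_lt_of_neg (by norm_num) (by linarith)
  have h40 : (0 : ℝ) ≤ (4 : ℝ) ^ (-a) := by positivity
  have hle : ∀ i, lenR h₁ q (m + i) ^ (-a) ≤ ((4 : ℝ) ^ (-a)) ^ i * lenR h₁ q m ^ (-a) := by
    intro i
    have h1 : ((4 : ℝ) ^ (-a)) ^ i = ((4 : ℝ) ^ i) ^ (-a) := by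
      rw [← Real.rpow_natCast, ← Real.rpow_mul (by norm_num), mul_comm,
        Real.rpow_mul (by norm_num), Real.rpow_natCast]
    rw [h1, ← Real.mul_rpow (by positivity) hl.le]
    exact Real.rpow_le_rpow_of_nonpos (by positivity) (four_pow_mul_lenR_le hq m i) (by linarith)
  calc _ ≤ ∑ i ∈ Finset.range j, ((4 : ℝ) ^ (-a)) ^ i * lenR h₁ q m ^ (-a) :=
        Finset.sum_le_sum fun i _ => hle i
    _ = (∑ i ∈ Finset.range j, ((4 : ℝ) ^ (-a)) ^ i) * lenR h₁ q m ^ (-a) := by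
        rw [Finset.sum_mul]
    _ ≤ _ := by
        refine mul_le_mul_of_nonneg_right ?_ (by positivity)
        rw [← tsum_geometric_of_lt_one h40 h4]
        exact (summable_geometric_of_lt_one h40 h4).sum_le_tsum _ fun i _ => by positivity

end Errors

/-! ### Decay of the limit of the correlation functions -/

section Decay

variable {K : Type*} [CommRing K] [LinearOrder K] [IsStrictOrderedRing K] [Archimedean K]
  {d : ℕ} {h₁ : ℕ+} {q : ℕ → ℕ+} [MeasurableSpace K] [MeasurableAdd₂ K] [MeasurableNeg K]

/-- A function on `G` which is the limit of functions `r k` on `M (n + k)` that satisfy the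
recursion for the correlation functions up to small errors. -/
structure IsCorrLimit (ν : Measure (Fin d → K)) (n : ℕ) (r : ∀ k, Space K d h₁ q (n + k) → ℂ)
    (R : (Fin d → K) → ℂ) (C : ℝ) : Prop where
  measurable : ∀ k, Measurable (r k)
  norm_le : ∀ k z, ‖r k z‖ ≤ C
  tendsto : ∀ t, Tendsto (fun k => r k (QuotientAddGroup.mk t)) atTop (𝓝 (R t))
  recursion : ∀ᶠ k in atTop, ∀ z, ‖r (k + 1) z -
    stay ν (n + k) z * r k (proj K d h₁ q (n + k) z)‖ ≤ err d h₁ q (n + k)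

namespace IsStandard

variable {e : K →+* ℝ} {ν : Measure (Fin d → K)} (hS : IsStandard e ν)

include hS in
theorem abs_map_lattice {n : ℕ} (γ : lattice K d h₁ q n) {i : Fin d}
    (h : |e ((γ : Fin d → K) i)| < lenR h₁ q n) : (γ : Fin d → K) i = 0 := by
  obtain ⟨k, hk⟩ := (mem_lattice K d h₁ q).1 γ.2 i
  have hl := lenR_pos h₁ q n
  rw [← hk, map_zsmul, map_len, zsmul_eq_mul, abs_mul, abs_of_pos hl] at h
  have h1 : |(k : ℝ)| < 1 := by
    by_contra hcon
    nlinarith [not_lt.1 hcon]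
  have h2 : k = 0 := by
    have : |k| < 1 := by exact_mod_cast h1
    exact Int.abs_lt_one_iff.1 this
  rw [← hk, h2, zero_smul]

variable [ν.IsAddLeftInvariant] (hq : ∀ n, ((q n : ℕ) : ℝ) = (4 * lenR h₁ q n) ^ (n + 2))
include hS hq

/-- Some lattice vector of `Γ (m + 1)` is within `h m` of `t`. Since `t` is shorter than `h (m + 1)
/ 2`, that vector is zero. -/
theorem abs_lt_of_stay_ne_zero {m : ℕ} {t : Fin d → K} {ρ : ℝ} (hρ : ∀ i, |e (t i)| ≤ ρ)
    (hρm : ρ < lenR h₁ q (m + 1) / 2)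
    (h : stay ν m (QuotientAddGroup.mk t : Space K d h₁ q (m + 1)) ≠ 0) (i : Fin d) :
    |e (t i)| < lenR h₁ q m := by
  obtain ⟨γ, hγ⟩ := hS.exists_of_stay_ne_zero m t h
  have h4 := four_mul_lenR_le_succ hq m
  have hl := lenR_pos h₁ q m
  have h0 := hS.abs_map_lattice γ (i := i) (by
    have h1 := hγ i
    have h2 := abs_sub_abs_le_abs_sub (e ((γ : Fin d → K) i)) (e (t i))
    rw [abs_sub_comm] at h2
    linarith [hρ i])
  have := hγ i
  rwa [h0, map_zero, sub_zero] at this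

/-- Here `t` is within `h m` of a nonzero vector `γ` of `Γ (m + 1)`. At the next level the short
vector `t - γ` stays in its block except with probability at most `d * h m / h (m + 1)`, and `t - γ`
and `t` cannot both keep a point in its block. -/
theorem stay_succ_le {m : ℕ} {t : Fin d → K} {ρ : ℝ} (hρ : ∃ i, |e (t i)| = ρ)
    (hρm : lenR h₁ q (m + 1) / 2 ≤ ρ) (hρm' : ∀ i, |e (t i)| < lenR h₁ q (m + 1))
    (h : stay ν m (QuotientAddGroup.mk t : Space K d h₁ q (m + 1)) ≠ 0) :
    stay ν (m + 1) (QuotientAddGroup.mk t : Space K d h₁ q (m + 1 + 1)) ≤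
      d * (lenR h₁ q m / lenR h₁ q (m + 1)) := by
  obtain ⟨γ, hγ⟩ := hS.exists_of_stay_ne_zero m t h
  obtain ⟨i, hi⟩ := hρ
  have h4 := four_mul_lenR_le_succ hq m
  have h4' := four_mul_lenR_le_succ hq (m + 1)
  have hl := lenR_pos h₁ q m
  have hl' := lenR_pos h₁ q (m + 1)
  -- If `γ` were in `Γ (m + 2)`, its coordinate `i` would be shorter than the period and hence zero.
  -- Then the coordinate of modulus `ρ ≥ h (m + 1) / 2` would be shorter than `h m`.
  have hne : ((-γ : lattice K d h₁ q (m + 1)) : Fin d → K) ∉ lattice K d h₁ q (m + 1 + 1) := by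
    intro hmem
    have h1 := hS.abs_map_lattice (⟨_, hmem⟩ : lattice K d h₁ q (m + 1 + 1)) (i := i) (by
      change |e ((-(γ : Fin d → K)) i)| < _
      rw [Pi.neg_apply, map_neg, abs_neg]
      have h2 := abs_sub_abs_le_abs_sub (e ((γ : Fin d → K) i)) (e (t i))
      rw [abs_sub_comm] at h2
      linarith [hγ i, hρm' i])
    have h3 : (γ : Fin d → K) i = 0 := by
      have : (-(γ : Fin d → K)) i = 0 := h1
      simpa using this
    have h5 := hγ i
    rw [h3, map_zero, sub_zero, hi] at h5
    linarith
  have h6 := hS.stay_add_stay_le (m + 1) (QuotientAddGroup.mk t) (-γ) hne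
  have h7 := hS.one_sub_stay_le (h₁ := h₁) (q := q) (m + 1)
    (((-γ : lattice K d h₁ q (m + 1)) : Fin d → K) + t)
  rw [QuotientAddGroup.mk_add] at h7
  have h8 : ∑ i, |e ((((-γ : lattice K d h₁ q (m + 1)) : Fin d → K) + t) i)| /
      lenR h₁ q (m + 1) ≤ d * (lenR h₁ q m / lenR h₁ q (m + 1)) := by
    refine (Finset.sum_le_sum (g := fun _ => lenR h₁ q m / lenR h₁ q (m + 1)) fun j _ => ?_).trans
      (by simp)
    refine div_le_div_of_nonneg_right ?_ hl'.le
    change |e (-(γ : Fin d → K) j + t j)| ≤ _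
    rw [map_add, map_neg, neg_add_eq_sub]
    exact (hγ j).le
  linarith

end IsStandard

namespace IsCorrLimit

variable {e : K →+* ℝ} {ν : Measure (Fin d → K)} {n : ℕ} {r : ∀ k, Space K d h₁ q (n + k) → ℂ}
  {R : (Fin d → K) → ℂ} {C : ℝ}

theorem norm_limit_le (h : IsCorrLimit ν n r R C) (t : Fin d → K) : ‖R t‖ ≤ C :=
  le_of_tendsto' (h.tendsto t).norm fun _ => h.norm_le _ _

theorem measurable_limit (h : IsCorrLimit ν n r R C) : Measurable R :=
  measurable_of_tendsto_metrizable (fun k => (h.measurable k).comp (measurable_mk _))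
    (tendsto_pi_nhds.2 h.tendsto)

variable (hS : IsStandard e ν) [ν.IsAddLeftInvariant]
include hS

theorem norm_succ_le {k : ℕ} (h : ∀ z, ‖r (k + 1) z -
    stay ν (n + k) z * r k (proj K d h₁ q (n + k) z)‖ ≤ err d h₁ q (n + k)) (t : Fin d → K) :
    ‖r (k + 1) (QuotientAddGroup.mk t)‖ ≤
      stay ν (n + k) (QuotientAddGroup.mk t : Space K d h₁ q (n + k + 1)) *
      ‖r k (QuotientAddGroup.mk t)‖ + err d h₁ q (n + k) := by
  have h1 := h (QuotientAddGroup.mk t)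
  rw [proj_mk] at h1
  have h2 := norm_le_norm_add_norm_sub
    ((stay ν (n + k) (QuotientAddGroup.mk t : Space K d h₁ q (n + k + 1)) : ℂ) *
      r k (QuotientAddGroup.mk t)) (r (k + 1) (QuotientAddGroup.mk t))
  rw [norm_sub_rev, norm_mul, Complex.norm_real,
    Real.norm_of_nonneg (hS.stay_nonneg _ _)] at h2
  exact h2.trans (add_le_add le_rfl h1)

theorem norm_limit_le_add {k : ℕ} (h : IsCorrLimit ν n r R C)
    (hrec : ∀ j, k ≤ j → ∀ z, ‖r (j + 1) z -
      stay ν (n + j) z * r j (proj K d h₁ q (n + j) z)‖ ≤ err d h₁ q (n + j)) {S : ℝ}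
    (hSum : ∀ j, ∑ i ∈ Finset.range j, err d h₁ q (n + k + i) ≤ S) (t : Fin d → K) :
    ‖R t‖ ≤ ‖r k (QuotientAddGroup.mk t)‖ + S := by
  have key : ∀ j, ‖r (k + j) (QuotientAddGroup.mk t)‖ ≤ ‖r k (QuotientAddGroup.mk t)‖ +
      ∑ i ∈ Finset.range j, err d h₁ q (n + k + i) := by
    intro j
    induction j with
    | zero => simp
    | succ j ih =>
      have h1 := norm_succ_le hS (hrec (k + j) (by omega)) t
      have h2 := hS.stay_le_one (n + (k + j)) (QuotientAddGroup.mk t : Space K d h₁ q _)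
      have h3 := norm_nonneg (r (k + j) (QuotientAddGroup.mk t))
      rw [Finset.sum_range_succ, add_assoc n k j]
      exact (h1.trans (add_le_add ((mul_le_of_le_one_left h3 h2).trans ih) le_rfl)).trans
        (le_of_eq (add_assoc _ _ _))
  have hlim : Tendsto (fun j => ‖r (k + j) (QuotientAddGroup.mk t)‖) atTop (𝓝 ‖R t‖) :=
    ((h.tendsto t).comp (tendsto_atTop_mono (fun j => Nat.le_add_left j k) tendsto_id)).norm
  exact le_of_tendsto' hlim fun j => (key j).trans (by linarith [hSum j])

/-- For `t` this short, the level `k + j` multiplies by at least `1 - 4 ^ (-j) / 8`. These factors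
have a product above `1 / 2`; the induction carries `1 / 2 + 4 ^ (-j) / 2`, whose decrease leaves
room for each factor. -/
theorem le_norm_limit {k : ℕ} (h : IsCorrLimit ν n r R C)
    (hq : ∀ n, ((q n : ℕ) : ℝ) = (4 * lenR h₁ q n) ^ (n + 2))
    (hrec : ∀ j, k ≤ j → ∀ z, ‖r (j + 1) z -
      stay ν (n + j) z * r j (proj K d h₁ q (n + j) z)‖ ≤ err d h₁ q (n + j)) {S : ℝ}
    (hSum : ∀ j, ∑ i ∈ Finset.range j, err d h₁ q (n + k + i) ≤ S) {t : Fin d → K}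
    (ht : ∑ i, |e (t i)| ≤ lenR h₁ q (n + k) / 8) :
    1 / 2 * ‖r k (QuotientAddGroup.mk t)‖ - S ≤ ‖R t‖ := by
  have key : ∀ j, (1 / 2 + 1 / 2 * (1 / 4 : ℝ) ^ j) * ‖r k (QuotientAddGroup.mk t)‖ -
      ∑ i ∈ Finset.range j, err d h₁ q (n + k + i) ≤ ‖r (k + j) (QuotientAddGroup.mk t)‖ := by
    intro j
    induction j with
    | zero => simp; linarith
    | succ j ih =>
      have h1 := hrec (k + j) (by omega) (QuotientAddGroup.mk t)
      rw [proj_mk] at h1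
      have h2 := hS.stay_le_one (n + (k + j)) (QuotientAddGroup.mk t : Space K d h₁ q _)
      have h20 := hS.stay_nonneg (n + (k + j)) (QuotientAddGroup.mk t : Space K d h₁ q _)
      have h3 := hS.one_sub_stay_le (h₁ := h₁) (q := q) (n + (k + j)) t
      have h4 : ∑ i, |e (t i)| / lenR h₁ q (n + (k + j)) ≤ 1 / 8 * (1 / 4 : ℝ) ^ j := by
        have h5 := four_pow_mul_lenR_le hq (n + k) j
        rw [add_assoc] at h5
        have h6 := lenR_pos h₁ q (n + k)
        rw [← Finset.sum_div, div_le_iff₀ (lenR_pos _ _ _)]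
        calc _ ≤ lenR h₁ q (n + k) / 8 := ht
          _ = 1 / 8 * (1 / 4 : ℝ) ^ j * (4 ^ j * lenR h₁ q (n + k)) := by
              rw [one_div_pow]; field_simp
          _ ≤ _ := by gcongr
      have h7 := norm_sub_norm_le
        ((stay ν (n + (k + j)) (QuotientAddGroup.mk t : Space K d h₁ q (n + (k + j) + 1)) : ℂ) *
          r (k + j) (QuotientAddGroup.mk t)) (r (k + j + 1) (QuotientAddGroup.mk t))
      rw [norm_sub_rev, norm_mul, Complex.norm_real, Real.norm_of_nonneg h20] at h7
      rw [Finset.sum_range_succ, add_assoc n k j]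
      change _ ≤ ‖r (k + j + 1) _‖
      have h11 := h7.trans h1
      set w := stay ν (n + (k + j)) (QuotientAddGroup.mk t : Space K d h₁ q (n + (k + j) + 1))
      set x : ℝ := (1 / 4 : ℝ) ^ j with hx
      have hx0 : 0 < x := by positivity
      have hx1 : x ≤ 1 := pow_le_one₀ (by norm_num) (by norm_num)
      set A := ‖r k (QuotientAddGroup.mk t)‖
      have hA : 0 ≤ A := norm_nonneg _
      set T := ∑ i ∈ Finset.range j, err d h₁ q (n + k + i)
      have hT : 0 ≤ T := Finset.sum_nonneg fun i _ => err_nonneg _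
      have h8 : w * ((1 / 2 + 1 / 2 * x) * A - T) ≤ w * ‖r (k + j) (QuotientAddGroup.mk t)‖ :=
        mul_le_mul_of_nonneg_left ih h20
      have h9 : (1 / 2 + 1 / 2 * (x * (1 / 4))) * A ≤ w * ((1 / 2 + 1 / 2 * x) * A) := by
        rw [← mul_assoc w]
        refine mul_le_mul_of_nonneg_right ?_ hA
        have : 1 - 1 / 8 * x ≤ w := by linarith
        nlinarith
      have h10 : w * T ≤ T := mul_le_of_le_one_left hT h2
      rw [pow_succ, ← hx]
      refine le_trans ?_ (sub_le_comm.1 h11)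
      linarith
  have hlim : Tendsto (fun j => ‖r (k + j) (QuotientAddGroup.mk t)‖) atTop (𝓝 ‖R t‖) :=
    ((h.tendsto t).comp (tendsto_atTop_mono (fun j => Nat.le_add_left j k) tendsto_id)).norm
  refine ge_of_tendsto' hlim fun j => le_trans ?_ (key j)
  have : 0 ≤ 1 / 2 * (1 / 4 : ℝ) ^ j * ‖r k (QuotientAddGroup.mk t)‖ := by positivity
  linarith [hSum j]

/-- The pointwise decay of the limit. -/
theorem exists_norm_le_rpow (h : IsCorrLimit ν n r R C)
    (hq : ∀ n, ((q n : ℕ) : ℝ) = (4 * lenR h₁ q n) ^ (n + 2)) (hd : 0 < d) {a : ℝ}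
    (ha0 : 0 < a) (ha : a < 1 / 2) :
    ∃ D ρ₀ : ℝ, ∀ (t : Fin d → K) (ρ : ℝ), ρ₀ ≤ ρ → (∃ i, |e (t i)| = ρ) →
      (∀ i, |e (t i)| ≤ ρ) → ‖R t‖ ≤ D * ρ ^ (-a) := by
  have hC : 0 ≤ C := (norm_nonneg _).trans (h.norm_limit_le 0)
  obtain ⟨k₁, hk₁⟩ := eventually_atTop.1 h.recursion
  obtain ⟨k₂, hk₂⟩ := eventually_atTop.1 ((tendsto_atTop_mono (fun k => Nat.le_add_left k n)
    tendsto_id).eventually (eventually_err_le_succ (d := d) hq hd ha))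
  set k₀ := max k₁ k₂
  set c₄ := (1 - (4 : ℝ) ^ (-a))⁻¹
  have hc₄ : 0 ≤ c₄ := by
    have h4 : (4 : ℝ) ^ (-a) < 1 := Real.rpow_lt_one_of_one_lt_of_neg (by norm_num) (by linarith)
    exact inv_nonneg.2 (by linarith)
  refine ⟨d * C + 1 + 1 + c₄, lenR h₁ q (n + (k₀ + 1)) / 2, fun t ρ hρ hex hall => ?_⟩
  -- the level at which `t` is comparable with the side
  have hexists : ∃ j, ρ < lenR h₁ q (n + (j + 1)) / 2 := by
    obtain ⟨N, hN⟩ := eventually_atTop.1 ((tendsto_lenR hq).eventually_gt_atTop (2 * ρ))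
    exact ⟨N, by linarith [hN (n + (N + 1)) (by omega)]⟩
  obtain ⟨k, hk1, hkmin⟩ : ∃ k, ρ < lenR h₁ q (n + (k + 1)) / 2 ∧
      ∀ j < k, ¬ ρ < lenR h₁ q (n + (j + 1)) / 2 := by
    classical
    exact ⟨Nat.find hexists, Nat.find_spec hexists, fun j hj => Nat.find_min hexists hj⟩
  have hmono : ∀ i j, i ≤ j → lenR h₁ q (n + i) ≤ lenR h₁ q (n + j) := by
    intro i j hij
    obtain ⟨l, rfl⟩ := Nat.exists_eq_add_of_le hij
    have h1 := four_pow_mul_lenR_le hq (n + i) l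
    have h2 := lenR_pos h₁ q (n + i)
    have h3 : (1 : ℝ) ≤ 4 ^ l := one_le_pow₀ (by norm_num)
    rw [← add_assoc]
    nlinarith
  have hk0 : k₀ + 1 ≤ k := by
    by_contra hcon
    have := hmono (k + 1) (k₀ + 1) (by omega)
    linarith
  -- Now `ρ` lies between half of `h (n + j + 1)` and half of `h (n + j + 2)`. Levels from `j + 2`
  -- on contribute summable errors only; the levels `j + 1` and `j` are unrolled by hand.
  obtain ⟨j, rfl⟩ : ∃ j, k = j + 1 := ⟨k - 1, by omega⟩
  have hk2 : lenR h₁ q (n + (j + 1)) / 2 ≤ ρ := not_lt.1 (hkmin j (by omega))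
  have hρ0 : 0 < ρ := lt_of_lt_of_le (half_pos (lenR_pos _ _ _)) hk2
  have hrec : ∀ i, j ≤ i → ∀ z, ‖r (i + 1) z -
      stay ν (n + i) z * r i (proj K d h₁ q (n + i) z)‖ ≤ err d h₁ q (n + i) :=
    fun i hi => hk₁ i (by omega)
  have herr : ∀ i, j ≤ i → err d h₁ q (n + i) ≤ lenR h₁ q (n + (i + 1)) ^ (-a) :=
    fun i hi => hk₂ i (by omega)
  have hpow : ∀ x, ρ ≤ x → x ^ (-a) ≤ ρ ^ (-a) := fun x hx =>
    Real.rpow_le_rpow_of_nonpos hρ0 hx (by linarith)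
  have hρ2 : ∀ i, j + 2 ≤ i → ρ ≤ lenR h₁ q (n + i) := fun i hi => by
    have := hmono (j + 1 + 1) i (by omega)
    have := lenR_pos h₁ q (n + i)
    linarith
  have hsum : ∀ l, ∑ i ∈ Finset.range l, err d h₁ q (n + (j + 2) + i) ≤ c₄ * ρ ^ (-a) := by
    intro l
    refine (Finset.sum_le_sum (g := fun i => lenR h₁ q (n + (j + 3) + i) ^ (-a)) fun i _ => ?_).trans
      ((sum_rpow_le hq ha0 _ _).trans (mul_le_mul_of_nonneg_left (hpow _ (hρ2 _ (by omega))) hc₄))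
    have := herr (j + 2 + i) (by omega)
    rwa [← add_assoc, show n + (j + 2 + i + 1) = n + (j + 3) + i by omega] at this
  have h1 := h.norm_limit_le_add hS (k := j + 2) (fun i hi => hrec i (by omega)) hsum t
  have h2 := norm_succ_le hS (hrec (j + 1) (by omega)) t
  have h3 := norm_succ_le hS (hrec j le_rfl) t
  have e1 : err d h₁ q (n + (j + 1)) ≤ ρ ^ (-a) :=
    (herr (j + 1) (by omega)).trans (hpow _ (hρ2 _ le_rfl))
  have hp : 0 ≤ ρ ^ (-a) := by positivity
  -- Only a nonzero `stay` at level `j + 1` matters, and it forces `ρ ≤ h (n + j + 1)`, so that the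
  -- error of level `j` is small enough. The main term also carries `stay` at level `j`; if that is
  -- nonzero too, `t` is near a nonzero lattice vector and `stay_succ_le` applies.
  have h4 : stay ν (n + (j + 1)) (QuotientAddGroup.mk t : Space K d h₁ q (n + (j + 1) + 1)) *
      ‖r (j + 1) (QuotientAddGroup.mk t)‖ ≤ (d * C + 1) * ρ ^ (-a) := by
    by_cases hs : stay ν (n + (j + 1))
        (QuotientAddGroup.mk t : Space K d h₁ q (n + (j + 1) + 1)) = 0
    · rw [hs, zero_mul]; positivity
    have hlt := hS.abs_lt_of_stay_ne_zero hq hall hk1 hs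
    have hle : ρ ≤ lenR h₁ q (n + (j + 1)) := by
      obtain ⟨i, hi⟩ := hex
      exact hi ▸ (hlt i).le
    have hs1 := hS.stay_le_one (n + (j + 1)) (QuotientAddGroup.mk t : Space K d h₁ q _)
    have hs0 := hS.stay_nonneg (n + (j + 1)) (QuotientAddGroup.mk t : Space K d h₁ q _)
    have e0 : err d h₁ q (n + j) ≤ ρ ^ (-a) := (herr j le_rfl).trans (hpow _ hle)
    have h5 : stay ν (n + (j + 1)) (QuotientAddGroup.mk t : Space K d h₁ q (n + (j + 1) + 1)) *
        stay ν (n + j) (QuotientAddGroup.mk t : Space K d h₁ q (n + j + 1)) ≤ d * ρ ^ (-a) := by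
      by_cases hs' : stay ν (n + j) (QuotientAddGroup.mk t : Space K d h₁ q (n + j + 1)) = 0
      · rw [hs', mul_zero]; positivity
      have h6 : stay ν (n + j + 1) (QuotientAddGroup.mk t : Space K d h₁ q (n + j + 1 + 1)) ≤
        d * (lenR h₁ q (n + j) / lenR h₁ q (n + j + 1)) := hS.stay_succ_le hq hex hk2 hlt hs'
      -- The ratio is `1 / q`, and `h (n + j + 1) = q * h ≤ q ^ 2`. Since `2 * a < 1`, this gives `1
      -- / q ≤ (q ^ 2) ^ (-a) ≤ h (n + j + 1) ^ (-a)`.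
      have h7 : lenR h₁ q (n + j) / lenR h₁ q (n + j + 1) ≤ ρ ^ (-a) := by
        refine le_trans ?_ (hpow _ hle)
        have hl := lenR_pos h₁ q (n + j)
        have hq0 : (1 : ℝ) ≤ ((q (n + j) : ℕ) : ℝ) := by exact_mod_cast (q (n + j)).pos
        have hlq := lenR_le_q hq (n + j)
        have hr0 : lenR h₁ q (n + j) / lenR h₁ q (n + j + 1) = ((q (n + j) : ℕ) : ℝ)⁻¹ := by
          rw [lenR_succ]; field_simp
        rw [hr0]
        change _ ≤ lenR h₁ q (n + j + 1) ^ (-a)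
        have h8 : lenR h₁ q (n + j + 1) ≤ ((q (n + j) : ℕ) : ℝ) ^ (2 : ℝ) := by
          rw [lenR_succ, Real.rpow_two]; nlinarith
        calc ((q (n + j) : ℕ) : ℝ)⁻¹ = ((q (n + j) : ℕ) : ℝ) ^ (-1 : ℝ) := (Real.rpow_neg_one _).symm
          _ ≤ ((q (n + j) : ℕ) : ℝ) ^ (2 * (-a)) :=
              Real.rpow_le_rpow_of_exponent_le hq0 (by linarith)
          _ = (((q (n + j) : ℕ) : ℝ) ^ (2 : ℝ)) ^ (-a) := Real.rpow_mul (by positivity) _ _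
          _ ≤ _ := Real.rpow_le_rpow_of_nonpos (lenR_pos _ _ _) h8 (by linarith)
      have h9 := hS.stay_le_one (n + j) (QuotientAddGroup.mk t : Space K d h₁ q _)
      exact (mul_le_of_le_one_right hs0 h9).trans
        (h6.trans (mul_le_mul_of_nonneg_left h7 (by positivity)))
    calc _ ≤ stay ν (n + (j + 1)) (QuotientAddGroup.mk t : Space K d h₁ q (n + (j + 1) + 1)) *
          (stay ν (n + j) (QuotientAddGroup.mk t : Space K d h₁ q (n + j + 1)) * C +
            ρ ^ (-a)) := by
          refine mul_le_mul_of_nonneg_left (h3.trans (add_le_add ?_ e0)) hs0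
          exact mul_le_mul_of_nonneg_left (h.norm_le _ _) (hS.stay_nonneg _ _)
      _ ≤ d * ρ ^ (-a) * C + 1 * ρ ^ (-a) := by
          rw [mul_add, ← mul_assoc]
          exact add_le_add (mul_le_mul_of_nonneg_right h5 hC)
            (mul_le_mul_of_nonneg_right hs1 hp)
      _ = _ := by ring
  calc ‖R t‖ ≤ (d * C + 1) * ρ ^ (-a) + ρ ^ (-a) + c₄ * ρ ^ (-a) :=
        h1.trans (add_le_add (h2.trans (add_le_add h4 e1)) le_rfl)
    _ = _ := by ring

end IsCorrLimit
end Decay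

end Iceberg

namespace Iceberg

/-! ### Integrability of the limit of the correlation functions -/

section Integrability

variable {K : Type*} [CommRing K] [LinearOrder K] [IsStrictOrderedRing K] [Archimedean K]
  {d : ℕ} {h₁ : ℕ+} {q : ℕ → ℕ+} [MeasurableSpace K] [MeasurableAdd₂ K] [MeasurableNeg K]

namespace IsCorrLimit

variable {e : K →+* ℝ} {ν : Measure (Fin d → K)} {n : ℕ} {r : ∀ k, Space K d h₁ q (n + k) → ℂ}
  {R : (Fin d → K) → ℂ} {C : ℝ} (hS : IsStandard e ν) [ν.IsAddLeftInvariant]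
include hS

/-- The limit is not square integrable if its approximations have mass in the annuli. -/
theorem not_memLp_two (h : IsCorrLimit ν n r R C)
    (hq : ∀ n, ((q n : ℕ) : ℝ) = (4 * lenR h₁ q n) ^ (n + 2)) (hd : 0 < d) {c : ℝ} (hc : 0 < c)
    (hfreq : ∃ᶠ k in atTop, c ≤ ∫ t in annulus e d h₁ q (n + k),
      ‖r (k + 1) (QuotientAddGroup.mk t)‖ ^ 2 ∂ν) : ¬ MemLp R 2 ν := by
  intro hR
  have hC : 0 ≤ C := (norm_nonneg _).trans (h.norm_limit_le 0)
  have hd1 : (0 : ℝ) < d := by exact_mod_cast hd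
  have hRint : Integrable (fun t => ‖R t‖ ^ 2) ν := hR.integrable_norm_pow (by norm_num)
  have hsh : Tendsto (fun k => n + k) atTop atTop :=
    tendsto_atTop_mono (fun k => Nat.le_add_left k n) tendsto_id
  have hlen := (tendsto_lenR hq).comp hsh
  -- the mass of the limit in the annuli vanishes
  have h1 : Tendsto (fun k => ∫ t in annulus e d h₁ q (n + k), ‖R t‖ ^ 2 ∂ν) atTop (𝓝 0) := by
    have h2 : Tendsto (fun k => ∫ t, (annulus e d h₁ q (n + k)).indicator (fun t => ‖R t‖ ^ 2) t ∂ν)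
        atTop (𝓝 (∫ _, (0 : ℝ) ∂ν)) := by
      refine tendsto_integral_of_dominated_convergence (fun t => ‖R t‖ ^ 2)
        (fun k => hRint.aestronglyMeasurable.indicator (hS.measurableSet_annulus _)) hRint
        (fun k => ae_of_all _ fun t => norm_indicator_le_norm_self _ _ |>.trans (by simp)) ?_
      -- The annuli escape to infinity: all coordinates of their points are at least the side length
      -- of the level.
      refine ae_of_all _ fun t => tendsto_const_nhds.congr' ?_
      filter_upwards [hlen.eventually_gt_atTop (e (t ⟨0, hd⟩))] with k hk
      rw [Set.indicator_of_notMem]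
      exact fun hmem => absurd (hmem ⟨0, hd⟩).1 (not_le.2 hk)
    rw [integral_zero] at h2
    refine h2.congr fun k => ?_
    rw [integral_indicator (hS.measurableSet_annulus _)]
  set c₄ := (1 - (4 : ℝ) ^ (-(d : ℝ)))⁻¹
  have h2 : Tendsto (fun k => 8 * (∫ t in annulus e d h₁ q (n + k), ‖R t‖ ^ 2 ∂ν) +
      8 * c₄ ^ 2 * lenR h₁ q (n + (k + 1)) ^ (-(d : ℝ))) atTop (𝓝 (8 * 0 + 8 * c₄ ^ 2 * 0)) := by
    refine (h1.const_mul 8).add (Tendsto.const_mul _ ?_)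
    exact (tendsto_rpow_neg_atTop hd1).comp (hlen.comp (tendsto_add_atTop_nat 1))
  rw [mul_zero, mul_zero, add_zero] at h2
  obtain ⟨k₁, hk₁⟩ := eventually_atTop.1 h.recursion
  obtain ⟨k₂, hk₂⟩ := eventually_atTop.1
    (hsh.eventually (eventually_err_le_pow (d := d) hq hd d))
  obtain ⟨k, hk, hlt, hk1, hk2, hqk⟩ := (hfreq.and_eventually ((h2.eventually_lt_const hc).and
    ((eventually_ge_atTop k₁).and ((eventually_ge_atTop k₂).and
    (((tendsto_q_real hq).comp hsh).eventually_ge_atTop (32 * d : ℝ)))))).exists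
  obtain ⟨-, hV, hVtop, -⟩ := hS.measureReal_annulus_bounds (h₁ := h₁) hd hqk
  refine absurd (hk.trans ?_) (not_le.2 hlt)
  set A := annulus e d h₁ q (n + k)
  have hl := lenR_pos h₁ q (n + k)
  have hl' := lenR_pos h₁ q (n + (k + 1))
  -- The errors after level `k` are bounded by the power `-d` of the side. Thus `S ^ 2` times the
  -- volume of the annulus, at most the power `d` of the next side, still tends to zero.
  set S := c₄ * lenR h₁ q (n + (k + 1)) ^ (-(d : ℝ)) with hSdef
  have hsum : ∀ l, ∑ i ∈ Finset.range l, err d h₁ q (n + (k + 1) + i) ≤ S := by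
    intro l
    refine (Finset.sum_le_sum (g := fun i => lenR h₁ q (n + (k + 1) + i) ^ (-(d : ℝ)))
      fun i _ => ?_).trans (sum_rpow_le hq hd1 _ _)
    have := hk₂ (k + 1 + i) (by omega)
    rwa [← add_assoc] at this
  -- From `‖r‖ ≤ 2 * (‖R‖ + S)`; squaring gives the two factors `8`.
  have hpt : ∀ t ∈ A, ‖r (k + 1) (QuotientAddGroup.mk t)‖ ^ 2 ≤ 8 * ‖R t‖ ^ 2 + 8 * S ^ 2 := by
    intro t ht
    have h3 := h.le_norm_limit hS hq (k := k + 1) (fun j hj => hk₁ j (by omega)) hsum (t := t) (by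
      have hM : (((q (n + k) : ℕ) / (8 * d) : ℕ) : ℝ) * (8 * d) ≤ ((q (n + k) : ℕ) : ℝ) := by
        exact_mod_cast Nat.div_mul_le_self _ _
      calc ∑ i, |e (t i)| ≤ ∑ _i : Fin d, (((q (n + k) : ℕ) / (8 * d) : ℕ) : ℝ) *
            lenR h₁ q (n + k) := Finset.sum_le_sum fun i _ => by
              rw [abs_of_nonneg (hl.le.trans (ht i).1)]
              exact (ht i).2.le
        _ = (((q (n + k) : ℕ) / (8 * d) : ℕ) : ℝ) * (8 * d) * lenR h₁ q (n + k) / 8 := by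
            simp; ring
        _ ≤ ((q (n + k) : ℕ) : ℝ) * lenR h₁ q (n + k) / 8 := by gcongr
        _ = _ := by rw [← lenR_succ]; rfl)
    have h4 := norm_nonneg (R t)
    have h5 := norm_nonneg (r (k + 1) (QuotientAddGroup.mk t))
    nlinarith [sq_nonneg (‖R t‖ - S)]
  have hfin : IsFiniteMeasure (ν.restrict A) := ⟨by simpa using hVtop.lt_top⟩
  calc _ ≤ ∫ t in A, (8 * ‖R t‖ ^ 2 + 8 * S ^ 2) ∂ν := by
        refine setIntegral_mono_on ?_ ?_ (hS.measurableSet_annulus _) hpt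
        · refine Integrable.of_bound (C := C ^ 2)
            (((h.measurable (k + 1)).comp (measurable_mk _)).norm.pow_const 2).aestronglyMeasurable
            (ae_of_all _ fun t => ?_)
          rw [Real.norm_of_nonneg (by positivity)]
          exact pow_le_pow_left₀ (norm_nonneg _) (h.norm_le _ _) 2
        · exact (hRint.integrableOn.const_mul 8).add (integrable_const _)
    _ = 8 * (∫ t in A, ‖R t‖ ^ 2 ∂ν) + 8 * S ^ 2 * ν.real A := by
        rw [integral_add (hRint.integrableOn.const_mul 8) (integrable_const _),
          integral_const_mul, setIntegral_const, smul_eq_mul, mul_comm (ν.real A)]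
    _ ≤ _ := by
        have hV' : ν.real A ≤ lenR h₁ q (n + (k + 1)) ^ (d : ℝ) := by
          rw [Real.rpow_natCast]
          exact hV.trans (le_of_eq (by rw [← lenR_succ]; rfl))
        refine add_le_add le_rfl ?_
        calc 8 * S ^ 2 * ν.real A ≤ 8 * S ^ 2 * lenR h₁ q (n + (k + 1)) ^ (d : ℝ) := by gcongr
          _ = 8 * c₄ ^ 2 * lenR h₁ q (n + (k + 1)) ^ (-(d : ℝ)) *
              (lenR h₁ q (n + (k + 1)) ^ (-(d : ℝ)) * lenR h₁ q (n + (k + 1)) ^ (d : ℝ)) := by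
              rw [hSdef]; ring
          _ = _ := by rw [← Real.rpow_add hl', neg_add_cancel, Real.rpow_zero, mul_one]

/-- The norm of the approximation of the limit on its fundamental domain. -/
def cubeNorm (ν : Measure (Fin d → K)) (r : ∀ k, Space K d h₁ q (n + k) → ℂ) (p : ℝ≥0∞) (k : ℕ) :
    ℝ≥0∞ :=
  eLpNorm (fun t => r k (QuotientAddGroup.mk t)) p (ν.restrict (cube K d h₁ q (n + k)))

omit hS in
theorem measurable_lift (h : IsCorrLimit ν n r R C) (k : ℕ) :
    Measurable fun t : Fin d → K => r k (QuotientAddGroup.mk t) :=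
  (h.measurable k).comp (measurable_mk _)

/-- As `0 ≤ stay ≤ 1` and `p ≥ 1`, `stay ^ p ≤ stay`. By `lintegral_stay_mul`, the weight `stay`
reduces the integral of a periodic function over the large cube to the integral over the small one.
So the main term does not increase the norm, and the error costs its supremum times the volume to
the power `1 / p`. -/
theorem cubeNorm_succ_le (h : IsCorrLimit ν n r R C) {p : ℝ≥0∞} (hp : 1 ≤ p) (hp' : p ≠ ∞) {k : ℕ}
    (hrec : ∀ z, ‖r (k + 1) z -
      stay ν (n + k) z * r k (proj K d h₁ q (n + k) z)‖ ≤ err d h₁ q (n + k)) :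
    cubeNorm ν r p (k + 1) ≤ cubeNorm ν r p k +
      ENNReal.ofReal (err d h₁ q (n + k) * lenR h₁ q (n + k + 1) ^ ((d : ℝ) / p.toReal)) := by
  have hp0 : p ≠ 0 := (zero_lt_one.trans_le hp).ne'
  have hp1 : 1 ≤ p.toReal := by
    rw [← ENNReal.toReal_one]; exact (ENNReal.toReal_le_toReal (by simp) hp').2 hp
  have hst := hS.measurable_stay (h₁ := h₁) (q := q) (n + k)
  have hpm := hS.measurable_proj (h₁ := h₁) (q := q) (n + k)
  set f : (Fin d → K) → ℂ := fun t =>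
    stay ν (n + k) (QuotientAddGroup.mk t : Space K d h₁ q (n + k + 1)) *
      r k (proj K d h₁ q (n + k) (QuotientAddGroup.mk t)) with hf
  have hfm : Measurable f := by
    have h1 : Measurable fun z : Space K d h₁ q (n + k + 1) =>
        (stay ν (n + k) z : ℂ) * r k (proj K d h₁ q (n + k) z) :=
      (Complex.measurable_ofReal.comp hst).mul ((h.measurable k).comp hpm)
    exact h1.comp (measurable_mk _)
  have hadd : (fun t : Fin d → K => r (k + 1) (QuotientAddGroup.mk t)) =
      f + fun t => (r (k + 1) (QuotientAddGroup.mk t) - f t) := by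
    funext t; simp
  rw [cubeNorm, hadd]
  refine (eLpNorm_add_le hfm.aestronglyMeasurable
    ((h.measurable_lift (k + 1)).sub hfm).aestronglyMeasurable hp).trans (add_le_add ?_ ?_)
  · rw [cubeNorm, eLpNorm_eq_lintegral_rpow_enorm_toReal hp0 hp',
      eLpNorm_eq_lintegral_rpow_enorm_toReal hp0 hp']
    refine ENNReal.rpow_le_rpow ?_ (by positivity)
    have hgm : Measurable fun z : Space K d h₁ q (n + k) => ‖r k z‖ₑ ^ p.toReal :=
      (h.measurable k).enorm.pow_const _
    have h1 := hS.lintegral_stay_mul (n + k) hgm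
    have hsm : Measurable fun z : Space K d h₁ q (n + k + 1) =>
        ENNReal.ofReal (stay ν (n + k) z) * ‖r k (proj K d h₁ q (n + k) z)‖ₑ ^ p.toReal :=
      hst.ennreal_ofReal.mul (hgm.comp hpm)
    rw [hS.lintegral_uniform _ hgm, hS.lintegral_uniform _ hsm] at h1
    calc _ ≤ ∫⁻ u in cube K d h₁ q (n + k + 1), ENNReal.ofReal (stay ν (n + k)
            (QuotientAddGroup.mk u : Space K d h₁ q (n + k + 1))) *
            ‖r k (proj K d h₁ q (n + k) (QuotientAddGroup.mk u))‖ₑ ^ p.toReal ∂ν := by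
          refine lintegral_mono fun u => ?_
          rw [hf]
          simp only
          rw [enorm_mul, ENNReal.mul_rpow_of_nonneg _ _ (by positivity)]
          refine mul_le_mul_left ?_ _
          have h0 := hS.stay_nonneg (n + k) (QuotientAddGroup.mk u : Space K d h₁ q (n + k + 1))
          have h1 := hS.stay_le_one (n + k) (QuotientAddGroup.mk u : Space K d h₁ q (n + k + 1))
          rw [← ofReal_norm, Complex.norm_real, Real.norm_of_nonneg h0]
          refine (ENNReal.rpow_le_rpow_of_exponent_ge ?_ hp1).trans (le_of_eq (ENNReal.rpow_one _))
          exact ENNReal.ofReal_le_one.2 h1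
      _ = _ := by
          have hc0 := hS.measure_cube_ne_zero (h₁ := h₁) (q := q) (n + k + 1)
          have hct := hS.measure_cube_ne_top (h₁ := h₁) (q := q) (n + k + 1)
          have hc0' := hS.measure_cube_ne_zero (h₁ := h₁) (q := q) (n + k)
          have hct' := hS.measure_cube_ne_top (h₁ := h₁) (q := q) (n + k)
          have h2 := congrArg (fun x => ν (cube K d h₁ q (n + k + 1)) * x) h1
          rw [← mul_assoc, ENNReal.mul_inv_cancel hc0 hct, one_mul] at h2
          refine Eq.trans h2 ?_
          have hq0 : (((q (n + k) : ℕ) : ℝ≥0∞) ^ d) ≠ 0 := by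
            have := (q (n + k)).pos
            positivity
          have hqt : (((q (n + k) : ℕ) : ℝ≥0∞) ^ d) ≠ ∞ := by finiteness
          have hcancel : ∀ a b I : ℝ≥0∞, a ≠ 0 → a ≠ ∞ → b ≠ 0 → b ≠ ∞ →
              a * b * (a⁻¹ * (b⁻¹ * I)) = I := by
            intro a b I ha ha' hb hb'
            calc a * b * (a⁻¹ * (b⁻¹ * I)) = a * a⁻¹ * (b * b⁻¹) * I := by ring
              _ = I := by rw [ENNReal.mul_inv_cancel ha ha', ENNReal.mul_inv_cancel hb hb',
                  one_mul, one_mul]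
          rw [hS.measure_cube_succ]
          exact hcancel _ _ _ hq0 hqt hc0' hct'
  · refine (eLpNorm_le_of_ae_bound (C := err d h₁ q (n + k)) (ae_of_all _ fun t => hrec _)).trans ?_
    rw [Measure.restrict_apply_univ, hS.measure_cube, mul_comm,
      ENNReal.ofReal_rpow_of_nonneg (pow_nonneg (lenR_pos _ _ _).le _) (by positivity),
      ← ENNReal.ofReal_mul (err_nonneg _), ← Real.rpow_natCast, ← Real.rpow_mul (lenR_pos _ _ _).le,
      div_eq_mul_inv]
    rfl

/-- The only place where `p > 2` is used quantitatively. The added norms are about `q ^ (-d / 2 + d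
/ p)`, and `θ = d / 2 - d / p > 0` leaves room to bound them by `1 / h`, which is summable. -/
theorem exists_cubeNorm_le (h : IsCorrLimit ν n r R C)
    (hq : ∀ n, ((q n : ℕ) : ℝ) = (4 * lenR h₁ q n) ^ (n + 2)) (hd : 0 < d)
    {p : ℝ≥0∞} (hp : 2 < p) (hp' : p ≠ ∞) :
    ∃ M : ℝ≥0∞, M ≠ ∞ ∧ ∀ᶠ k in atTop, cubeNorm ν r p k ≤ M := by
  have hp1 : 1 ≤ p := (by norm_num : (1 : ℝ≥0∞) ≤ 2).trans hp.le
  have hp2 : 2 < p.toReal := by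
    have := (ENNReal.toReal_lt_toReal (by simp) hp').2 hp
    simpa using this
  have hd1 : (0 : ℝ) < d := by exact_mod_cast hd
  have hθ : 0 < (d : ℝ) / 2 - d / p.toReal := by
    rw [sub_pos]
    exact div_lt_div_of_pos_left hd1 (by norm_num) hp2
  obtain ⟨N, hN⟩ := eventually_atTop.1
    (eventually_err_le_rpow (d := d) hq hd (1 + d / p.toReal) hθ)
  have herr : ∀ m, N ≤ m →
      err d h₁ q m * lenR h₁ q (m + 1) ^ ((d : ℝ) / p.toReal) ≤ 1 / lenR h₁ q m := by
    intro m hm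
    have hl := lenR_pos h₁ q m
    have hq0 : (0 : ℝ) < ((q m : ℕ) : ℝ) := by exact_mod_cast (q m).pos
    refine (mul_le_mul_of_nonneg_right (hN m hm) (by
      have := lenR_pos h₁ q (m + 1)
      positivity)).trans (le_of_eq ?_)
    rw [lenR_succ, Real.mul_rpow hq0.le hl.le]
    calc _ = (lenR h₁ q m ^ (-(1 + (d : ℝ) / p.toReal)) * lenR h₁ q m ^ ((d : ℝ) / p.toReal)) *
          (((q m : ℕ) : ℝ) ^ (-((d : ℝ) / 2) + ((d : ℝ) / 2 - d / p.toReal)) *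
            ((q m : ℕ) : ℝ) ^ ((d : ℝ) / p.toReal)) := by ring
      _ = lenR h₁ q m ^ (-1 : ℝ) * ((q m : ℕ) : ℝ) ^ (0 : ℝ) := by
          rw [← Real.rpow_add hl, ← Real.rpow_add hq0]
          congr 2 <;> ring
      _ = _ := by rw [Real.rpow_zero, mul_one, Real.rpow_neg_one, one_div]
  obtain ⟨k₁, hk₁⟩ := eventually_atTop.1 h.recursion
  set k₀ := max N k₁
  have hsum := summable_inv_lenR hq
  have hnn : ∀ m, 0 ≤ 1 / lenR h₁ q m := fun m => by
    have := lenR_pos h₁ q m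
    positivity
  have key : ∀ j, cubeNorm ν r p (k₀ + j) ≤ cubeNorm ν r p k₀ +
      ENNReal.ofReal (∑ i ∈ Finset.range j, 1 / lenR h₁ q (n + k₀ + i)) := by
    intro j
    induction j with
    | zero => simp
    | succ j ih =>
      refine (cubeNorm_succ_le hS h hp1 hp' (hk₁ (k₀ + j) (by omega))).trans ?_
      rw [Finset.sum_range_succ, ENNReal.ofReal_add (Finset.sum_nonneg fun i _ => hnn _) (hnn _)]
      refine (add_le_add ih (ENNReal.ofReal_le_ofReal ?_)).trans (le_of_eq (add_assoc _ _ _))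
      rw [add_assoc n k₀ j]
      exact herr _ (by omega)
  refine ⟨cubeNorm ν r p k₀ + ENNReal.ofReal (∑' i, 1 / lenR h₁ q i), ?_, ?_⟩
  · refine ENNReal.add_ne_top.2 ⟨?_, ENNReal.ofReal_ne_top⟩
    have : IsFiniteMeasure (ν.restrict (cube K d h₁ q (n + k₀))) :=
      ⟨by simpa using (hS.measure_cube_ne_top (h₁ := h₁) (q := q) _).lt_top⟩
    exact (MemLp.of_bound (h.measurable_lift k₀).aestronglyMeasurable C
      (ae_of_all _ fun t => h.norm_le _ _)).2.ne
  · filter_upwards [eventually_ge_atTop k₀] with k hk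
    obtain ⟨j, rfl⟩ := Nat.exists_eq_add_of_le hk
    refine (key j).trans (add_le_add le_rfl (ENNReal.ofReal_le_ofReal ?_))
    have hinj : Function.Injective fun i => n + k₀ + i := add_right_injective _
    have h1 := (hsum.comp_injective hinj).sum_le_tsum (Finset.range j) fun i _ => hnn _
    exact h1.trans (tsum_comp_le_tsum_of_inj hsum hnn hinj)

/-- Fatou's lemma for the functions `r k` cut off to translated fundamental cubes. The norm over
such a cube does not depend on the translate, while the cubes must exhaust the group for pointwise
convergence to `R`. For `p = ∞` the uniform bound suffices. -/
theorem memLp (h : IsCorrLimit ν n r R C)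
    (hq : ∀ n, ((q n : ℕ) : ℝ) = (4 * lenR h₁ q n) ^ (n + 2)) (hd : 0 < d)
    {p : ℝ≥0∞} (hp : 2 < p) : MemLp R p ν := by
  have hRm := h.measurable_limit
  rcases eq_or_ne p ∞ with rfl | hp'
  · exact memLp_top_of_bound hRm.aestronglyMeasurable C (ae_of_all _ h.norm_limit_le)
  refine ⟨hRm.aestronglyMeasurable, ?_⟩
  have hp0 : p ≠ 0 := (lt_trans (by norm_num) hp).ne'
  obtain ⟨M, hM, hle⟩ := h.exists_cubeNorm_le hS hq hd hp hp'
  -- Half of the side, rounded down so that it makes sense in `ℤ`; the shift puts the origin near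
  -- the centre of the cube.
  set s : ℕ → Fin d → K := fun k _ => ((side h₁ q (n + k) / 2 : ℕ) : K)
  set U : ℕ → Set (Fin d → K) := fun k => {t | s k + t ∈ cube K d h₁ q (n + k)}
  have hUm : ∀ k, MeasurableSet (U k) := fun k =>
    (measurable_const_add (s k)) (hS.measurableSet_cube _)
  set g : ℕ → (Fin d → K) → ℂ := fun k => (U k).indicator fun t => r k (QuotientAddGroup.mk t)
  have hgm : ∀ k, Measurable (g k) := fun k => (h.measurable_lift k).indicator (hUm k)
  have hgn : ∀ k, eLpNorm (g k) p ν = cubeNorm ν r p k := by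
    intro k
    rw [eLpNorm_indicator_eq_eLpNorm_restrict (hUm k), cubeNorm,
      eLpNorm_eq_lintegral_rpow_enorm_toReal hp0 hp', eLpNorm_eq_lintegral_rpow_enorm_toReal hp0 hp']
    congr 1
    exact hS.setLIntegral_cube_translate (n + k) (s k) fun z => ‖r k z‖ₑ ^ p.toReal
  have hlim : ∀ t, Tendsto (fun k => g k t) atTop (𝓝 (R t)) := by
    intro t
    refine (h.tendsto t).congr' ?_
    have hlen := (tendsto_lenR hq).comp
      (tendsto_atTop_mono (fun k => Nat.le_add_left k n) tendsto_id : Tendsto (n + ·) atTop atTop)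
    filter_upwards [hlen.eventually_ge_atTop (2 * (∑ i, |e (t i)|) + 4)] with k hk
    have hmem : t ∈ U k → r k (QuotientAddGroup.mk t) = g k t := fun ht =>
      (Set.indicator_of_mem ht fun t : Fin d → K => r k (QuotientAddGroup.mk t)).symm
    refine hmem fun i => ?_
    have h1 : |e (t i)| ≤ ∑ i, |e (t i)| :=
      Finset.single_le_sum (f := fun i => |e (t i)|) (fun _ _ => abs_nonneg _) (Finset.mem_univ i)
    obtain ⟨h2, h3⟩ := abs_le.1 h1
    have h4 : ((side h₁ q (n + k) / 2 : ℕ) : ℝ) * 2 ≤ lenR h₁ q (n + k) := by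
      rw [lenR]; exact_mod_cast Nat.div_mul_le_self _ _
    have h5 : lenR h₁ q (n + k) ≤ ((side h₁ q (n + k) / 2 : ℕ) : ℝ) * 2 + 2 := by
      rw [lenR]
      have := Nat.lt_div_mul_add (a := (side h₁ q (n + k) : ℕ)) (b := 2) (by omega)
      exact_mod_cast this.le
    change 2 * _ + 4 ≤ lenR h₁ q (n + k) at hk
    change 0 ≤ ((side h₁ q (n + k) / 2 : ℕ) : K) + t i ∧
      ((side h₁ q (n + k) / 2 : ℕ) : K) + t i < len K h₁ q (n + k)
    rw [← hS.strictMono.le_iff_le, ← hS.strictMono.lt_iff_lt, map_add, map_natCast, map_zero,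
      map_len]
    constructor <;> linarith
  calc eLpNorm R p ν ≤ liminf (fun k => eLpNorm (g k) p ν) atTop :=
        Lp.eLpNorm_lim_le_liminf_eLpNorm (fun k => (hgm k).aestronglyMeasurable) R
          (ae_of_all _ hlim)
    _ ≤ M := by
        refine liminf_le_of_frequently_le' (Eventually.frequently ?_)
        filter_upwards [hle] with k hk
        rw [hgn]
        exact hk
    _ < ∞ := hM.lt_top

end IsCorrLimit
end Integrability

end Iceberg

namespace Iceberg

/-! ### The theorems of Herglotz and Bochner -/

section Bochner

/-- Positive definite functions on an abelian group. -/
def IsPositiveDefinite {G : Type*} [AddCommGroup G] (R : G → ℂ) : Prop :=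
  ∀ (ι : Type) (s : Finset ι) (a : ι → G) (c : ι → ℂ), ∃ x : ℝ, 0 ≤ x ∧
    ∑ i ∈ s, ∑ j ∈ s, c i * (starRingEnd ℂ) (c j) * R (a i - a j) = x

theorem IsPositiveDefinite.comp {G H : Type*} [AddCommGroup G] [AddCommGroup H] {R : H → ℂ}
    (hR : IsPositiveDefinite R) (φ : G →+ H) : IsPositiveDefinite (R ∘ φ) := by
  intro ι s a c
  obtain ⟨x, hx, h⟩ := hR ι s (φ ∘ a) c
  exact ⟨x, hx, by simpa using h⟩

variable {d : ℕ}

/-- The normalized Haar measure of the torus. -/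
def torusMeasure (d : ℕ) : Measure (UnitAddTorus (Fin d)) :=
  Measure.pi fun _ => (AddCircle.haarAddCircle : Measure UnitAddCircle)

instance : IsProbabilityMeasure (torusMeasure d) :=
  inferInstanceAs (IsProbabilityMeasure
    (Measure.pi fun _ : Fin d => (AddCircle.haarAddCircle : Measure UnitAddCircle)))

open UnitAddTorus

theorem integral_fourier (n : ℤ) :
    ∫ x, fourier n x ∂(AddCircle.haarAddCircle : Measure UnitAddCircle) = if n = 0 then 1 else 0 := by
  split_ifs with h
  · simp [h]
  · exact integral_eq_zero_of_add_right_eq_neg (μ := AddCircle.haarAddCircle)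
      (fourier_add_half_inv_index h one_pos)

theorem integral_mFourier (m : Fin d → ℤ) :
    ∫ ξ, mFourier m ξ ∂(torusMeasure d) = if m = 0 then 1 else 0 := by
  have h1 : ∫ ξ, mFourier m ξ ∂(torusMeasure d) = ∏ i, ∫ x, fourier (m i) x
      ∂(AddCircle.haarAddCircle : Measure UnitAddCircle) :=
    integral_fintype_prod_eq_prod (fun i (x : UnitAddCircle) => (fourier (m i) x : ℂ))
  rw [h1]
  simp_rw [integral_fourier]
  split_ifs with h
  · simp [h]
  · obtain ⟨i, hi⟩ := Function.ne_iff.1 h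
    exact Finset.prod_eq_zero (Finset.mem_univ i) (if_neg hi)

/-- The box with side `N + 1` in the lattice. -/
def box (d N : ℕ) : Finset (Fin d → ℤ) := Fintype.piFinset fun _ => Finset.Ico (0 : ℤ) (N + 1)

/-- The Fejér weights: the fraction of a large box that stays in the box after a shift by `m`. It
factors over the coordinates, with each factor between `1 - |m i| / (N + 1)` and `1`. -/
theorem tendsto_card_box (m : Fin d → ℤ) :
    Tendsto (fun N : ℕ => (((box d N).filter fun a => a - m ∈ box d N).card : ℝ) /
      ((N : ℝ) + 1) ^ d) atTop (𝓝 1) := by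
  have h1 : ∀ N, (((box d N).filter fun a => a - m ∈ box d N).card : ℝ) / ((N : ℝ) + 1) ^ d =
      ∏ i : Fin d, ((((Finset.Ico (0 : ℤ) (N + 1)).filter fun x =>
        x - m i ∈ Finset.Ico (0 : ℤ) (N + 1)).card : ℝ) / ((N : ℝ) + 1)) := by
    intro N
    have h2 : (box d N).filter (fun a => a - m ∈ box d N) = Fintype.piFinset fun i =>
        (Finset.Ico (0 : ℤ) (N + 1)).filter fun x => x - m i ∈ Finset.Ico (0 : ℤ) (N + 1) := by
      ext a
      simp only [box, Finset.mem_filter, Fintype.mem_piFinset, Pi.sub_apply, forall_and]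
    rw [h2, Fintype.card_piFinset, Finset.prod_div_distrib]
    push_cast
    simp
  simp_rw [h1]
  suffices h2 : ∀ i : Fin d, Tendsto (fun N : ℕ => ((((Finset.Ico (0 : ℤ) (N + 1)).filter fun x =>
      x - m i ∈ Finset.Ico (0 : ℤ) (N + 1)).card : ℝ) / ((N : ℝ) + 1))) atTop (𝓝 1) by
    have h3 := tendsto_finsetProd Finset.univ fun i (_ : i ∈ Finset.univ) => h2 i
    rwa [Finset.prod_const_one] at h3
  intro i
  have h3 : Tendsto (fun N : ℕ => 1 - |(m i : ℝ)| * (1 / ((N : ℝ) + 1))) atTop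
      (𝓝 (1 - |(m i : ℝ)| * 0)) :=
    tendsto_const_nhds.sub (tendsto_one_div_add_atTop_nhds_zero_nat.const_mul _)
  rw [mul_zero, sub_zero] at h3
  refine tendsto_of_tendsto_of_tendsto_of_le_of_le h3 tendsto_const_nhds (fun N => ?_) fun N => ?_
  · have hN : (0 : ℝ) < (N : ℝ) + 1 := by positivity
    have h4 : Finset.Ico (max 0 (m i)) (min ((N : ℤ) + 1) (N + 1 + m i)) ⊆
        (Finset.Ico (0 : ℤ) (N + 1)).filter fun x => x - m i ∈ Finset.Ico (0 : ℤ) (N + 1) := by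
      intro x hx
      simp only [Finset.mem_Ico, Finset.mem_filter, max_le_iff, lt_min_iff] at hx ⊢
      omega
    have h5 := Finset.card_le_card h4
    rw [Int.card_Ico] at h5
    have h6 : (N : ℤ) + 1 - |m i| ≤ (((Finset.Ico (0 : ℤ) (N + 1)).filter fun x =>
        x - m i ∈ Finset.Ico (0 : ℤ) (N + 1)).card : ℤ) := by
      rcases abs_cases (m i) with h | h <;> omega
    have h7 : (N : ℝ) + 1 - |(m i : ℝ)| ≤ (((Finset.Ico (0 : ℤ) (N + 1)).filter fun x =>
        x - m i ∈ Finset.Ico (0 : ℤ) (N + 1)).card : ℝ) := by exact_mod_cast h6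
    rw [le_div_iff₀ hN]
    have : (1 - |(m i : ℝ)| * (1 / ((N : ℝ) + 1))) * ((N : ℝ) + 1) = N + 1 - |(m i : ℝ)| := by
      field_simp
    linarith
  · have hN : (0 : ℝ) < (N : ℝ) + 1 := by positivity
    rw [div_le_one hN]
    have := Finset.card_filter_le (Finset.Ico (0 : ℤ) (N + 1)) fun x =>
      x - m i ∈ Finset.Ico (0 : ℤ) (N + 1)
    rw [Int.card_Ico] at this
    have h8 : (((Finset.Ico (0 : ℤ) (N + 1)).filter fun x =>
        x - m i ∈ Finset.Ico (0 : ℤ) (N + 1)).card : ℕ) ≤ N + 1 := by omega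
    exact_mod_cast h8

/-- A sequence of measures in a compact set of finite measures has a limit along the hyperfilter. -/
theorem exists_tendsto_hyperfilter {E : Type*} [TopologicalSpace E] [MeasurableSpace E]
    [OpensMeasurableSpace E] {S : Set (FiniteMeasure E)} (hS : IsCompact S)
    {σ : ℕ → FiniteMeasure E} (hσ : ∀ n, σ n ∈ S) :
    ∃ τ : FiniteMeasure E, Tendsto σ (hyperfilter ℕ) (𝓝 τ) := by
  obtain ⟨τ, -, hτ⟩ := hS.ultrafilter_le_nhds ((hyperfilter ℕ).map σ)
    (le_principal_iff.2 (Filter.mem_map.2 (Filter.univ_mem' hσ)))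
  exact ⟨τ, hτ⟩

/-- **Herglotz's theorem** on the torus. -/
theorem IsPositiveDefinite.exists_measure_torus {R : (Fin d → ℤ) → ℂ} (hR : IsPositiveDefinite R) :
    ∃ σ : FiniteMeasure (UnitAddTorus (Fin d)), ∀ m, ∫ ξ, mFourier m ξ ∂σ = R m := by
  -- A Fejér mean of the Fourier series with coefficients `R`. Its value at `ξ` is, up to
  -- normalization, the positive definite form of `R` on the box with the characters at `ξ` as
  -- coefficients, hence a nonnegative density.
  obtain ⟨P, hP⟩ : ∃ P : ℕ → UnitAddTorus (Fin d) → ℂ, ∀ N ξ, P N ξ = (((N : ℝ) + 1) ^ d)⁻¹ •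
    ∑ a ∈ box d N, ∑ b ∈ box d N, R (a - b) * mFourier (b - a) ξ := ⟨_, fun _ _ => rfl⟩
  have hPc : ∀ N, Continuous (P N) := by
    intro N
    rw [funext (hP N)]
    fun_prop
  have hpos : ∀ N ξ, ∃ x : ℝ, 0 ≤ x ∧ P N ξ = x := by
    intro N ξ
    obtain ⟨x, hx, h⟩ := hR _ (box d N) id fun a => mFourier (-a) ξ
    refine ⟨(((N : ℝ) + 1) ^ d)⁻¹ * x, by positivity, ?_⟩
    have h1 : ∑ a ∈ box d N, ∑ b ∈ box d N, R (a - b) * mFourier (b - a) ξ = x := by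
      rw [← h]
      refine Finset.sum_congr rfl fun a _ => Finset.sum_congr rfl fun b _ => ?_
      rw [← mFourier_neg, neg_neg, ← mFourier_add, mul_comm, neg_add_eq_sub, id, id]
    rw [hP, h1, Complex.real_smul, Complex.ofReal_mul]
  choose p hp0 hp using hpos
  have hpc : ∀ N, Continuous (p N) := by
    intro N
    have : p N = fun ξ => (P N ξ).re := by funext ξ; rw [hp]; rfl
    rw [this]
    exact Complex.continuous_re.comp (hPc N)
  -- Orthogonality of the characters keeps the pairs with `a - b = m`, so the coefficient is `R m`
  -- times a Fejér weight tending to one.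
  have hint : ∀ N (m : Fin d → ℤ), ∫ ξ, mFourier m ξ ∂((torusMeasure d).withDensity fun ξ =>
      ENNReal.ofReal (p N ξ)) = R m * ((((box d N).filter fun a => a - m ∈ box d N).card : ℝ) /
        ((N : ℝ) + 1) ^ d : ℝ) := by
    intro N m
    rw [integral_withDensity_eq_integral_toReal_smul (hpc N).measurable.ennreal_ofReal
      (ae_of_all _ fun _ => ENNReal.ofReal_lt_top)]
    have h1 : ∀ ξ, (ENNReal.ofReal (p N ξ)).toReal • mFourier m ξ = (((N : ℝ) + 1) ^ d)⁻¹ •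
        ∑ a ∈ box d N, ∑ b ∈ box d N, R (a - b) * mFourier (b - a + m) ξ := by
      intro ξ
      rw [ENNReal.toReal_ofReal (hp0 N ξ), Complex.real_smul, ← hp, hP]
      simp only [smul_mul_assoc, Finset.sum_mul, mul_assoc, mFourier_add]
    simp_rw [h1]
    have hci : ∀ f : UnitAddTorus (Fin d) → ℂ, Continuous f → Integrable f (torusMeasure d) :=
      fun f hf => hf.integrable_of_hasCompactSupport (HasCompactSupport.of_compactSpace f)
    rw [integral_smul, integral_finsetSum _ fun a _ => hci _ (by fun_prop)]
    have h2 : ∀ a ∈ box d N, ∫ ξ, ∑ b ∈ box d N, R (a - b) * mFourier (b - a + m) ξ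
        ∂(torusMeasure d) = if a - m ∈ box d N then R m else 0 := by
      intro a _
      rw [integral_finsetSum _ fun b _ => hci _ (by fun_prop)]
      simp_rw [integral_const_mul, integral_mFourier]
      have h3 : ∀ b, (R (a - b) * if b - a + m = 0 then (1 : ℂ) else 0) =
          if b = a - m then R m else 0 := by
        intro b
        have : b - a + m = 0 ↔ b = a - m := by
          rw [sub_add, sub_eq_zero]
        by_cases h : b = a - m
        · rw [if_pos h, if_pos (this.2 h), h]; simp
        · rw [if_neg h, if_neg (fun h' => h (this.1 h')), mul_zero]
      simp_rw [h3]
      rw [Finset.sum_ite_eq' (box d N)]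
    rw [Finset.sum_congr rfl h2, ← Finset.sum_filter, Finset.sum_const, nsmul_eq_mul,
      Complex.real_smul]
    push_cast
    ring
  have hfin : ∀ N, IsFiniteMeasure ((torusMeasure d).withDensity fun ξ =>
      ENNReal.ofReal (p N ξ)) := by
    intro N
    refine isFiniteMeasure_withDensity_ofReal ?_
    exact ((hpc N).integrable_of_hasCompactSupport (HasCompactSupport.of_compactSpace _)).2
  set σ : ℕ → FiniteMeasure (UnitAddTorus (Fin d)) := fun N => ⟨_, hfin N⟩
  have hσ : ∀ N m, ∫ ξ, mFourier m ξ ∂(σ N : Measure (UnitAddTorus (Fin d))) =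
      R m * ((((box d N).filter fun a => a - m ∈ box d N).card : ℝ) / ((N : ℝ) + 1) ^ d : ℝ) := hint
  have hmass : ∀ N, σ N ∈ {τ : FiniteMeasure (UnitAddTorus (Fin d)) | τ.mass ≤ ‖R 0‖₊} := by
    intro N
    have h1 := congrArg (fun z => ‖z‖) (hσ N 0)
    simp only [mFourier_zero, ContinuousMap.one_apply] at h1
    rw [integral_const, norm_smul, norm_one, mul_one, Real.norm_of_nonneg measureReal_nonneg,
      norm_mul] at h1
    change (σ N).mass ≤ ‖R 0‖₊
    rw [← NNReal.coe_le_coe]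
    refine (le_of_eq h1).trans (mul_le_of_le_one_right (norm_nonneg _) ?_)
    rw [Complex.norm_real, Real.norm_of_nonneg (by positivity), div_le_one (by positivity)]
    have h2 := Finset.card_filter_le (box d N) fun a => a - 0 ∈ box d N
    rw [box, Fintype.card_piFinset] at h2
    simp only [Int.card_Ico, sub_zero, Finset.prod_const, Finset.card_univ, Fintype.card_fin] at h2
    have h3 : ((N : ℤ) + 1).toNat = N + 1 := by omega
    rw [h3] at h2
    simp only [sub_zero]
    exact_mod_cast h2
  -- The masses are bounded by `‖R 0‖`, so compactness gives a weak limit. An ultrafilter finer than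
  -- `atTop` takes the place of a subsequence, and the coefficients converge along it to `R m`.
  obtain ⟨τ, hτ⟩ := exists_tendsto_hyperfilter
    (isCompact_setOfPred_finiteMeasure_le_of_compactSpace _ ‖R 0‖₊) hmass
  refine ⟨τ, fun m => ?_⟩
  have h1 := (FiniteMeasure.tendsto_iff_forall_integral_rclike_tendsto ℂ).1 hτ
    (BoundedContinuousFunction.mkOfCompact (mFourier m))
  simp only [BoundedContinuousFunction.mkOfCompact_apply, hσ] at h1
  have h2 : Tendsto (fun N : ℕ => R m * ((((box d N).filter fun a => a - m ∈ box d N).card : ℝ) /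
      ((N : ℝ) + 1) ^ d : ℝ)) (hyperfilter ℕ) (𝓝 (R m * (1 : ℝ))) :=
    (((Complex.continuous_ofReal.tendsto _).comp (tendsto_card_box m)).const_mul _).mono_left
      Nat.hyperfilter_le_atTop
  rw [Complex.ofReal_one, mul_one] at h2
  exact tendsto_nhds_unique h1 h2

end Bochner

end Iceberg

namespace Iceberg

/-! ### From the torus to `ℝ ^ d`: tightness and Bochner's theorem. -/

section Bochner

variable {d : ℕ}

open UnitAddTorus

/-- The representative of a point of the circle in `(-1/2, 1/2]`. -/
def circleRep (x : UnitAddCircle) : ℝ := AddCircle.measurableEquivIoc 1 (-1 / 2) x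

theorem measurable_circleRep : Measurable circleRep :=
  measurable_subtype_coe.comp (AddCircle.measurableEquivIoc 1 (-1 / 2)).measurable

theorem abs_circleRep_le (x : UnitAddCircle) : |circleRep x| ≤ 1 / 2 := by
  obtain ⟨h1, h2⟩ := (AddCircle.measurableEquivIoc 1 (-1 / 2) x).2
  rw [abs_le, circleRep]
  constructor <;> linarith

theorem coe_circleRep (x : UnitAddCircle) : (circleRep x : UnitAddCircle) = x :=
  (AddCircle.measurableEquivIoc 1 (-1 / 2)).symm_apply_apply x

/-- The bound for geometric sums on the circle. -/
theorem norm_geom_sum_le (θ : ℝ) (hθ : |θ| ≤ 1 / 2) (J : ℕ) (h : 1 ≤ J * |θ|) :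
    ‖∑ j ∈ Finset.range J, (Complex.exp (2 * Real.pi * Complex.I * θ)) ^ j‖ ≤ J / 2 := by
  have hπ := Real.pi_pos
  have hθ0 : 0 < |θ| := by
    by_contra hcon
    have : |θ| = 0 := le_antisymm (not_lt.1 hcon) (abs_nonneg _)
    rw [this] at h
    linarith
  have hJ : (0 : ℝ) < J := by
    by_contra hcon
    nlinarith
  set z := Complex.exp (2 * Real.pi * Complex.I * θ) with hz
  have hz' : z = Complex.exp (Complex.I * (2 * Real.pi * θ : ℝ)) := by
    rw [hz]; push_cast; congr 1; ring
  have h1 : 4 * |θ| ≤ ‖z - 1‖ := by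
    rw [hz', Complex.norm_exp_I_mul_ofReal_sub_one, norm_mul, Real.norm_eq_abs, Real.norm_eq_abs,
      abs_two]
    have h2 : |2 * Real.pi * θ / 2| = Real.pi * |θ| := by
      rw [show 2 * Real.pi * θ / 2 = Real.pi * θ by ring, abs_mul, abs_of_pos hπ]
    have h3 := Real.mul_abs_le_abs_sin (x := 2 * Real.pi * θ / 2) (by rw [h2]; nlinarith)
    rw [h2] at h3
    have h4 : 2 / Real.pi * (Real.pi * |θ|) = 2 * |θ| := by field_simp
    linarith
  have hzn : ‖z‖ = 1 := by
    rw [hz', mul_comm, Complex.norm_exp_ofReal_mul_I]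
  have h5 : ‖∑ j ∈ Finset.range J, z ^ j‖ * ‖z - 1‖ ≤ 2 := by
    rw [← norm_mul, geom_sum_mul]
    refine (norm_sub_le _ _).trans ?_
    rw [norm_pow, hzn, one_pow, norm_one]
    norm_num
  have h6 := norm_nonneg (∑ j ∈ Finset.range J, z ^ j)
  have h7 : ‖∑ j ∈ Finset.range J, z ^ j‖ * (4 * |θ|) ≤ 2 :=
    (mul_le_mul_of_nonneg_left h1 h6).trans h5
  have h8 : ‖∑ j ∈ Finset.range J, z ^ j‖ * 4 ≤ 2 * J := by
    calc _ ≤ ‖∑ j ∈ Finset.range J, z ^ j‖ * 4 * (J * |θ|) :=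
          le_mul_of_one_le_right (by positivity) h
      _ = ‖∑ j ∈ Finset.range J, z ^ j‖ * (4 * |θ|) * J := by ring
      _ ≤ _ := mul_le_mul_of_nonneg_right h7 hJ.le
  linarith

theorem mFourier_eq_exp (m : Fin d → ℤ) (ξ : UnitAddTorus (Fin d)) :
    mFourier m ξ = Complex.exp (2 * Real.pi * Complex.I *
      ((∑ i, m i * circleRep (ξ i) : ℝ) : ℂ)) := by
  have h1 : ∀ i, (fourier (m i) (ξ i) : ℂ) =
      Complex.exp (2 * Real.pi * Complex.I * (m i * circleRep (ξ i) : ℝ)) := by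
    intro i
    conv_lhs => rw [← coe_circleRep (ξ i)]
    rw [fourier_coe_apply]
    congr 1
    push_cast
    ring
  change ∏ i, (fourier (m i) (ξ i) : ℂ) = _
  simp_rw [h1]
  rw [← Complex.exp_sum, Complex.ofReal_sum, Finset.mul_sum]

/-- A measure on the torus whose Fourier coefficients vary little has little mass far from zero. -/
theorem measure_torus_le {τ : FiniteMeasure (UnitAddTorus (Fin d))} {R : (Fin d → ℤ) → ℂ}
    (hτ : ∀ m, ∫ ξ, mFourier m ξ ∂τ = R m) (i : Fin d) {J : ℕ} (hJ : 0 < J) {η : ℝ}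
    (hη : ∀ j < J, ‖R (Pi.single i (j : ℤ)) - R 0‖ ≤ η) :
    (τ : Measure (UnitAddTorus (Fin d))).real {ξ | 1 ≤ J * |circleRep (ξ i)|} ≤ 2 * η := by
  have hJ0 : (0 : ℝ) < J := by exact_mod_cast hJ
  have hci : ∀ f : UnitAddTorus (Fin d) → ℂ, Continuous f →
      Integrable f (τ : Measure (UnitAddTorus (Fin d))) :=
    fun f hf => hf.integrable_of_hasCompactSupport (HasCompactSupport.of_compactSpace f)
  -- The sum of `1 - e (j * θ)` over `j < J`, with `θ` the coordinate `i`, has nonnegative real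
  -- part, and by the geometric sum bound this is at least `J / 2` where `|θ| ≥ 1 / J`. Its integral
  -- has real part at most `J * η`, so Markov's inequality applies.
  obtain ⟨f, hf⟩ : ∃ f : UnitAddTorus (Fin d) → ℂ, ∀ ξ, f ξ = ∑ j ∈ Finset.range J,
    (mFourier 0 ξ - mFourier (Pi.single i (j : ℤ)) ξ) := ⟨_, fun _ => rfl⟩
  have hfc : Continuous f := by
    rw [funext hf]
    fun_prop
  have hnorm : ∀ (m : Fin d → ℤ) ξ, ‖mFourier m ξ‖ ≤ 1 := fun m ξ =>
    (ContinuousMap.norm_coe_le_norm _ ξ).trans (le_of_eq mFourier_norm)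
  have hone : ∀ ξ : UnitAddTorus (Fin d), (mFourier 0 ξ : ℂ) = 1 := fun ξ => by
    rw [mFourier_zero]; rfl
  have hf0 : ∀ ξ, 0 ≤ (f ξ).re := by
    intro ξ
    rw [hf, Complex.re_sum]
    refine Finset.sum_nonneg fun j _ => ?_
    rw [hone, Complex.sub_re, Complex.one_re]
    linarith [Complex.re_le_norm (mFourier (Pi.single i (j : ℤ)) ξ), hnorm (Pi.single i (j : ℤ)) ξ]
  have hlow : ∀ ξ, 1 ≤ J * |circleRep (ξ i)| → (J : ℝ) / 2 ≤ (f ξ).re := by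
    intro ξ hξ
    have h1 : ∀ j : ℕ, mFourier (Pi.single i (j : ℤ)) ξ =
        (Complex.exp (2 * Real.pi * Complex.I * circleRep (ξ i))) ^ j := by
      intro j
      rw [mFourier_eq_exp, ← Complex.exp_nat_mul]
      congr 1
      rw [Finset.sum_eq_single i (fun b _ hb => by simp [hb]) (by simp)]
      simp
      ring
    have h2 := norm_geom_sum_le _ (abs_circleRep_le (ξ i)) J hξ
    rw [hf, Finset.sum_sub_distrib]
    simp_rw [h1, hone]
    rw [Complex.sub_re, Finset.sum_const, Finset.card_range]
    have h3 := Complex.re_le_norm (∑ j ∈ Finset.range J,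
      (Complex.exp (2 * Real.pi * Complex.I * circleRep (ξ i))) ^ j)
    simp only [nsmul_eq_mul, mul_one, Complex.natCast_re]
    linarith
  have hfi : Integrable (fun ξ => (f ξ).re) (τ : Measure (UnitAddTorus (Fin d))) := (hci f hfc).re
  have hint : ∫ ξ, (f ξ).re ∂(τ : Measure (UnitAddTorus (Fin d))) ≤ J * η := by
    have h1 : ∫ ξ, (f ξ).re ∂(τ : Measure (UnitAddTorus (Fin d))) = (∫ ξ, f ξ ∂τ).re :=
      integral_re (hci f hfc)
    rw [h1]
    simp_rw [hf]
    rw [integral_finsetSum _ fun j _ => hci _ (by fun_prop)]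
    refine (Complex.re_le_norm _).trans ((norm_sum_le _ _).trans ?_)
    refine (Finset.sum_le_sum (g := fun _ => η) fun j hj => ?_).trans (by simp)
    rw [integral_sub (hci _ (by fun_prop)) (hci _ (by fun_prop)), hτ, hτ, norm_sub_rev]
    exact hη j (Finset.mem_range.1 hj)
  have hmarkov := mul_meas_ge_le_integral_of_nonneg (ae_of_all _ hf0) hfi ((J : ℝ) / 2)
  have hle : (τ : Measure (UnitAddTorus (Fin d))).real {ξ | 1 ≤ J * |circleRep (ξ i)|} ≤
      (τ : Measure (UnitAddTorus (Fin d))).real {ξ | (J : ℝ) / 2 ≤ (f ξ).re} :=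
    measureReal_mono hlow
  have h9 := (mul_le_mul_of_nonneg_left hle (half_pos hJ0).le).trans (hmarkov.trans hint)
  have h10 : (J : ℝ) * (τ : Measure (UnitAddTorus (Fin d))).real {ξ | 1 ≤ J * |circleRep (ξ i)|} ≤
      J * (2 * η) := by linarith
  exact le_of_mul_le_mul_left h10 hJ0

/-- The inclusion of the lattice with mesh `2 ^ (-k)`. -/
def dyadic (d k : ℕ) : (Fin d → ℤ) →+ (Fin d → ℝ) where
  toFun m i := m i / 2 ^ k
  map_zero' := by ext; simp
  map_add' m m' := by ext; simp [add_div]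

theorem tendsto_dyadic_floor (t : Fin d → ℝ) :
    Tendsto (fun k => dyadic d k fun i => ⌊2 ^ k * t i⌋) atTop (𝓝 t) := by
  refine tendsto_pi_nhds.2 fun i => ?_
  have h1 : Tendsto (fun k : ℕ => t i - (1 / 2 : ℝ) ^ k) atTop (𝓝 (t i - 0)) :=
    tendsto_const_nhds.sub (tendsto_pow_atTop_nhds_zero_of_lt_one (by norm_num) (by norm_num))
  rw [sub_zero] at h1
  refine tendsto_of_tendsto_of_tendsto_of_le_of_le h1 tendsto_const_nhds (fun k => ?_) fun k => ?_
  · change t i - (1 / 2) ^ k ≤ (⌊2 ^ k * t i⌋ : ℝ) / 2 ^ k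
    rw [le_div_iff₀ (by positivity), sub_mul, ← mul_pow]
    norm_num
    linarith [Int.lt_floor_add_one (2 ^ k * t i)]
  · change (⌊2 ^ k * t i⌋ : ℝ) / 2 ^ k ≤ t i
    rw [div_le_iff₀ (by positivity), mul_comm]
    exact Int.floor_le _

/-- **Bochner's theorem**. -/
theorem IsPositiveDefinite.exists_measure_real {R : (Fin d → ℝ) → ℂ} (hR : IsPositiveDefinite R)
    (hc : Continuous R) : ∃ σ : FiniteMeasure (Fin d → ℝ), ∀ t, ∫ ξ, Complex.exp
      (2 * Real.pi * Complex.I * ((∑ i, t i * ξ i : ℝ) : ℂ)) ∂(σ : Measure (Fin d → ℝ)) = R t := by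
  -- Herglotz's theorem for the restriction of `R` to the lattice of mesh `2 ^ (-k)`. The torus is
  -- then unrolled to a cube of side `2 ^ k` in `ℝ ^ d`, where the characters match.
  choose τ hτ using fun k => (hR.comp (dyadic d k)).exists_measure_torus
  set g : ℕ → UnitAddTorus (Fin d) → Fin d → ℝ := fun k ξ i => 2 ^ k * circleRep (ξ i)
  have hg : ∀ k, Measurable (g k) := fun k => measurable_pi_lambda _ fun i =>
    (measurable_circleRep.comp (measurable_pi_apply i)).const_mul _
  set E : (Fin d → ℝ) → (Fin d → ℝ) → ℂ := fun t ξ =>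
    Complex.exp (2 * Real.pi * Complex.I * ((∑ i, t i * ξ i : ℝ) : ℂ))
  have hEc : Continuous fun p : (Fin d → ℝ) × (Fin d → ℝ) => E p.1 p.2 := by fun_prop
  have hEc2 : ∀ t, Continuous (E t) := fun t => by fun_prop
  have hEn : ∀ t ξ, ‖E t ξ‖ = 1 := by
    intro t ξ
    have : E t ξ = Complex.exp (((2 * Real.pi * ∑ i, t i * ξ i : ℝ) : ℂ) * Complex.I) := by
      simp only [E]; congr 1; push_cast; ring
    rw [this, Complex.norm_exp_ofReal_mul_I]
  set σ : ℕ → FiniteMeasure (Fin d → ℝ) := fun k => (τ k).map (g k)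
  have hσmap : ∀ k, (σ k : Measure (Fin d → ℝ)) = Measure.map (g k) (τ k) := fun k => rfl
  have hσ : ∀ k (m : Fin d → ℤ), ∫ ξ, E (dyadic d k m) ξ ∂(σ k : Measure (Fin d → ℝ)) =
      R (dyadic d k m) := by
    intro k m
    rw [hσmap, integral_map (hg k).aemeasurable (hEc2 _).aestronglyMeasurable,
      ← Function.comp_apply (f := R), ← hτ k m]
    refine integral_congr_ae (ae_of_all _ fun ξ => ?_)
    simp only
    rw [mFourier_eq_exp]
    simp only [E, g]
    congr 3
    refine Finset.sum_congr rfl fun i _ => ?_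
    change (m i : ℝ) / 2 ^ k * (2 ^ k * _) = _
    field_simp
  have hcont : ∀ n : ℕ, ∃ X : ℝ, 0 < X ∧ ∀ (i : Fin d) (x : ℝ), |x| < 1 / X →
      ‖R (Pi.single i x) - R 0‖ ≤ 1 / (n + 1) := by
    intro n
    obtain ⟨δ, hδ, h⟩ := Metric.continuous_iff.1 hc 0 (1 / ((n : ℝ) + 1)) (by positivity)
    refine ⟨1 / δ, by positivity, fun i x hx => ?_⟩
    rw [one_div_one_div] at hx
    rw [← dist_eq_norm]
    refine (h _ ?_).le
    rwa [dist_zero_right, Pi.norm_single, Real.norm_eq_abs]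
  choose X hX0 hX using hcont
  -- Tightness uniform in `k`, from continuity of `R` at zero. With `J = ⌈2 ^ k / X n⌉`, each `j <
  -- J` gives a lattice point `j / 2 ^ k < 1 / X n`, at which `R` is within `1 / (n + 1)` of `R 0`.
  have htight : ∀ n k (i : Fin d), (σ k : Measure (Fin d → ℝ)).real {x | X n < |x i|} ≤
      2 * (1 / ((n : ℝ) + 1)) := by
    intro n k i
    have h2k : (0 : ℝ) < 2 ^ k := by positivity
    set J := ⌈2 ^ k / X n⌉₊
    have hJ : 0 < J := Nat.ceil_pos.2 (div_pos h2k (hX0 n))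
    have h1 := measure_torus_le (hτ k) i hJ (η := 1 / ((n : ℝ) + 1)) (by
      intro j hj
      have h2 : dyadic d k (Pi.single i (j : ℤ)) = Pi.single i ((j : ℝ) / 2 ^ k) := by
        ext b
        change ((Pi.single i (j : ℤ) : Fin d → ℤ) b : ℝ) / 2 ^ k = _
        by_cases hb : b = i
        · subst hb; simp
        · simp [hb]
      rw [Function.comp_apply, Function.comp_apply, map_zero, h2]
      refine hX n i _ ?_
      rw [abs_of_nonneg (by positivity), div_lt_iff₀ h2k, one_div, inv_mul_eq_div]
      exact Nat.lt_ceil.1 hj)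
    refine le_trans ?_ h1
    rw [hσmap, map_measureReal_apply (hg k)
      (measurableSet_lt measurable_const (measurable_pi_apply i).abs)]
    refine measureReal_mono fun ξ hξ => ?_
    change X n < |2 ^ k * circleRep (ξ i)| at hξ
    rw [abs_mul, abs_of_pos h2k] at hξ
    change 1 ≤ (J : ℝ) * |circleRep (ξ i)|
    have h3 : 2 ^ k / X n ≤ J := Nat.le_ceil _
    rw [div_le_iff₀ (hX0 n)] at h3
    have h4 := abs_nonneg (circleRep (ξ i))
    have h5 : X n * 1 ≤ X n * (J * |circleRep (ξ i)|) := by nlinarith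
    exact le_of_mul_le_mul_left h5 (hX0 n)
  set u : ℕ → NNReal := fun n => d * (2 * (1 / ((n : NNReal) + 1)))
  have hu : Tendsto u atTop (𝓝 0) := by
    rw [← NNReal.tendsto_coe]
    have := ((tendsto_one_div_add_atTop_nhds_zero_nat (𝕜 := ℝ)).const_mul 2).const_mul (d : ℝ)
    simpa [u] using this
  have hmem : ∀ k, σ k ∈ {μ : FiniteMeasure (Fin d → ℝ) | μ.mass ≤ ‖R 0‖₊ ∧
      ∀ n, μ (Set.Icc (fun _ => -X n) fun _ => X n)ᶜ ≤ u n} := by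
    intro k
    refine ⟨?_, fun n => ?_⟩
    · have h1 := congrArg (fun z => ‖z‖) (hσ k 0)
      have h2 : ∀ ξ, E 0 ξ = 1 := fun ξ => by simp [E]
      simp only [map_zero, h2] at h1
      rw [integral_const, norm_smul, norm_one, mul_one, Real.norm_of_nonneg measureReal_nonneg] at h1
      rw [← NNReal.coe_le_coe]
      exact le_of_eq h1
    · rw [← NNReal.coe_le_coe]
      have h1 : (σ k : Measure (Fin d → ℝ)).real (Set.Icc (fun _ => -X n) fun _ => X n)ᶜ ≤
          ∑ i : Fin d, (σ k : Measure (Fin d → ℝ)).real {x | X n < |x i|} := by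
        refine (measureReal_mono (fun x hx => ?_)).trans (measureReal_iUnion_fintype_le _)
        by_contra hcon
        simp only [Set.mem_iUnion, not_exists] at hcon
        exact hx ⟨fun i => (abs_le.1 (not_lt.1 (hcon i))).1, fun i => (abs_le.1 (not_lt.1 (hcon i))).2⟩
      refine h1.trans ((Finset.sum_le_sum fun i _ => htight n k i).trans (le_of_eq ?_))
      simp [u]
  obtain ⟨μ, hμ⟩ := exists_tendsto_hyperfilter
    (isCompact_setOfPred_finiteMeasure_mass_le_compl_isCompact_le ‖R 0‖₊ hu
      (fun n => isCompact_Icc) (Or.inl inferInstance)) hmem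
  have hdy : ∀ k (m : Fin d → ℤ), ∫ ξ, E (dyadic d k m) ξ ∂(μ : Measure (Fin d → ℝ)) =
      R (dyadic d k m) := by
    intro k m
    have h1 := (FiniteMeasure.tendsto_iff_forall_integral_rclike_tendsto ℂ).1 hμ
      (BoundedContinuousFunction.ofNormedAddCommGroup (E (dyadic d k m)) (hEc2 _) 1
        fun ξ => (hEn _ ξ).le)
    refine tendsto_nhds_unique h1 (tendsto_const_nhds.congr' ?_)
    refine Filter.Eventually.filter_mono Nat.hyperfilter_le_atTop ?_
    filter_upwards [eventually_ge_atTop k] with l hl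
    obtain ⟨j, rfl⟩ := Nat.exists_eq_add_of_le hl
    -- The lattices are nested, so all later measures have exactly the right value at a given dyadic
    -- point and the limit inherits it. Continuity of both sides then gives all `t`.
    have h2 : dyadic d k m = dyadic d (k + j) fun i => 2 ^ j * m i := by
      ext i
      change (m i : ℝ) / 2 ^ k = ((2 ^ j * m i : ℤ) : ℝ) / 2 ^ (k + j)
      push_cast
      rw [pow_add]
      field_simp
    rw [h2]
    exact (hσ (k + j) _).symm
  refine ⟨μ, fun t => ?_⟩
  have hcμ : Continuous fun t => ∫ ξ, E t ξ ∂(μ : Measure (Fin d → ℝ)) :=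
    continuous_of_dominated (bound := fun _ => 1) (fun t => (hEc2 t).aestronglyMeasurable)
      (fun t => ae_of_all _ fun ξ => (hEn t ξ).le) (integrable_const _)
      (ae_of_all _ fun ξ => by fun_prop)
  have h1 := (hcμ.tendsto t).comp (tendsto_dyadic_floor t)
  have h2 := (hc.tendsto t).comp (tendsto_dyadic_floor t)
  exact tendsto_nhds_unique h1 (h2.congr fun k => (hdy k _).symm)

end Bochner

end Iceberg

namespace Iceberg

/-! ### Density of the regular cylindric functions -/

section Density

variable {K : Type*} [CommRing K] [LinearOrder K] [IsStrictOrderedRing K] [Archimedean K]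
  {d : ℕ} {h₁ : ℕ+} {q : ℕ → ℕ+} [MeasurableSpace K] [MeasurableAdd₂ K] [MeasurableNeg K]

/-- Square integrable functions can be approximated by bounded Lipschitz continuous ones. -/
def HasLipschitzApprox (e : K →+* ℝ) (ν : Measure (Fin d → K)) : Prop :=
  ∀ f : (Fin d → K) → ℂ, MemLp f 2 ν → ∀ ε : ℝ, 0 < ε → ∃ (g : (Fin d → K) → ℂ) (B L : ℝ),
    Measurable g ∧ (∀ u, ‖g u‖ ≤ B) ∧ (∀ u v, ‖g u - g v‖ ≤ L * ∑ i, |e (u i - v i)|) ∧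
    eLpNorm (f - g) 2 ν ≤ ENNReal.ofReal ε

/-- Regular functions which do not vanish almost everywhere. -/
def IsRegular (e : K →+* ℝ) (ν : Measure (Fin d → K)) {n : ℕ} (F : Space K d h₁ q n → ℂ) : Prop :=
  ∃ B L s : ℝ, 0 < s ∧ Regular e ν F B L s

theorem norm_integral_le_eLpNorm_two {Ω : Type*} [MeasurableSpace Ω] {μ : Measure Ω}
    [IsProbabilityMeasure μ] {f : Ω → ℂ} (hf : AEStronglyMeasurable f μ) :
    ‖∫ x, f x ∂μ‖ₑ ≤ eLpNorm f 2 μ := by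
  refine (enorm_integral_le_lintegral_enorm f).trans ?_
  rw [← eLpNorm_one_eq_lintegral_enorm]
  exact eLpNorm_le_eLpNorm_of_exponent_le (by norm_num) hf

theorem eLpNorm_const_two {Ω : Type*} [MeasurableSpace Ω] (μ : Measure Ω)
    [IsProbabilityMeasure μ] (c : ℂ) : eLpNorm (fun _ => c) 2 μ = ‖c‖ₑ := by
  rw [eLpNorm_const c (by norm_num) (IsProbabilityMeasure.ne_zero μ)]
  simp

namespace IsStandard

variable {e : K →+* ℝ} {ν : Measure (Fin d → K)} (hS : IsStandard e ν) [ν.IsAddLeftInvariant]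
include hS

/-- A Lipschitz function on the cube, regarded on the torus, may jump across the boundary of the
cube. Translation by `t` wraps around only on a set of mass at most `(∑ i, |e (t i)|) / h n`, so the
function remains Lipschitz in the mean; subtracting a constant does not affect this. -/
theorem regular_of_lipschitz (n : ℕ) {g : (Fin d → K) → ℂ} {B L : ℝ} (hg : Measurable g)
    (hB : ∀ u, ‖g u‖ ≤ B) (hL : ∀ u v, ‖g u - g v‖ ≤ L * ∑ i, |e (u i - v i)|) :
    Regular e ν (fun x : Space K d h₁ q n => g (rep n x) - ∫ x, g (rep n x) ∂(uniform K d h₁ q ν n))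
      (B + B) (L + 2 * B / lenR h₁ q n) (∫ x, ‖g (rep n x) - ∫ x, g (rep n x)
        ∂(uniform K d h₁ q ν n)‖ ^ 2 ∂(uniform K d h₁ q ν n)) := by
  have hpr := hS.isProbabilityMeasure_uniform (h₁ := h₁) (q := q) n
  have hm : Measurable fun x : Space K d h₁ q n => g (rep n x) := hg.comp (hS.measurable_rep n)
  have hi : Integrable (fun x : Space K d h₁ q n => g (rep n x)) (uniform K d h₁ q ν n) :=
    IncrementFamily.integrable_of_norm_le hm fun _ => hB _
  have hB0 : 0 ≤ B := (norm_nonneg _).trans (hB 0)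
  refine ⟨hm.sub_const _, fun x => ?_, ?_, fun t => ?_, rfl⟩
  · refine (norm_sub_le _ _).trans (add_le_add (hB _) ?_)
    refine (norm_integral_le_of_norm_le_const (ae_of_all _ fun x => hB (rep n x))).trans ?_
    simp
  · rw [integral_sub hi (integrable_const _), integral_const]
    simp
  · simp only [sub_sub_sub_cancel_right]
    set A : Set (Space K d h₁ q n) := {z | t + rep n z ∉ cube K d h₁ q n}
    have hA : MeasurableSet A :=
      ((measurable_const_add t).comp (hS.measurable_rep n) (hS.measurableSet_cube n)).compl
    have hpt : ∀ x : Space K d h₁ q n, ‖g (rep n (QuotientAddGroup.mk t + x)) - g (rep n x)‖ ≤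
        L * ∑ i, |e (t i)| + A.indicator (fun _ => 2 * B) x := by
      intro x
      have hL0 : 0 ≤ L * ∑ i, |e (t i)| := by
        have := (norm_nonneg _).trans (hL t 0)
        simpa using this
      by_cases hx : x ∈ A
      · rw [Set.indicator_of_mem hx]
        have := norm_sub_le (g (rep n (QuotientAddGroup.mk t + x))) (g (rep n x))
        linarith [hB (rep n (QuotientAddGroup.mk t + x)), hB (rep n x)]
      · rw [Set.indicator_of_notMem hx, add_zero]
        have hx' : t + rep n x ∈ cube K d h₁ q n := not_not.1 hx
        have h1 : rep n (QuotientAddGroup.mk t + x) = t + rep n x := by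
          conv_lhs => rw [← mk_rep x, ← QuotientAddGroup.mk_add]
          exact rep_mk_of_mem hx'
        rw [h1]
        refine (hL _ _).trans (le_of_eq ?_)
        simp
    have hint : Integrable (A.indicator fun _ => 2 * B) (uniform K d h₁ q ν n) :=
      (integrable_const _).indicator hA
    refine (integral_mono_of_nonneg (ae_of_all _ fun _ => norm_nonneg _)
      ((integrable_const _).add hint) (ae_of_all _ hpt)).trans ?_
    rw [integral_add' (integrable_const _) hint, integral_const, integral_indicator_const _ hA]
    have h2 := hS.uniform_boundary_le (h₁ := h₁) (q := q) n t
    rw [← Finset.sum_div] at h2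
    simp only [probReal_univ, smul_eq_mul, one_mul]
    have h3 := mul_le_mul_of_nonneg_right h2 (by linarith : (0 : ℝ) ≤ 2 * B)
    calc _ ≤ L * ∑ i, |e (t i)| + (∑ i, |e (t i)|) / lenR h₁ q n * (2 * B) := by gcongr
      _ = _ := by ring

/-- The normalized restriction of the Haar measure to the cube is dominated by the Haar measure. -/
theorem cond_cube_le (n : ℕ) : ν[|cube K d h₁ q n] ≤ ν := by
  have h1 : (ν (cube K d h₁ q n))⁻¹ ≤ 1 := by
    rw [ENNReal.inv_le_one, hS.measure_cube, ← ENNReal.ofReal_one]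
    exact ENNReal.ofReal_le_ofReal (one_le_pow₀ (one_le_lenR h₁ q n))
  refine Measure.le_iff.2 fun s _ => ?_
  rw [ProbabilityTheory.cond, Measure.smul_apply, smul_eq_mul]
  exact (mul_le_of_le_one_left zero_le h1).trans (Measure.restrict_apply_le _ _)

/-- Half of `ε` is spent on the approximation on the cube and half on restoring mean zero: since `F`
has mean zero, the mean of the approximating function is bounded by its distance from `F`. -/
theorem exists_regular_approx (hap : HasLipschitzApprox e ν) {n : ℕ} {F : Space K d h₁ q n → ℂ}
    (hF : MemLp F 2 (uniform K d h₁ q ν n)) (hF0 : ∫ x, F x ∂(uniform K d h₁ q ν n) = 0) {ε : ℝ}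
    (hε : 0 < ε) : ∃ (G : Space K d h₁ q n → ℂ) (B L s : ℝ), Regular e ν G B L s ∧
      eLpNorm (F - G) 2 (uniform K d h₁ q ν n) ≤ ENNReal.ofReal ε := by
  have hpr := hS.isProbabilityMeasure_uniform (h₁ := h₁) (q := q) n
  have hmk : MeasurePreserving (QuotientAddGroup.mk : (Fin d → K) → Space K d h₁ q n)
      ν[|cube K d h₁ q n] (uniform K d h₁ q ν n) := ⟨measurable_mk n, rfl⟩
  have hc0 := hS.measure_cube_ne_zero (h₁ := h₁) (q := q) n
  have hct := hS.measure_cube_ne_top (h₁ := h₁) (q := q) n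
  have hcube := hS.measurableSet_cube (h₁ := h₁) (q := q) n
  set f : (Fin d → K) → ℂ := (cube K d h₁ q n).indicator
    (F ∘ (QuotientAddGroup.mk : (Fin d → K) → Space K d h₁ q n))
  have hf : MemLp f 2 ν := by
    refine (memLp_indicator_iff_restrict hcube).2 ?_
    refine (hF.comp_measurePreserving hmk).of_measure_le_smul hct ?_
    rw [ProbabilityTheory.cond, smul_smul, ENNReal.mul_inv_cancel hc0 hct, one_smul]
  obtain ⟨g, B, L, hg, hB, hL, hfg⟩ := hap f hf (ε / 2) (by positivity)
  have hm : Measurable fun x : Space K d h₁ q n => g (rep n x) := hg.comp (hS.measurable_rep n)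
  have haes : AEStronglyMeasurable (fun x => F x - g (rep n x)) (uniform K d h₁ q ν n) :=
    hF.1.sub hm.aestronglyMeasurable
  have h1 : eLpNorm (fun x => F x - g (rep n x)) 2 (uniform K d h₁ q ν n) ≤
      ENNReal.ofReal (ε / 2) := by
    rw [← eLpNorm_comp_measurePreserving haes hmk]
    have h2 : (fun x => F x - g (rep n x)) ∘ (QuotientAddGroup.mk : (Fin d → K) →
        Space K d h₁ q n) =ᵐ[ν[|cube K d h₁ q n]] f - g := by
      filter_upwards [ae_cond_mem hcube] with u hu
      simp only [Function.comp_apply, Pi.sub_apply, f, Set.indicator_of_mem hu, rep_mk_of_mem hu]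
    rw [eLpNorm_congr_ae h2]
    exact (eLpNorm_mono_measure _ (hS.cond_cube_le n)).trans hfg
  have hi : Integrable (fun x : Space K d h₁ q n => g (rep n x)) (uniform K d h₁ q ν n) :=
    IncrementFamily.integrable_of_norm_le hm fun _ => hB _
  set m := ∫ x, g (rep n x) ∂(uniform K d h₁ q ν n) with hmdef
  have h3 : ‖m‖ₑ ≤ ENNReal.ofReal (ε / 2) := by
    have h4 := norm_integral_le_eLpNorm_two haes
    rw [integral_sub (hF.integrable (by norm_num)) hi, hF0, zero_sub, enorm_neg] at h4
    exact h4.trans h1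
  refine ⟨_, _, _, _, hS.regular_of_lipschitz n hg hB hL, ?_⟩
  have h5 : (F - fun x => g (rep n x) - m) = (fun x => F x - g (rep n x)) + fun _ => m := by
    funext x; simp only [Pi.sub_apply, Pi.add_apply]; ring
  rw [h5, ← add_halves ε, ENNReal.ofReal_add (by positivity) (by positivity)]
  refine (eLpNorm_add_le haes aestronglyMeasurable_const (by norm_num)).trans (add_le_add h1 ?_)
  rw [eLpNorm_const_two]
  exact h3

/-- There are small functions with mean zero that do not vanish. -/
theorem exists_small (n : ℕ) (hd : 0 < d) (hq : 1 < (q n : ℕ)) {δ : ℝ} (hδ : 0 < δ) :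
    ∃ w : Space K d h₁ q (n + 1) → ℂ, MemLp w 2 (uniform K d h₁ q ν (n + 1)) ∧
      ∫ x, w x ∂(uniform K d h₁ q ν (n + 1)) = 0 ∧
      eLpNorm w 2 (uniform K d h₁ q ν (n + 1)) ≠ 0 ∧
      eLpNorm w 2 (uniform K d h₁ q ν (n + 1)) ≤ ENNReal.ofReal δ := by
  have hpr := hS.isProbabilityMeasure_uniform (h₁ := h₁) (q := q) (n + 1)
  set p : ℝ := 1 / ((q n : ℕ) : ℝ) ^ d with hp
  have hq1 : (1 : ℝ) < ((q n : ℕ) : ℝ) ^ d := one_lt_pow₀ (by exact_mod_cast hq) hd.ne'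
  have hp0 : 0 < p := by positivity
  have hp1 : p < 1 := by rw [hp, div_lt_one (by linarith)]; exact hq1
  obtain ⟨f, hf⟩ : ∃ f : Block K d h₁ q n → ℝ, ∀ c, f c = δ * ((if c = 0 then 1 else 0) - p) :=
    ⟨_, fun _ => rfl⟩
  have hfn : ∀ c, ‖(f c : ℂ)‖ ≤ δ := by
    intro c
    rw [Complex.norm_real, Real.norm_eq_abs, hf, abs_mul, abs_of_pos hδ]
    refine mul_le_of_le_one_right hδ.le ?_
    split_ifs <;> rw [abs_le] <;> constructor <;> linarith
  have hf0 : ∀ c, (f c : ℂ) ≠ 0 := by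
    intro c
    rw [Complex.ofReal_ne_zero, hf]
    refine mul_ne_zero hδ.ne' ?_
    split_ifs <;> intro h <;> linarith
  have hm : Measurable fun x : Space K d h₁ q (n + 1) => (f (block K d h₁ q n x) : ℂ) :=
    hS.measurable_block_comp n fun c => (f c : ℂ)
  have hbound := ae_of_all (uniform K d h₁ q ν (n + 1)) fun x => hfn (block K d h₁ q n x)
  refine ⟨_, MemLp.of_bound hm.aestronglyMeasurable δ hbound, ?_, ?_, ?_⟩
  · have hA := hS.measurableSet_block (h₁ := h₁) (q := q) n 0
    have h1 : ∀ x : Space K d h₁ q (n + 1), f (block K d h₁ q n x) =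
        δ * ((block K d h₁ q n ⁻¹' {0}).indicator (fun _ => (1 : ℝ)) x - p) := by
      intro x
      rw [hf]
      rfl
    rw [integral_complex_ofReal, Complex.ofReal_eq_zero]
    simp_rw [h1]
    rw [integral_const_mul, integral_sub ((integrable_const _).indicator hA) (integrable_const _),
      integral_indicator_const _ hA, hS.measureReal_block]
    simp [hp]
  · rw [Ne, eLpNorm_eq_zero_iff hm.aestronglyMeasurable (by norm_num)]
    intro h
    obtain ⟨x, hx⟩ := h.exists
    exact hf0 _ hx
  · refine (eLpNorm_le_of_ae_bound hbound).trans ?_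
    simp

/-- A function of positive second moment is needed, since the correlation of the zero function is in
`L ^ 2`. An approximation within half the norm cannot vanish; if `F` itself vanishes, a small
nonzero function is approximated instead. That function is built from blocks, which exist at
positive levels only, hence `0 < n`. -/
theorem exists_isRegular_approx (hap : HasLipschitzApprox e ν) (hd : 0 < d) {n : ℕ} (hn : 0 < n)
    (hq : ∀ n, 1 < (q n : ℕ)) {F : Space K d h₁ q n → ℂ} (hF : MemLp F 2 (uniform K d h₁ q ν n))
    (hF0 : ∫ x, F x ∂(uniform K d h₁ q ν n) = 0) {ε : ℝ} (hε : 0 < ε) :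
    ∃ G : Space K d h₁ q n → ℂ, IsRegular e ν G ∧
      eLpNorm (F - G) 2 (uniform K d h₁ q ν n) ≤ ENNReal.ofReal ε := by
  have key : ∀ {H : Space K d h₁ q n → ℂ}, MemLp H 2 (uniform K d h₁ q ν n) →
      ∫ x, H x ∂(uniform K d h₁ q ν n) = 0 → eLpNorm H 2 (uniform K d h₁ q ν n) ≠ 0 →
      ∀ {ε : ℝ}, 0 < ε → ∃ G : Space K d h₁ q n → ℂ, IsRegular e ν G ∧
        eLpNorm (H - G) 2 (uniform K d h₁ q ν n) ≤ ENNReal.ofReal ε := by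
    intro H hH hH0 hne ε hε
    have hpos : 0 < (eLpNorm H 2 (uniform K d h₁ q ν n)).toReal :=
      ENNReal.toReal_pos hne hH.2.ne
    obtain ⟨G, B, L, s, hG, hle⟩ := hS.exists_regular_approx hap hH hH0
      (ε := min ε ((eLpNorm H 2 (uniform K d h₁ q ν n)).toReal / 2)) (by positivity)
    refine ⟨G, ⟨B, L, s, ?_, hG⟩, hle.trans (ENNReal.ofReal_le_ofReal (min_le_left _ _))⟩
    have hs0 : 0 ≤ s := by
      rw [← hG.integral_sq]
      positivity
    refine lt_of_le_of_ne hs0 fun hs => ?_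
    have hpr := hS.isProbabilityMeasure_uniform (h₁ := h₁) (q := q) n
    have h1 := hG.integral_sq
    rw [← hs, integral_eq_zero_iff_of_nonneg (fun _ => by positivity)] at h1
    · have h2 : H - G =ᵐ[uniform K d h₁ q ν n] H := by
        filter_upwards [h1] with x hx
        have : G x = 0 := by simpa using hx
        simp [this]
      rw [eLpNorm_congr_ae h2] at hle
      have h3 := ENNReal.toReal_mono ENNReal.ofReal_ne_top hle
      rw [ENNReal.toReal_ofReal (by positivity)] at h3
      linarith [min_le_right ε ((eLpNorm H 2 (uniform K d h₁ q ν n)).toReal / 2)]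
    · refine Integrable.of_bound (C := B ^ 2) (hG.measurable.norm.pow_const 2).aestronglyMeasurable
        (ae_of_all _ fun x => ?_)
      rw [Real.norm_of_nonneg (by positivity)]
      exact pow_le_pow_left₀ (norm_nonneg _) (hG.norm_le x) 2
  by_cases hz : eLpNorm F 2 (uniform K d h₁ q ν n) = 0
  · obtain ⟨m, rfl⟩ : ∃ m, n = m + 1 := ⟨n - 1, by omega⟩
    obtain ⟨w, hw, hw0, hwn, hwle⟩ := hS.exists_small (h₁ := h₁) m hd (hq m) (half_pos hε)
    obtain ⟨G, hG, hle⟩ := key hw hw0 hwn (half_pos hε)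
    refine ⟨G, hG, ?_⟩
    have hGm : Measurable G := by
      obtain ⟨_, _, _, _, h⟩ := hG
      exact h.measurable
    have h1 : F - G = F + (-w + (w - G)) := by abel
    rw [h1]
    refine (eLpNorm_add_le hF.1 (hw.1.neg.add (hw.1.sub hGm.aestronglyMeasurable))
      (by norm_num)).trans ?_
    rw [hz, zero_add]
    refine (eLpNorm_add_le hw.1.neg (hw.1.sub hGm.aestronglyMeasurable) (by norm_num)).trans ?_
    rw [eLpNorm_neg]
    refine (add_le_add hwle hle).trans (le_of_eq ?_)
    rw [← ENNReal.ofReal_add (by positivity) (by positivity), add_halves]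
  · exact key hF hF0 hz hε

/-- There are countable dense sets of regular functions. -/
theorem exists_countable_isRegular [MeasurableSpace.CountablyGenerated (Fin d → K)] (n : ℕ) :
    ∃ S : Set (Space K d h₁ q n → ℂ), S.Countable ∧ (∀ F ∈ S, IsRegular e ν F) ∧
      ∀ F, IsRegular e ν F → ∀ ε : ℝ, 0 < ε → ∃ G ∈ S,
        eLpNorm (F - G) 2 (uniform K d h₁ q ν n) < ENNReal.ofReal ε := by
  have hpr := hS.isProbabilityMeasure_uniform (h₁ := h₁) (q := q) n
  -- The `σ`-algebra of the quotient is pulled back from the group by `rep`, so it is countably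
  -- generated and `L ^ 2` is separable.
  have hcg : MeasurableSpace.CountablyGenerated (Space K d h₁ q n) := by
    have h1 : (inferInstance : MeasurableSpace (Space K d h₁ q n)) =
        MeasurableSpace.comap (rep n) (inferInstance : MeasurableSpace (Fin d → K)) := by
      refine le_antisymm (fun s hs => ⟨QuotientAddGroup.mk ⁻¹' s, measurable_mk n hs, ?_⟩)
        (hS.measurable_rep n).comap_le
      ext x
      simp [mk_rep]
    have h2 := MeasurableSpace.CountablyGenerated.comap (rep n : Space K d h₁ q n → Fin d → K)
    rwa [← h1] at h2
  have hmem : ∀ F : Space K d h₁ q n → ℂ, IsRegular e ν F → MemLp F 2 (uniform K d h₁ q ν n) := by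
    rintro F ⟨B, L, s, -, hF⟩
    exact MemLp.of_bound hF.measurable.aestronglyMeasurable B (ae_of_all _ hF.norm_le)
  set A : Set (Lp ℂ 2 (uniform K d h₁ q ν n)) :=
    {x | ∃ F : Space K d h₁ q n → ℂ, ∃ hF : IsRegular e ν F, (hmem F hF).toLp F = x} with hA
  have : Fact ((2 : ℝ≥0∞) ≠ ∞) := ⟨by simp⟩
  obtain ⟨c, hcA, hcc, hdense⟩ :=
    (TopologicalSpace.IsSeparable.of_separableSpace A).exists_countable_dense_subset
  choose! f hf1 hf2 using fun x (hx : x ∈ A) => hx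
  refine ⟨f '' c, hcc.image f, ?_, fun F hF ε hε => ?_⟩
  · rintro _ ⟨x, hx, rfl⟩
    exact hf1 x (hcA hx)
  · obtain ⟨x, hx, hdist⟩ := Metric.mem_closure_iff.1 (hdense (show (hmem F hF).toLp F ∈ A from
      ⟨F, hF, rfl⟩)) ε hε
    refine ⟨f x, ⟨x, hx, rfl⟩, ?_⟩
    rw [← hf2 x (hcA hx), dist_edist, Lp.edist_toLp_toLp] at hdist
    refine (ENNReal.lt_ofReal_iff_toReal_lt ?_).2 hdist
    exact ((hmem F hF).sub (hmem _ (hf1 x (hcA hx)))).2.ne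

end IsStandard

namespace IsLimitMeasure

variable {α : Rotations K d h₁ q} {ν : Measure (Fin d → K)} {μ : Measure (Phase α)}
  {e : K →+* ℝ} (hS : IsStandard e ν) [ν.IsAddLeftInvariant]

theorem eLpNorm_cyl (hμ : IsLimitMeasure α ν μ) {n : ℕ} {F : Space K d h₁ q n → ℂ}
    (hF : AEStronglyMeasurable F (uniform K d h₁ q ν n)) (p : ℝ≥0∞) :
    eLpNorm (cyl α F) p μ = eLpNorm F p (uniform K d h₁ q ν n) :=
  eLpNorm_comp_measurePreserving hF (hμ.measurePreserving_coord n)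

include hS

theorem exists_common_cyl {m n : ℕ} (h : m ≤ n) {F : Space K d h₁ q m → ℂ} (hF : Measurable F)
    {B : ℝ} (hB : ∀ x, ‖F x‖ ≤ B) :
    ∃ F' : Space K d h₁ q n → ℂ, Measurable F' ∧ (∀ x, ‖F' x‖ ≤ B) ∧ cyl α F = cyl α F' := by
  obtain ⟨k, rfl⟩ := Nat.exists_eq_add_of_le h
  refine ⟨F ∘ descend α m k, hF.comp (hS.measurable_descend α m k), fun x => hB _, ?_⟩
  funext x
  simp [cyl, descend_coord]

theorem isSetAlgebra_cylinders : IsSetAlgebra (cylinders α) where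
  empty_mem := ⟨0, ∅, MeasurableSet.empty, by simp⟩
  compl_mem := by
    rintro _ ⟨n, A, hA, rfl⟩
    exact ⟨n, Aᶜ, hA.compl, rfl⟩
  union_mem := by
    rintro _ _ ⟨m, A, hA, rfl⟩ ⟨n, B, hB, rfl⟩
    obtain ⟨A', hA', e1⟩ := exists_common_level hS (α := α) (le_max_left m n) hA
    obtain ⟨B', hB', e2⟩ := exists_common_level hS (α := α) (le_max_right m n) hB
    exact ⟨max m n, A' ∪ B', hA'.union hB', by rw [e1, e2]; rfl⟩

/-- The bounded cylindric functions are dense. -/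
theorem exists_cyl_approx (hμ : IsLimitMeasure α ν μ) {g : Phase α → ℂ} (hg : MemLp g 2 μ) {ε : ℝ}
    (hε : 0 < ε) : ∃ n, 0 < n ∧ ∃ F : Space K d h₁ q n → ℂ, Measurable F ∧ (∃ B, ∀ x, ‖F x‖ ≤ B) ∧
      eLpNorm (g - cyl α F) 2 μ ≤ ENNReal.ofReal ε := by
  have hpr := hμ.isProbabilityMeasure
  suffices h : ∃ f, eLpNorm (g - f) 2 μ ≤ ENNReal.ofReal ε ∧ ∃ n, 0 < n ∧
      ∃ F : Space K d h₁ q n → ℂ, Measurable F ∧ (∃ B, ∀ x, ‖F x‖ ≤ B) ∧ f = cyl α F by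
    obtain ⟨_, hfg, n, hn, F, hF, hB, rfl⟩ := h
    exact ⟨n, hn, F, hF, hB, hfg⟩
  refine hg.induction_dense (by norm_num) _ (fun c s hs _ ε hε => ?_) ?_ ?_
    (ENNReal.ofReal_pos.2 hε).ne'
  · obtain ⟨η, hη, hle⟩ := exists_eLpNorm_indicator_le (p := 2) (μ := μ) (by norm_num) c hε
    obtain ⟨_, ⟨n, A, hA, rfl⟩, hlt⟩ := (Measure.MeasureDense.of_generateFrom_isSetAlgebra_finite μ
      (isSetAlgebra_cylinders hS) (generateFrom_cylinders α).symm).approx s hs (measure_ne_top _ _)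
      η (by exact_mod_cast hη)
    -- The indicator is lifted by one level so that its level is positive, as
    -- `exists_isRegular_approx` requires.
    obtain ⟨F, hF, hFB, hcyl⟩ := exists_common_cyl hS (α := α) (Nat.le_succ n)
      (measurable_const.indicator hA : Measurable (A.indicator fun _ => c)) (B := ‖c‖)
      fun x => norm_indicator_le_norm_self _ _
    refine ⟨_, ?_, n + 1, Nat.succ_pos n, F, hF, ⟨_, hFB⟩, rfl⟩
    rw [← hcyl]
    refine (eLpNorm_mono (fun x => le_of_eq ?_)).trans
      (hle (symmDiff s {x | x.1 n ∈ A}) (hlt.le.trans (by simp)))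
    by_cases h1 : x.1 n ∈ A <;> by_cases h2 : x ∈ s <;>
      simp [cyl, Set.indicator, Set.mem_symmDiff, h1, h2]
  · rintro _ _ ⟨m, hm, F, hF, ⟨B, hB⟩, rfl⟩ ⟨n, hn, G, hG, ⟨C, hC⟩, rfl⟩
    obtain ⟨F', hF', hB', e1⟩ := exists_common_cyl hS (α := α) (le_max_left m n) hF hB
    obtain ⟨G', hG', hC', e2⟩ := exists_common_cyl hS (α := α) (le_max_right m n) hG hC
    refine ⟨max m n, lt_max_of_lt_left hm, F' + G', hF'.add hG',
      ⟨B + C, fun x => (norm_add_le _ _).trans (add_le_add (hB' x) (hC' x))⟩, ?_⟩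
    rw [e1, e2]
    rfl
  · rintro _ ⟨n, -, F, hF, -, rfl⟩
    exact (hF.comp (measurable_coord α n)).aestronglyMeasurable

/-- Regular cylindric functions are dense among the functions with mean zero. -/
theorem denseInMeanZero (hap : HasLipschitzApprox e ν) (hd : 0 < d) (hq : ∀ n, 1 < (q n : ℕ))
    (hμ : IsLimitMeasure α ν μ) {S : ∀ n, Set (Space K d h₁ q n → ℂ)}
    (hS1 : ∀ n, ∀ F ∈ S n, IsRegular e ν F)
    (hS2 : ∀ n F, IsRegular e ν F → ∀ ε : ℝ, 0 < ε → ∃ G ∈ S n,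
      eLpNorm (F - G) 2 (uniform K d h₁ q ν n) < ENNReal.ofReal ε) : DenseInMeanZero α μ S := by
  intro g hg hg0 ε hε
  have hprμ := hμ.isProbabilityMeasure
  obtain ⟨n, hn, F, hF, ⟨B, hB⟩, hle⟩ := hμ.exists_cyl_approx hS hg (ε := ε / 4) (by positivity)
  have hpr := hS.isProbabilityMeasure_uniform (h₁ := h₁) (q := q) n
  have hmp := hμ.measurePreserving_coord n
  have hFi : MemLp F 2 (uniform K d h₁ q ν n) :=
    MemLp.of_bound hF.aestronglyMeasurable B (ae_of_all _ hB)
  have hcm : AEStronglyMeasurable (cyl α F) μ := (hF.comp (measurable_coord α n)).aestronglyMeasurable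
  have hci : Integrable (cyl α F) μ := (hFi.comp_measurePreserving hmp).integrable (by norm_num)
  set m := ∫ x, F x ∂(uniform K d h₁ q ν n) with hm
  have h1 : ‖m‖ₑ ≤ ENNReal.ofReal (ε / 4) := by
    have h2 := norm_integral_le_eLpNorm_two (hg.1.sub hcm)
    have h3 : ∫ x, cyl α F x ∂μ = m := by
      rw [hm, ← hmp.map_eq, integral_map (measurable_coord α n).aemeasurable
        hF.aestronglyMeasurable]
      rfl
    simp only [Pi.sub_apply] at h2
    rw [integral_sub (hg.integrable (by norm_num)) hci, hg0, h3, zero_sub, enorm_neg] at h2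
    exact h2.trans hle
  have hFm : MemLp (fun x => F x - m) 2 (uniform K d h₁ q ν n) := hFi.sub (memLp_const m)
  obtain ⟨G, hG, hle2⟩ := hS.exists_isRegular_approx hap hd hn hq hFm (by
    rw [integral_sub (hFi.integrable (by norm_num)) (integrable_const _), integral_const]
    simp [hm]) (ε := ε / 4) (by positivity)
  obtain ⟨H, hH, hlt⟩ := hS2 n G hG (ε / 4) (by positivity)
  have hmeas : ∀ {F}, IsRegular e ν F → AEStronglyMeasurable F (uniform K d h₁ q ν n) := by
    rintro F ⟨_, _, _, _, h⟩
    exact h.measurable.aestronglyMeasurable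
  have hGm := hmeas hG
  have hHm := hmeas (hS1 n H hH)
  refine ⟨n, H, hH, ?_⟩
  have h4 : eLpNorm (F - H) 2 (uniform K d h₁ q ν n) ≤
      ENNReal.ofReal (ε / 4) + (ENNReal.ofReal (ε / 4) + eLpNorm (G - H) 2
        (uniform K d h₁ q ν n)) := by
    -- Three of the four errors of size `ε / 4`: the mean of `F`, the regular approximation `G` of
    -- the centred function, and the choice of `H` in the countable set. The fourth is the distance
    -- from `g` to the cylindric function of `F`.
    have h5 : F - H = (fun _ => m) + (((fun x => F x - m) - G) + (G - H)) := by
      funext x; simp only [Pi.sub_apply, Pi.add_apply]; ring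
    rw [h5]
    refine (eLpNorm_add_le aestronglyMeasurable_const ((hFm.1.sub hGm).add (hGm.sub hHm))
      (by norm_num)).trans (add_le_add ((le_of_eq (eLpNorm_const_two _ m)).trans h1) ?_)
    exact (eLpNorm_add_le (hFm.1.sub hGm) (hGm.sub hHm) (by norm_num)).trans
      (add_le_add hle2 le_rfl)
  have h6 : cyl α H - g = -((g - cyl α F) + cyl α (F - H)) := by
    funext x; simp [cyl]
  rw [h6, eLpNorm_neg]
  have hFH : AEStronglyMeasurable (cyl α (F - H)) μ :=
    (hF.aestronglyMeasurable.sub hHm).comp_measurePreserving hmp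
  refine (eLpNorm_add_le (hg.1.sub hcm) hFH (by norm_num)).trans_lt ?_
  rw [hμ.eLpNorm_cyl (hF.aestronglyMeasurable.sub hHm)]
  refine (add_le_add hle h4).trans_lt ?_
  have h7 : ENNReal.ofReal ε = ENNReal.ofReal (ε / 4) + (ENNReal.ofReal (ε / 4) +
      (ENNReal.ofReal (ε / 4) + ENNReal.ofReal (ε / 4))) := by
    rw [← ENNReal.ofReal_add, ← ENNReal.ofReal_add, ← ENNReal.ofReal_add] <;> first | positivity | skip
    congr 1; ring
  rw [h7]
  refine ENNReal.add_lt_add_left ENNReal.ofReal_ne_top ?_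
  refine ENNReal.add_lt_add_left ENNReal.ofReal_ne_top ?_
  exact ENNReal.add_lt_add_left ENNReal.ofReal_ne_top hlt

end IsLimitMeasure

end Density

end Iceberg

namespace Iceberg

/-! ### The correlation functions of the regular cylindric functions -/

section Correlation

variable {M : Type*} [AddCommGroup M] [MeasurableSpace M] [MeasurableAdd₂ M] [MeasurableNeg M]
  {μ : Measure M} [IsProbabilityMeasure μ] [μ.IsAddLeftInvariant] {F : M → ℂ} {B : ℝ}

theorem corr_neg (z : M) : corr μ F (-z) = (starRingEnd ℂ) (corr μ F z) := by
  have h := corr_shift (μ := μ) (F := F) 0 z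
  rw [zero_sub] at h
  rw [← h, corr, ← integral_conj]
  refine integral_congr_ae (ae_of_all _ fun x => ?_)
  simp only [zero_add, map_mul, Complex.conj_conj, mul_comm]

theorem isPositiveDefinite_corr (hF : Measurable F) (hB : ∀ x, ‖F x‖ ≤ B) :
    IsPositiveDefinite (corr μ F) := by
  intro ι s a c
  refine ⟨∫ x, ‖∑ i ∈ s, c i * F (a i + x)‖ ^ 2 ∂μ, by positivity, ?_⟩
  rw [← integral_complex_ofReal]
  have hm : ∀ i, Measurable fun x => F (a i + x) := fun i => hF.comp (measurable_const_add _)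
  have h1 : ∀ x, ((‖∑ i ∈ s, c i * F (a i + x)‖ ^ 2 : ℝ) : ℂ) = ∑ i ∈ s, ∑ j ∈ s,
      c i * (starRingEnd ℂ) (c j) * (F (a i + x) * (starRingEnd ℂ) (F (a j + x))) := by
    intro x
    rw [Complex.ofReal_pow, ← Complex.mul_conj', map_sum, Finset.sum_mul_sum]
    refine Finset.sum_congr rfl fun i _ => Finset.sum_congr rfl fun j _ => ?_
    rw [map_mul]
    ring
  have hi : ∀ i j, Integrable (fun x => c i * (starRingEnd ℂ) (c j) *
      (F (a i + x) * (starRingEnd ℂ) (F (a j + x)))) μ := fun i j =>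
    (Integrable.of_bound (C := B ^ 2) ((hm i).mul (measurable_conj (hm j))).aestronglyMeasurable
      (ae_of_all _ fun x => norm_mul_conj_le (hB _) (hB _))).const_mul _
  simp_rw [h1]
  rw [integral_finsetSum _ fun i _ => integrable_finsetSum _ fun j _ => hi i j]
  refine Finset.sum_congr rfl fun i _ => ?_
  rw [integral_finsetSum _ fun j _ => hi i j]
  refine Finset.sum_congr rfl fun j _ => ?_
  rw [integral_const_mul, corr_shift]

theorem IsPositiveDefinite.of_tendsto {G : Type*} [AddCommGroup G] {R : ℕ → G → ℂ} {R' : G → ℂ}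
    (hR : ∀ k, IsPositiveDefinite (R k)) (h : ∀ t, Tendsto (fun k => R k t) atTop (𝓝 (R' t))) :
    IsPositiveDefinite R' := by
  intro ι s a c
  have h1 : Tendsto (fun k => ∑ i ∈ s, ∑ j ∈ s, c i * (starRingEnd ℂ) (c j) * R k (a i - a j)) atTop
      (𝓝 (∑ i ∈ s, ∑ j ∈ s, c i * (starRingEnd ℂ) (c j) * R' (a i - a j))) :=
    tendsto_finsetSum _ fun i _ => tendsto_finsetSum _ fun j _ => (h _).const_mul _
  choose x hx0 hx using fun k => hR k ι s a c
  simp_rw [hx] at h1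
  have h2 := (Complex.continuous_re.tendsto _).comp h1
  have h3 := (Complex.continuous_im.tendsto _).comp h1
  refine ⟨_, ge_of_tendsto' h2 fun k => hx0 k, ?_⟩
  have h4 : Tendsto (fun _ : ℕ => (0 : ℝ)) atTop (𝓝 0) := tendsto_const_nhds
  refine Complex.ext rfl ?_
  rw [Complex.ofReal_im]
  exact tendsto_nhds_unique h3 h4

end Correlation

/-! ### Assembly of the estimates and the theorem for a group satisfying the abstract hypotheses. -/

section Estimates

variable {K : Type*} [CommRing K] [LinearOrder K] [IsStrictOrderedRing K] [Archimedean K]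
  {d : ℕ} {h₁ : ℕ+} {q : ℕ → ℕ+} [MeasurableSpace K] [MeasurableAdd₂ K] [MeasurableNeg K]

/-- The properties of the correlation functions from which those of the spectral measures are
derived. -/
structure SpectralEstimates (e : K →+* ℝ) (ν : Measure (Fin d → K)) (R : (Fin d → K) → ℂ) : Prop where
  posDef : IsPositiveDefinite R
  neg : ∀ t, R (-t) = (starRingEnd ℂ) (R t)
  lipschitz : ∃ C, ∀ s t, ‖R (t + s) - R s‖ ≤ C * ∑ i, |e (t i)|
  decay : ∀ a : ℝ, 0 < a → a < 1 / 2 → ∃ D ρ₀ : ℝ, ∀ (t : Fin d → K) (ρ : ℝ), ρ₀ ≤ ρ →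
    (∃ i, |e (t i)| = ρ) → (∀ i, |e (t i)| ≤ ρ) → ‖R t‖ ≤ D * ρ ^ (-a)
  not_memLp_two : ¬ MemLp R 2 ν
  memLp : ∀ p : ℝ≥0∞, 2 < p → MemLp R p ν

variable {e : K →+* ℝ} {ν : Measure (Fin d → K)} (hS : IsStandard e ν) [ν.IsAddLeftInvariant]
include hS

/-- Almost surely, the correlation function of a regular cylindric function has all properties. -/
theorem IsStandard.ae_spectralEstimates (hq : ∀ n, ((q n : ℕ) : ℝ) = (4 * lenR h₁ q n) ^ (n + 2))
    (hd : 0 < d) (hnet : HasNet e) {n : ℕ} {F : Space K d h₁ q n → ℂ} (hF : IsRegular e ν F) :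
    ∀ᵐ α ∂(rotationLaw K d h₁ q ν), ∀ μ : Measure (Phase α), IsLimitMeasure α ν μ →
      SpectralEstimates e ν (correlation α μ (cyl α F)) := by
  obtain ⟨B, L, s, hs, hF⟩ := hF
  have hsum := summable_inv_lenR hq
  have hpr := fun n => hS.isProbabilityMeasure_uniform (h₁ := h₁) (q := q) n
  have hadd := fun n => hS.measurableAdd₂ (h₁ := h₁) (q := q) n
  have hneg := fun n => hS.measurableNeg (h₁ := h₁) (q := q) n
  have hinv := fun n => hS.isAddLeftInvariant_uniform (h₁ := h₁) (q := q) n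
  obtain ⟨c, hc, hfreq⟩ := hS.ae_frequently_le_integral hq hd hF hs
  filter_upwards [hS.ae_eventually_fluct_le hq hd hnet hF, hfreq] with α hα1 hα2 μ hμ
  have hreg := fun k => hF.descend_of_summable hS hsum α k
  have hlim := hμ.tendsto_correlation hS hsum hF.measurable hF.norm_le
  have h : IsCorrLimit ν n (fun k => corr (uniform K d h₁ q ν (n + k)) (F ∘ descend α n k))
      (correlation α μ (cyl α F)) (B ^ 2) :=
    { measurable := fun k => measurable_corr (hreg k).measurable
      norm_le := fun k z => norm_corr_le (hreg k).norm_le z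
      tendsto := hlim
      recursion := hα1 }
  refine ⟨?_, fun t => ?_, ⟨B * (L + 2 * B * ∑' j, 1 / lenR h₁ q j), fun u t => ?_⟩,
    fun a ha0 ha => h.exists_norm_le_rpow hS hq hd ha0 ha, h.not_memLp_two hS hq hd hc hα2,
    fun p hp => h.memLp hS hq hd hp⟩
  · exact IsPositiveDefinite.of_tendsto (fun k => (isPositiveDefinite_corr (hreg k).measurable
      (hreg k).norm_le).comp (QuotientAddGroup.mk' (lattice K d h₁ q (n + k)))) hlim
  · refine tendsto_nhds_unique (hlim (-t)) ?_
    refine ((Complex.continuous_conj.tendsto _).comp (hlim t)).congr fun k => ?_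
    exact (corr_neg _).symm
  · refine le_of_tendsto' ((hlim (t + u)).sub (hlim u)).norm fun k => ?_
    exact (hreg k).norm_corr_sub_le hS t (QuotientAddGroup.mk u)

/-- The theorem for an abstract group with its Haar measure. -/
theorem IsStandard.exists_dense_spectralEstimates
    [MeasurableSpace.CountablyGenerated (Fin d → K)] (hd : 0 < d) (hnet : HasNet e)
    (hap : HasLipschitzApprox e ν) (h₁ : ℕ+) :
    ∃ q : ℕ → ℕ+, Tendsto (fun n => (q n : ℕ)) atTop atTop ∧ (∀ n, 2 * (q n : ℕ) < q (n + 1)) ∧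
      ∃ S : ∀ n, Set (Space K d h₁ q n → ℂ), MeanZeroSquareIntegrable ν S ∧
        ∀ (Ω : Type*) [MeasurableSpace Ω] (P : Measure Ω) [IsProbabilityMeasure P]
          (α : Ω → Rotations K d h₁ q), IsUniformFamily ν P α →
          ∀ᵐ ω ∂P, ∃ μ : Measure (Phase (α ω)), IsLimitMeasure (α ω) ν μ ∧ IsAction (α ω) μ ∧
            DenseInMeanZero (α ω) μ S ∧
            ∀ n, ∀ F ∈ S n, SpectralEstimates e ν (correlation (α ω) μ (cyl (α ω) F)) := by
  have hq := sparse_eq h₁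
  refine ⟨sparse h₁, tendsto_q hq, two_mul_q_lt hq, ?_⟩
  have hsum := summable_inv_lenR hq
  choose S hSc hS1 hS2 using fun n => hS.exists_countable_isRegular (h₁ := h₁) (q := sparse h₁) n
  refine ⟨S, fun n F hF => ?_, fun Ω _ P _ α hα => ?_⟩
  · obtain ⟨B, L, s, -, h⟩ := hS1 n F hF
    have hpr := hS.isProbabilityMeasure_uniform (h₁ := h₁) (q := sparse h₁) n
    exact ⟨h.measurable, MemLp.of_bound h.measurable.aestronglyMeasurable B (ae_of_all _ h.norm_le),
      h.integral_eq_zero⟩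
  -- The sets `S n` are countable and do not depend on the rotations, so one null set serves all
  -- functions at once.
  have h1 : ∀ᵐ ω ∂P, ∀ n, ∀ F ∈ S n, ∀ μ : Measure (Phase (α ω)), IsLimitMeasure (α ω) ν μ →
      SpectralEstimates e ν (correlation (α ω) μ (cyl (α ω) F)) := by
    refine ae_all_iff.2 fun n => (ae_ball_iff (hSc n)).2 fun F hF => ?_
    exact hα.ae_of_ae_rotationLaw hS (hS.ae_spectralEstimates hq hd hnet (hS1 n F hF))
  filter_upwards [h1] with ω hω
  obtain ⟨μ, hμ⟩ := hS.exists_isLimitMeasure (α ω)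
  refine ⟨μ, hμ, hμ.isAction hS hsum, ?_, fun n F hF => hω n F hF μ hμ⟩
  refine hμ.denseInMeanZero hS hap hd (fun n => ?_) hS1 hS2
  have := four_le_q hq n
  exact_mod_cast (by linarith : (1 : ℝ) < ((sparse h₁ n : ℕ) : ℝ))

end Estimates

end Iceberg

namespace Iceberg

/-! ### The two groups -/

section Groups

variable {d : ℕ}

theorem isStandard_int : IsStandard (Int.castRingHom ℝ) (Measure.count : Measure (Fin d → ℤ)) where
  strictMono := fun a b h => by simpa using h
  measurable := measurable_from_top
  box a b hab := by
    have h1 : (Set.univ.pi fun i => Set.Ico (a i) (b i)) =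
        ((Fintype.piFinset fun i => Finset.Ico (a i) (b i) : Finset (Fin d → ℤ)) :
          Set (Fin d → ℤ)) := by
      ext; simp
    rw [h1, Measure.count_apply_finset, Fintype.card_piFinset]
    push_cast
    refine Finset.prod_congr rfl fun i _ => ?_
    rw [Int.card_Ico, Int.coe_castRingHom, ← Int.cast_sub,
      ← Int.toNat_of_nonneg (sub_nonneg.2 (hab i)), Int.cast_natCast, ENNReal.ofReal_natCast,
      Int.toNat_natCast]

theorem hasNet_int : HasNet (Int.castRingHom ℝ) := by
  intro N L hN
  refine ⟨Finset.Ico 0 (L : ℤ), ?_, fun x hx => ⟨x, Finset.mem_Ico.2 hx, by simp⟩⟩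
  rw [Int.card_Ico, sub_zero, Int.toNat_natCast]
  exact Nat.le_mul_of_pos_right L hN

/-- No approximation is needed on the lattice: a square summable function is bounded by its norm,
and a bounded function is Lipschitz because distinct points are at distance at least one. -/
theorem hasLipschitzApprox_int :
    HasLipschitzApprox (Int.castRingHom ℝ) (Measure.count : Measure (Fin d → ℤ)) := by
  intro f hf ε hε
  have hB : ∀ u, ‖f u‖ ≤ (eLpNorm f 2 Measure.count).toReal := by
    intro u
    have h1 := ENNReal.toReal_mono hf.2.ne (enorm_le_eLpNorm_count f u (p := 2) (by norm_num))
    rwa [toReal_enorm] at h1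
  refine ⟨f, _, 2 * (eLpNorm f 2 Measure.count).toReal, measurable_of_countable f, hB,
    fun u v => ?_, by simp⟩
  have hnn : (0 : ℝ) ≤ (eLpNorm f 2 Measure.count).toReal := ENNReal.toReal_nonneg
  by_cases huv : u = v
  · simp [huv]
  · obtain ⟨i, hi⟩ := Function.ne_iff.1 huv
    have h1 : (1 : ℝ) ≤ ∑ i, |(Int.castRingHom ℝ) (u i - v i)| := by
      refine le_trans ?_ (Finset.single_le_sum (fun _ _ => abs_nonneg _) (Finset.mem_univ i))
      rw [Int.coe_castRingHom, ← Int.cast_abs]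
      exact_mod_cast Int.one_le_abs (sub_ne_zero.2 hi)
    have h2 := norm_sub_le (f u) (f v)
    have h3 := hB u
    have h4 := hB v
    nlinarith

theorem isStandard_real : IsStandard (RingHom.id ℝ) (volume : Measure (Fin d → ℝ)) where
  strictMono := fun a b h => h
  measurable := measurable_id
  box a b _ := Real.volume_pi_Ico

theorem hasNet_real : HasNet (RingHom.id ℝ) := by
  intro N L hN
  have hN0 : (0 : ℝ) < N := by exact_mod_cast hN
  refine ⟨(Finset.range (L * N)).image fun k : ℕ => (k : ℝ) / N,
    Finset.card_image_le.trans (by simp), fun x hx => ?_⟩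
  have hx0 : 0 ≤ x * N := mul_nonneg hx.1 hN0.le
  refine ⟨(⌊x * N⌋₊ : ℝ) / N, Finset.mem_image.2 ⟨_, Finset.mem_range.2 ?_, rfl⟩, ?_⟩
  · rw [Nat.floor_lt hx0]
    push_cast
    exact mul_lt_mul_of_pos_right hx.2 hN0
  · have h1 := Nat.floor_le hx0
    have h2 := Nat.lt_floor_add_one (x * N)
    rw [RingHom.id_apply, abs_le]
    have h3 : x = x * N / N := by field_simp
    have h4 : (⌊x * N⌋₊ : ℝ) / N ≤ x * N / N := div_le_div_of_nonneg_right h1 hN0.le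
    have h5 : x * N / N ≤ (⌊x * N⌋₊ + 1 : ℝ) / N := div_le_div_of_nonneg_right h2.le hN0.le
    have h6 : 0 < 1 / (N : ℝ) := by positivity
    rw [add_div] at h5
    constructor <;> linarith

theorem hasLipschitzApprox_real :
    HasLipschitzApprox (RingHom.id ℝ) (volume : Measure (Fin d → ℝ)) := by
  intro f hf ε hε
  obtain ⟨g, hg, hgs, hle⟩ := hf.exist_eLpNorm_sub_le (by norm_num) (by norm_num) hε
  obtain ⟨B, hB⟩ := hgs.continuous.bounded_above_of_compact_support hg
  obtain ⟨C, hC⟩ := hgs.lipschitzWith_of_hasCompactSupport (𝕂 := ℝ) hg (by simp)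
  refine ⟨g, B, C, hgs.continuous.measurable, hB, fun u v => ?_, hle⟩
  refine (hC.norm_sub_le u v).trans (mul_le_mul_of_nonneg_left ?_ C.2)
  refine (pi_norm_le_iff_of_nonneg (Finset.sum_nonneg fun _ _ => abs_nonneg _)).2 fun i => ?_
  exact Finset.single_le_sum (f := fun i => |(RingHom.id ℝ) (u i - v i)|)
    (fun _ _ => abs_nonneg _) (Finset.mem_univ i)

/-- The minimum of `ε` and `1 / 4` keeps the exponent `a` inside `(0, 1 / 2)`. The norm on `Fin d →
K` is the maximum norm, attained in some coordinate, which supplies `ρ = ‖t‖`. -/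
theorem isBigO_of_decay {K : Type*} [NormedAddCommGroup K] [ProperSpace K] (hd : 0 < d)
    {c : (Fin d → K) → ℂ} (h : ∀ a : ℝ, 0 < a → a < 1 / 2 → ∃ D ρ₀ : ℝ, ∀ (t : Fin d → K) (ρ : ℝ),
      ρ₀ ≤ ρ → (∃ i, ‖t i‖ = ρ) → (∀ i, ‖t i‖ ≤ ρ) → ‖c t‖ ≤ D * ρ ^ (-a)) {ε : ℝ} (hε : 0 < ε) :
    c =O[cocompact (Fin d → K)] fun t => ‖t‖ ^ (-(1 / 2 : ℝ) + ε) := by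
  have hm : min ε (1 / 4) ≤ 1 / 4 := min_le_right _ _
  have hm0 : 0 < min ε (1 / 4) := by positivity
  obtain ⟨D, ρ₀, hD⟩ := h (1 / 2 - min ε (1 / 4)) (by linarith) (by linarith)
  refine Asymptotics.IsBigO.of_bound |D| ?_
  filter_upwards [(tendsto_norm_cocompact_atTop (E := Fin d → K)).eventually_ge_atTop (max ρ₀ 1)]
    with t ht
  have ht1 : 1 ≤ ‖t‖ := (le_max_right _ _).trans ht
  have hne : (Finset.univ : Finset (Fin d)).Nonempty := ⟨⟨0, hd⟩, Finset.mem_univ _⟩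
  obtain ⟨i, -, hi⟩ := Finset.exists_mem_eq_sup Finset.univ hne fun i => ‖t i‖₊
  refine (hD t ‖t‖ ((le_max_left _ _).trans ht) ⟨i, ?_⟩ fun i => norm_le_pi_norm t i).trans ?_
  · rw [Pi.norm_def, hi]
    rfl
  · rw [Real.norm_of_nonneg (by positivity)]
    refine mul_le_mul (le_abs_self D) ?_ (by positivity) (abs_nonneg D)
    exact Real.rpow_le_rpow_of_exponent_le ht1 (by linarith [min_le_left ε (1 / 4)])

/-- The Fourier transform of the spectral measure is `R (-t)`, the conjugate of `R t`, so the
reflection does not affect integrability. -/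
theorem memLp_comp_neg_iff {G : Type*} [AddCommGroup G] [MeasurableSpace G] {ν : Measure G}
    {R : G → ℂ} (h : ∀ t, R (-t) = (starRingEnd ℂ) (R t)) (p : ℝ≥0∞) :
    MemLp (fun t => R (-t)) p ν ↔ MemLp R p ν := by
  simp_rw [h]
  refine ⟨fun h => ?_, fun h => h.star⟩
  have h1 := h.star
  have h2 : star (fun t => (starRingEnd ℂ) (R t)) = R := by
    funext t
    exact Complex.conj_conj (R t)
  rwa [h2] at h1

theorem SpectralEstimates.exists_measure_int (hd : 0 < d) {R : (Fin d → ℤ) → ℂ}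
    (hR : SpectralEstimates (Int.castRingHom ℝ) Measure.count R) :
    ∃ σ : Measure (UnitAddTorus (Fin d)), IsFiniteMeasure σ ∧
      (∀ t, fourierTorus σ t = R (-t)) ∧ SalemDecay Measure.count (fourierTorus σ) := by
  obtain ⟨σ, hσ⟩ := hR.posDef.exists_measure_torus
  have h1 : fourierTorus (σ : Measure (UnitAddTorus (Fin d))) = fun t => R (-t) :=
    funext fun t => hσ (-t)
  refine ⟨σ, inferInstance, fun t => congrFun h1 t, ?_⟩
  rw [h1]
  refine ⟨fun ε hε => isBigO_of_decay hd (fun a ha0 ha => ?_) hε,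
    fun h => hR.not_memLp_two ((memLp_comp_neg_iff hR.neg 2).1 h),
    fun p hp => (memLp_comp_neg_iff hR.neg p).2 (hR.memLp p hp)⟩
  obtain ⟨D, ρ₀, h⟩ := hR.decay a ha0 ha
  refine ⟨D, ρ₀, fun t ρ hρ hex hall => ?_⟩
  rw [hR.neg, RCLike.norm_conj]
  exact h t ρ hρ (by simpa [Int.norm_eq_abs] using hex) (by simpa [Int.norm_eq_abs] using hall)

theorem SpectralEstimates.exists_measure_real (hd : 0 < d) {R : (Fin d → ℝ) → ℂ}
    (hR : SpectralEstimates (RingHom.id ℝ) volume R) :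
    ∃ σ : Measure (Fin d → ℝ), IsFiniteMeasure σ ∧
      (∀ t, fourierReal σ t = R (-t)) ∧ SalemDecay volume (fourierReal σ) := by
  obtain ⟨C, hC⟩ := hR.lipschitz
  have hcont : Continuous R := by
    refine continuous_iff_continuousAt.2 fun s => tendsto_iff_norm_sub_tendsto_zero.2 ?_
    have h1 : Tendsto (fun t : Fin d → ℝ => C * ∑ i, |(t - s) i|) (𝓝 s)
        (𝓝 (C * ∑ i, |(s - s) i|)) := by
      refine Continuous.tendsto ?_ s
      simp only [Pi.sub_apply]
      fun_prop
    simp only [sub_self, Pi.zero_apply, abs_zero, Finset.sum_const_zero, mul_zero] at h1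
    refine squeeze_zero (fun _ => norm_nonneg _) (fun t => ?_) h1
    have h2 := hC s (t - s)
    rwa [sub_add_cancel] at h2
  obtain ⟨σ, hσ⟩ := hR.posDef.exists_measure_real hcont
  have h1 : fourierReal (σ : Measure (Fin d → ℝ)) = fun t => R (-t) := by
    funext t
    rw [← hσ (-t), fourierReal]
    refine integral_congr_ae (ae_of_all _ fun ξ => ?_)
    simp only [Pi.neg_apply, neg_mul, Finset.sum_neg_distrib, Complex.ofReal_neg, mul_neg]
  refine ⟨σ, inferInstance, fun t => congrFun h1 t, ?_⟩
  rw [h1]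
  refine ⟨fun ε hε => isBigO_of_decay hd (fun a ha0 ha => ?_) hε,
    fun h => hR.not_memLp_two ((memLp_comp_neg_iff hR.neg 2).1 h),
    fun p hp => (memLp_comp_neg_iff hR.neg p).2 (hR.memLp p hp)⟩
  obtain ⟨D, ρ₀, h⟩ := hR.decay a ha0 ha
  refine ⟨D, ρ₀, fun t ρ hρ hex hall => ?_⟩
  rw [hR.neg, RCLike.norm_conj]
  exact h t ρ hρ (by simpa [Real.norm_eq_abs] using hex) (by simpa [Real.norm_eq_abs] using hall)

end Groups

end Iceberg

end

theorem mainTheorem1 (d : ℕ) (hd : 0 < d) (h₁ : ℕ+) :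
    (∃ q : ℕ → ℕ+, Tendsto (fun n => (q n : ℕ)) atTop atTop ∧
      (∀ n, 2 * (q n : ℕ) < q (n + 1)) ∧
      ∃ S : ∀ n, Set (Iceberg.Space ℤ d h₁ q n → ℂ),
        Iceberg.MeanZeroSquareIntegrable Measure.count S ∧
        ∀ (Ω : Type*) [MeasurableSpace Ω] (P : Measure Ω) [IsProbabilityMeasure P]
          (α : Ω → Iceberg.Rotations ℤ d h₁ q),
          Iceberg.IsUniformFamily Measure.count P α →
          ∀ᵐ ω ∂P, ∃ μ : Measure (Iceberg.Phase (α ω)),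
            Iceberg.IsLimitMeasure (α ω) Measure.count μ ∧
            Iceberg.IsAction (α ω) μ ∧
            Iceberg.DenseInMeanZero (α ω) μ S ∧
            ∀ n, ∀ F ∈ S n, ∃ σ : Measure (UnitAddTorus (Fin d)), IsFiniteMeasure σ ∧
              (∀ t, Iceberg.fourierTorus σ t =
                Iceberg.correlation (α ω) μ (Iceberg.cyl (α ω) F) (-t)) ∧
              Iceberg.SalemDecay Measure.count (Iceberg.fourierTorus σ)) ∧
    (∃ q : ℕ → ℕ+, Tendsto (fun n => (q n : ℕ)) atTop atTop ∧
      (∀ n, 2 * (q n : ℕ) < q (n + 1)) ∧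
      ∃ S : ∀ n, Set (Iceberg.Space ℝ d h₁ q n → ℂ),
        Iceberg.MeanZeroSquareIntegrable volume S ∧
        ∀ (Ω : Type*) [MeasurableSpace Ω] (P : Measure Ω) [IsProbabilityMeasure P]
          (α : Ω → Iceberg.Rotations ℝ d h₁ q),
          Iceberg.IsUniformFamily volume P α →
          ∀ᵐ ω ∂P, ∃ μ : Measure (Iceberg.Phase (α ω)),
            Iceberg.IsLimitMeasure (α ω) volume μ ∧
            Iceberg.IsAction (α ω) μ ∧
            Iceberg.DenseInMeanZero (α ω) μ S ∧
            ∀ n, ∀ F ∈ S n, ∃ σ : Measure (Fin d → ℝ), IsFiniteMeasure σ ∧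
              (∀ t, Iceberg.fourierReal σ t =
                Iceberg.correlation (α ω) μ (Iceberg.cyl (α ω) F) (-t)) ∧
              Iceberg.SalemDecay volume (Iceberg.fourierReal σ)) := by
  constructor
  · obtain ⟨q, hq1, hq2, S, hS, h⟩ := Iceberg.isStandard_int.exists_dense_spectralEstimates hd
      Iceberg.hasNet_int Iceberg.hasLipschitzApprox_int h₁
    refine ⟨q, hq1, hq2, S, hS, fun Ω _ P _ α hα => ?_⟩
    filter_upwards [h Ω P α hα] with ω hω
    obtain ⟨μ, hμ, hact, hdense, hest⟩ := hω
    exact ⟨μ, hμ, hact, hdense, fun n F hF => (hest n F hF).exists_measure_int hd⟩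
  · obtain ⟨q, hq1, hq2, S, hS, h⟩ := Iceberg.isStandard_real.exists_dense_spectralEstimates hd
      Iceberg.hasNet_real Iceberg.hasLipschitzApprox_real h₁
    refine ⟨q, hq1, hq2, S, hS, fun Ω _ P _ α hα => ?_⟩
    filter_upwards [h Ω P α hα] with ω hω
    obtain ⟨μ, hμ, hact, hdense, hest⟩ := hω
    exact ⟨μ, hμ, hact, hdense, fun n F hF => (hest n F hF).exists_measure_real hd⟩
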